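/- A fat graph $\Gamma$ here is a finite connected non-empty three-valent graph (loops and multiple edges allowed) with a cyclic (counterclockwise) order on the three oriented edges starting at each vertex; $\alpha^\vee$ denotes the oriented edge $\alpha$ with reversed orientation, and $\mathrm{next}(\alpha)$ the oriented edge following $\alpha$ in counterclockwise order around its beginning. Let a complex number $Z_\alpha=Z_{\alpha^\vee}$ be assigned to each edge. To each oriented edge $\alpha$ assign the strip $S_\alpha=\{-\pi<\mathrm{Im}\,x_\alpha<\mathrm{Im}\,Z_\alpha\}$, and let $\Sigma(\Gamma,Z)$ be the quotient (with the quotient topology) of the disjoint union of all strips by the equivalence relation generated by the transition functions $$x_{\alpha^\vee}=Z_\alpha-i\pi-x_\alpha ,\qquad x_\alpha=Z_\alpha+\ln(e^{x_\beta}+1)\quad\text{for }\beta=\mathrm{next}(\alpha^\vee),\ -\pi<\mathrm{Im}\,x_\beta<0 ,$$ where $\ln$ is the principal branch. Call $\beta$ subsequent to $\alpha$ if $\beta$ begins where $\alpha$ ends and $\beta\ne\alpha^\vee$; a closed path without returns is a cyclic sequence of oriented edges, each subsequent to the preceding one. 1. (Arbitrary $Z$.) Let $\beta$ be subsequent to $\alpha$,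 and let $x_\alpha\in S_\alpha$ and $x_\beta\in S_\beta$ be related by a transition at their common vertex (that is, either $x_\beta\mapsto x_\alpha$ by the second transition function, or $x_{\alpha^\vee}\mapsto x_{\beta^\vee}$ by the second transition function). Then $\mathrm{Im}\,x_\alpha>\mathrm{Im}\,Z_\alpha+\mathrm{Im}\,x_\beta$. 2. If $\sum_{\alpha\in\gamma}\mathrm{Im}\,Z_\alpha>0$ for every closed path $\gamma$ without returns (in particular if all $\mathrm{Im}\,Z_\alpha>0$), then every equivalence class of points of the strips is finite. 3. If $\mathrm{Im}\,Z_\alpha>0$ for every edge, then $\Sigma(\Gamma,Z)$ is a smooth projective surface which gives back $(\Gamma,Z)$. That is: there are a compact connected Riemann surface $\Sigma$, a finite set $P\subset\Sigma$ of punctures, a projective structure on $\Sigma_0=\Sigma\setminus P$ (an atlas of holomorphic coordinates with Möbius transition functions) which is regular at each puncture (in a local coordinate $\zeta$ at the puncture, the Schwarzian derivative of the projective coordinates with respect to $\zeta$ has at most a double pole), and a homeomorphism $\Sigma(\Gamma,Z)\to\Sigma_0$ for which the functions $e^{x_\alpha}$ on the strips are projective, such that the graph of maximal disks of $\Sigma$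 is $\Gamma$ with the numbers $Z$, in the following sense. A projective disk is a projective map $u$ from the open unit disk $D$ to $\Sigma_0$, considered up to projective automorphisms of $D$; $u\le v$ if $u=v\circ f$ for a projective map $f:D\to D$; let $\mathcal D^{\max}$ be the set of maximal projective disks, topologized as a quotient of a space of maps with the compact-open topology. The lean points of $u$ are the points $\xi\in\partial D$ at which $u$ tends to a puncture. There is a homeomorphism from the geometric realization of $\Gamma$ onto $\mathcal D^{\max}$ such that (a) the vertices of $\Gamma$ correspond exactly to the disks with at least three lean points; (b) for each oriented edge $\alpha$ and each parametrization $u$ of the disk at its beginning there are lean points $\xi,\eta,\kappa$ of $u$, with $\eta$ following $\xi$ and $\kappa$ following $\eta$ counterclockwise among the lean points of $u$, such that the disks along $\alpha$ can be parametrized continuously starting from $u$ so as to lean at $\xi$ and $\eta$ throughout, and those along $\mathrm{next}(\alpha)$ so as to lean at $\eta$ and $\kappa$ throughout; (c) for each oriented edge $\alpha$, from $u_1$ to $u_2$, the number $Z_\alpha$ is obtained as follows: there is a (multivalued) projective function $z_\alpha$ along the disks of the edge equal to $-1,0,\infty$ at the lean points of $u_1$ and with negative imaginary part in $u_1$, such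 that $u_2$ leans at $z_\alpha=0$, $z_\alpha=\infty$ and one more point, at which the branch of $x_\alpha=\ln z_\alpha$ continued along the edge from the one with $-\pi<\mathrm{Im}\,x_\alpha<0$ in $u_1$ has the value $Z_\alpha$; the disks of the edge are the half planes $\theta-\pi<\mathrm{Im}\,x_\alpha<\theta$ with $\theta$ varying continuously in $[0,\mathrm{Im}\,Z_\alpha]$ from $0$ to $\mathrm{Im}\,Z_\alpha$. -/

import Mathlib

open Filter Topology
open scoped ContDiff Manifold

universe u

noncomputable section

/-! ### Fat graphs and the gluing of strips -/

/-- A finite connected three-valent fat graph, given by its set `E` of oriented edges.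
`rev` reverses the orientation of an edge; `next e` is the oriented edge that follows `e` in
counterclockwise direction among the oriented edges with the same beginning.  Vertices are the
orbits of `next` (all of length three), edges are the orbits of `rev`. -/
structure FatGraph (E : Type*) where
  rev : E → E
  rev_rev : ∀ e, rev (rev e) = e
  rev_ne : ∀ e, rev e ≠ e
  next : E → E
  next_next_next : ∀ e, next (next (next e)) = e
  next_ne : ∀ e, next e ≠ e
  connected : ∀ e e', Relation.ReflTransGen (fun a b => b = rev a ∨ b = next a) e e'

namespace FatGraph

variable {E : Type*} (Γ : FatGraph E) (Z : E → ℂ)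

/-- The end of `α` is the beginning of `β`, and `β` is not `α` run backwards. -/
def Subsequent (α β : E) : Prop :=
  β = Γ.next (Γ.rev α) ∨ β = Γ.next (Γ.next (Γ.rev α))

/-- A closed path without returns, of length `n ≥ 1`, as an `n`-periodic sequence of oriented
edges. -/
def IsClosedPathWithoutReturns (n : ℕ) (c : ℕ → E) : Prop :=
  0 < n ∧ (∀ k, c (k + n) = c k) ∧ ∀ k, Γ.Subsequent (c k) (c (k + 1))

/-- The open strip `-π < Im x < Im w`. -/
def strip (w : ℂ) : Set ℂ := {x | -Real.pi < x.im ∧ x.im < w.im}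

/-- The disjoint union of the strips `-π < Im x_α < Im Z_α` over all oriented edges `α`. -/
abbrev StripPoint (Z : E → ℂ) : Type _ := Σ α : E, strip (Z α)

/-- The transition `x_{α^∨} = Z_α - iπ - x_α` (`p` is on the strip of `α`, `q` on that of
`α^∨`). -/
def Flip (p q : StripPoint Z) : Prop :=
  q.1 = Γ.rev p.1 ∧ (q.2 : ℂ) = Z p.1 - Real.pi * Complex.I - p.2

/-- The transition `x_α = Z_α + ln (e^{x_β} + 1)`, defined for `-π < Im x_β < 0`, where `β` is next
after `α^∨` around the end of `α` (`p` is on the strip of `β`, `q` on that of `α`). -/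
def Turn (p q : StripPoint Z) : Prop :=
  p.1 = Γ.next (Γ.rev q.1) ∧ (p.2 : ℂ).im < 0 ∧
    (q.2 : ℂ) = Z q.1 + Complex.log (Complex.exp p.2 + 1)

/-- One transition function takes `p` to `q`. -/
def Glue (p q : StripPoint Z) : Prop := Γ.Flip Z p q ∨ Γ.Turn Z p q

/-- The glued space: classes of points of the strips under the equivalence relation generated by
the transition functions, with the quotient topology. -/
def GluedSurface : Type _ := Quot (Γ.Glue Z)

instance : TopologicalSpace (Γ.GluedSurface Z) :=
  inferInstanceAs (TopologicalSpace (Quot (Γ.Glue Z)))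

/-- The class of the point `x` of the strip of `α`. -/
def glued (α : E) (x : strip (Z α)) : Γ.GluedSurface Z := Quot.mk _ ⟨α, x⟩

/-- The identifications defining the geometric realization: the point with parameter `t` on `α` is
the point with parameter `1 - t` on `α^∨`, and edges with the same beginning start at the same
point. -/
inductive RealizationRel : (Σ _ : E, unitInterval) → (Σ _ : E, unitInterval) → Prop
  | rev (α : E) (t : unitInterval) : RealizationRel ⟨α, t⟩ ⟨Γ.rev α, unitInterval.symm t⟩
  | next (α : E) : RealizationRel ⟨α, 0⟩ ⟨Γ.next α, 0⟩

/-- The geometric realization of the graph, a topological space. -/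
def Realization : Type _ := Quot Γ.RealizationRel

instance : TopologicalSpace Γ.Realization :=
  inferInstanceAs (TopologicalSpace (Quot Γ.RealizationRel))

/-- The point with parameter `t` on the oriented edge `α`. -/
def point (α : E) (t : unitInterval) : Γ.Realization := Quot.mk _ ⟨α, t⟩

end FatGraph

/-! ### Projective surfaces -/

/-- Near `p`, the function `y` is a Möbius function of the function `z`. -/
def MobiusAt {X : Type*} [TopologicalSpace X] (z y : X → ℂ) (p : X) : Prop :=
  ∃ a b c d : ℂ, a * d - b * c ≠ 0 ∧
    ∀ᶠ q in 𝓝 p, c * z q + d ≠ 0 ∧ y q = (a * z q + b) / (c * z q + d)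

/-- The Schwarzian derivative. -/
def schwarzian (f : ℂ → ℂ) (z : ℂ) : ℂ :=
  iteratedDeriv 3 f z / deriv f z - 3 / 2 * (iteratedDeriv 2 f z / deriv f z) ^ 2

/-- A compact connected Riemann surface `carrier` with a finite set of punctures, and a projective
structure, compatible with the complex structure, on the complement of the punctures, which is
regular at each puncture (its projective connection has a pole of order at most two there). -/
structure RegularProjectiveSurface where
  carrier : Type u
  [top : TopologicalSpace carrier]
  [t2 : T2Space carrier]
  [compact : CompactSpace carrier]
  [conn : ConnectedSpace carrier]
  [charted : ChartedSpace ℂ carrier]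
  [complexManifold : IsManifold 𝓘(ℂ) ω carrier]
  punctures : Set carrier
  punctures_finite : punctures.Finite
  /-- The projective coordinates. -/
  projAtlas : Set (OpenPartialHomeomorph carrier ℂ)
  projAtlas_holomorphic : projAtlas ⊆ IsManifold.maximalAtlas 𝓘(ℂ) ω carrier
  projAtlas_cover : ⋃ φ ∈ projAtlas, φ.source = puncturesᶜ
  projAtlas_mobius : ∀ φ ∈ projAtlas, ∀ ψ ∈ projAtlas, ∀ p ∈ φ.source ∩ ψ.source, MobiusAt φ ψ p
  regular : ∀ p ∈ punctures, ∃ h : ℂ → ℂ, AnalyticAt ℂ h (chartAt ℂ p p) ∧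
    ∀ᶠ q in 𝓝[≠] p, ∀ φ ∈ projAtlas, q ∈ φ.source →
      schwarzian (φ ∘ (chartAt ℂ p).symm) (chartAt ℂ p q) =
        h (chartAt ℂ p q) / (chartAt ℂ p q - chartAt ℂ p p) ^ 2

namespace RegularProjectiveSurface

attribute [instance] top t2 compact conn charted complexManifold

variable (S : RegularProjectiveSurface)

/-- The surface with removed punctures. -/
abbrev Punctured : Type _ := {p : S.carrier // p ∉ S.punctures}

/-- `f : X → S` avoids the punctures near `p`, is continuous at `p` and is there a projective map,
where `z` is a projective coordinate on `X`. -/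
def ProjectiveAt {X : Type*} [TopologicalSpace X] (z : X → ℂ) (f : X → S.carrier) (p : X) : Prop :=
  ContinuousAt f p ∧ ∃ φ ∈ S.projAtlas, f p ∈ φ.source ∧ MobiusAt z (fun q => φ (f q)) p

/-! ### Projective disks -/

/-- A projective map from the open unit disk to the punctured surface. -/
def IsProjectiveDisk (u : C(Complex.UnitDisc, S.carrier)) : Prop :=
  ∀ w, S.ProjectiveAt (fun v : Complex.UnitDisc => (v : ℂ)) u w

/-- A projective map of the unit disk to itself. -/
def IsMobiusSelfMap (f : Complex.UnitDisc → Complex.UnitDisc) : Prop :=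
  ∃ a b c d : ℂ, a * d - b * c ≠ 0 ∧
    ∀ w : Complex.UnitDisc, c * (w : ℂ) + d ≠ 0 ∧
      (f w : ℂ) = (a * (w : ℂ) + b) / (c * (w : ℂ) + d)

/-- `u ≤ v`: the disk `u` factors through the disk `v`. -/
def DiskLE (u v : C(Complex.UnitDisc, S.carrier)) : Prop :=
  ∃ f, IsMobiusSelfMap f ∧ ∀ w, u w = v (f w)

/-- `u` and `v` differ by a projective automorphism of the unit disk. -/
def DiskEquiv (u v : C(Complex.UnitDisc, S.carrier)) : Prop :=
  ∃ f, IsMobiusSelfMap f ∧ Function.Bijective f ∧ ∀ w, u w = v (f w)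

/-- A maximal projective disk. -/
def IsMaximalDisk (u : C(Complex.UnitDisc, S.carrier)) : Prop :=
  S.IsProjectiveDisk u ∧ ∀ v, S.IsProjectiveDisk v → S.DiskLE u v → S.DiskEquiv u v

/-- Parametrized maximal disks, with the compact-open topology. -/
abbrev ParamMaximalDisk : Type _ := {u : C(Complex.UnitDisc, S.carrier) // S.IsMaximalDisk u}

/-- The set of maximal disks up to automorphisms of the unit disk, with the quotient topology. -/
def MaximalDisk : Type _ := Quot (fun u v : S.ParamMaximalDisk => S.DiskEquiv u.1 v.1)

instance : TopologicalSpace S.MaximalDisk :=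
  inferInstanceAs
    (TopologicalSpace (Quot (fun u v : S.ParamMaximalDisk => S.DiskEquiv u.1 v.1)))

/-- The maximal disk parametrized by `u`. -/
def diskClass (u : S.ParamMaximalDisk) : S.MaximalDisk := Quot.mk _ u

/-- The points of the unit circle at which (the extension to the closed disk of) `u` takes a
puncture as its value. -/
def leanPoints (u : C(Complex.UnitDisc, S.carrier)) : Set ℂ :=
  {ξ | ‖ξ‖ = 1 ∧ ∃ p ∈ S.punctures,
    Tendsto u (comap (fun w : Complex.UnitDisc => (w : ℂ)) (𝓝 ξ)) (𝓝 p)}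

/-- A vertex of the graph of maximal disks: a disk that leans on punctures at least three times. -/
def IsVertex (x : S.MaximalDisk) : Prop :=
  ∃ u : S.ParamMaximalDisk, S.diskClass u = x ∧ 3 ≤ (S.leanPoints u.1).encard

/-! ### Cyclic order of the ends of edges -/

/-- `κ` lies strictly inside the arc of the unit circle that goes counterclockwise from `ξ` to
`η`. -/
def InArc (ξ η κ : ℂ) : Prop :=
  ∃ s t : ℝ, 0 < s ∧ s < t ∧ t < 2 * Real.pi ∧
    κ = ξ * Complex.exp (s * Complex.I) ∧ η = ξ * Complex.exp (t * Complex.I)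

/-- The path `γ` of maximal disks leaves the disk `u` through the arc from `ξ` to `η`: the disks of
`γ` can be parametrized continuously, starting from `u`, so that they all lean on punctures at `ξ`
and at `η`, where `η` is the lean point of `u` that follows `ξ` in counterclockwise direction. -/
def LeavesThrough (u : S.ParamMaximalDisk) (γ : unitInterval → S.MaximalDisk) (ξ η : ℂ) : Prop :=
  (∃ v : unitInterval → S.ParamMaximalDisk, Continuous v ∧ v 0 = u ∧
    ∀ s, S.diskClass (v s) = γ s ∧ ξ ∈ S.leanPoints (v s).1 ∧ η ∈ S.leanPoints (v s).1) ∧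
  ξ ≠ η ∧ ∀ κ ∈ S.leanPoints u.1, ¬ InArc ξ η κ

/-! ### Complex numbers on edges -/

/-- The Möbius map of the unit disk onto the lower half plane with `1, -1, -i ↦ ∞, 0, -1`. -/
def toLowerHalfPlane (w : ℂ) : ℂ := -Complex.I * (1 + w) / (1 - w)

/-- The logarithmic coordinate `x = ln z` on the half plane `θ - π < arg z < θ`, parametrized by
the unit disk through `z = e^{iθ} · toLowerHalfPlane w`. -/
def halfPlaneLog (θ : ℝ) (w : ℂ) : ℂ := Complex.log (toLowerHalfPlane w) + θ * Complex.I

/-- `ζ` is the complex number of the oriented edge `γ` of the graph of maximal disks, a path from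
the vertex `u₁` to the vertex `u₂`.  Here `X` is the inverse of the coordinate `x = ln z` on the
union of the disks of `γ`, where `z` is a multivalued projective function.  In terms of `z`, each
disk of `γ` is a half plane `θ - π < arg z < θ`, the angle `θ` varying continuously from its value
`0` at `u₁`, where `z` has negative imaginary part.  The disk `u₁` leans on the punctures at
`z = ∞, 0, -1` (that is, at `w = 1, -1, -i`), the disk `u₂` leans at `z = ∞, 0` (that is, at
`w = 1, -1`) and at one more point, at which `x = ζ`. -/
def IsEdgeNumber (γ : unitInterval → S.MaximalDisk) (ζ : ℂ) : Prop :=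
  ∃ X : ℂ → S.carrier,
    (∀ x ∈ FatGraph.strip ζ, S.ProjectiveAt Complex.exp X x) ∧
    ∃ (θ : unitInterval → ℝ) (u : unitInterval → S.ParamMaximalDisk),
      Continuous θ ∧ θ 0 = 0 ∧ θ 1 = ζ.im ∧ (∀ s, 0 ≤ θ s ∧ θ s ≤ ζ.im) ∧
      (∀ s, S.diskClass (u s) = γ s ∧ ∀ w : Complex.UnitDisc,
        (u s).1 w = X (halfPlaneLog (θ s) (w : ℂ))) ∧
      S.leanPoints (u 0).1 = {1, -1, -Complex.I} ∧
      ∃ w : ℂ, S.leanPoints (u 1).1 = {1, -1, w} ∧ w ≠ 1 ∧ w ≠ -1 ∧ halfPlaneLog ζ.im w = ζ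

/-! ### Recovering the graph -/

/-- The graph of maximal disks of `S`, with its fat graph structure and its complex numbers on
edges, is the graph `Γ` with the numbers `Z`. -/
def Reproduces {E : Type*} (Γ : FatGraph E) (Z : E → ℂ) : Prop :=
  ∃ Φ : Γ.Realization ≃ₜ S.MaximalDisk,
    -- vertices correspond to vertices
    (∀ x, S.IsVertex (Φ x) ↔ ∃ α, x = Γ.point α 0) ∧
    -- the cyclic order of the edges at a vertex is that of the arcs between the lean points
    (∀ α, ∀ u : S.ParamMaximalDisk, S.diskClass u = Φ (Γ.point α 0) → ∃ ξ η κ : ℂ,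
      S.LeavesThrough u (fun s => Φ (Γ.point α s)) ξ η ∧
      S.LeavesThrough u (fun s => Φ (Γ.point (Γ.next α) s)) η κ) ∧
    -- the numbers on edges coincide
    (∀ α, S.IsEdgeNumber (fun s => Φ (Γ.point α s)) (Z α))

end RegularProjectiveSurface

end

/-!
A point of a strip is continued to a subsequent strip by a *passage*: if `x` is the coordinate on an
edge with the number `Z` and `-π < Im (x - Z) < 0`, then the coordinate on the right subsequent edge
is `log (e^(x - Z) - 1)` (`turnR`), and on the left one it is `-πi - log (1 - e^(Z - x))` (`turnL`).
In the exponential coordinate a passage is a Möbius map of the lower half plane, and adding `1` to a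
number in the lower half plane increases its argument.  This is the inequality for imaginary parts
(`Step.im_lt`, `im_lt_of_turn`).

*Finite classes.*  The three transitions at a vertex compose to the identity, so that two
consecutive transitions at the same vertex reduce to one, or cancel (`Step.sibling`).  Hence two
points are identified if and only if a chain of passages without returns links them, up to reversal
of the edges at its ends (`mk_eq_iff`).  Along such a chain the imaginary parts decrease by more
than the sum of the `Im Z`, which grows linearly with the length of the path
(`exists_path_sum_bound`), whereas they are bounded on strips.  So the lengths of chains are
bounded, and a chain is determined by its first point and its path (`finite_class`).

*The surface.*  A Riemann surface is obtained by gluing the strips and one disk for each face of the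
graph (`HoloGluing`).  The identification is a closed relation with isolated points, because a
passage that appears in the limit would start on the boundary of its domain, where the inequality
forbids it (`eventually_not_linked`, `eventually_eq_of_linked`).  Far to the right on a strip only
passages to the right are possible, and going around the face multiplies the exponential coordinate
by `e^L` and adds a constant, where `L` is the sum of the numbers along the face.  For suitable
constants the function `e^ξ + A ξ + B` has the same monodromy under `ξ ↦ ξ + L`, and `e^(-2πi ξ /
L)` is the coordinate of a disk at the puncture (`exists_isMonodromic`, `exists_cusp`).  In this
coordinate the logarithmic derivative of the derivative of the exponential coordinate has a simple
pole, and its Schwarzian derivative a double pole (`regular_puncture`).  The surface is compact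
because every class has a representative at a fixed distance from the upper and the lower boundary
of its strip (`exists_linked_inner`).

*Maximal disks.*  The half planes `θ - π < Im x < θ` with `0 ≤ θ ≤ Im Z` are projective disks
(`CuspSystem.disk`), and every projective disk factors through one of them (`exists_eq_disk_comp`):
it has a local lift to some strip; a lift over a concentric disk takes its values in a half plane
and extends to the closed disk, where it touches the boundary of the half plane in at most one point
and never at a lean point; so it extends to a larger disk, after a change of the edge if the half
plane is at an end of the edge (`IsLift.exists_gt`); as there are only finitely many points over the
centre, lifts over all smaller disks fit together.  A Möbius map between half planes takes lean
points to lean points, at least two of them, and is therefore an automorphism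
(`exists_discAut_of_disk_comp`); so the maximal disks are exactly the half planes.

Two half planes with the same image are related by one and the same chain of passages, as chains are
open and closed conditions, and the inequality shows that such a chain has at most one passage, from
the end of an edge to the beginning of another one (`point_eq_of_diskClass_eq`).  The inverse of the
resulting bijection from the graph is continuous because the parameters of maximal disks converge
along convergent ultrafilters: the space of parameters has a compact closure, and degenerate limits
give constant maps (`exists_tendsto_parameters`, `graphHomeo`).  The lean points of a half plane are
`x = ±∞`, `-πi` and `Z`, as far as they are on its boundary, from which the vertices, the cyclic
order and the numbers are read off (`isVertex_iff`, `leavesThrough`, `isEdgeNumber`).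
-/

noncomputable section

/-! ### Riemann surfaces obtained by gluing plane domains -/

/-- The point `p.2` of the domain with index `p.1` and the point `q.2` of the domain with index
`q.1` are related by a germ of a biholomorphic map that commutes with the parametrizations `f`. -/
def HoloRel {I M : Type*} (f : I → ℂ → M) (p q : I × ℂ) : Prop :=
  ∃ g : ℂ → ℂ, AnalyticAt ℂ g p.2 ∧ deriv g p.2 ≠ 0 ∧ g p.2 = q.2 ∧
    ∀ᶠ x in 𝓝 p.2, f q.1 (g x) = f p.1 x

theorem HoloRel.refl {I M : Type*} (f : I → ℂ → M) (p : I × ℂ) : HoloRel f p p :=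
  ⟨id, analyticAt_id, by simp, rfl, by simp⟩

theorem exists_analytic_inverse {g : ℂ → ℂ} {x : ℂ} (hg : AnalyticAt ℂ g x)
    (hd : deriv g x ≠ 0) : ∃ k : ℂ → ℂ, AnalyticAt ℂ k (g x) ∧ deriv k (g x) ≠ 0 ∧ k (g x) = x ∧
      (∀ᶠ y in 𝓝 (g x), g (k y) = y) ∧ ∀ᶠ y in 𝓝 x, k (g y) = y := by
  refine ⟨hg.hasStrictDerivAt.localInverse _ _ _ hd, hg.analyticAt_localInverse hd, ?_, ?_, ?_, ?_⟩
  · rw [(hg.hasStrictDerivAt.to_localInverse hd).hasDerivAt.deriv]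
    exact inv_ne_zero hd
  · exact HasStrictFDerivAt.localInverse_apply_image ..
  · exact HasStrictDerivAt.eventually_right_inverse ..
  · exact HasStrictDerivAt.eventually_left_inverse ..

theorem HoloRel.symm {I M : Type*} {f : I → ℂ → M} {p q : I × ℂ} (h : HoloRel f p q) :
    HoloRel f q p := by
  obtain ⟨g, hg, hd, hgx, hev⟩ := h
  obtain ⟨k, hk, hkd, hkx, hr, -⟩ := exists_analytic_inverse hg hd
  rw [hgx] at hk hkd hkx hr
  refine ⟨k, hk, hkd, hkx, ?_⟩
  have hc : Tendsto k (𝓝 q.2) (𝓝 p.2) := by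
    have := hk.continuousAt.tendsto
    rwa [hkx] at this
  filter_upwards [hr, hc.eventually hev] with y hy h2
  rw [← h2, hy]

theorem HoloRel.trans {I M : Type*} {f : I → ℂ → M} {p q r : I × ℂ} (h : HoloRel f p q)
    (h' : HoloRel f q r) : HoloRel f p r := by
  obtain ⟨g, hg, hd, hgx, hev⟩ := h
  obtain ⟨k, hk, hkd, hkx, hev'⟩ := h'
  rw [← hgx] at hk hkd hkx hev'
  refine ⟨k ∘ g, hk.comp hg, ?_, hkx, ?_⟩
  · rw [deriv_comp _ hk.differentiableAt hg.differentiableAt]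
    exact mul_ne_zero hkd hd
  · filter_upwards [hev, hg.continuousAt.tendsto.eventually hev'] with y hy h2
    rw [Function.comp_apply, h2, hy]

/-- Plane domains with parametrizations of a set `M`, glued by biholomorphic maps. -/
structure HoloGluing (I M : Type*) where
  dom : I → Set ℂ
  isOpen_dom : ∀ i, IsOpen (dom i)
  map : I → ℂ → M
  surj : ∀ m, ∃ i, ∃ x ∈ dom i, map i x = m
  rel : ∀ i j x y, x ∈ dom i → y ∈ dom j → map i x = map j y → HoloRel map (i, x) (j, y)
  inj : ∀ i, ∀ x ∈ dom i, ∃ V ∈ 𝓝 x, Set.InjOn (map i) V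

namespace HoloGluing

variable {I : Type*} {M : Type u} (G : HoloGluing I M)

/-- The glued space: the set `M` with the finest topology for which all parametrizations are
continuous on their domains. -/
def Space (_ : HoloGluing I M) : Type u := M

/-- The parametrization of the glued space by the domain with index `i`. -/
def par (i : I) (x : ℂ) : G.Space := G.map i x

instance : TopologicalSpace G.Space where
  IsOpen W := ∀ i, IsOpen (G.dom i ∩ G.par i ⁻¹' W)
  isOpen_univ i := by
    rw [Set.preimage_univ, Set.inter_univ]
    exact G.isOpen_dom i
  isOpen_inter s t hs ht i := by
    have := (hs i).inter (ht i)
    rwa [← Set.inter_inter_distrib_left] at this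
  isOpen_sUnion s hs i := by
    have : G.dom i ∩ G.par i ⁻¹' ⋃₀ s = ⋃ t ∈ s, G.dom i ∩ G.par i ⁻¹' t := by
      ext x
      simp only [Set.mem_inter_iff, Set.mem_preimage, Set.mem_sUnion, Set.mem_iUnion, exists_prop]
      tauto
    rw [this]
    exact isOpen_biUnion fun t ht => hs t ht i

theorem isOpen_iff {W : Set G.Space} : IsOpen W ↔ ∀ i, IsOpen (G.dom i ∩ G.par i ⁻¹' W) :=
  Iff.rfl

theorem exists_par (m : G.Space) : ∃ i, ∃ x ∈ G.dom i, G.par i x = m := G.surj m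

theorem continuousAt_par {i : I} {x : ℂ} (hx : x ∈ G.dom i) : ContinuousAt (G.par i) x := by
  intro W hW
  obtain ⟨W', hW', hWo, hm⟩ := mem_nhds_iff.1 hW
  have := (G.isOpen_iff.1 hWo i).mem_nhds ⟨hx, hm⟩
  exact Filter.mem_map.2 <| mem_of_superset this fun y hy => hW' hy.2

theorem isOpen_image_par {i : I} {V : Set ℂ} (hV : IsOpen V) (hs : V ⊆ G.dom i) :
    IsOpen (G.par i '' V) := by
  rw [isOpen_iff]
  intro j
  rw [isOpen_iff_mem_nhds]
  rintro y ⟨hy, x, hx, hxy⟩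
  obtain ⟨g, hg, -, hgy, hev⟩ := G.rel j i y x hy (hs hx) hxy.symm
  simp only at hg hgy hev
  have hc : Tendsto g (𝓝 y) (𝓝 x) := by
    have := hg.continuousAt.tendsto
    rwa [hgy] at this
  filter_upwards [hev, hc.eventually (hV.mem_nhds hx), (G.isOpen_dom j).mem_nhds hy] with z h1 h2 h3
  exact ⟨h3, g z, h2, h1⟩

theorem par_mem_nhds {i : I} {x : ℂ} (hx : x ∈ G.dom i) {V : Set ℂ} (hV : V ∈ 𝓝 x) :
    G.par i '' V ∈ 𝓝 (G.par i x) := by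
  obtain ⟨V', hV', ho, hm⟩ := mem_nhds_iff.1 (inter_mem hV ((G.isOpen_dom i).mem_nhds hx))
  exact mem_of_superset
    ((G.isOpen_image_par ho fun y hy => (hV' hy).2).mem_nhds ⟨x, hm, rfl⟩)
    (Set.image_mono fun y hy => (hV' hy).1)

theorem map_nhds_par {i : I} {x : ℂ} (hx : x ∈ G.dom i) :
    Filter.map (G.par i) (𝓝 x) = 𝓝 (G.par i x) := by
  refine le_antisymm (G.continuousAt_par hx) ?_
  intro W hW
  exact mem_of_superset (G.par_mem_nhds hx hW) (Set.image_preimage_subset _ _)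

/-- A parametrization as a partial homeomorphism, on an open set where it is injective. -/
def mapChart (i : I) (V : Set ℂ) (hV : IsOpen V) (hs : V ⊆ G.dom i)
    (hi : Set.InjOn (G.par i) V) : OpenPartialHomeomorph ℂ G.Space :=
  OpenPartialHomeomorph.ofContinuousOpenRestrict (hi.toPartialEquiv (G.par i) V)
    (fun x hx => (G.continuousAt_par (hs hx)).continuousWithinAt)
    (by
      intro W hW
      obtain ⟨W', hW', rfl⟩ := isOpen_induced_iff.1 hW
      have : (Set.domRestrict (hi.toPartialEquiv (G.par i) V).source
          (hi.toPartialEquiv (G.par i) V)) '' (Subtype.val ⁻¹' W') = G.par i '' (V ∩ W') := by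
        ext m
        constructor
        · rintro ⟨⟨x, hx⟩, hxW, rfl⟩
          exact ⟨x, ⟨hx, hxW⟩, rfl⟩
        · rintro ⟨x, ⟨hx, hxW⟩, rfl⟩
          exact ⟨⟨x, hx⟩, hxW, rfl⟩
      rw [this]
      exact G.isOpen_image_par (hV.inter hW') fun y hy => hs hy.1)
    hV

section mapChart
variable {i : I} {V : Set ℂ} (hV : IsOpen V) (hs : V ⊆ G.dom i) (hi : Set.InjOn (G.par i) V)

@[simp] theorem mapChart_source : (G.mapChart i V hV hs hi).source = V := rfl

@[simp] theorem mapChart_target : (G.mapChart i V hV hs hi).target = G.par i '' V := rfl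

@[simp] theorem mapChart_apply (x : ℂ) : G.mapChart i V hV hs hi x = G.par i x := rfl

theorem mapChart_symm_par {x : ℂ} (hx : x ∈ V) :
    (G.mapChart i V hV hs hi).symm (G.par i x) = x :=
  (G.mapChart i V hV hs hi).left_inv hx

end mapChart

theorem exists_injOn {i : I} {x : ℂ} (hx : x ∈ G.dom i) :
    ∃ V, IsOpen V ∧ x ∈ V ∧ V ⊆ G.dom i ∧ Set.InjOn (G.par i) V := by
  obtain ⟨V, hV, hi⟩ := G.inj i x hx
  obtain ⟨V', hV', ho, hm⟩ := mem_nhds_iff.1 (inter_mem hV ((G.isOpen_dom i).mem_nhds hx))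
  exact ⟨V', ho, hm, fun y hy => (hV' hy).2, fun y hy z hz h => hi (hV' hy).1 (hV' hz).1 h⟩

theorem exists_chart (m : G.Space) : ∃ (i : I) (x : ℂ) (V : Set ℂ) (_ : IsOpen V)
    (_ : V ⊆ G.dom i) (_ : Set.InjOn (G.par i) V), x ∈ V ∧ G.par i x = m := by
  obtain ⟨i, x, hx, rfl⟩ := G.exists_par m
  obtain ⟨V, h1, h2, h3, h4⟩ := G.exists_injOn hx
  exact ⟨i, x, V, h1, h3, h4, h2, rfl⟩

instance : ChartedSpace ℂ G.Space where
  atlas := {e | ∃ (i : I) (V : Set ℂ) (hV : IsOpen V) (hs : V ⊆ G.dom i)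
    (hi : Set.InjOn (G.par i) V), e = (G.mapChart i V hV hs hi).symm}
  chartAt m := (G.mapChart (G.exists_chart m).choose
    (G.exists_chart m).choose_spec.choose_spec.choose
    (G.exists_chart m).choose_spec.choose_spec.choose_spec.choose
    (G.exists_chart m).choose_spec.choose_spec.choose_spec.choose_spec.choose
    (G.exists_chart m).choose_spec.choose_spec.choose_spec.choose_spec.choose_spec.choose).symm
  mem_chart_source m := by
    have := (G.exists_chart
      m).choose_spec.choose_spec.choose_spec.choose_spec.choose_spec.choose_spec
    exact ⟨_, this.1, this.2⟩
  chart_mem_atlas m := ⟨_, _, _, _, _, rfl⟩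

theorem chartAt_eq (m : G.Space) : ∃ (i : I) (x : ℂ) (V : Set ℂ) (hV : IsOpen V)
    (hs : V ⊆ G.dom i) (hi : Set.InjOn (G.par i) V), x ∈ V ∧ G.par i x = m ∧
    chartAt ℂ m = (G.mapChart i V hV hs hi).symm := by
  have := (G.exists_chart m).choose_spec.choose_spec.choose_spec.choose_spec.choose_spec.choose_spec
  exact ⟨_, _, _, _, _, _, this.1, this.2, rfl⟩

theorem mem_contDiffGroupoid {f : OpenPartialHomeomorph ℂ ℂ}
    (h : ∀ x ∈ f.source, AnalyticAt ℂ f x ∧ deriv f x ≠ 0) : f ∈ contDiffGroupoid ω 𝓘(ℂ) := by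
  refine (mem_groupoid_of_pregroupoid).2 ⟨?_, ?_⟩
  · simp only [contDiffPregroupoid]
    intro x hx
    simp only [modelWithCornersSelf_coe_symm, Set.preimage_id_eq, id, modelWithCornersSelf_coe,
      Set.range_id, Set.inter_univ] at hx
    exact ((h x hx).1.contDiffAt).contDiffWithinAt
  · simp only [contDiffPregroupoid]
    intro y hy
    simp only [modelWithCornersSelf_coe_symm, Set.preimage_id_eq, id, modelWithCornersSelf_coe,
      Set.range_id, Set.inter_univ] at hy
    have hx := f.map_target hy
    obtain ⟨k, hk, -, hkx, hr, -⟩ := exists_analytic_inverse (h _ hx).1 (h _ hx).2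
    rw [f.right_inv hy] at hk hr hkx
    have hc : Tendsto k (𝓝 y) (𝓝 (f.symm y)) := by
      have h1 := hk.continuousAt.tendsto
      rwa [hkx] at h1
    have : AnalyticAt ℂ f.symm y := by
      refine hk.congr ?_
      filter_upwards [hr, hc.eventually (f.open_source.mem_nhds hx)] with z h1 h2
      rw [← h1, f.left_inv h2, h1]
    exact this.contDiffAt.contDiffWithinAt

theorem analyticAt_transition {i j : I} {x y : ℂ} (hx : x ∈ G.dom i) (hy : y ∈ G.dom j)
    (h : G.par i x = G.par j y) {V : Set ℂ} (hV : IsOpen V) (hs : V ⊆ G.dom j)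
    (hi : Set.InjOn (G.par j) V) (hyV : y ∈ V) :
    AnalyticAt ℂ (fun z => (G.mapChart j V hV hs hi).symm (G.par i z)) x ∧
      deriv (fun z => (G.mapChart j V hV hs hi).symm (G.par i z)) x ≠ 0 := by
  obtain ⟨g, hg, hd, hgy, hev⟩ := G.rel i j x y hx hy h
  simp only at hg hd hgy hev
  have hc : Tendsto g (𝓝 x) (𝓝 y) := by
    have := hg.continuousAt.tendsto
    rwa [hgy] at this
  have heq : g =ᶠ[𝓝 x] fun z => (G.mapChart j V hV hs hi).symm (G.par i z) := by
    filter_upwards [hev, hc.eventually (hV.mem_nhds hyV)] with z h1 h2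
    rw [← G.mapChart_symm_par hV hs hi h2]
    exact congrArg _ h1
  exact ⟨hg.congr heq, heq.deriv_eq ▸ hd⟩

instance : IsManifold 𝓘(ℂ) ω G.Space where
  compatible := by
    rintro e e' ⟨i, V, hV, hs, hi, rfl⟩ ⟨j, W, hW, hs', hi', rfl⟩
    refine mem_contDiffGroupoid fun x hx => ?_
    simp only [OpenPartialHomeomorph.symm_symm, OpenPartialHomeomorph.trans_source,
      mapChart_source, OpenPartialHomeomorph.symm_source, mapChart_target, Set.mem_inter_iff,
      Set.mem_preimage, mapChart_apply] at hx
    obtain ⟨hxV, y, hy, hyx⟩ := hx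
    exact G.analyticAt_transition (hs hxV) (hs' hy) hyx.symm hW hs' hi' hy

/-- A partial homeomorphism belongs to the complex structure as soon as it is holomorphic with
non-vanishing derivative in all parametrizations. -/
theorem mem_maximalAtlas {φ : OpenPartialHomeomorph G.Space ℂ}
    (h : ∀ i, ∀ x ∈ G.dom i, G.par i x ∈ φ.source →
      AnalyticAt ℂ (fun z => φ (G.par i z)) x ∧ deriv (fun z => φ (G.par i z)) x ≠ 0) :
    φ ∈ IsManifold.maximalAtlas 𝓘(ℂ) ω G.Space := by
  rintro e ⟨i, V, hV, hs, hi, rfl⟩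
  have key : (G.mapChart i V hV hs hi).symm.symm ≫ₕ φ ∈ contDiffGroupoid ω 𝓘(ℂ) := by
    refine mem_contDiffGroupoid fun x hx => ?_
    simp only [OpenPartialHomeomorph.symm_symm, OpenPartialHomeomorph.trans_source,
      mapChart_source, Set.mem_inter_iff, Set.mem_preimage, mapChart_apply] at hx
    exact h i x (hs hx.1) hx.2
  refine ⟨?_, key⟩
  have := (contDiffGroupoid ω 𝓘(ℂ)).symm key
  rwa [OpenPartialHomeomorph.trans_symm_eq_symm_trans_symm] at this

end HoloGluing

end

noncomputable section

/-! ### The turn at a vertex in logarithmic coordinates -/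

theorem Complex.exp_im_neg {x : ℂ} (h : -Real.pi < x.im) (h' : x.im < 0) :
    (Complex.exp x).im < 0 := by
  rw [Complex.exp_im]
  exact mul_neg_of_pos_of_neg (Real.exp_pos _) (Real.sin_neg_of_neg_of_neg_pi_lt h' h)

theorem Complex.log_im_of_im_neg {z : ℂ} (h : z.im < 0) :
    -Real.pi < (Complex.log z).im ∧ (Complex.log z).im < 0 := by
  rw [Complex.log_im]
  exact ⟨Complex.neg_pi_lt_arg z, Complex.arg_neg_iff.2 h⟩

theorem Complex.ne_zero_of_im_neg {z : ℂ} (h : z.im < 0) : z ≠ 0 := by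
  rintro rfl; simp at h

theorem Complex.eq_of_exp_eq {a b : ℂ} (h : Complex.exp a = Complex.exp b)
    (h1 : a.im - b.im < 2 * Real.pi) (h2 : b.im - a.im < 2 * Real.pi) : a = b := by
  obtain ⟨n, hn⟩ := Complex.exp_eq_exp_iff_exists_int.1 h
  have him : a.im = b.im + n * (2 * Real.pi) := by
    have := congrArg Complex.im hn
    simpa using this
  have hp := Real.pi_pos
  have hn1 : (n : ℝ) < 1 := by
    by_contra hc; push Not at hc
    nlinarith
  have hn2 : (-1 : ℝ) < n := by
    by_contra hc; push Not at hc
    nlinarith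
  have h0 : n = 0 := by
    have a1 : n < 1 := by exact_mod_cast hn1
    have a2 : -1 < n := by exact_mod_cast hn2
    omega
  rw [hn, h0]; simp

namespace FatGraph

/-- The coordinate on the right one of the two subsequent edges (the one that follows the reversed
edge counterclockwise) of the point with coordinate `x` on an edge with the number `w`. -/
def turnR (w x : ℂ) : ℂ := Complex.log (Complex.exp (x - w) - 1)

/-- The coordinate on the left one of the two subsequent edges of the point with coordinate `x`
on an edge with the number `w`. -/
def turnL (w x : ℂ) : ℂ := -(Real.pi * Complex.I) - Complex.log (1 - Complex.exp (w - x))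

section turn

variable {w x : ℂ} (h1 : -Real.pi < (x - w).im) (h2 : (x - w).im < 0)
include h1 h2

theorem exp_sub_one_im : (Complex.exp (x - w) - 1).im < 0 := by
  simpa using Complex.exp_im_neg h1 h2

theorem one_sub_exp_im : (1 - Complex.exp (w - x)).im < 0 := by
  have e : 1 - Complex.exp (w - x) = 1 + Complex.exp (w - x - Real.pi * Complex.I) := by
    rw [Complex.exp_sub (w - x), Complex.exp_pi_mul_I]; ring
  rw [e]
  have : (Complex.exp (w - x - Real.pi * Complex.I)).im < 0 := by
    simp only [Complex.sub_im] at h1 h2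
    apply Complex.exp_im_neg <;> simp <;> linarith
  simpa using this

theorem exp_turnR : Complex.exp (turnR w x) = Complex.exp (x - w) - 1 :=
  Complex.exp_log (Complex.ne_zero_of_im_neg (exp_sub_one_im h1 h2))

theorem turnR_im : -Real.pi < (turnR w x).im ∧ (turnR w x).im < 0 :=
  Complex.log_im_of_im_neg (exp_sub_one_im h1 h2)

theorem turnL_im : -Real.pi < (turnL w x).im ∧ (turnL w x).im < 0 := by
  have := Complex.log_im_of_im_neg (one_sub_exp_im h1 h2)
  constructor <;> simp [turnL] <;> linarith

theorem exp_turnL : Complex.exp (turnL w x) = -(1 - Complex.exp (w - x))⁻¹ := by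
  rw [turnL, Complex.exp_sub, Complex.exp_neg, Complex.exp_pi_mul_I,
    Complex.exp_log (Complex.ne_zero_of_im_neg (one_sub_exp_im h1 h2))]
  field_simp

theorem exp_turnL' : Complex.exp (turnL w x) =
    -(Complex.exp (x - w) / (Complex.exp (x - w) - 1)) := by
  rw [exp_turnL h1 h2, show w - x = -(x - w) by ring, Complex.exp_neg]
  have := Complex.ne_zero_of_im_neg (exp_sub_one_im h1 h2)
  have h0 := Complex.exp_ne_zero (x - w)
  have h3 : 1 - (Complex.exp (x - w))⁻¹ ≠ 0 := by
    intro hc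
    apply this
    field_simp at hc
    simpa using hc
  field_simp

/-- The angles under which the three sides of an ideal triangle are seen add up to `π`. -/
theorem turnR_add_turnL : turnR w x + turnL w x = x - w - Real.pi * Complex.I := by
  have hR := turnR_im h1 h2
  have hL := turnL_im h1 h2
  apply Complex.eq_of_exp_eq
  · rw [Complex.exp_add, exp_turnR h1 h2, exp_turnL' h1 h2, Complex.exp_sub _ (Real.pi * _),
      Complex.exp_pi_mul_I]
    have := Complex.ne_zero_of_im_neg (exp_sub_one_im h1 h2)
    field_simp
  · simp at h1 h2 ⊢; linarith
  · simp at h1 h2 ⊢; linarith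

theorem turnR_lt : (turnR w x).im < (x - w).im := by
  have := congrArg Complex.im (turnR_add_turnL h1 h2)
  have hL := turnL_im h1 h2
  simp at this ⊢; linarith

theorem turnL_lt : (turnL w x).im < (x - w).im := by
  have := congrArg Complex.im (turnR_add_turnL h1 h2)
  have hR := turnR_im h1 h2
  simp at this ⊢; linarith

theorem turnL_flip_turnR (w' : ℂ) :
    turnL w' (w' - Real.pi * Complex.I - turnR w x) = w - Real.pi * Complex.I - x := by
  have e : Complex.exp (w' - (w' - Real.pi * Complex.I - turnR w x)) = 1 - Complex.exp (x - w) := by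
    rw [show w' - (w' - Real.pi * Complex.I - turnR w x) = Real.pi * Complex.I + turnR w x by ring,
      Complex.exp_add, Complex.exp_pi_mul_I, exp_turnR h1 h2]
    ring
  rw [turnL, e, sub_sub_cancel, Complex.log_exp h1 (by linarith [Real.pi_pos])]
  ring

theorem turnR_flip_turnL (w' : ℂ) :
    turnR w' (w' - Real.pi * Complex.I - turnL w x) = w - Real.pi * Complex.I - x := by
  have h0 := Complex.ne_zero_of_im_neg (one_sub_exp_im h1 h2)
  have e : Complex.exp (w' - Real.pi * Complex.I - turnL w x - w') - 1
      = Complex.exp (w - Real.pi * Complex.I - x) := by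
    rw [show w' - Real.pi * Complex.I - turnL w x - w' = -(Real.pi * Complex.I) - turnL w x by ring,
      Complex.exp_sub, Complex.exp_neg, Complex.exp_pi_mul_I, exp_turnL h1 h2,
      show w - Real.pi * Complex.I - x = (w - x) - Real.pi * Complex.I by ring,
      Complex.exp_sub (w - x) (Real.pi * Complex.I), Complex.exp_pi_mul_I]
    field_simp
    ring
  rw [turnR, e, Complex.log_exp]
  · simp at h1 h2 ⊢; linarith
  · simp at h1 h2 ⊢; linarith [Real.pi_pos]

theorem turnR_flip_turnR (w' : ℂ) :
    turnR w' (w' - Real.pi * Complex.I - turnR w x) = turnL w x := by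
  have h0 := Complex.ne_zero_of_im_neg (exp_sub_one_im h1 h2)
  have hL := turnL_im h1 h2
  have e : Complex.exp (w' - Real.pi * Complex.I - turnR w x - w') - 1
      = Complex.exp (turnL w x) := by
    rw [show w' - Real.pi * Complex.I - turnR w x - w' = -(Real.pi * Complex.I) - turnR w x by ring,
      Complex.exp_sub, Complex.exp_neg, Complex.exp_pi_mul_I, exp_turnL' h1 h2, exp_turnR h1 h2]
    field_simp
    ring
  rw [turnR, e, Complex.log_exp hL.1 (by linarith [Real.pi_pos])]

theorem turnL_flip_turnL (w' : ℂ) :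
    turnL w' (w' - Real.pi * Complex.I - turnL w x) = turnR w x := by
  have h0 := Complex.ne_zero_of_im_neg (exp_sub_one_im h1 h2)
  have hR := turnR_im h1 h2
  have e : 1 - Complex.exp (w' - (w' - Real.pi * Complex.I - turnL w x))
      = Complex.exp (-(Real.pi * Complex.I) - turnR w x) := by
    rw [show w' - (w' - Real.pi * Complex.I - turnL w x) = Real.pi * Complex.I + turnL w x by ring,
      Complex.exp_add, Complex.exp_sub, Complex.exp_neg, Complex.exp_pi_mul_I, exp_turnL' h1 h2,
      exp_turnR h1 h2]
    field_simp
    ring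
  rw [turnL, e, Complex.log_exp]
  · ring
  · simp; linarith
  · simp; linarith [Real.pi_pos]

end turn

theorem log_exp_turnR_add_one {w x : ℂ} (h1 : -Real.pi < (x - w).im) (h2 : (x - w).im < 0) :
    w + Complex.log (Complex.exp (turnR w x) + 1) = x := by
  rw [exp_turnR h1 h2, sub_add_cancel, Complex.log_exp h1 (by linarith [Real.pi_pos])]
  ring

/-! ### Chains of subsequent strips -/

variable {E : Type*} (Γ : FatGraph E) (Z : E → ℂ)

theorem next_injective : Function.Injective Γ.next := by
  intro a b h
  rw [← Γ.next_next_next a, h, Γ.next_next_next]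

theorem rev_injective : Function.Injective Γ.rev := by
  intro a b h
  rw [← Γ.rev_rev a, h, Γ.rev_rev]

theorem next_next_ne (a : E) : Γ.next (Γ.next a) ≠ a := by
  intro h
  apply Γ.next_ne a
  conv_rhs => rw [← Γ.next_next_next a, h]

/-- The pair of an edge and a complex number is a point of a strip. -/
def InStrip (p : E × ℂ) : Prop := p.2 ∈ strip (Z p.1)

/-- The same point with the coordinate on the reversed edge. -/
def flip (p : E × ℂ) : E × ℂ := (Γ.rev p.1, Z p.1 - Real.pi * Complex.I - p.2)

/-- The passage from a point on a strip to the same point on the strip of a subsequent edge. -/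
def Step (p q : E × ℂ) : Prop :=
  InStrip Z p ∧ InStrip Z q ∧ -Real.pi < (p.2 - Z p.1).im ∧
    (q = (Γ.next (Γ.rev p.1), turnR (Z p.1) p.2) ∨
      q = (Γ.next (Γ.next (Γ.rev p.1)), turnL (Z p.1) p.2))

/-- Chains of `n` passages.  The edges of such a chain form a path without returns. -/
def Steps : ℕ → E × ℂ → E × ℂ → Prop
  | 0, p, q => p = q
  | n + 1, p, q => ∃ r, Γ.Step Z p r ∧ Steps n r q

variable {Γ Z}

theorem InStrip.sub_im {p : E × ℂ} (h : InStrip Z p) : (p.2 - Z p.1).im < 0 := by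
  have := h.2
  simp; linarith

theorem Step.im_lt {p q : E × ℂ} (h : Γ.Step Z p q) : (Z p.1).im + q.2.im < p.2.im := by
  obtain ⟨hp, -, h1, rfl | rfl⟩ := h
  · have := turnR_lt h1 hp.sub_im
    simp at this ⊢; linarith
  · have := turnL_lt h1 hp.sub_im
    simp at this ⊢; linarith

theorem Step.im_neg {p q : E × ℂ} (h : Γ.Step Z p q) : q.2.im < 0 := by
  obtain ⟨hp, -, h1, rfl | rfl⟩ := h
  · exact (turnR_im h1 hp.sub_im).2
  · exact (turnL_im h1 hp.sub_im).2

theorem Step.subsequent {p q : E × ℂ} (h : Γ.Step Z p q) : Γ.Subsequent p.1 q.1 := by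
  obtain ⟨hp, -, h1, rfl | rfl⟩ := h
  · exact Or.inl rfl
  · exact Or.inr rfl

section flip
variable (hZ : ∀ α, Z (Γ.rev α) = Z α)
include hZ

theorem flip_flip (p : E × ℂ) : Γ.flip Z (Γ.flip Z p) = p := by
  apply Prod.ext
  · exact Γ.rev_rev _
  · simp [flip, hZ]

theorem InStrip.flip {p : E × ℂ} (h : InStrip Z p) : InStrip Z (Γ.flip Z p) := by
  obtain ⟨h1, h2⟩ := h
  constructor
  · simp [FatGraph.flip]; linarith
  · simp [FatGraph.flip, hZ]; linarith

theorem Step.flip {p q : E × ℂ} (h : Γ.Step Z p q) : Γ.Step Z (Γ.flip Z q) (Γ.flip Z p) := by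
  have hn := h.im_neg
  obtain ⟨hp, hq, h1, hpq⟩ := h
  refine ⟨hq.flip hZ, hp.flip hZ, ?_, ?_⟩
  · simp [FatGraph.flip, hZ]; linarith
  · rcases hpq with rfl | rfl
    · right
      simp only [FatGraph.flip, Γ.rev_rev, Γ.next_next_next, hZ]
      rw [turnL_flip_turnR h1 hp.sub_im]
    · left
      simp only [FatGraph.flip, Γ.rev_rev, Γ.next_next_next, hZ]
      rw [turnR_flip_turnL h1 hp.sub_im]

/-- Of the two continuations `q` and `q'` of `p`, each continues the reversal of the other: the
three strips at a vertex play symmetric roles. -/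
theorem Step.sibling {p q q' : E × ℂ} (h : Γ.Step Z p q) (h' : Γ.Step Z p q') (hne : q ≠ q') :
    Γ.Step Z (Γ.flip Z q) q' := by
  have hn := h.im_neg
  obtain ⟨hp, hq, h1, hpq⟩ := h
  obtain ⟨-, hq', -, hpq'⟩ := h'
  refine ⟨hq.flip hZ, hq', ?_, ?_⟩
  · simp [FatGraph.flip, hZ]; linarith
  · rcases hpq with rfl | rfl <;> rcases hpq' with rfl | rfl
    · exact absurd rfl hne
    · left
      simp only [FatGraph.flip, Γ.rev_rev, hZ]
      rw [turnR_flip_turnR h1 hp.sub_im]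
    · right
      simp only [FatGraph.flip, Γ.rev_rev, hZ, Γ.next_next_next]
      rw [turnL_flip_turnL h1 hp.sub_im]
    · exact absurd rfl hne

end flip

theorem Steps.snoc {n : ℕ} {p q r : E × ℂ} (h : Γ.Steps Z n p q) (h' : Γ.Step Z q r) :
    Γ.Steps Z (n + 1) p r := by
  induction n generalizing p with
  | zero => cases h; exact ⟨r, h', rfl⟩
  | succ n ih =>
    obtain ⟨s, hs, hsq⟩ := h
    exact ⟨s, hs, ih hsq⟩

theorem Steps.exists_last {n : ℕ} {p q : E × ℂ} (h : Γ.Steps Z (n + 1) p q) :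
    ∃ r, Γ.Steps Z n p r ∧ Γ.Step Z r q := by
  induction n generalizing p with
  | zero => obtain ⟨s, hs, hsq⟩ := h; cases hsq; exact ⟨p, rfl, hs⟩
  | succ n ih =>
    obtain ⟨s, hs, hsq⟩ := h
    obtain ⟨r, hr, hrq⟩ := ih hsq
    exact ⟨r, ⟨s, hs, hr⟩, hrq⟩

theorem Steps.flip (hZ : ∀ α, Z (Γ.rev α) = Z α) {n : ℕ} {p q : E × ℂ} (h : Γ.Steps Z n p q) :
    Γ.Steps Z n (Γ.flip Z q) (Γ.flip Z p) := by
  induction n generalizing p with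
  | zero => cases h; rfl
  | succ n ih =>
    obtain ⟨s, hs, hsq⟩ := h
    exact (ih hsq).snoc (hs.flip hZ)

theorem Steps.inStrip {n : ℕ} {p q : E × ℂ} (h : Γ.Steps Z n p q) :
    InStrip Z p ↔ InStrip Z q := by
  induction n generalizing p with
  | zero => cases h; rfl
  | succ n ih =>
    obtain ⟨s, hs, hsq⟩ := h
    rw [← ih hsq]
    exact ⟨fun _ => hs.2.1, fun _ => hs.1⟩

theorem Steps.exists_path {n : ℕ} {p q : E × ℂ} (h : Γ.Steps Z n p q) :
    ∃ c : ℕ → E, c 0 = p.1 ∧ (∀ k < n, Γ.Subsequent (c k) (c (k + 1))) ∧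
      ∑ k ∈ Finset.range n, (Z (c k)).im + q.2.im ≤ p.2.im := by
  induction n generalizing p with
  | zero => cases h; exact ⟨fun _ => q.1, rfl, by simp, by simp⟩
  | succ n ih =>
    obtain ⟨s, hs, hsq⟩ := h
    obtain ⟨c, h0, hc, hsum⟩ := ih hsq
    refine ⟨fun k => Nat.casesOn k p.1 c, rfl, ?_, ?_⟩
    · rintro (_ | k) hk
      · simpa [h0] using hs.subsequent
      · exact hc k (by omega)
    · rw [Finset.sum_range_succ']
      have := hs.im_lt
      change ∑ k ∈ Finset.range n, (Z (c k)).im + (Z p.1).im + q.2.im ≤ p.2.im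
      linarith

theorem Steps.finite (n : ℕ) (p : E × ℂ) : {q | Γ.Steps Z n p q}.Finite := by
  induction n generalizing p with
  | zero => exact (Set.finite_singleton p).subset fun q hq => Eq.symm hq
  | succ n ih =>
    refine ((ih (Γ.next (Γ.rev p.1), turnR (Z p.1) p.2)).union
      (ih (Γ.next (Γ.next (Γ.rev p.1)), turnL (Z p.1) p.2))).subset ?_
    rintro q ⟨s, ⟨-, -, -, rfl | rfl⟩, hsq⟩
    · exact Or.inl hsq
    · exact Or.inr hsq

variable (Γ Z) in
/-- A chain of passages leads from `p` to `q`, up to reversal of the first and the last edge. -/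
def Linked (p q : E × ℂ) : Prop :=
  ∃ n, Γ.Steps Z n p q ∨ Γ.Steps Z n p (Γ.flip Z q) ∨ Γ.Steps Z n (Γ.flip Z p) q ∨
    Γ.Steps Z n (Γ.flip Z p) (Γ.flip Z q)

section linked
variable (hZ : ∀ α, Z (Γ.rev α) = Z α)
include hZ

theorem Linked.flip {p q : E × ℂ} (h : Γ.Linked Z p q) : Γ.Linked Z p (Γ.flip Z q) := by
  obtain ⟨n, h⟩ := h
  refine ⟨n, ?_⟩
  rw [flip_flip hZ]
  tauto

/-- A chain can be prolonged by a passage.  If it arrives at the reversal of `b` through a passage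
from `c`, then `a` is either the reversal of `c` or the other continuation of `c`; so returns can
be removed. -/
theorem Linked.step {p b a : E × ℂ} (h : Γ.Linked Z p b) (hs : Γ.Step Z b a) :
    Γ.Linked Z p a := by
  have key : ∀ (p0 : E × ℂ), (p0 = p ∨ p0 = Γ.flip Z p) → ∀ n, Γ.Steps Z n p0 b →
      Γ.Linked Z p a := by
    rintro p0 (rfl | rfl) n hn
    · exact ⟨n + 1, Or.inl (hn.snoc hs)⟩
    · exact ⟨n + 1, Or.inr (Or.inr (Or.inl (hn.snoc hs)))⟩
  have key2 : ∀ (p0 : E × ℂ), (p0 = p ∨ p0 = Γ.flip Z p) → ∀ n, Γ.Steps Z n p0 (Γ.flip Z b) →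
      Γ.Linked Z p a := by
    intro p0 hp0 n hn
    cases n with
    | zero =>
      refine key (Γ.flip Z p0) ?_ 0 ?_
      · rcases hp0 with rfl | rfl
        · exact Or.inr rfl
        · exact Or.inl (flip_flip hZ _)
      · have : p0 = Γ.flip Z b := hn
        rw [this, flip_flip hZ]; rfl
    | succ n =>
      obtain ⟨c, hc, hcb⟩ := hn.exists_last
      have h1 := hcb.flip hZ
      rw [flip_flip hZ] at h1
      by_cases hac : Γ.flip Z c = a
      · rw [← hac]
        rcases hp0 with rfl | rfl
        · exact Linked.flip hZ ⟨n, Or.inl hc⟩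
        · exact Linked.flip hZ ⟨n, Or.inr (Or.inr (Or.inl hc))⟩
      · have h2 := h1.sibling hZ hs hac
        rw [flip_flip hZ] at h2
        rcases hp0 with rfl | rfl
        · exact ⟨n + 1, Or.inl (hc.snoc h2)⟩
        · exact ⟨n + 1, Or.inr (Or.inr (Or.inl (hc.snoc h2)))⟩
  obtain ⟨n, h | h | h | h⟩ := h
  · exact key p (Or.inl rfl) n h
  · exact key2 p (Or.inl rfl) n h
  · exact key _ (Or.inr rfl) n h
  · exact key2 _ (Or.inr rfl) n h

end linked

/-- The pair of an edge and a coordinate given by a point of the disjoint union of the strips. -/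
def StripPoint.pair (a : StripPoint Z) : E × ℂ := (a.1, a.2)

theorem StripPoint.pair_injective : Function.Injective (StripPoint.pair (Z := Z)) := by
  rintro ⟨a, x⟩ ⟨b, y⟩ h
  simp only [pair, Prod.mk.injEq] at h
  obtain ⟨rfl, h⟩ := h
  rw [Subtype.ext h]

theorem StripPoint.inStrip (a : StripPoint Z) : InStrip Z a.pair := a.2.2

theorem flip_of_flip {a b : StripPoint Z} (h : Γ.Flip Z a b) : b.pair = Γ.flip Z a.pair :=
  Prod.ext h.1 h.2

theorem step_of_turn {b a : StripPoint Z} (h : Γ.Turn Z b a) : Γ.Step Z a.pair b.pair := by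
  obtain ⟨h1, h2, h3⟩ := h
  have hb := b.2.2.1
  have hexp := Complex.exp_im_neg hb h2
  have hexp' : (Complex.exp b.2 + 1).im < 0 := by simpa using hexp
  have hlog := Complex.log_im_of_im_neg hexp'
  have e : (a.2 : ℂ) - Z a.1 = Complex.log (Complex.exp b.2 + 1) := by rw [h3]; ring
  refine ⟨a.inStrip, b.inStrip, ?_, Or.inl (Prod.ext h1 ?_)⟩
  · simp only [StripPoint.pair]
    rw [e]; exact hlog.1
  · simp only [StripPoint.pair, turnR]
    rw [e, Complex.exp_log (Complex.ne_zero_of_im_neg hexp'), add_sub_cancel_right,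
      Complex.log_exp hb (by linarith [Real.pi_pos])]

theorem turn_of_eq {a b : StripPoint Z} (h1 : -Real.pi < (a.pair.2 - Z a.1).im)
    (h : b.pair = (Γ.next (Γ.rev a.1), turnR (Z a.1) a.2)) : Γ.Turn Z b a := by
  have hb2 : (b.2 : ℂ) = turnR (Z a.1) a.2 := congrArg Prod.snd h
  refine ⟨congrArg Prod.fst h, ?_, ?_⟩
  · rw [hb2]; exact (turnR_im h1 a.inStrip.sub_im).2
  · rw [hb2]
    exact (log_exp_turnR_add_one h1 a.inStrip.sub_im).symm

theorem mk_flip {a b : StripPoint Z} (h : b.pair = Γ.flip Z a.pair) :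
    (Quot.mk (Γ.Glue Z) a) = Quot.mk _ b :=
  Quot.sound (Or.inl ⟨congrArg Prod.fst h, congrArg Prod.snd h⟩)

section glue
variable (hZ : ∀ α, Z (Γ.rev α) = Z α)
include hZ

theorem mk_step {a b : StripPoint Z} (h : Γ.Step Z a.pair b.pair) :
    (Quot.mk (Γ.Glue Z) a) = Quot.mk _ b := by
  have h' := h.flip hZ
  have hL : ∀ {a b : StripPoint Z}, -Real.pi < (a.pair.2 - Z a.1).im →
      b.pair = (Γ.next (Γ.rev a.1), turnR (Z a.1) a.2) →
      (Quot.mk (Γ.Glue Z) a) = Quot.mk _ b :=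
    fun h1 h2 => (Quot.sound (r := Γ.Glue Z) (Or.inr (turn_of_eq h1 h2))).symm
  obtain ⟨-, hb, h1, hab | hab⟩ := h
  · exact hL h1 hab
  · let a' : StripPoint Z := ⟨_, ⟨_, a.inStrip.flip hZ⟩⟩
    let b' : StripPoint Z := ⟨_, ⟨_, b.inStrip.flip hZ⟩⟩
    have ea : a'.pair = Γ.flip Z a.pair := rfl
    have eb : b'.pair = Γ.flip Z b.pair := rfl
    rw [mk_flip ea, mk_flip eb]
    rw [← ea, ← eb] at h'
    obtain ⟨-, -, h2, h3⟩ := h'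
    refine (hL h2 ?_).symm
    rcases h3 with h3 | h3
    · exact h3
    · exfalso
      have h4 := congrArg Prod.fst h3
      have h5 := congrArg Prod.fst hab
      rw [ea, eb] at h4
      simp only [FatGraph.flip, Γ.rev_rev] at h4
      rw [h5, Γ.next_next_next] at h4
      exact Γ.next_ne _ h4.symm

theorem mk_steps {n : ℕ} {a b : StripPoint Z} (h : Γ.Steps Z n a.pair b.pair) :
    (Quot.mk (Γ.Glue Z) a) = Quot.mk _ b := by
  induction n generalizing a with
  | zero => rw [StripPoint.pair_injective h]
  | succ n ih =>
    obtain ⟨s, hs, hsq⟩ := h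
    let c : StripPoint Z := ⟨s.1, ⟨s.2, hs.2.1⟩⟩
    exact (mk_step hZ (b := c) hs).trans (ih (a := c) hsq)

/-- Two points of the strips are identified if and only if they are linked by a chain of
passages without returns. -/
theorem mk_eq_iff {a b : StripPoint Z} :
    (Quot.mk (Γ.Glue Z) a) = Quot.mk _ b ↔ Γ.Linked Z a.pair b.pair := by
  constructor
  · intro h
    have key : ∀ c d : StripPoint Z, Γ.Glue Z c d →
        (Γ.Linked Z a.pair c.pair ↔ Γ.Linked Z a.pair d.pair) := by
      rintro c d (h | h)
      · rw [flip_of_flip h]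
        refine ⟨fun h => h.flip hZ, fun h => ?_⟩
        have := h.flip hZ
        rwa [flip_flip hZ] at this
      · have hs := step_of_turn h
        refine ⟨fun h => ?_, fun h => h.step hZ hs⟩
        have := ((h.flip hZ).step hZ (hs.flip hZ)).flip hZ
        rwa [flip_flip hZ] at this
    have h2 := Quot.eqvGen_exact h
    have h3 : ∀ c d : StripPoint Z, Relation.EqvGen (Γ.Glue Z) c d →
        (Γ.Linked Z a.pair c.pair ↔ Γ.Linked Z a.pair d.pair) := by
      intro c d hcd
      induction hcd with
      | rel c d h => exact key c d h
      | refl => rfl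
      | symm _ _ _ ih => exact ih.symm
      | trans _ _ _ _ _ ih1 ih2 => exact ih1.trans ih2
    exact (h3 a b h2).1 ⟨0, Or.inl rfl⟩
  · rintro ⟨n, h⟩
    let a' : StripPoint Z := ⟨_, ⟨_, a.inStrip.flip hZ⟩⟩
    let b' : StripPoint Z := ⟨_, ⟨_, b.inStrip.flip hZ⟩⟩
    have ea : a'.pair = Γ.flip Z a.pair := rfl
    have eb : b'.pair = Γ.flip Z b.pair := rfl
    rcases h with h | h | h | h
    · exact mk_steps hZ h
    · rw [mk_flip eb]; exact mk_steps hZ h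
    · rw [mk_flip ea]; exact mk_steps hZ h
    · rw [mk_flip ea, mk_flip eb]; exact mk_steps hZ h

end glue

/-! ### Finiteness of the equivalence classes -/

theorem im_lt_of_turn (hZ : ∀ α, Z (Γ.rev α) = Z α) (p q p' q' : StripPoint Z)
    (h : Γ.Turn Z q p ∨ Γ.Flip Z p p' ∧ Γ.Flip Z q q' ∧ Γ.Turn Z p' q') :
    (Z p.1).im + (q.2 : ℂ).im < (p.2 : ℂ).im := by
  rcases h with h | ⟨hp, hq, h⟩
  · exact (step_of_turn h).im_lt
  · have := (step_of_turn h).flip hZ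
    rw [flip_of_flip hp, flip_of_flip hq, flip_flip hZ, flip_flip hZ] at this
    exact this.im_lt

/-- Along a path of length `n` without returns the sum of the weights grows linearly, if it is
positive along all closed paths: remove closed paths of bounded length, one after another. -/
theorem exists_path_sum_bound [Finite E] [Nonempty E] (f : E → ℝ)
    (hf : ∀ n c, Γ.IsClosedPathWithoutReturns n c → 0 < ∑ k ∈ Finset.range n, f (c k)) :
    ∃ ε > 0, ∃ C, ∀ (n : ℕ) (c : ℕ → E), (∀ k < n, Γ.Subsequent (c k) (c (k + 1))) →
      ε * n - C ≤ ∑ k ∈ Finset.range n, f (c k) := by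
  have := Fintype.ofFinite E
  set m := Fintype.card E with hm
  have hm0 : 0 < m := Fintype.card_pos
  -- a positive lower bound for the positive sums over at most `m` edges
  obtain ⟨δ, hδ, hmin⟩ : ∃ δ > 0, ∀ l ≤ m, ∀ c : ℕ → E, 0 < ∑ k ∈ Finset.range l, f (c k) →
      δ ≤ ∑ k ∈ Finset.range l, f (c k) := by
    let T : Set ℝ := Set.range fun d : Fin (m + 1) × (Fin (m + 1) → E) =>
      ∑ k ∈ Finset.range d.1, f (d.2 (Fin.ofNat (m + 1) k))
    have hT : T.Finite := Set.finite_range _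
    have hT' : (T ∩ Set.Ioi 0).Finite := hT.inter_of_left _
    have : ∃ δ > 0, ∀ t ∈ T ∩ Set.Ioi 0, δ ≤ t := by
      rcases (T ∩ Set.Ioi 0).eq_empty_or_nonempty with h | h
      · exact ⟨1, one_pos, by simp [h]⟩
      · obtain ⟨t, ht, hmin⟩ := Set.exists_min_image _ id hT' h
        exact ⟨t, ht.2, hmin⟩
    obtain ⟨δ, hδ, hmin⟩ := this
    refine ⟨δ, hδ, fun l hl c hc => hmin _ ⟨⟨(⟨l, by omega⟩, fun i => c i), ?_⟩, hc⟩⟩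
    refine Finset.sum_congr rfl fun k hk => ?_
    have : k < m + 1 := by have := Finset.mem_range.1 hk; omega
    simp [Nat.mod_eq_of_lt this]
  obtain ⟨B, hB⟩ : ∃ B, ∀ e, -B ≤ f e := by
    obtain ⟨B, hB⟩ := (Set.finite_range f).bddBelow
    exact ⟨-B, fun e => by simpa using hB ⟨e, rfl⟩⟩
  have hB0 : ∀ n (c : ℕ → E), -(n * |B|) ≤ ∑ k ∈ Finset.range n, f (c k) := by
    intro n c
    have : ∑ _k ∈ Finset.range n, (-|B|) ≤ ∑ k ∈ Finset.range n, f (c k) :=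
      Finset.sum_le_sum fun k _ => by linarith [hB (c k), le_abs_self B]
    simpa using this
  have hmR : (0 : ℝ) < m := by exact_mod_cast hm0
  refine ⟨δ / m, by positivity, m * |B| + δ, ?_⟩
  intro n
  induction n using Nat.strong_induction_on with
  | _ n ih =>
    intro c hc
    by_cases hnm : n < m
    · have h1 := hB0 n c
      have h2 : (n : ℝ) ≤ m := by exact_mod_cast hnm.le
      have h3 : (n : ℝ) * |B| ≤ m * |B| := by gcongr
      have h4 : δ / m * n ≤ δ := by
        rw [div_mul_eq_mul_div, div_le_iff₀ hmR]; gcongr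
      linarith
    · push Not at hnm
      -- the first `m + 1` edges of the path are not all different
      obtain ⟨i, j, hij, heq⟩ : ∃ i j : Fin (m + 1), i < j ∧ c i = c j := by
        obtain ⟨i, j, hne, heq⟩ := Fintype.exists_ne_map_eq_of_card_lt
          (fun i : Fin (m + 1) => c i) (by simp [hm])
        rcases lt_or_gt_of_ne hne with h | h
        · exact ⟨i, j, h, heq⟩
        · exact ⟨j, i, h, heq.symm⟩
      obtain ⟨i, hi⟩ := i
      obtain ⟨j, hj⟩ := j
      simp only [Fin.mk_lt_mk] at hij heq
      obtain ⟨l, rfl⟩ := Nat.exists_eq_add_of_lt hij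
      obtain ⟨l', hl'⟩ : ∃ l', l' = l + 1 := ⟨_, rfl⟩
      rw [show i + l + 1 = i + l' by omega] at heq
      -- the part between two equal edges is a closed path, continued periodically
      have hcyc : 0 < ∑ k ∈ Finset.range l', f (c (i + k)) := by
        have := hf l' (fun k => c (i + k % l')) ⟨by omega, fun k => by simp, fun k => ?_⟩
        · refine this.trans_le (le_of_eq (Finset.sum_congr rfl fun k hk => ?_))
          rw [Nat.mod_eq_of_lt (Finset.mem_range.1 hk)]
        · have hlt := Nat.mod_lt k (show 0 < l' by omega)
          have hs := hc (i + k % l') (by omega)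
          change Γ.Subsequent (c (i + k % l')) (c (i + (k + 1) % l'))
          by_cases hk : k % l' + 1 = l'
          · have : (k + 1) % l' = 0 := by
              rw [Nat.add_mod, ← Nat.dvd_iff_mod_eq_zero]
              rcases Nat.eq_or_lt_of_le (show 1 ≤ l' by omega) with h1 | h1
              · rw [← h1]; exact one_dvd _
              · rw [Nat.mod_eq_of_lt h1, hk]
            have e : c (i + k % l' + 1) = c (i + (k + 1) % l') := by
              rw [this, add_assoc, hk, add_zero, heq]
            rw [← e]; exact hs
          · have : (k + 1) % l' = k % l' + 1 := by
              rw [Nat.add_mod]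
              have : 1 % l' = 1 := Nat.mod_eq_of_lt (by omega)
              rw [this, Nat.mod_eq_of_lt (by omega)]
            rw [this]; exact hs
      have hδ' := hmin l' (by omega) (fun k => c (i + k)) hcyc
      -- the path without this closed part
      let c' : ℕ → E := fun k => if k < i then c k else c (k + l')
      have hc' : ∀ k < n - l', Γ.Subsequent (c' k) (c' (k + 1)) := by
        intro k hk
        simp only [c']
        by_cases h1 : k + 1 < i
        · rw [if_pos (by omega), if_pos h1]; exact hc k (by omega)
        · by_cases h2 : k < i
          · have h3 : k + 1 = i := by omega
            rw [if_pos h2, if_neg (by omega), h3]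
            have := hc k (by omega)
            rw [h3, heq] at this
            exact this
          · rw [if_neg h2, if_neg (by omega), show k + 1 + l' = k + l' + 1 by omega]
            exact hc _ (by omega)
      have hI := ih (n - l') (by omega) c' hc'
      have hsum : ∑ k ∈ Finset.range n, f (c k) =
          ∑ k ∈ Finset.range (n - l'), f (c' k) + ∑ k ∈ Finset.range l', f (c (i + k)) := by
        obtain ⟨r, rfl⟩ : ∃ r, n = i + (l' + r) := ⟨n - l' - i, by omega⟩
        have hn' : i + (l' + r) - l' = i + r := by omega
        rw [hn', Finset.sum_range_add, Finset.sum_range_add, Finset.sum_range_add]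
        have e1 : ∑ k ∈ Finset.range i, f (c' k) = ∑ k ∈ Finset.range i, f (c k) :=
          Finset.sum_congr rfl fun k hk => by
            simp only [c']; rw [if_pos (Finset.mem_range.1 hk)]
        have e2 : ∑ k ∈ Finset.range r, f (c' (i + k)) =
            ∑ k ∈ Finset.range r, f (c (i + (l' + k))) :=
          Finset.sum_congr rfl fun k hk => by
            simp only [c']; rw [if_neg (by omega)]; congr 2; omega
        rw [e1, e2]; ring
      have hcast : ((n - l' : ℕ) : ℝ) = n - l' := by
        rw [Nat.cast_sub (by omega)]
      rw [hcast] at hI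
      have hl'm : (l' : ℝ) ≤ m := by exact_mod_cast (show l' ≤ m by omega)
      have h4 : δ / m * l' ≤ δ := by
        rw [div_mul_eq_mul_div, div_le_iff₀ hmR]; gcongr
      rw [hsum]
      linarith [mul_sub (δ / m) n l']

/-- The lengths of the chains that start at height at most `B` are bounded: the imaginary part drops
along a passage by more than the imaginary part of the number of the edge, and it never drops
below `-π`. -/
theorem exists_steps_bound [Finite E] [Nonempty E]
    (hpos : ∀ n c, Γ.IsClosedPathWithoutReturns n c → 0 < ∑ k ∈ Finset.range n, (Z (c k)).im)
    (B : ℝ) : ∃ N : ℕ, ∀ n p q, Γ.Steps Z n p q → InStrip Z p → p.2.im ≤ B → n < N := by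
  obtain ⟨ε, hε, C, hC⟩ := exists_path_sum_bound (fun e => (Z e).im) hpos
  obtain ⟨N, hN⟩ := exists_nat_gt ((B + Real.pi + C) / ε)
  refine ⟨N, fun n p q h hp hB => ?_⟩
  obtain ⟨c, -, hc, hsum⟩ := h.exists_path
  have h1 := hC n c hc
  have h2 := (h.inStrip.1 hp).1
  rw [div_lt_iff₀ hε] at hN
  have : (n : ℝ) < N := by
    by_contra hcon
    push Not at hcon
    have : ε * N ≤ ε * n := by gcongr
    linarith
  exact_mod_cast this

theorem finite_linked [Finite E] [Nonempty E] (hZ : ∀ α, Z (Γ.rev α) = Z α)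
    (hpos : ∀ n c, Γ.IsClosedPathWithoutReturns n c → 0 < ∑ k ∈ Finset.range n, (Z (c k)).im)
    {p : E × ℂ} (hp : InStrip Z p) : {q | Γ.Linked Z p q}.Finite := by
  have key : ∀ p : E × ℂ, InStrip Z p → {q | ∃ n, Γ.Steps Z n p q}.Finite := by
    intro p hp
    obtain ⟨N, hN⟩ := exists_steps_bound hpos p.2.im
    refine ((Set.finite_lt_nat N).biUnion fun n _ => Steps.finite (Γ := Γ) (Z := Z) n p).subset ?_
    rintro q ⟨n, hn⟩
    exact Set.mem_biUnion (hN n p q hn hp le_rfl) hn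
  have h1 := (key p hp).union (key _ (hp.flip hZ))
  refine (h1.union (h1.image (Γ.flip Z))).subset ?_
  rintro q ⟨n, h | h | h | h⟩
  · exact Or.inl (Or.inl ⟨n, h⟩)
  · exact Or.inr ⟨_, Or.inl ⟨n, h⟩, flip_flip hZ q⟩
  · exact Or.inl (Or.inr ⟨n, h⟩)
  · exact Or.inr ⟨_, Or.inr ⟨n, h⟩, flip_flip hZ q⟩

theorem finite_class [Finite E] [Nonempty E] (hZ : ∀ α, Z (Γ.rev α) = Z α)
    (hpos : ∀ n c, Γ.IsClosedPathWithoutReturns n c → 0 < ∑ k ∈ Finset.range n, (Z (c k)).im)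
    (m : Γ.GluedSurface Z) : {a : StripPoint Z | Γ.glued Z a.1 a.2 = m}.Finite := by
  obtain ⟨a, rfl⟩ := Quot.exists_rep m
  refine Set.Finite.of_finite_image ((finite_linked hZ hpos a.inStrip).subset ?_)
    (f := StripPoint.pair) StripPoint.pair_injective.injOn
  rintro _ ⟨b, hb, rfl⟩
  exact (mk_eq_iff hZ).1 (Eq.symm hb)

end FatGraph

end

noncomputable section

/-! ### Identified points: closedness and discreteness -/

namespace FatGraph

variable {E : Type*} {Γ : FatGraph E} {Z : E → ℂ}

theorem continuousAt_turnR {w x : ℂ} (h1 : -Real.pi < (x - w).im) (h2 : (x - w).im < 0) :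
    ContinuousAt (turnR w) x := by
  have hs : Complex.exp (x - w) - 1 ∈ Complex.slitPlane :=
    Or.inr (exp_sub_one_im h1 h2).ne
  exact ContinuousAt.clog (by fun_prop) hs

theorem continuousAt_turnL {w x : ℂ} (h1 : -Real.pi < (x - w).im) (h2 : (x - w).im < 0) :
    ContinuousAt (turnL w) x := by
  have hs : 1 - Complex.exp (w - x) ∈ Complex.slitPlane :=
    Or.inr (one_sub_exp_im h1 h2).ne
  exact ContinuousAt.sub continuousAt_const (ContinuousAt.clog (by fun_prop) hs)

theorem continuous_flip (Γ : FatGraph E) (Z : E → ℂ) (α : E) :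
    Continuous fun x => (Γ.flip Z (α, x)).2 := by
  simp only [FatGraph.flip]; fun_prop

section pos
variable (hpos : ∀ α, 0 < (Z α).im)
include hpos

theorem inStrip_of_im {α : E} {x : ℂ} (h1 : -Real.pi < x.im) (h2 : x.im < 0) :
    InStrip Z (α, x) := ⟨h1, h2.trans (hpos α)⟩

theorem step_right {p : E × ℂ} (hp : InStrip Z p) (h1 : -Real.pi < (p.2 - Z p.1).im) :
    Γ.Step Z p (Γ.next (Γ.rev p.1), turnR (Z p.1) p.2) :=
  ⟨hp, inStrip_of_im hpos (turnR_im h1 hp.sub_im).1 (turnR_im h1 hp.sub_im).2, h1, Or.inl rfl⟩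

theorem step_left {p : E × ℂ} (hp : InStrip Z p) (h1 : -Real.pi < (p.2 - Z p.1).im) :
    Γ.Step Z p (Γ.next (Γ.next (Γ.rev p.1)), turnL (Z p.1) p.2) :=
  ⟨hp, inStrip_of_im hpos (turnL_im h1 hp.sub_im).1 (turnL_im h1 hp.sub_im).2, h1, Or.inr rfl⟩

theorem Steps.im_le {n : ℕ} {p q : E × ℂ} (h : Γ.Steps Z n p q) : q.2.im ≤ p.2.im := by
  obtain ⟨c, -, -, hsum⟩ := h.exists_path
  have : 0 ≤ ∑ k ∈ Finset.range n, (Z (c k)).im := Finset.sum_nonneg fun k _ => (hpos _).le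
  linarith

theorem Steps.im_lt {n : ℕ} {p q : E × ℂ} (h : Γ.Steps Z (n + 1) p q) :
    (Z p.1).im + q.2.im < p.2.im := by
  obtain ⟨r, hr, hrq⟩ := h
  have h1 := hr.im_lt
  have h2 := hrq.im_le hpos
  linarith

theorem not_steps_self (n : ℕ) (p : E × ℂ) : ¬ Γ.Steps Z (n + 1) p p := fun h => by
  have := h.im_lt hpos
  linarith [hpos p.1]

/-- A chain without returns does not lead to the same point on the reversed edge: the chain from
`p` to the reversal of `p` can be shortened at both ends, or it closes up to a chain from a point to
itself. -/
theorem not_steps_flip (hZ : ∀ α, Z (Γ.rev α) = Z α) (n : ℕ) (p : E × ℂ) :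
    ¬ Γ.Steps Z n p (Γ.flip Z p) := by
  induction n using Nat.strong_induction_on generalizing p with
  | _ n ih =>
    intro h
    match n, ih, h with
    | 0, _, h => exact Γ.rev_ne _ (congrArg Prod.fst h).symm
    | 1, _, h =>
      obtain ⟨r, ⟨-, -, -, hr⟩, rfl⟩ := h
      rcases hr with hr | hr
      · exact Γ.next_ne _ (congrArg Prod.fst hr).symm
      · exact Γ.next_next_ne _ (congrArg Prod.fst hr).symm
    | n + 2, ih, h =>
      obtain ⟨r, hpr, hr⟩ := h
      obtain ⟨s, hs, hsp⟩ := hr.exists_last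
      have hps := hsp.flip hZ
      rw [flip_flip hZ] at hps
      by_cases hrs : Γ.flip Z s = r
      · have : s = Γ.flip Z r := by rw [← hrs, flip_flip hZ]
        rw [this] at hs
        exact ih n (by omega) r hs
      · have h1 := hps.sibling hZ hpr hrs
        rw [flip_flip hZ] at h1
        exact not_steps_self hpos n r (hs.snoc h1)

theorem exists_steps_lt (Γ : FatGraph E) [Finite E] [Nonempty E] :
    ∃ N : ℕ, ∀ n p q, Γ.Steps Z n p q → InStrip Z p → n < N := by
  obtain ⟨B, hB⟩ := (Set.finite_range fun α => (Z α).im).bddAbove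
  obtain ⟨N, hN⟩ := exists_steps_bound (Γ := Γ) (Z := Z)
    (fun n c hc => Finset.sum_pos (fun k _ => hpos _) ⟨0, by simpa using hc.1⟩) B
  exact ⟨N, fun n p q h hp => hN n p q h hp (hp.2.le.trans (hB ⟨_, rfl⟩))⟩

/-- Being linked by a chain of given length is a closed relation.  The only way in which a passage
could appear in the limit is from the lower boundary `Im x = Im Z - π` of its domain, and there the
inequality for the imaginary parts excludes it. -/
theorem eventually_not_steps (n : ℕ) {α β : E} {x y : ℂ} (hx : InStrip Z (α, x))
    (hy : InStrip Z (β, y)) (h : ¬ Γ.Steps Z n (α, x) (β, y)) :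
    ∀ᶠ q : ℂ × ℂ in 𝓝 (x, y), ¬ Γ.Steps Z n (α, q.1) (β, q.2) := by
  induction n generalizing α x with
  | zero =>
    by_cases hab : α = β
    · subst hab
      have hxy : x ≠ y := fun e => h (by rw [e]; rfl)
      have : ∀ᶠ q : ℂ × ℂ in 𝓝 (x, y), q.1 ≠ q.2 :=
        (isOpen_ne_fun continuous_fst continuous_snd).mem_nhds hxy
      filter_upwards [this] with q hq hc
      exact hq (congrArg Prod.snd hc)
    · exact Eventually.of_forall fun q hc => hab (congrArg Prod.fst hc)
  | succ n ih =>
    by_cases him : (Z α).im + y.im ≤ x.im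
    · have h1 : -Real.pi < (x - Z α).im := by
        have := hy.1
        simp at this ⊢; linarith
      have h2 : (x - Z α).im < 0 := hx.sub_im
      have hR := step_right (Γ := Γ) hpos hx h1
      have hL := step_left (Γ := Γ) hpos hx h1
      have eR := ih hR.2.1 fun hc => h ⟨_, hR, hc⟩
      have eL := ih hL.2.1 fun hc => h ⟨_, hL, hc⟩
      have tR : Tendsto (fun q : ℂ × ℂ => (turnR (Z α) q.1, q.2)) (𝓝 (x, y))
          (𝓝 (turnR (Z α) x, y)) :=
        ((continuousAt_turnR h1 h2).tendsto.comp (continuous_fst.tendsto (x, y))).prodMk_nhds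
          (continuous_snd.tendsto (x, y))
      have tL : Tendsto (fun q : ℂ × ℂ => (turnL (Z α) q.1, q.2)) (𝓝 (x, y))
          (𝓝 (turnL (Z α) x, y)) :=
        ((continuousAt_turnL h1 h2).tendsto.comp (continuous_fst.tendsto (x, y))).prodMk_nhds
          (continuous_snd.tendsto (x, y))
      filter_upwards [tR.eventually eR, tL.eventually eL] with q h3 h4
      rintro ⟨r, ⟨-, -, -, rfl | rfl⟩, hr⟩
      · exact h3 hr
      · exact h4 hr
    · push Not at him
      have : ∀ᶠ q : ℂ × ℂ in 𝓝 (x, y), q.1.im < (Z α).im + q.2.im :=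
        (isOpen_lt (by fun_prop) (by fun_prop)).mem_nhds him
      filter_upwards [this] with q hq hc
      have := hc.im_lt hpos
      simp only at this
      linarith

variable (hZ : ∀ α, Z (Γ.rev α) = Z α)
include hZ

/-- The relation between identified points is closed. -/
theorem eventually_not_linked [Finite E] [Nonempty E] {α β : E} {x y : ℂ}
    (hx : InStrip Z (α, x)) (hy : InStrip Z (β, y)) (h : ¬ Γ.Linked Z (α, x) (β, y)) :
    ∀ᶠ q : ℂ × ℂ in 𝓝 (x, y), InStrip Z (α, q.1) → ¬ Γ.Linked Z (α, q.1) (β, q.2) := by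
  obtain ⟨N, hN⟩ := exists_steps_lt hpos Γ
  have c1 := (continuous_flip Γ Z α).tendsto x
  have c2 := (continuous_flip Γ Z β).tendsto y
  have ft : Tendsto (Prod.fst : ℂ × ℂ → ℂ) (𝓝 (x, y)) (𝓝 x) := continuous_fst.tendsto (x, y)
  have st : Tendsto (Prod.snd : ℂ × ℂ → ℂ) (𝓝 (x, y)) (𝓝 y) := continuous_snd.tendsto (x, y)
  have key : ∀ n, ∀ᶠ q : ℂ × ℂ in 𝓝 (x, y), ¬ (Γ.Steps Z n (α, q.1) (β, q.2) ∨
      Γ.Steps Z n (α, q.1) (Γ.flip Z (β, q.2)) ∨ Γ.Steps Z n (Γ.flip Z (α, q.1)) (β, q.2) ∨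
      Γ.Steps Z n (Γ.flip Z (α, q.1)) (Γ.flip Z (β, q.2))) := by
    intro n
    have e1 := eventually_not_steps hpos n hx hy fun hc => h ⟨n, Or.inl hc⟩
    have e2 := eventually_not_steps hpos n hx (hy.flip hZ) fun hc => h ⟨n, Or.inr (Or.inl hc)⟩
    have e3 := eventually_not_steps hpos n (hx.flip hZ) hy
      fun hc => h ⟨n, Or.inr (Or.inr (Or.inl hc))⟩
    have e4 := eventually_not_steps hpos n (hx.flip hZ) (hy.flip hZ)
      fun hc => h ⟨n, Or.inr (Or.inr (Or.inr hc))⟩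
    filter_upwards [e1, (ft.prodMk_nhds (c2.comp st)).eventually e2,
      ((c1.comp ft).prodMk_nhds st).eventually e3,
      ((c1.comp ft).prodMk_nhds (c2.comp st)).eventually e4] with q h1 h2 h3 h4
    rintro (h | h | h | h)
    exacts [h1 h, h2 h, h3 h, h4 h]
  have key2 := (Set.finite_lt_nat N).eventually_all.2 fun n _ => key n
  filter_upwards [key2] with q hq hin
  rintro ⟨n, hn⟩
  refine hq n ?_ hn
  rcases hn with h | h | h | h
  · exact hN _ _ _ h hin
  · exact hN _ _ _ h hin
  · exact hN _ _ _ h (hin.flip hZ)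
  · exact hN _ _ _ h (hin.flip hZ)

/-- Points of the same strip that are close to each other are not identified. -/
theorem eventually_eq_of_linked [Finite E] [Nonempty E] {α : E} {x : ℂ}
    (hx : InStrip Z (α, x)) :
    ∀ᶠ q : ℂ × ℂ in 𝓝 (x, x), InStrip Z (α, q.1) → Γ.Linked Z (α, q.1) (α, q.2) →
      q.1 = q.2 := by
  obtain ⟨N, hN⟩ := exists_steps_lt hpos Γ
  have c1 := (continuous_flip Γ Z α).tendsto x
  have ft : Tendsto (Prod.fst : ℂ × ℂ → ℂ) (𝓝 (x, x)) (𝓝 x) := continuous_fst.tendsto (x, x)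
  have st : Tendsto (Prod.snd : ℂ × ℂ → ℂ) (𝓝 (x, x)) (𝓝 x) := continuous_snd.tendsto (x, x)
  have key : ∀ n, ∀ᶠ q : ℂ × ℂ in 𝓝 (x, x), (Γ.Steps Z n (α, q.1) (α, q.2) ∨
      Γ.Steps Z n (α, q.1) (Γ.flip Z (α, q.2)) ∨ Γ.Steps Z n (Γ.flip Z (α, q.1)) (α, q.2) ∨
      Γ.Steps Z n (Γ.flip Z (α, q.1)) (Γ.flip Z (α, q.2))) → q.1 = q.2 := by
    intro n
    have e2 := eventually_not_steps hpos n hx (hx.flip hZ) (not_steps_flip hpos hZ n _)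
    have e3 := eventually_not_steps hpos n (hx.flip hZ) hx (fun h => by
      have := not_steps_flip hpos hZ n (Γ.flip Z (α, x))
      rw [flip_flip hZ] at this
      exact this h)
    have e1 : ∀ᶠ q : ℂ × ℂ in 𝓝 (x, x), Γ.Steps Z n (α, q.1) (α, q.2) → q.1 = q.2 := by
      cases n with
      | zero => exact Eventually.of_forall fun q h => congrArg Prod.snd h
      | succ n =>
        filter_upwards [eventually_not_steps hpos _ hx hx (not_steps_self hpos n _)] with q h1 h2
        exact absurd h2 h1
    have sw : Tendsto (fun q : ℂ × ℂ => (q.2, q.1)) (𝓝 (x, x)) (𝓝 (x, x)) :=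
      (continuous_snd.prodMk continuous_fst).tendsto (x, x)
    filter_upwards [e1, (ft.prodMk_nhds (c1.comp st)).eventually e2,
      ((c1.comp ft).prodMk_nhds st).eventually e3,
      sw.eventually e1] with q h1 h2 h3 h4
    rintro (h | h | h | h)
    · exact h1 h
    · exact absurd h h2
    · exact absurd h h3
    · have := h.flip hZ
      rw [flip_flip hZ, flip_flip hZ] at this
      exact (h4 this).symm
  have key2 := (Set.finite_lt_nat N).eventually_all.2 fun n _ => key n
  filter_upwards [key2] with q hq hin
  rintro ⟨n, hn⟩
  refine hq n ?_ hn
  rcases hn with h | h | h | h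
  · exact hN _ _ _ h hin
  · exact hN _ _ _ h hin
  · exact hN _ _ _ h (hin.flip hZ)
  · exact hN _ _ _ h (hin.flip hZ)

end pos

/-! ### Identified points near the ends of the strips -/

theorem turnR_eq_log_one_sub {w x : ℂ} (h1 : -Real.pi < (x - w).im) (h2 : (x - w).im < 0) :
    turnR w x = Complex.log (1 - Complex.exp (x - w)) - Real.pi * Complex.I := by
  have hR := turnR_im h1 h2
  have hi := exp_sub_one_im h1 h2
  have h0 : 1 - Complex.exp (x - w) ≠ 0 := fun h => by
    apply Complex.ne_zero_of_im_neg hi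
    linear_combination -h
  have ha := Complex.neg_pi_lt_arg (1 - Complex.exp (x - w))
  have ha' := Complex.arg_le_pi (1 - Complex.exp (x - w))
  apply Complex.eq_of_exp_eq
  · rw [exp_turnR h1 h2, Complex.exp_sub _ (Real.pi * Complex.I), Complex.exp_pi_mul_I,
      Complex.exp_log h0]
    ring
  · have : 0 ≤ Complex.arg (1 - Complex.exp (x - w)) := by
      rw [Complex.arg_nonneg_iff]
      simp at hi ⊢; linarith
    simp [Complex.log_im]; linarith
  · simp [Complex.log_im]; linarith

theorem eventually_norm_log_one_sub_lt {η : ℝ} (hη : 0 < η) (w : ℂ) :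
    ∀ᶠ C : ℝ in atTop, ∀ x : ℂ, C < x.re → ‖Complex.log (1 - Complex.exp (w - x))‖ < η := by
  have hc : ContinuousAt (fun t : ℂ => Complex.log (1 - t)) 0 :=
    ContinuousAt.clog (by fun_prop) (by simp)
  have h0 : ∀ᶠ t : ℂ in 𝓝 0, ‖Complex.log (1 - t)‖ < η := by
    have := hc.norm.eventually_lt (f := fun t : ℂ => ‖Complex.log (1 - t)‖)
      (g := fun _ => η) continuousAt_const (by simpa using hη)
    exact this
  obtain ⟨δ, hδ, hball⟩ := Metric.eventually_nhds_iff.1 h0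
  have ht : Tendsto (fun C : ℝ => Real.exp (w.re - C)) atTop (𝓝 0) :=
    Real.tendsto_exp_atBot.comp (tendsto_atBot_add_const_left _ _ tendsto_neg_atTop_atBot)
  filter_upwards [ht.eventually (gt_mem_nhds hδ)] with C hC x hx
  apply hball
  rw [dist_zero_right, Complex.norm_exp, Complex.sub_re]
  exact lt_of_le_of_lt (Real.exp_le_exp.2 (by linarith)) hC

theorem eventually_turnL {η : ℝ} (hη : 0 < η) (w : ℂ) :
    ∀ᶠ C : ℝ in atTop, ∀ x : ℂ, C < x.re → ‖turnL w x + Real.pi * Complex.I‖ < η := by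
  filter_upwards [eventually_norm_log_one_sub_lt hη w] with C hC x hx
  have : turnL w x + Real.pi * Complex.I = - Complex.log (1 - Complex.exp (w - x)) := by
    rw [turnL]; ring
  rw [this, norm_neg]
  exact hC x hx

theorem eventually_turnR {η : ℝ} (hη : 0 < η) (w : ℂ) :
    ∀ᶠ C : ℝ in atTop, ∀ x : ℂ, -Real.pi < (x - w).im → (x - w).im < 0 → x.re < -C →
      ‖turnR w x + Real.pi * Complex.I‖ < η := by
  filter_upwards [eventually_norm_log_one_sub_lt hη (-w)] with C hC x h1 h2 hx
  rw [turnR_eq_log_one_sub h1 h2, sub_add_cancel, show x - w = -w - -x by ring]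
  exact hC (-x) (by simp; linarith)

theorem eventually_turnR_re (B : ℝ) (w : ℂ) :
    ∀ᶠ C : ℝ in atTop, ∀ x : ℂ, -Real.pi < (x - w).im → (x - w).im < 0 → C < x.re →
      B < (turnR w x).re := by
  filter_upwards [eventually_turnL one_pos w, eventually_ge_atTop (B + w.re + 1)]
    with C hC hCB x h1 h2 hx
  have e := congrArg Complex.re (turnR_add_turnL h1 h2)
  have h3 := (Complex.abs_re_le_norm _).trans_lt (hC x hx)
  simp at e h3
  have := (abs_lt.1 h3).2
  linarith

theorem eventually_turnL_re (B : ℝ) (w : ℂ) :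
    ∀ᶠ C : ℝ in atTop, ∀ x : ℂ, -Real.pi < (x - w).im → (x - w).im < 0 → x.re < -C →
      (turnL w x).re < -B := by
  filter_upwards [eventually_turnR one_pos w, eventually_ge_atTop (B - w.re + 1)]
    with C hC hCB x h1 h2 hx
  have e := congrArg Complex.re (turnR_add_turnL h1 h2)
  have h3 := (Complex.abs_re_le_norm _).trans_lt (hC x h1 h2 hx)
  simp at e h3
  have := (abs_lt.1 h3).1
  linarith

variable (Γ Z) in
/-- The passage from a point on a strip to the same point on the right subsequent strip. -/
def RightStep (p q : E × ℂ) : Prop :=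
  InStrip Z p ∧ InStrip Z q ∧ -Real.pi < (p.2 - Z p.1).im ∧
    q = (Γ.next (Γ.rev p.1), turnR (Z p.1) p.2)

variable (Γ Z) in
/-- Chains of `n` right passages: the edges of the chain have a puncture in common. -/
def RightSteps : ℕ → E × ℂ → E × ℂ → Prop
  | 0, p, q => p = q
  | n + 1, p, q => ∃ r, Γ.RightStep Z p r ∧ RightSteps n r q

theorem RightSteps.snoc {n : ℕ} {p q r : E × ℂ} (h : Γ.RightSteps Z n p q)
    (h' : Γ.RightStep Z q r) : Γ.RightSteps Z (n + 1) p r := by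
  induction n generalizing p with
  | zero => cases h; exact ⟨r, h', rfl⟩
  | succ n ih =>
    obtain ⟨s, hs, hsq⟩ := h
    exact ⟨s, hs, ih hsq⟩

section far
variable (hpos : ∀ α, 0 < (Z α).im)
include hpos

theorem exists_pos_le_im [Finite E] [Nonempty E] : ∃ ε > 0, ∀ α, ε ≤ (Z α).im := by
  obtain ⟨α, hα⟩ := Finite.exists_min fun α => (Z α).im
  exact ⟨_, hpos α, hα⟩

/-- A chain that starts far to the right makes right passages and stays far to the right, possibly
until a left passage, which leads to a point close to `-iπ`, where the chain ends. -/
theorem eventually_steps_pos [Finite E] [Nonempty E] (n : ℕ) (B : ℝ) {η : ℝ} (hη : 0 < η) :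
    ∀ᶠ C : ℝ in atTop, ∀ p q, Γ.Steps Z n p q → C < p.2.re →
      (Γ.RightSteps Z n p q ∧ B < q.2.re) ∨ ‖q.2 + Real.pi * Complex.I‖ < η := by
  obtain ⟨ε, hε, hεZ⟩ := exists_pos_le_im hpos
  induction n with
  | zero =>
    filter_upwards [eventually_ge_atTop B] with C hC p q h hp
    cases h
    exact Or.inl ⟨rfl, by linarith⟩
  | succ n ih =>
    obtain ⟨C', hC'⟩ := ih.exists
    have e1 := eventually_all.2 fun α => eventually_turnR_re C' (Z α)
    have e2 := eventually_all.2 fun α => eventually_turnL (lt_min hη hε) (Z α)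
    filter_upwards [e1, e2] with C h1 h2 p q h hp
    obtain ⟨r, ⟨hp1, hp2, hp3, hr⟩, hrq⟩ := h
    rcases hr with hr | hr
    · have hre : C' < r.2.re := by
        rw [hr]; exact h1 p.1 p.2 hp3 hp1.sub_im hp
      refine (hC' r q hrq hre).imp (fun h => ⟨⟨r, ⟨hp1, hp2, hp3, hr⟩, h.1⟩, h.2⟩) id
    · have hn : ‖r.2 + Real.pi * Complex.I‖ < min η ε := by
        rw [hr]; exact h2 p.1 p.2 hp
      right
      cases n with
      | zero => cases hrq; exact hn.trans_le (min_le_left _ _)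
      | succ n =>
        -- close to `-iπ` the strip has no passage to a subsequent strip
        exfalso
        obtain ⟨s, ⟨-, -, hs, -⟩, -⟩ := hrq
        have h3 := (Complex.abs_im_le_norm _).trans_lt (hn.trans_le (min_le_right _ _))
        have := (abs_lt.1 h3).2
        have h4 := hεZ r.1
        simp at this hs
        linarith

variable (hZ : ∀ α, Z (Γ.rev α) = Z α)
include hZ

/-- The mirror image of `eventually_steps_pos`: a chain that starts far to the left makes left
passages, whose reversals are right passages. -/
theorem eventually_steps_neg [Finite E] [Nonempty E] (n : ℕ) (B : ℝ) {η : ℝ} (hη : 0 < η) :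
    ∀ᶠ C : ℝ in atTop, ∀ p q, Γ.Steps Z n p q → p.2.re < -C →
      (Γ.RightSteps Z n (Γ.flip Z q) (Γ.flip Z p) ∧ q.2.re < -B) ∨
        ‖q.2 + Real.pi * Complex.I‖ < η := by
  obtain ⟨ε, hε, hεZ⟩ := exists_pos_le_im hpos
  induction n with
  | zero =>
    filter_upwards [eventually_ge_atTop B] with C hC p q h hp
    cases h
    exact Or.inl ⟨rfl, by linarith⟩
  | succ n ih =>
    obtain ⟨C', hC'⟩ := ih.exists
    have e1 := eventually_all.2 fun α => eventually_turnL_re C' (Z α)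
    have e2 := eventually_all.2 fun α => eventually_turnR (lt_min hη hε) (Z α)
    filter_upwards [e1, e2] with C h1 h2 p q h hp
    obtain ⟨r, hpr, hrq⟩ := h
    have hfl := hpr.flip hZ
    obtain ⟨hp1, hp2, hp3, hr⟩ := hpr
    rcases hr with hr | hr
    · have hn : ‖r.2 + Real.pi * Complex.I‖ < min η ε := by
        rw [hr]; exact h2 p.1 p.2 hp3 hp1.sub_im hp
      right
      cases n with
      | zero => cases hrq; exact hn.trans_le (min_le_left _ _)
      | succ n =>
        -- close to `-iπ` the strip has no passage to a subsequent strip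
        exfalso
        obtain ⟨s, ⟨-, -, hs, -⟩, -⟩ := hrq
        have h3 := (Complex.abs_im_le_norm _).trans_lt (hn.trans_le (min_le_right _ _))
        have := (abs_lt.1 h3).2
        have h4 := hεZ r.1
        simp at this hs
        linarith
    · have hre : r.2.re < -C' := by
        rw [hr]; exact h1 p.1 p.2 hp3 hp1.sub_im hp
      refine (hC' r q hrq hre).imp (fun h => ⟨h.1.snoc ?_, h.2⟩) id
      obtain ⟨hf1, hf2, hf3, hf⟩ := hfl
      refine ⟨hf1, hf2, hf3, hf.resolve_right fun hc => ?_⟩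
      have h4 := congrArg Prod.fst hc
      rw [hr] at h4
      simp only [FatGraph.flip, Γ.rev_rev, Γ.next_next_next] at h4
      exact Γ.next_ne _ h4.symm

/-- A point far to the right on a strip is identified with points far to the right on the strips
with the same puncture, with points far to the left on the reversed strips, and with points close
to the finite punctures on the boundaries of the strips. -/
theorem eventually_linked_far [Finite E] [Nonempty E] (B : ℝ) {η : ℝ} (hη : 0 < η) :
    ∀ᶠ C : ℝ in atTop, ∀ p q, Γ.Linked Z p q → InStrip Z p → C < p.2.re →
      (B < q.2.re ∧ ∃ n, Γ.RightSteps Z n p q ∨ Γ.RightSteps Z n q p) ∨ q.2.re < -B ∨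
        ‖q.2 + Real.pi * Complex.I‖ < η ∨ ‖q.2 - Z q.1‖ < η := by
  obtain ⟨N, hN⟩ := exists_steps_lt hpos Γ
  obtain ⟨A, hA⟩ := (Set.finite_range fun α => |(Z α).re|).bddAbove
  have hA' : ∀ α, |(Z α).re| ≤ A := fun α => hA ⟨α, rfl⟩
  have e1 := (Set.finite_lt_nat N).eventually_all.2 fun n _ =>
    eventually_steps_pos (Γ := Γ) hpos n (max B (A + B)) hη
  have e2 := (Set.finite_lt_nat N).eventually_all.2 fun n _ =>
    eventually_steps_neg hpos hZ n (max B (A + B)) hη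
  obtain ⟨C', h2⟩ := e2.exists
  filter_upwards [e1, eventually_ge_atTop (C' + A)] with C h1 hC p q hpq hin hp
  have hfp : (Γ.flip Z p).2.re < -C' := by
    have := (abs_le.1 (hA' p.1)).2
    simp [FatGraph.flip]; linarith
  have hfq : (Γ.flip Z q).2 + Real.pi * Complex.I = -(q.2 - Z q.1) := by
    simp only [FatGraph.flip]; ring
  have hqre : (Γ.flip Z q).2.re = (Z q.1).re - q.2.re := by simp [FatGraph.flip]
  have hq1 := (abs_le.1 (hA' q.1)).1
  have hq2 := (abs_le.1 (hA' q.1)).2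
  have m1 := le_max_left B (A + B)
  have m2 := le_max_right B (A + B)
  obtain ⟨n, h | h | h | h⟩ := hpq
  · rcases h1 n (hN _ _ _ h hin) p q h hp with h | h
    · exact Or.inl ⟨by linarith, n, Or.inl h.1⟩
    · exact Or.inr (Or.inr (Or.inl h))
  · rcases h1 n (hN _ _ _ h hin) p _ h hp with h | h
    · right; left
      have := h.2
      rw [hqre] at this
      linarith
    · rw [hfq, norm_neg] at h
      exact Or.inr (Or.inr (Or.inr h))
  · rcases h2 n (hN _ _ _ h (hin.flip hZ)) _ q h hfp with h | h
    · right; left; linarith [h.2]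
    · exact Or.inr (Or.inr (Or.inl h))
  · rcases h2 n (hN _ _ _ h (hin.flip hZ)) _ _ h hfp with h | h
    · left
      rw [flip_flip hZ, flip_flip hZ, hqre] at h
      exact ⟨by linarith [h.2], n, Or.inr h.1⟩
    · rw [hfq, norm_neg] at h
      exact Or.inr (Or.inr (Or.inr h))

end far

end FatGraph

end

noncomputable section

/-! ### Coordinates at the punctures -/

namespace FatGraph

variable {E : Type u} (Γ : FatGraph E) (Z : E → ℂ)

/-- The right subsequent edge: it has the puncture at the right end in common. -/
def right (α : E) : E := Γ.next (Γ.rev α)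

/-- The faces of the fat graph: the orbits of `right`. -/
def Face : Type u := Quot fun α β : E => β = Γ.right α

/-- The face of an oriented edge. -/
def face (α : E) : Γ.Face := Quot.mk _ α

/-- The points of the completed surface: those of the glued surface and one for each face. -/
abbrev Completed : Type u := Γ.GluedSurface Z ⊕ Γ.Face

open Classical in
/-- The point of the completed surface with a given coordinate on a given strip (a point of the
face, which has no meaning, outside of the strip). -/
def stripMap (p : E × ℂ) : Γ.Completed Z :=
  if h : InStrip Z p then Sum.inl (Quot.mk _ ⟨p.1, ⟨p.2, h⟩⟩) else Sum.inr (Γ.face p.1)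

variable {Γ Z}

theorem stripMap_of_inStrip {p : E × ℂ} (h : InStrip Z p) :
    Γ.stripMap Z p = Sum.inl (Quot.mk _ ⟨p.1, ⟨p.2, h⟩⟩) := dif_pos h

theorem stripMap_eq_iff (hZ : ∀ α, Z (Γ.rev α) = Z α) {p q : E × ℂ} (hp : InStrip Z p)
    (hq : InStrip Z q) : Γ.stripMap Z p = Γ.stripMap Z q ↔ Γ.Linked Z p q := by
  rw [stripMap_of_inStrip hp, stripMap_of_inStrip hq]
  exact ⟨fun h => (mk_eq_iff hZ).1 (Sum.inl_injective h),
    fun h => congrArg Sum.inl ((mk_eq_iff hZ).2 h)⟩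

theorem RightStep.step {p q : E × ℂ} (h : Γ.RightStep Z p q) : Γ.Step Z p q :=
  ⟨h.1, h.2.1, h.2.2.1, Or.inl h.2.2.2⟩

theorem RightSteps.steps {n : ℕ} {p q : E × ℂ} (h : Γ.RightSteps Z n p q) : Γ.Steps Z n p q := by
  induction n generalizing p with
  | zero => exact h
  | succ n ih =>
    obtain ⟨s, hs, hsq⟩ := h
    exact ⟨s, hs.step, ih hsq⟩

theorem right_injective : Function.Injective Γ.right :=
  Γ.next_injective.comp Γ.rev_injective

variable (Γ Z)

/-- The edges of a face, in cyclic order. -/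
def faceEdge (α : E) (k : ℕ) : E := Γ.right^[k] α

/-- Partial sums of the complex numbers of the edges of a face. -/
def faceSum (α : E) (k : ℕ) : ℂ := ∑ i ∈ Finset.range k, Z (Γ.faceEdge α i)

/-- The exponentials of the coordinates on the strips of a face are affine functions of each other;
these are the translation parts. -/
def faceShift (α : E) (k : ℕ) : ℂ := ∑ i ∈ Finset.range k, Complex.exp (Γ.faceSum Z α (i + 1))

/-- The number of edges of a face. -/
def facePeriod (α : E) : ℕ := Function.minimalPeriod Γ.right α

/-- The sum of the complex numbers over all edges of a face. -/
def faceTotal (α : E) : ℂ := Γ.faceSum Z α (Γ.facePeriod α)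

theorem faceEdge_succ (α : E) (k : ℕ) : Γ.faceEdge α (k + 1) = Γ.right (Γ.faceEdge α k) :=
  Function.iterate_succ_apply' _ _ _

theorem faceEdge_add_period (α : E) (k : ℕ) :
    Γ.faceEdge α (k + Γ.facePeriod α) = Γ.faceEdge α k := by
  rw [faceEdge, Function.iterate_add_apply, facePeriod, Function.iterate_minimalPeriod]
  rfl

theorem faceSum_succ (α : E) (k : ℕ) :
    Γ.faceSum Z α (k + 1) = Γ.faceSum Z α k + Z (Γ.faceEdge α k) := Finset.sum_range_succ _ _

theorem faceShift_succ (α : E) (k : ℕ) :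
    Γ.faceShift Z α (k + 1) = Γ.faceShift Z α k + Complex.exp (Γ.faceSum Z α (k + 1)) :=
  Finset.sum_range_succ _ _

theorem faceSum_add_period (α : E) (k : ℕ) :
    Γ.faceSum Z α (k + Γ.facePeriod α) = Γ.faceSum Z α k + Γ.faceTotal Z α := by
  rw [add_comm k, faceSum, Finset.sum_range_add, add_comm]
  congr 1
  refine Finset.sum_congr rfl fun i _ => ?_
  rw [add_comm, faceEdge_add_period]

theorem faceShift_add_period (α : E) (k : ℕ) :
    Γ.faceShift Z α (k + Γ.facePeriod α) =
      Complex.exp (Γ.faceTotal Z α) * Γ.faceShift Z α k + Γ.faceShift Z α (Γ.facePeriod α) := by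
  rw [add_comm k, faceShift, Finset.sum_range_add, add_comm]
  congr 1
  rw [faceShift, Finset.mul_sum]
  refine Finset.sum_congr rfl fun i _ => ?_
  rw [show Γ.facePeriod α + i + 1 = i + 1 + Γ.facePeriod α by ring, faceSum_add_period,
    Complex.exp_add, mul_comm]

theorem facePeriod_pos [Finite E] (α : E) : 0 < Γ.facePeriod α :=
  Function.minimalPeriod_pos_of_mem_periodicPts
    (Γ.right_injective.mem_periodicPts α)

/-- The correction term of the coordinate on the `k`-th strip. -/
def cuspErr (α : E) (A B : ℂ) (k : ℕ) (ξ : ℂ) : ℂ :=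
  (A * ξ + B - Γ.faceShift Z α k) * Complex.exp (-ξ)

/-- The coordinate on the `k`-th strip of the face of `α`: the continuous branch of the logarithm of
the image of `e ^ ξ + A ξ + B` under the affine map to the `k`-th exponential coordinate. -/
def cuspCoord (α : E) (A B : ℂ) (k : ℕ) (ξ : ℂ) : ℂ :=
  ξ - Γ.faceSum Z α k + Complex.log (1 + Γ.cuspErr Z α A B k ξ)

/-- `e ^ ξ + A ξ + B` has the monodromy of the exponential coordinates around the puncture. -/
def IsMonodromic (α : E) (A B : ℂ) : Prop :=
  A * Complex.exp (Γ.faceTotal Z α) = A ∧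
    A * Γ.faceTotal Z α + B = Complex.exp (Γ.faceTotal Z α) * B + Γ.faceShift Z α (Γ.facePeriod α)

/-- If `e ^ L ≠ 1` for the total `L` of the face, the affine monodromy `w ↦ e ^ L w + c` has a fixed
point and no linear term is needed; otherwise it is a translation, which the linear term provides.
-/
theorem exists_isMonodromic (α : E) (hL : Γ.faceTotal Z α ≠ 0) :
    ∃ A B, Γ.IsMonodromic Z α A B := by
  by_cases h : Complex.exp (Γ.faceTotal Z α) = 1
  · refine ⟨Γ.faceShift Z α (Γ.facePeriod α) / Γ.faceTotal Z α, 0, by rw [h, mul_one], ?_⟩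
    field_simp
    ring
  · refine ⟨0, Γ.faceShift Z α (Γ.facePeriod α) / (1 - Complex.exp (Γ.faceTotal Z α)), by simp, ?_⟩
    have : 1 - Complex.exp (Γ.faceTotal Z α) ≠ 0 := fun hc => h (by linear_combination -hc)
    field_simp
    ring

variable {Γ Z} {α : E} {A B : ℂ}

theorem cuspErr_add_period (h : Γ.IsMonodromic Z α A B) (k : ℕ) (ξ : ℂ) :
    Γ.cuspErr Z α A B (k + Γ.facePeriod α) (ξ + Γ.faceTotal Z α) = Γ.cuspErr Z α A B k ξ := by
  obtain ⟨h1, h2⟩ := h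
  rw [cuspErr, cuspErr, faceShift_add_period, neg_add, Complex.exp_add,
    Complex.exp_neg (Γ.faceTotal Z α)]
  have h0 := Complex.exp_ne_zero (Γ.faceTotal Z α)
  field_simp
  linear_combination h2 - ξ * h1

theorem cuspCoord_add_period (h : Γ.IsMonodromic Z α A B) (k : ℕ) (ξ : ℂ) :
    Γ.cuspCoord Z α A B (k + Γ.facePeriod α) (ξ + Γ.faceTotal Z α) = Γ.cuspCoord Z α A B k ξ := by
  rw [cuspCoord, cuspErr_add_period h, faceSum_add_period, cuspCoord]
  ring

theorem cuspCoord_add_periods (h : Γ.IsMonodromic Z α A B) (k m : ℕ) (ξ : ℂ) :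
    Γ.cuspCoord Z α A B (k + m * Γ.facePeriod α) (ξ + m * Γ.faceTotal Z α) =
      Γ.cuspCoord Z α A B k ξ := by
  induction m with
  | zero => simp
  | succ m ih =>
    rw [show k + (m + 1) * Γ.facePeriod α = k + m * Γ.facePeriod α + Γ.facePeriod α by ring,
      show ξ + ((m + 1 : ℕ) : ℂ) * Γ.faceTotal Z α =
        ξ + m * Γ.faceTotal Z α + Γ.faceTotal Z α by push_cast; ring, cuspCoord_add_period h, ih]

theorem faceEdge_add_periods (k m : ℕ) :
    Γ.faceEdge α (k + m * Γ.facePeriod α) = Γ.faceEdge α k := by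
  induction m with
  | zero => simp
  | succ m ih =>
    rw [show k + (m + 1) * Γ.facePeriod α = k + m * Γ.facePeriod α + Γ.facePeriod α by ring,
      faceEdge_add_period, ih]

theorem faceSum_add_periods (k m : ℕ) :
    Γ.faceSum Z α (k + m * Γ.facePeriod α) = Γ.faceSum Z α k + m * Γ.faceTotal Z α := by
  induction m with
  | zero => simp
  | succ m ih =>
    rw [show k + (m + 1) * Γ.facePeriod α = k + m * Γ.facePeriod α + Γ.facePeriod α by ring,
      faceSum_add_period, ih]
    push_cast; ring

theorem exp_cuspCoord {k : ℕ} {ξ : ℂ} (h : 1 + Γ.cuspErr Z α A B k ξ ≠ 0) :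
    Complex.exp (Γ.cuspCoord Z α A B k ξ) = Complex.exp (-Γ.faceSum Z α k) *
      (Complex.exp ξ + A * ξ + B - Γ.faceShift Z α k) := by
  rw [cuspCoord, Complex.exp_add, Complex.exp_log h, sub_eq_neg_add, Complex.exp_add, cuspErr,
    Complex.exp_neg ξ]
  have := Complex.exp_ne_zero ξ
  field_simp
  ring

theorem exp_cuspCoord_succ {k : ℕ} {ξ : ℂ} (h : 1 + Γ.cuspErr Z α A B k ξ ≠ 0)
    (h' : 1 + Γ.cuspErr Z α A B (k + 1) ξ ≠ 0) :
    Complex.exp (Γ.cuspCoord Z α A B k ξ - Z (Γ.faceEdge α k)) =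
      Complex.exp (Γ.cuspCoord Z α A B (k + 1) ξ) + 1 := by
  rw [exp_cuspCoord h', Complex.exp_sub, exp_cuspCoord h, faceShift_succ, faceSum_succ, neg_add,
    Complex.exp_add, Complex.exp_add, Complex.exp_neg, Complex.exp_neg]
  have h1 := Complex.exp_ne_zero (Γ.faceSum Z α k)
  have h2 := Complex.exp_ne_zero (Z (Γ.faceEdge α k))
  field_simp
  ring

/-- Of two numbers that are close to each other and satisfy the equation of a right turn, the
imaginary parts are between `-π` and `0` at the same time. -/
theorem im_window {X Y : ℂ} (h : Complex.exp X = Complex.exp Y + 1) (hc : ‖X - Y‖ < 1 / 4) :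
    (X.im < 0 → Y.im < 0) ∧ (-Real.pi < Y.im → -Real.pi < X.im) ∧
      (-Real.pi < X.im → X.im < 0 → -Real.pi < Y.im) := by
  have him : (Complex.exp X).im = (Complex.exp Y).im := by rw [h]; simp
  have hd := abs_lt.1 ((Complex.abs_im_le_norm _).trans_lt hc)
  rw [Complex.sub_im] at hd
  have hpi := Real.pi_gt_three
  have nonneg1 : ∀ {W : ℂ}, 0 ≤ W.im → W.im ≤ Real.pi → 0 ≤ (Complex.exp W).im := by
    intro W h1 h2
    rw [Complex.exp_im]
    exact mul_nonneg (Real.exp_pos _).le (Real.sin_nonneg_of_nonneg_of_le_pi h1 h2)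
  have nonneg2 : ∀ {W : ℂ}, W.im ≤ -Real.pi → -(2 * Real.pi) ≤ W.im → 0 ≤ (Complex.exp W).im := by
    intro W h1 h2
    rw [Complex.exp_im, ← Real.sin_add_two_pi]
    exact mul_nonneg (Real.exp_pos _).le
      (Real.sin_nonneg_of_nonneg_of_le_pi (by linarith) (by linarith))
  refine ⟨fun hX => ?_, fun hY => ?_, fun hX hX' => ?_⟩
  · by_contra hY
    push Not at hY
    have h1 := nonneg1 hY (by linarith)
    have h2 := Complex.exp_im_neg (x := X) (by linarith) hX
    linarith
  · by_contra hX
    push Not at hX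
    have h1 := nonneg2 hX (by linarith)
    have h2 := Complex.exp_im_neg hY (by linarith)
    linarith
  · by_contra hY
    push Not at hY
    have h1 := nonneg2 hY (by linarith)
    have h2 := Complex.exp_im_neg hX hX'
    linarith

variable (Γ Z) in
/-- For the parameters `ξ` with `C < Re ξ` and `|Im ξ| < H + 1` the corrections of the coordinates
on the first strips of a face are small, together with their derivatives. -/
def CuspSmall (α : E) (A B : ℂ) (K : ℕ) (H C : ℝ) : Prop :=
  ∀ k ≤ K, ∀ ξ : ℂ, C < ξ.re → |ξ.im| < H + 1 → ‖Γ.cuspErr Z α A B k ξ‖ ≤ 1 / 16 ∧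
    ‖(A - (A * ξ + B - Γ.faceShift Z α k)) * Complex.exp (-ξ)‖ ≤ 1 / 16

/-- The corrections are products of `e ^ (-ξ)` and affine functions of `ξ`. -/
theorem eventually_cuspSmall (Γ : FatGraph E) (Z : E → ℂ) (α : E) (A B : ℂ) (K : ℕ) (H : ℝ) :
    ∀ᶠ C in atTop, Γ.CuspSmall Z α A B K H C := by
  have key : ∀ a b : ℂ, ∀ᶠ C : ℝ in atTop, ∀ ξ : ℂ, C < ξ.re → |ξ.im| < H + 1 →
      ‖(a * ξ + b) * Complex.exp (-ξ)‖ ≤ 1 / 16 := by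
    intro a b
    have h1 : Tendsto (fun t : ℝ => ‖a‖ * (t ^ 1 * Real.exp (-t)) +
        (‖a‖ * |H + 1| + ‖b‖) * Real.exp (-t)) atTop (𝓝 0) := by
      have h2 := (Real.tendsto_pow_mul_exp_neg_atTop_nhds_zero 1).const_mul ‖a‖
      have h3 := (Real.tendsto_exp_neg_atTop_nhds_zero).const_mul (‖a‖ * |H + 1| + ‖b‖)
      simpa using h2.add h3
    obtain ⟨C0, hC0⟩ := eventually_atTop.1
      (h1.eventually (gt_mem_nhds (show (0 : ℝ) < 1 / 16 by norm_num)))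
    filter_upwards [eventually_ge_atTop C0, eventually_ge_atTop 0] with C hC hC' ξ hξ hi
    have h4 := hC0 ξ.re (by linarith)
    rw [norm_mul, Complex.norm_exp, Complex.neg_re]
    have h5 : ‖a * ξ + b‖ ≤ ‖a‖ * ξ.re + (‖a‖ * |H + 1| + ‖b‖) := by
      have h6 : ‖ξ‖ ≤ ξ.re + |H + 1| := by
        have := Complex.norm_le_abs_re_add_abs_im ξ
        rw [abs_of_pos (by linarith : 0 < ξ.re)] at this
        linarith [le_abs_self (H + 1)]
      calc ‖a * ξ + b‖ ≤ ‖a‖ * ‖ξ‖ + ‖b‖ := by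
            rw [← norm_mul]; exact norm_add_le _ _
        _ ≤ ‖a‖ * (ξ.re + |H + 1|) + ‖b‖ := by gcongr
        _ = _ := by ring
    calc ‖a * ξ + b‖ * Real.exp (-ξ.re)
        ≤ (‖a‖ * ξ.re + (‖a‖ * |H + 1| + ‖b‖)) * Real.exp (-ξ.re) := by gcongr
      _ = ‖a‖ * (ξ.re ^ 1 * Real.exp (-ξ.re)) + (‖a‖ * |H + 1| + ‖b‖) * Real.exp (-ξ.re) := by ring
      _ ≤ 1 / 16 := h4.le
  have key2 := (Set.finite_le_nat K).eventually_all.2 fun k _ =>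
    (key A (B - Γ.faceShift Z α k)).and (key (-A) (A - (B - Γ.faceShift Z α k)))
  filter_upwards [key2] with C hC k hk ξ h1 h2
  obtain ⟨h3, h4⟩ := hC k hk
  refine ⟨?_, ?_⟩
  · have := h3 ξ h1 h2
    rwa [← add_sub_assoc] at this
  · convert! h4 ξ h1 h2 using 3
    ring

section small
variable {K : ℕ} {H C : ℝ} (hs : Γ.CuspSmall Z α A B K H C)
include hs

theorem CuspSmall.one_add_ne {k : ℕ} (hk : k ≤ K) {ξ : ℂ} (h1 : C < ξ.re) (h2 : |ξ.im| < H + 1) :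
    1 + Γ.cuspErr Z α A B k ξ ∈ Complex.slitPlane := by
  left
  have h3 := (Complex.abs_re_le_norm _).trans (hs k hk ξ h1 h2).1
  have := (abs_le.1 h3).1
  simp; linarith

theorem CuspSmall.norm_coord_sub_le {k : ℕ} (hk : k ≤ K) {ξ : ℂ} (h1 : C < ξ.re)
    (h2 : |ξ.im| < H + 1) :
    ‖Γ.cuspCoord Z α A B k ξ - (ξ - Γ.faceSum Z α k)‖ ≤ 3 / 32 := by
  rw [cuspCoord, add_sub_cancel_left]
  have h3 := (hs k hk ξ h1 h2).1
  refine (Complex.norm_log_one_add_half_le_self (h3.trans (by norm_num))).trans ?_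
  linarith

theorem CuspSmall.hasDerivAt {k : ℕ} (hk : k ≤ K) {ξ : ℂ} (h1 : C < ξ.re) (h2 : |ξ.im| < H + 1) :
    HasDerivAt (Γ.cuspCoord Z α A B k) (1 + (A - (A * ξ + B - Γ.faceShift Z α k)) *
      Complex.exp (-ξ) / (1 + Γ.cuspErr Z α A B k ξ)) ξ := by
  have e1 : HasDerivAt (fun ξ => A * ξ + B - Γ.faceShift Z α k) A ξ := by
    simpa using (((hasDerivAt_id ξ).const_mul A).add_const B).sub_const (Γ.faceShift Z α k)
  have e2 : HasDerivAt (fun ξ : ℂ => Complex.exp (-ξ)) (-Complex.exp (-ξ)) ξ := by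
    simpa using (hasDerivAt_neg ξ).cexp
  have e3 : HasDerivAt (Γ.cuspErr Z α A B k)
      ((A - (A * ξ + B - Γ.faceShift Z α k)) * Complex.exp (-ξ)) ξ := by
    refine (e1.mul e2).congr_deriv ?_
    ring
  have e4 := (e3.const_add 1).clog (hs.one_add_ne hk h1 h2)
  exact ((hasDerivAt_id ξ).sub_const (Γ.faceSum Z α k)).add e4

theorem CuspSmall.norm_deriv_le {k : ℕ} (hk : k ≤ K) {ξ : ℂ} (h1 : C < ξ.re)
    (h2 : |ξ.im| < H + 1) :
    ‖(A - (A * ξ + B - Γ.faceShift Z α k)) * Complex.exp (-ξ) /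
      (1 + Γ.cuspErr Z α A B k ξ)‖ ≤ 1 / 8 := by
  obtain ⟨h3, h4⟩ := hs k hk ξ h1 h2
  have h5 : 15 / 16 ≤ ‖1 + Γ.cuspErr Z α A B k ξ‖ := by
    have := norm_sub_le (1 + Γ.cuspErr Z α A B k ξ) (Γ.cuspErr Z α A B k ξ)
    rw [add_sub_cancel_right, norm_one] at this
    linarith
  rw [norm_div, div_le_iff₀ (by linarith)]
  linarith

theorem CuspSmall.deriv_ne_zero {k : ℕ} (hk : k ≤ K) {ξ : ℂ} (h1 : C < ξ.re)
    (h2 : |ξ.im| < H + 1) : 1 + (A - (A * ξ + B - Γ.faceShift Z α k)) * Complex.exp (-ξ) /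
      (1 + Γ.cuspErr Z α A B k ξ) ≠ 0 := by
  intro h
  have h3 := hs.norm_deriv_le hk h1 h2
  rw [show (A - (A * ξ + B - Γ.faceShift Z α k)) * Complex.exp (-ξ) /
      (1 + Γ.cuspErr Z α A B k ξ) = -1 by linear_combination h] at h3
  norm_num at h3

theorem CuspSmall.lipschitz {k : ℕ} (hk : k ≤ K) {ξ ξ' : ℂ} (h1 : C < ξ.re)
    (h2 : |ξ.im| < H + 1) (h1' : C < ξ'.re) (h2' : |ξ'.im| < H + 1) :
    ‖Γ.cuspCoord Z α A B k ξ - Γ.cuspCoord Z α A B k ξ' - (ξ - ξ')‖ ≤ 1 / 8 * ‖ξ - ξ'‖ := by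
  have hconv : Convex ℝ {ξ : ℂ | C < ξ.re ∧ |ξ.im| < H + 1} := by
    have e : {ξ : ℂ | C < ξ.re ∧ |ξ.im| < H + 1} =
        {ξ : ℂ | C < ξ.re} ∩ ({ξ : ℂ | -(H + 1) < ξ.im} ∩ {ξ : ℂ | ξ.im < H + 1}) := by
      ext ξ; simp [abs_lt]
    rw [e]
    exact (convex_halfSpace_re_gt C).inter
      ((convex_halfSpace_im_gt _).inter (convex_halfSpace_im_lt _))
  have := hconv.norm_image_sub_le_of_norm_hasDerivWithin_le (C := 1 / 8)
    (f := fun ξ => Γ.cuspCoord Z α A B k ξ - ξ)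
    (f' := fun ξ => (A - (A * ξ + B - Γ.faceShift Z α k)) * Complex.exp (-ξ) /
      (1 + Γ.cuspErr Z α A B k ξ))
    (x := ξ') (y := ξ)
    (fun ξ hξ => by
      have := (hs.hasDerivAt hk hξ.1 hξ.2).sub (hasDerivAt_id ξ)
      rw [add_sub_cancel_left] at this
      exact this.hasDerivWithinAt)
    (fun ξ hξ => hs.norm_deriv_le hk hξ.1 hξ.2) ⟨h1', h2'⟩ ⟨h1, h2⟩
  convert! this using 2
  ring

theorem CuspSmall.window {k : ℕ} (hk : k + 1 ≤ K) {ξ : ℂ} (h1 : C < ξ.re)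
    (h2 : |ξ.im| < H + 1) :
    Complex.exp (Γ.cuspCoord Z α A B k ξ - Z (Γ.faceEdge α k)) =
      Complex.exp (Γ.cuspCoord Z α A B (k + 1) ξ) + 1 ∧
    ‖Γ.cuspCoord Z α A B k ξ - Z (Γ.faceEdge α k) - Γ.cuspCoord Z α A B (k + 1) ξ‖ < 1 / 4 := by
  have hk' : k ≤ K := by omega
  refine ⟨exp_cuspCoord_succ (Complex.slitPlane_ne_zero (hs.one_add_ne hk' h1 h2))
    (Complex.slitPlane_ne_zero (hs.one_add_ne hk h1 h2)), ?_⟩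
  have e1 := hs.norm_coord_sub_le hk' h1 h2
  have e2 := hs.norm_coord_sub_le hk h1 h2
  have e3 := norm_sub_le (Γ.cuspCoord Z α A B k ξ - (ξ - Γ.faceSum Z α k))
    (Γ.cuspCoord Z α A B (k + 1) ξ - (ξ - Γ.faceSum Z α (k + 1)))
  have e4 : Γ.cuspCoord Z α A B k ξ - Z (Γ.faceEdge α k) - Γ.cuspCoord Z α A B (k + 1) ξ =
      Γ.cuspCoord Z α A B k ξ - (ξ - Γ.faceSum Z α k) -
      (Γ.cuspCoord Z α A B (k + 1) ξ - (ξ - Γ.faceSum Z α (k + 1))) := by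
    rw [faceSum_succ]; ring
  rw [e4]
  linarith

/-- Along a fixed parameter `ξ`, the coordinates on consecutive strips of the face are related by
right passages whenever they lie in the strips. -/
theorem CuspSmall.rightStep {k : ℕ} (hk : k + 1 ≤ K) {ξ : ℂ} (h1 : C < ξ.re)
    (h2 : |ξ.im| < H + 1) (h3 : InStrip Z (Γ.faceEdge α k, Γ.cuspCoord Z α A B k ξ))
    (h4 : InStrip Z (Γ.faceEdge α (k + 1), Γ.cuspCoord Z α A B (k + 1) ξ)) :
    Γ.RightStep Z (Γ.faceEdge α k, Γ.cuspCoord Z α A B k ξ)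
      (Γ.faceEdge α (k + 1), Γ.cuspCoord Z α A B (k + 1) ξ) := by
  obtain ⟨e, hc⟩ := hs.window hk h1 h2
  obtain ⟨w1, w2, -⟩ := im_window e hc
  refine ⟨h3, h4, w2 h4.1, Prod.ext (faceEdge_succ _ _ _) ?_⟩
  simp only [turnR]
  rw [e, add_sub_cancel_right, Complex.log_exp h4.1 (by linarith [w1 h3.sub_im, Real.pi_pos])]

theorem CuspSmall.eq_of_rightStep {k : ℕ} (hk : k + 1 ≤ K) {ξ : ℂ} (h1 : C < ξ.re)
    (h2 : |ξ.im| < H + 1) {q : E × ℂ}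
    (h : Γ.RightStep Z (Γ.faceEdge α k, Γ.cuspCoord Z α A B k ξ) q) :
    q = (Γ.faceEdge α (k + 1), Γ.cuspCoord Z α A B (k + 1) ξ) := by
  obtain ⟨e, hc⟩ := hs.window hk h1 h2
  obtain ⟨w1, -, w3⟩ := im_window e hc
  obtain ⟨h3, h4, h5, h6⟩ := h
  rw [h6, faceEdge_succ]
  refine Prod.ext rfl ?_
  simp only [turnR]
  rw [e, add_sub_cancel_right, Complex.log_exp (w3 h5 h3.sub_im)
    (by linarith [w1 h3.sub_im, Real.pi_pos])]

variable (hpos : ∀ α, 0 < (Z α).im)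
include hpos

theorem CuspSmall.im_gt (d : ℕ) {k : ℕ} (hk : k + d ≤ K) {ξ : ℂ} (h1 : C < ξ.re)
    (h2 : |ξ.im| < H + 1) (h3 : -Real.pi < (Γ.cuspCoord Z α A B (k + d) ξ).im) :
    -Real.pi < (Γ.cuspCoord Z α A B k ξ).im := by
  induction d generalizing k with
  | zero => exact h3
  | succ d ih =>
    have h4 := ih (k := k + 1) (by omega) (by rwa [show k + 1 + d = k + (d + 1) by ring])
    obtain ⟨e, hc⟩ := hs.window (k := k) (by omega) h1 h2
    have := (im_window e hc).2.1 h4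
    simp only [Complex.sub_im] at this
    linarith [hpos (Γ.faceEdge α k)]

theorem CuspSmall.rightSteps (d : ℕ) {k : ℕ} (hk : k + d ≤ K) {ξ : ℂ} (h1 : C < ξ.re)
    (h2 : |ξ.im| < H + 1) (h3 : InStrip Z (Γ.faceEdge α k, Γ.cuspCoord Z α A B k ξ))
    (h4 : InStrip Z (Γ.faceEdge α (k + d), Γ.cuspCoord Z α A B (k + d) ξ)) :
    Γ.RightSteps Z d (Γ.faceEdge α k, Γ.cuspCoord Z α A B k ξ)
      (Γ.faceEdge α (k + d), Γ.cuspCoord Z α A B (k + d) ξ) := by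
  induction d generalizing k with
  | zero => rfl
  | succ d ih =>
    rw [show k + (d + 1) = k + 1 + d by ring] at h4 hk ⊢
    obtain ⟨e, hc⟩ := hs.window (k := k) (by omega) h1 h2
    have h5 : InStrip Z (Γ.faceEdge α (k + 1), Γ.cuspCoord Z α A B (k + 1) ξ) :=
      ⟨hs.im_gt hpos d hk h1 h2 h4.1,
        ((im_window e hc).1 h3.sub_im).trans (hpos _)⟩
    exact ⟨_, hs.rightStep (by omega) h1 h2 h3 h5, ih hk h5 h4⟩

end small

end FatGraph

end

noncomputable section

namespace FatGraph

variable {E : Type u} {Γ : FatGraph E} {Z : E → ℂ}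

/-- A holomorphic coordinate disk at the puncture of the face of `α`: a parametrization of a
neighbourhood of the puncture by a disk, whose points correspond to points with real part greater
than `C` on the strips.  If `X` is the exponential of the coordinate on a strip, as a function of
the coordinate `z` of the disk, then `X'' / X' = q z / z`, which bounds the pole of its Schwarzian.
-/
structure Cusp (Γ : FatGraph E) (Z : E → ℂ) (α : E) (C : ℝ) where
  radius : ℝ
  radius_pos : 0 < radius
  toFun : ℂ → Γ.Completed Z
  q : ℂ → ℂ
  analyticAt_q : AnalyticAt ℂ q 0
  map_zero : toFun 0 = Sum.inr (Γ.face α)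
  exists_lift : ∀ ζ, ζ ≠ 0 → ‖ζ‖ < radius → ∃ p, InStrip Z p ∧ C < p.2.re ∧
    Γ.face p.1 = Γ.face α ∧ ∃ g : ℂ → ℂ, AnalyticAt ℂ g ζ ∧ deriv g ζ ≠ 0 ∧ g ζ = p.2 ∧
      (∀ᶠ z in 𝓝 ζ, toFun z = Γ.stripMap Z (p.1, g z)) ∧
      ∃ w : ℂ → ℂ, ∀ᶠ z in 𝓝 ζ, HasDerivAt (fun z => Complex.exp (g z)) (w z) z ∧ w z ≠ 0 ∧
        HasDerivAt w (w z * (q z / z)) z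
  inj : Set.InjOn toFun (Metric.ball 0 radius)
  far : ∀ B : ℝ, ∃ ρ > 0, ∀ ζ, ζ ≠ 0 → ‖ζ‖ < ρ →
    ∃ p, InStrip Z p ∧ B < p.2.re ∧ toFun ζ = Γ.stripMap Z p
  surj : ∀ ρ > 0, ∃ C' : ℝ, ∀ p, InStrip Z p → Γ.face p.1 = Γ.face α → C' < p.2.re →
    ∃ ζ, ζ ≠ 0 ∧ ‖ζ‖ < ρ ∧ toFun ζ = Γ.stripMap Z p

theorem exists_faceEdge_eq [Finite E] {α β : E} (h : Γ.face β = Γ.face α) :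
    ∃ k < Γ.facePeriod α, β = Γ.faceEdge α k := by
  have h1 : ∃ k, β = Γ.faceEdge α k := by
    have h2 := Quot.eqvGen_exact h
    induction h2 with
    | rel a b hab =>
      have hp := Γ.facePeriod_pos b
      refine ⟨Γ.facePeriod b - 1, Γ.right_injective ?_⟩
      rw [← faceEdge_succ, Nat.sub_add_cancel hp, ← hab]
      have := faceEdge_add_period Γ b 0
      rw [zero_add] at this
      rw [this]; rfl
    | refl a => exact ⟨0, rfl⟩
    | symm a b hab ih =>
      obtain ⟨k, hk⟩ := ih (Quot.eqvGen_sound hab)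
      have hp := Γ.facePeriod_pos b
      -- complete the number of steps to a multiple of the period
      refine ⟨k * Γ.facePeriod b - k, ?_⟩
      have h3 : k ≤ k * Γ.facePeriod b := Nat.le_mul_of_pos_right k hp
      have h4 := faceEdge_add_periods (Γ := Γ) (α := b) 0 k
      rw [zero_add, ← Nat.sub_add_cancel h3, faceEdge, Function.iterate_add_apply] at h4
      change Γ.right^[_] (Γ.faceEdge b k) = b at h4
      rw [← hk] at h4
      have e : Γ.facePeriod a = Γ.facePeriod b := by
        rw [facePeriod, hk, faceEdge, Function.minimalPeriod_apply_iterate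
          (Γ.right_injective.mem_periodicPts b)]
        rfl
      rw [faceEdge, h4]
    | trans a b c hab hbc ih1 ih2 =>
      obtain ⟨k, hk⟩ := ih1 (Quot.eqvGen_sound hab)
      obtain ⟨l, hl⟩ := ih2 (Quot.eqvGen_sound hbc)
      refine ⟨k + l, ?_⟩
      rw [hk, hl, faceEdge, faceEdge, faceEdge, Function.iterate_add_apply]
  obtain ⟨k, rfl⟩ := h1
  have hp := Γ.facePeriod_pos α
  refine ⟨k % Γ.facePeriod α, Nat.mod_lt _ hp, ?_⟩
  conv_lhs => rw [← Nat.mod_add_div k (Γ.facePeriod α), mul_comm]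
  exact faceEdge_add_periods _ _

theorem face_faceEdge (α : E) (k : ℕ) : Γ.face (Γ.faceEdge α k) = Γ.face α := by
  induction k with
  | zero => rfl
  | succ k ih =>
    rw [← ih, faceEdge_succ]
    exact (Quot.sound (r := fun α β : E => β = Γ.right α) rfl).symm

/-- Two edges of the sequence of the edges of a face coincide only periodically. -/
theorem exists_period_of_faceEdge_eq [Finite E] {α : E} {i j : ℕ}
    (h : Γ.faceEdge α i = Γ.faceEdge α j) :
    ∃ m, j = i + m * Γ.facePeriod α ∨ i = j + m * Γ.facePeriod α := by
  have h1 := (Function.iterate_eq_iterate_iff_of_lt_minimalPeriod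
    (Nat.mod_lt i (Γ.facePeriod_pos α)) (Nat.mod_lt j (Γ.facePeriod_pos α))).1
  have e : ∀ k, Γ.faceEdge α k = Γ.faceEdge α (k % Γ.facePeriod α) := fun k => by
    conv_lhs => rw [← Nat.mod_add_div k (Γ.facePeriod α), mul_comm]
    exact faceEdge_add_periods _ _
  rw [e i, e j] at h
  have h2 := h1 h
  have hi := Nat.mod_add_div i (Γ.facePeriod α)
  have hj := Nat.mod_add_div j (Γ.facePeriod α)
  change i % Γ.facePeriod α = j % Γ.facePeriod α at h2
  rcases le_total (i / Γ.facePeriod α) (j / Γ.facePeriod α) with hle | hle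
  · obtain ⟨m, hm⟩ := Nat.exists_eq_add_of_le hle
    refine ⟨m, Or.inl ?_⟩
    rw [hm, mul_add] at hj
    rw [mul_comm m]; omega
  · obtain ⟨m, hm⟩ := Nat.exists_eq_add_of_le hle
    refine ⟨m, Or.inr ?_⟩
    rw [hm, mul_add] at hi
    rw [mul_comm m]; omega

section rate
variable {L : ℂ} (hL : 0 < L.im)
include hL

/-- The rate of the exponential function with the period `L`. -/
theorem rate_re_neg : (-(2 * Real.pi * Complex.I) / L).re < 0 := by
  have h0 : 0 < Complex.normSq L := Complex.normSq_pos.2 fun h => by simp [h] at hL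
  rw [Complex.div_re]
  have := Real.pi_pos
  have : (0:ℝ) < 2 * Real.pi * L.im / Complex.normSq L := by positivity
  simp
  rw [neg_div]
  linarith

theorem rate_mul : -(2 * Real.pi * Complex.I) / L * L = -(2 * Real.pi * Complex.I) :=
  div_mul_cancel₀ _ fun h => by simp [h] at hL

theorem exp_rate_add (ξ : ℂ) (m : ℤ) :
    Complex.exp (-(2 * Real.pi * Complex.I) / L * (ξ + m * L)) =
      Complex.exp (-(2 * Real.pi * Complex.I) / L * ξ) := by
  rw [Complex.exp_eq_exp_iff_exists_int]
  exact ⟨-m, by push_cast; linear_combination m * rate_mul hL⟩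

theorem exists_of_exp_rate_eq {ξ ξ' : ℂ}
    (h : Complex.exp (-(2 * Real.pi * Complex.I) / L * ξ) =
      Complex.exp (-(2 * Real.pi * Complex.I) / L * ξ')) :
    ∃ m : ℕ, ξ' = ξ + m * L ∨ ξ = ξ' + m * L := by
  obtain ⟨n, hn⟩ := Complex.exp_eq_exp_iff_exists_int.1 h
  have hpi : (2 * Real.pi * Complex.I : ℂ) ≠ 0 := Complex.two_pi_I_ne_zero
  have hL0 : L ≠ 0 := fun h => by simp [h] at hL
  have e : ξ' = ξ + n * L := by
    field_simp at hn
    linear_combination hn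
  obtain ⟨m, rfl | rfl⟩ := n.eq_nat_or_neg
  · exact ⟨m, Or.inl (by simpa using e)⟩
  · refine ⟨m, Or.inr ?_⟩
    rw [e]; push_cast; ring

theorem exists_re_gt (H C' : ℝ) : ∃ ρ > 0, ∀ ξ : ℂ, |ξ.im| < H →
    ‖Complex.exp (-(2 * Real.pi * Complex.I) / L * ξ)‖ < ρ → C' < ξ.re := by
  set μ := -(2 * Real.pi * Complex.I) / L with hμ
  have hneg : μ.re < 0 := rate_re_neg hL
  refine ⟨Real.exp (μ.re * C' - |μ.im| * H), Real.exp_pos _, fun ξ hH h => ?_⟩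
  rw [Complex.norm_exp, Real.exp_lt_exp, Complex.mul_re] at h
  by_contra hc
  push Not at hc
  have h1 : μ.re * C' ≤ μ.re * ξ.re := mul_le_mul_of_nonpos_left hc hneg.le
  have h2 : μ.im * ξ.im ≤ |μ.im| * H := by
    calc μ.im * ξ.im ≤ |μ.im * ξ.im| := le_abs_self _
      _ = |μ.im| * |ξ.im| := abs_mul _ _
      _ ≤ _ := by gcongr
  linarith

theorem exists_norm_lt (H : ℝ) {ρ : ℝ} (hρ : 0 < ρ) : ∃ C' : ℝ, ∀ ξ : ℂ, |ξ.im| < H →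
    C' < ξ.re → ‖Complex.exp (-(2 * Real.pi * Complex.I) / L * ξ)‖ < ρ := by
  set μ := -(2 * Real.pi * Complex.I) / L with hμ
  have hneg : μ.re < 0 := rate_re_neg hL
  refine ⟨(Real.log ρ - |μ.im| * H) / μ.re, fun ξ hH h => ?_⟩
  rw [Complex.norm_exp, ← Real.lt_log_iff_exp_lt hρ, Complex.mul_re]
  rw [div_lt_iff_of_neg hneg] at h
  have h2 : -(μ.im * ξ.im) ≤ |μ.im| * H := by
    calc -(μ.im * ξ.im) ≤ |μ.im * ξ.im| := neg_le_abs _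
      _ = |μ.im| * |ξ.im| := abs_mul _ _
      _ ≤ _ := by gcongr
  linarith

theorem exists_exp_rate_eq {ζ : ℂ} (hζ : ζ ≠ 0) : ∃ ξ : ℂ, 0 ≤ ξ.im ∧ ξ.im < L.im ∧
    Complex.exp (-(2 * Real.pi * Complex.I) / L * ξ) = ζ := by
  set μ := -(2 * Real.pi * Complex.I) / L with hμ
  have hμ0 : μ ≠ 0 := fun h => by have := rate_re_neg hL; rw [← hμ, h] at this; simp at this
  set ξ0 := Complex.log ζ / μ
  have h0 : Complex.exp (μ * ξ0) = ζ := by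
    rw [mul_div_cancel₀ _ hμ0, Complex.exp_log hζ]
  refine ⟨ξ0 + (-⌊ξ0.im / L.im⌋ : ℤ) * L, ?_, ?_, by rw [hμ, exp_rate_add hL, ← hμ, h0]⟩
  · have := Int.floor_le (ξ0.im / L.im)
    rw [le_div_iff₀ hL] at this
    simp; linarith
  · have := Int.lt_floor_add_one (ξ0.im / L.im)
    rw [div_lt_iff₀ hL] at this
    simp; linarith

end rate

variable {α : E} {A B : ℂ} {K : ℕ} {H C : ℝ}

variable (Γ Z) in
/-- The coordinates given by the parameter `ξ` on the `k`-th strip of the face of `α` are those of a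
point of the strip, and the parameter is in the range where the coordinates are controlled. -/
def CuspValid (α : E) (A B : ℂ) (K : ℕ) (H C : ℝ) (k : ℕ) (ξ : ℂ) : Prop :=
  C + 1 < ξ.re ∧ |ξ.im| < H ∧ k ≤ K ∧ InStrip Z (Γ.faceEdge α k, Γ.cuspCoord Z α A B k ξ)

theorem CuspValid.re_lt {k : ℕ} {ξ : ℂ} (h : Γ.CuspValid Z α A B K H C k ξ) : C < ξ.re := by
  linarith [h.1]

theorem CuspValid.im_lt {k : ℕ} {ξ : ℂ} (h : Γ.CuspValid Z α A B K H C k ξ) : |ξ.im| < H + 1 := by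
  linarith [h.2.1]

theorem CuspSmall.im_sub_le (hs : Γ.CuspSmall Z α A B K H C) {k : ℕ} (hk : k ≤ K) {ξ : ℂ}
    (h1 : C < ξ.re) (h2 : |ξ.im| < H + 1) :
    |(Γ.cuspCoord Z α A B k ξ).im - (ξ.im - (Γ.faceSum Z α k).im)| ≤ 3 / 32 := by
  have := (Complex.abs_im_le_norm _).trans (hs.norm_coord_sub_le hk h1 h2)
  simpa using this

theorem CuspValid.faceSum_im_lt (hs : Γ.CuspSmall Z α A B K H C) {k : ℕ} {ξ : ℂ}
    (h : Γ.CuspValid Z α A B K H C k ξ) : (Γ.faceSum Z α k).im < ξ.im + Real.pi + 1 := by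
  have h1 := (abs_le.1 (hs.im_sub_le h.2.2.1 h.re_lt h.im_lt)).2
  have h2 := h.2.2.2.1
  simp only at h2
  linarith

/-- The range of the indices is large enough for all the parameters in question. -/
def CuspRange (Γ : FatGraph E) (Z : E → ℂ) (α : E) (K : ℕ) (H : ℝ) : Prop :=
  ∀ k, (Γ.faceSum Z α k).im ≤ H + Real.pi + 1 → k ≤ K

section valid
variable (hs : Γ.CuspSmall Z α A B K H C) (hK : CuspRange Γ Z α K H)
  (hpos : ∀ α, 0 < (Z α).im) (hm : Γ.IsMonodromic Z α A B)
include hs hK hpos hm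

/-- The parameters `ξ` and `ξ + m L`, where `L` is the total of the face, describe the same point:
by the monodromy the coordinate of `ξ` on the `k`-th strip is the coordinate of `ξ + m L` after `m`
more turns around the face, and two strips of the face are related by right passages. -/
theorem stripMap_eq_of_valid (hZ : ∀ α, Z (Γ.rev α) = Z α) {k k' m : ℕ} {ξ : ℂ}
    (h : Γ.CuspValid Z α A B K H C k ξ)
    (h' : Γ.CuspValid Z α A B K H C k' (ξ + m * Γ.faceTotal Z α)) :
    Γ.stripMap Z (Γ.faceEdge α k, Γ.cuspCoord Z α A B k ξ) =
      Γ.stripMap Z (Γ.faceEdge α k', Γ.cuspCoord Z α A B k' (ξ + m * Γ.faceTotal Z α)) := by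
  set ξ' := ξ + m * Γ.faceTotal Z α with hξ'
  have hi := h.faceSum_im_lt hs
  have hk : k + m * Γ.facePeriod α ≤ K := by
    apply hK
    rw [faceSum_add_periods]
    have h2 := h'.2.1
    have h3 := le_abs_self ξ'.im
    rw [hξ'] at h2 h3
    simp at h2 h3 ⊢
    linarith
  have h4 := h.2.2.2
  rw [← faceEdge_add_periods k m, ← cuspCoord_add_periods hm k m ξ, ← hξ'] at h4 ⊢
  rw [stripMap_eq_iff hZ h4 h'.2.2.2]
  rcases le_total (k + m * Γ.facePeriod α) k' with hle | hle
  · obtain ⟨d, rfl⟩ := Nat.exists_eq_add_of_le hle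
    exact ⟨d, Or.inl (hs.rightSteps hpos d h'.2.2.1 h'.re_lt h'.im_lt h4 h'.2.2.2).steps⟩
  · obtain ⟨d, hd⟩ := Nat.exists_eq_add_of_le hle
    rw [hd] at h4 hk ⊢
    have := (hs.rightSteps hpos d hk h'.re_lt h'.im_lt h'.2.2.2 h4).steps.flip hZ
    exact ⟨d, Or.inr (Or.inr (Or.inr this))⟩

end valid

open Classical in
/-- The parametrization of a neighbourhood of a puncture by `e ^ (-2πiξ / L)`, where `L` is the
total of the face: the parameters `ξ` and `ξ + L` describe the same point.  At `0`, and where no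
parameter is valid, the value is the puncture. -/
def cuspMap (Γ : FatGraph E) (Z : E → ℂ) (α : E) (A B : ℂ) (K : ℕ) (H C : ℝ) (ζ : ℂ) :
    Γ.Completed Z :=
  if h : ∃ kξ : ℕ × ℂ, Γ.CuspValid Z α A B K H C kξ.1 kξ.2 ∧
      Complex.exp (-(2 * Real.pi * Complex.I) / Γ.faceTotal Z α * kξ.2) = ζ then
    Γ.stripMap Z (Γ.faceEdge α h.choose.1, Γ.cuspCoord Z α A B h.choose.1 h.choose.2)
  else Sum.inr (Γ.face α)

theorem cuspMap_zero : cuspMap Γ Z α A B K H C 0 = Sum.inr (Γ.face α) := by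
  refine dif_neg ?_
  rintro ⟨kξ, -, h⟩
  exact Complex.exp_ne_zero _ h

theorem cuspMap_eq (hs : Γ.CuspSmall Z α A B K H C) (hK : CuspRange Γ Z α K H)
    (hpos : ∀ α, 0 < (Z α).im) (hm : Γ.IsMonodromic Z α A B) (hZ : ∀ α, Z (Γ.rev α) = Z α)
    (hL : 0 < (Γ.faceTotal Z α).im) {k : ℕ} {ξ : ℂ} (h : Γ.CuspValid Z α A B K H C k ξ) :
    cuspMap Γ Z α A B K H C
      (Complex.exp (-(2 * Real.pi * Complex.I) / Γ.faceTotal Z α * ξ)) =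
      Γ.stripMap Z (Γ.faceEdge α k, Γ.cuspCoord Z α A B k ξ) := by
  have hex : ∃ kξ : ℕ × ℂ, Γ.CuspValid Z α A B K H C kξ.1 kξ.2 ∧
      Complex.exp (-(2 * Real.pi * Complex.I) / Γ.faceTotal Z α * kξ.2) =
        Complex.exp (-(2 * Real.pi * Complex.I) / Γ.faceTotal Z α * ξ) := ⟨(k, ξ), h, rfl⟩
  rw [cuspMap, dif_pos hex]
  obtain ⟨h1, h2⟩ := hex.choose_spec
  generalize hex.choose = kξ at h1 h2 ⊢
  obtain ⟨k', ξ'⟩ := kξ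
  obtain ⟨m, hm1 | hm1⟩ := exists_of_exp_rate_eq hL h2
  · simp only at hm1
    subst hm1
    exact stripMap_eq_of_valid hs hK hpos hm hZ h1 h
  · simp only at hm1
    subst hm1
    exact (stripMap_eq_of_valid hs hK hpos hm hZ h h1).symm

/-- Each parameter of height between `0` and `H` gives a point of some strip of the face: the
strips, shifted by the partial sums, overlap and cover this range of heights. -/
theorem exists_cuspValid (hs : Γ.CuspSmall Z α A B K H C) (hK : CuspRange Γ Z α K H)
    [Finite E] {ξ : ℂ} (h0 : 0 ≤ ξ.im) (h1 : ξ.im < H)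
    (hre : C + 1 < ξ.re) : ∃ k, Γ.CuspValid Z α A B K H C k ξ := by
  have hex : ∃ k, ξ.im < (Γ.faceSum Z α (k + 1)).im - Real.pi / 2 := by
    by_contra hc
    push Not at hc
    have := hK (K + 1) (by have := hc K; linarith [Real.pi_pos])
    omega
  classical
  have hpi := Real.pi_gt_three
  -- the first strip on which the point stays at distance `π / 2` from the upper boundary
  set k := Nat.find hex with hk
  have hup := Nat.find_spec hex
  rw [← hk] at hup
  have hlow : (Γ.faceSum Z α k).im - Real.pi / 2 ≤ ξ.im := by
    rcases Nat.eq_zero_or_pos k with h | h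
    · rw [h, faceSum]; simp; linarith
    · have := Nat.find_min hex (m := k - 1) (by omega)
      rw [Nat.sub_add_cancel h] at this
      linarith
  have hkK : k ≤ K := hK k (by linarith)
  have habs : |ξ.im| < H := by rwa [abs_of_nonneg h0]
  have h3 := abs_le.1 (hs.im_sub_le hkK (by linarith : C < ξ.re) (by linarith))
  rw [faceSum_succ, Complex.add_im] at hup
  exact ⟨k, hre, habs, hkK, by simp only; linarith, by simp only; linarith⟩

section cusp

variable (hs : Γ.CuspSmall Z α A B K H C) (hK : CuspRange Γ Z α K H)
  (hpos : ∀ α, 0 < (Z α).im) (hm : Γ.IsMonodromic Z α A B) (hZ : ∀ α, Z (Γ.rev α) = Z α)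
  (hL : 0 < (Γ.faceTotal Z α).im)
include hs hK hpos hm hZ hL

omit hpos in
/-- Two points far to the right on the strips of a face are identified only if they are related by
right passages, along which the parameter `ξ` does not change. -/
theorem cuspMap_injective [Finite E] {C' : ℝ}
    (hC' : ∀ p q, Γ.Linked Z p q → InStrip Z p → InStrip Z q → C' < p.2.re → C' < q.2.re →
      ∃ n, Γ.RightSteps Z n p q ∨ Γ.RightSteps Z n q p) {k k' : ℕ} {ξ ξ' : ℂ}
    (h : Γ.CuspValid Z α A B K H C k ξ) (h' : Γ.CuspValid Z α A B K H C k' ξ')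
    (hre : C' < (Γ.cuspCoord Z α A B k ξ).re) (hre' : C' < (Γ.cuspCoord Z α A B k' ξ').re)
    (heq : Γ.stripMap Z (Γ.faceEdge α k, Γ.cuspCoord Z α A B k ξ) =
      Γ.stripMap Z (Γ.faceEdge α k', Γ.cuspCoord Z α A B k' ξ')) :
    Complex.exp (-(2 * Real.pi * Complex.I) / Γ.faceTotal Z α * ξ) =
      Complex.exp (-(2 * Real.pi * Complex.I) / Γ.faceTotal Z α * ξ') := by
  -- two parameters with the same coordinate on the same strip are equal
  have inj : ∀ {k m : ℕ} {ξ ξ' : ℂ}, Γ.CuspValid Z α A B K H C k ξ → k + m * Γ.facePeriod α ≤ K →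
      C + 1 < ξ'.re → |ξ'.im| < H →
      Γ.cuspCoord Z α A B k ξ = Γ.cuspCoord Z α A B (k + m * Γ.facePeriod α) ξ' →
      Complex.exp (-(2 * Real.pi * Complex.I) / Γ.faceTotal Z α * ξ) =
      Complex.exp (-(2 * Real.pi * Complex.I) / Γ.faceTotal Z α * ξ') := by
    intro k m ξ ξ' h hK' hre him he
    set j := k + m * Γ.facePeriod α with hj
    have hd : ‖ξ + m * Γ.faceTotal Z α - ξ'‖ ≤ 1 / 4 := by
      have e1 := hs.norm_coord_sub_le h.2.2.1 h.re_lt h.im_lt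
      have e2 := hs.norm_coord_sub_le hK' (by linarith : C < ξ'.re) (by linarith)
      have e3 := norm_sub_le (Γ.cuspCoord Z α A B j ξ' - (ξ' - Γ.faceSum Z α j))
        (Γ.cuspCoord Z α A B k ξ - (ξ - Γ.faceSum Z α k))
      have e4 : Γ.cuspCoord Z α A B j ξ' - (ξ' - Γ.faceSum Z α j) -
        (Γ.cuspCoord Z α A B k ξ - (ξ - Γ.faceSum Z α k)) = ξ + m * Γ.faceTotal Z α - ξ' := by
        rw [he, hj, faceSum_add_periods]; ring
      rw [e4] at e3
      linarith
    have hd1 := abs_le.1 ((Complex.abs_re_le_norm _).trans hd)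
    have hd2 := abs_le.1 ((Complex.abs_im_le_norm _).trans hd)
    rw [Complex.sub_re] at hd1
    rw [Complex.sub_im] at hd2
    have him' : |(ξ + m * Γ.faceTotal Z α).im| < H + 1 := by
      rw [abs_lt] at him ⊢; constructor <;> linarith
    have h5 := hs.lipschitz hK' (by linarith : C < (ξ + m * Γ.faceTotal Z α).re) him'
      (by linarith : C < ξ'.re) (by linarith)
    rw [hj, cuspCoord_add_periods hm, ← hj, he, sub_self, zero_sub, norm_neg] at h5
    have h6 : ξ + m * Γ.faceTotal Z α - ξ' = 0 := by
      rw [← norm_eq_zero]; linarith [norm_nonneg (ξ + m * Γ.faceTotal Z α - ξ')]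
    rw [← sub_eq_zero.1 h6]
    exact (exp_rate_add hL ξ m).symm
  -- right chains stay on the strips of the face
  have chain : ∀ (n : ℕ) {k : ℕ} {ξ : ℂ} {q : E × ℂ}, Γ.CuspValid Z α A B K H C k ξ →
      Γ.RightSteps Z n (Γ.faceEdge α k, Γ.cuspCoord Z α A B k ξ) q →
      ∃ j ≤ K, q = (Γ.faceEdge α j, Γ.cuspCoord Z α A B j ξ) := by
    intro n
    induction n with
    | zero => intro k ξ q h hq; exact ⟨k, h.2.2.1, Eq.symm hq⟩
    | succ n ih =>
      rintro k ξ q h ⟨r, hr, hrq⟩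
      have hk1 : k + 1 ≤ K := by
        apply hK
        have h1 := abs_le.1 (hs.im_sub_le h.2.2.1 h.re_lt h.im_lt)
        have h2 := hr.2.2.1
        have h3 := le_abs_self ξ.im
        have h4 := h.2.1
        rw [faceSum_succ]
        simp at h2 ⊢
        linarith
      have hr' := hs.eq_of_rightStep hk1 h.re_lt h.im_lt hr
      subst hr'
      exact ih ⟨h.1, h.2.1, hk1, hr.2.1⟩ hrq
  have main : ∀ {k k' n : ℕ} {ξ ξ' : ℂ}, Γ.CuspValid Z α A B K H C k ξ →
      Γ.CuspValid Z α A B K H C k' ξ' →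
      Γ.RightSteps Z n (Γ.faceEdge α k, Γ.cuspCoord Z α A B k ξ)
        (Γ.faceEdge α k', Γ.cuspCoord Z α A B k' ξ') →
      Complex.exp (-(2 * Real.pi * Complex.I) / Γ.faceTotal Z α * ξ) =
      Complex.exp (-(2 * Real.pi * Complex.I) / Γ.faceTotal Z α * ξ') := by
    intro k k' n ξ ξ' h h' hn
    obtain ⟨j, hj, hq⟩ := chain n h hn
    obtain ⟨he, hc⟩ := Prod.ext_iff.1 hq
    simp only at he hc
    obtain ⟨m, hm1 | hm1⟩ := exists_period_of_faceEdge_eq he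
    · exact (inj h' (m := m) (hm1 ▸ hj) h.1 h.2.1 (by rw [hc, hm1])).symm
    · refine inj (k := j) (m := m) ⟨h.1, h.2.1, hj, ?_⟩ (hm1 ▸ h'.2.2.1) h'.1 h'.2.1
        (by rw [← hc, ← hm1])
      rw [← he, ← hc]; exact h'.2.2.2
  rw [stripMap_eq_iff hZ h.2.2.2 h'.2.2.2] at heq
  obtain ⟨n, hn | hn⟩ := hC' _ _ heq h.2.2.2 h'.2.2.2 hre hre'
  · exact main h h' hn
  · exact (main h' h hn).symm

/-- Locally the parametrization of the cusp is a strip coordinate `g`, and the derivative of `e ^ g`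
is a multiple of `(e ^ ξ + A) / z`, where `z = e ^ (-2πiξ / L)`.  Its logarithmic derivative is a
holomorphic function of `z`, divided by `z`, since `A e ^ (-ξ) = A z ^ m`. -/
theorem cuspMap_exists_lift {k : ℕ} {ξ₀ : ℂ} (h : Γ.CuspValid Z α A B K H C k ξ₀) {m : ℕ}
    (hAm : ∀ ξ, A * Complex.exp (-(2 * Real.pi * Complex.I) / Γ.faceTotal Z α * ξ) ^ m =
      A * Complex.exp (-ξ)) {ζ : ℂ}
    (hζ : ζ = Complex.exp (-(2 * Real.pi * Complex.I) / Γ.faceTotal Z α * ξ₀)) :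
    ∃ g : ℂ → ℂ, AnalyticAt ℂ g ζ ∧ deriv g ζ ≠ 0 ∧ g ζ = Γ.cuspCoord Z α A B k ξ₀ ∧
      (∀ᶠ z in 𝓝 ζ, cuspMap Γ Z α A B K H C z = Γ.stripMap Z (Γ.faceEdge α k, g z)) ∧
      ∃ w : ℂ → ℂ, ∀ᶠ z in 𝓝 ζ, HasDerivAt (fun z => Complex.exp (g z)) (w z) z ∧ w z ≠ 0 ∧
        HasDerivAt w (w z * ((1 / (-(2 * Real.pi * Complex.I) / Γ.faceTotal Z α) /
          (1 + A * z ^ m) - 1) / z)) z := by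
  set μ := -(2 * Real.pi * Complex.I) / Γ.faceTotal Z α with hμ
  have hμ0 : μ ≠ 0 := fun h => by have := rate_re_neg hL; rw [← hμ, h] at this; simp at this
  have hζ0 : ζ ≠ 0 := by rw [hζ]; exact Complex.exp_ne_zero _
  -- the local inverse of the exponential function
  set Ξ : ℂ → ℂ := fun z => ξ₀ + Complex.log (z / ζ) / μ with hΞ
  have hslit : ∀ᶠ z in 𝓝 ζ, z / ζ ∈ Complex.slitPlane := by
    have hc : ContinuousAt (fun z : ℂ => z / ζ) ζ := by fun_prop
    refine hc.eventually (Complex.isOpen_slitPlane.mem_nhds ?_)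
    simp only [div_self hζ0]; exact Complex.one_mem_slitPlane
  have hne : ∀ᶠ z in 𝓝 ζ, z ≠ 0 := isOpen_ne.mem_nhds hζ0
  have hΞd : ∀ᶠ z in 𝓝 ζ, HasDerivAt Ξ (1 / (μ * z)) z := by
    filter_upwards [hslit, hne] with z hz hz0
    have h1 := (((hasDerivAt_id z).div_const ζ).clog hz).div_const μ
    refine (h1.const_add ξ₀).congr_deriv ?_
    simp only [id]
    field_simp
  have hΞζ : Ξ ζ = ξ₀ := by simp [hΞ, div_self hζ0]
  have hΞc : ContinuousAt Ξ ζ := hΞd.self_of_nhds.continuousAt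
  have hΞe : ∀ᶠ z in 𝓝 ζ, Complex.exp (μ * Ξ z) = z := by
    filter_upwards [hne] with z hz
    rw [hΞ, mul_add, mul_div_cancel₀ _ hμ0, Complex.exp_add, ← hζ,
      Complex.exp_log (div_ne_zero hz hζ0), mul_div_cancel₀ _ hζ0]
  have hcd := hs.hasDerivAt h.2.2.1 h.re_lt h.im_lt
  have hvalid : ∀ᶠ z in 𝓝 ζ, Γ.CuspValid Z α A B K H C k (Ξ z) := by
    have e1 : ∀ᶠ ξ in 𝓝 ξ₀, C + 1 < ξ.re :=
      (isOpen_lt continuous_const Complex.continuous_re).mem_nhds h.1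
    have e2 : ∀ᶠ ξ in 𝓝 ξ₀, |ξ.im| < H :=
      (isOpen_lt (Complex.continuous_im.abs) continuous_const).mem_nhds h.2.1
    have e3 : ∀ᶠ ξ in 𝓝 ξ₀, InStrip Z (Γ.faceEdge α k, Γ.cuspCoord Z α A B k ξ) := by
      have hopen : IsOpen (strip (Z (Γ.faceEdge α k))) :=
        (isOpen_lt continuous_const Complex.continuous_im).inter
          (isOpen_lt Complex.continuous_im continuous_const)
      exact hcd.continuousAt.eventually (hopen.mem_nhds h.2.2.2)
    rw [← hΞζ] at e1 e2 e3
    filter_upwards [hΞc.eventually e1, hΞc.eventually e2, hΞc.eventually e3] with z h1 h2 h3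
    exact ⟨h1, h2, h.2.2.1, h3⟩
  have hgd : ∀ᶠ z in 𝓝 ζ, HasDerivAt (fun z => Γ.cuspCoord Z α A B k (Ξ z))
      ((1 + (A - (A * Ξ z + B - Γ.faceShift Z α k)) *
      Complex.exp (-Ξ z) / (1 + Γ.cuspErr Z α A B k (Ξ z))) * (1 / (μ * z))) z := by
    filter_upwards [hvalid, hΞd] with z h1 h2
    exact (hs.hasDerivAt h.2.2.1 h1.re_lt h1.im_lt).comp z h2
  -- the derivative of `e ^ ξ + A ξ + B` does not vanish
  have hnz : ∀ ξ, Γ.CuspValid Z α A B K H C k ξ → Complex.exp ξ + A ≠ 0 := by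
    intro ξ hv h0
    have h1 := hs.deriv_ne_zero h.2.2.1 hv.re_lt hv.im_lt
    have h2 := Complex.slitPlane_ne_zero (hs.one_add_ne h.2.2.1 hv.re_lt hv.im_lt)
    apply h1
    have h3 : 1 + A * Complex.exp (-ξ) = 0 := by
      rw [Complex.exp_neg]
      have := Complex.exp_ne_zero ξ
      field_simp
      simpa using h0
    have h4 : (1 + Γ.cuspErr Z α A B k ξ) +
        (A - (A * ξ + B - Γ.faceShift Z α k)) * Complex.exp (-ξ) = 0 := by
      rw [cuspErr]; linear_combination h3
    rw [div_eq_mul_inv]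
    field_simp
    simpa using h4
  refine ⟨fun z => Γ.cuspCoord Z α A B k (Ξ z), ?_, ?_, by simp only [hΞζ], ?_, ?_⟩
  · exact Complex.analyticAt_iff_eventually_differentiableAt.2
      (hgd.mono fun z hz => hz.differentiableAt)
  · rw [hgd.self_of_nhds.deriv, hΞζ]
    exact mul_ne_zero (hs.deriv_ne_zero h.2.2.1 h.re_lt h.im_lt)
      (one_div_ne_zero (mul_ne_zero hμ0 hζ0))
  · filter_upwards [hvalid, hΞe] with z h1 h2
    have := cuspMap_eq hs hK hpos hm hZ hL h1
    rwa [← hμ, h2] at this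
  · refine ⟨fun z => Complex.exp (-Γ.faceSum Z α k) * ((Complex.exp (Ξ z) + A) * (1 / (μ * z))), ?_⟩
    have hexp : ∀ᶠ z in 𝓝 ζ, Complex.exp (Γ.cuspCoord Z α A B k (Ξ z)) =
        Complex.exp (-Γ.faceSum Z α k) *
          (Complex.exp (Ξ z) + A * Ξ z + B - Γ.faceShift Z α k) := by
      filter_upwards [hvalid] with z h1
      exact exp_cuspCoord (Complex.slitPlane_ne_zero (hs.one_add_ne h.2.2.1 h1.re_lt h1.im_lt))
    filter_upwards [hvalid, hΞd, hne, hexp.eventually_nhds, hΞe] with z h1 h2 h3 h4 h5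
    have hA := hnz _ h1
    refine ⟨?_, ?_, ?_⟩
    · have e1 := (((h2.cexp.add (h2.const_mul A)).add_const B).sub_const
        (Γ.faceShift Z α k)).const_mul (Complex.exp (-Γ.faceSum Z α k))
      have e2 := e1.congr_of_eventuallyEq h4
      refine e2.congr_deriv ?_
      ring
    · exact mul_ne_zero (Complex.exp_ne_zero _)
        (mul_ne_zero hA (one_div_ne_zero (mul_ne_zero hμ0 h3)))
    · have e1 : HasDerivAt (fun z : ℂ => 1 / (μ * z)) (-(1 / (μ * z ^ 2))) z := by
        have := ((hasDerivAt_id z).const_mul μ).inv (mul_ne_zero hμ0 h3)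
        simp only [id, mul_one] at this
        refine (this.congr_deriv ?_).congr_of_eventuallyEq
          (Eventually.of_forall fun y => by simp)
        field_simp
      have e2 := ((h2.cexp.add_const A).mul e1).const_mul (Complex.exp (-Γ.faceSum Z α k))
      refine e2.congr_deriv ?_
      have e3 := hAm (Ξ z)
      rw [h5, Complex.exp_neg] at e3
      have e4 := Complex.exp_ne_zero (Ξ z)
      rw [e3]
      have e5 : 1 + A * (Complex.exp (Ξ z))⁻¹ ≠ 0 := by
        intro h0
        apply hA
        field_simp at h0
        simpa using h0
      have e6 : 1 + A * (Complex.exp (Ξ z))⁻¹ = (Complex.exp (Ξ z) + A) / Complex.exp (Ξ z) := by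
        field_simp
      rw [e6]
      field_simp
      ring

end cusp

theorem exists_faceSum_bound (Γ : FatGraph E) (Z : E → ℂ) (α : E) (K : ℕ) :
    ∃ D : ℝ, ∀ k ≤ K, |(Γ.faceSum Z α k).re| ≤ D :=
  ⟨∑ k ∈ Finset.range (K + 1), |(Γ.faceSum Z α k).re|, fun k hk =>
    Finset.single_le_sum (f := fun k => |(Γ.faceSum Z α k).re|) (fun _ _ => abs_nonneg _)
      (Finset.mem_range.2 (by omega))⟩

theorem mul_le_faceSum_im {ε : ℝ} (h : ∀ α, ε ≤ (Z α).im) (α : E) (k : ℕ) :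
    k * ε ≤ (Γ.faceSum Z α k).im := by
  induction k with
  | zero => simp [faceSum]
  | succ k ih => rw [faceSum_succ, Complex.add_im]; push_cast; linarith [h (Γ.faceEdge α k)]

/-- The coordinate on a strip is near a translation, hence takes all values in the range. -/
theorem CuspSmall.exists_coord_eq (hs : Γ.CuspSmall Z α A B K H C) {k : ℕ} (hk : k ≤ K) {x : ℂ}
    (h1 : C + 1 < (x + Γ.faceSum Z α k).re) (h2 : |(x + Γ.faceSum Z α k).im| < H) :
    ∃ ξ, ‖ξ - (x + Γ.faceSum Z α k)‖ ≤ 1 / 2 ∧ Γ.cuspCoord Z α A B k ξ = x := by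
  set b := x + Γ.faceSum Z α k with hb
  have hin : ∀ ξ ∈ Metric.closedBall b (1 / 2), C < ξ.re ∧ |ξ.im| < H + 1 := by
    intro ξ hξ
    rw [mem_closedBall_iff_norm] at hξ
    have e1 := abs_le.1 ((Complex.abs_re_le_norm _).trans hξ)
    have e2 := abs_le.1 ((Complex.abs_im_le_norm _).trans hξ)
    rw [Complex.sub_re] at e1
    rw [Complex.sub_im] at e2
    rw [abs_lt] at h2 ⊢
    refine ⟨by linarith, by linarith, by linarith⟩
  have happ : ApproximatesLinearOn (Γ.cuspCoord Z α A B k)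
      ((ContinuousLinearEquiv.refl ℂ ℂ : ℂ ≃L[ℂ] ℂ) : ℂ →L[ℂ] ℂ) (Metric.closedBall b (1 / 2))
      (1 / 8) := by
    intro ξ hξ ξ' hξ'
    have := hs.lipschitz hk (hin ξ hξ).1 (hin ξ hξ).2 (hin ξ' hξ').1 (hin ξ' hξ').2
    simpa using this
  have hsurj := happ.surjOn_closedBall_of_nonlinearRightInverse
    ((ContinuousLinearEquiv.refl ℂ ℂ).toNonlinearRightInverse) (by norm_num) le_rfl
  have hx : x ∈ Metric.closedBall (Γ.cuspCoord Z α A B k b)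
      ((((ContinuousLinearEquiv.refl ℂ ℂ).toNonlinearRightInverse.nnnorm : ℝ)⁻¹ -
        ((1 / 8 : NNReal) : ℝ)) * (1 / 2)) := by
    have e0 : ((ContinuousLinearEquiv.refl ℂ ℂ).toNonlinearRightInverse.nnnorm : ℝ) = 1 := by
      change ‖((ContinuousLinearEquiv.refl ℂ ℂ).symm : ℂ →L[ℂ] ℂ)‖ = 1
      exact ContinuousLinearMap.norm_id
    rw [e0, mem_closedBall_iff_norm, ← norm_neg, neg_sub]
    have e1 := hs.norm_coord_sub_le hk (hin b (Metric.mem_closedBall_self (by norm_num))).1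
      (hin b (Metric.mem_closedBall_self (by norm_num))).2
    rw [show b - Γ.faceSum Z α k = x by rw [hb]; ring] at e1
    refine e1.trans ?_
    norm_num
  obtain ⟨ξ, hξ, he⟩ := hsurj hx
  exact ⟨ξ, mem_closedBall_iff_norm.1 hξ, he⟩

/-- Each face has a cusp, provided that points far to the right are identified by right passages
only. -/
theorem exists_cusp [Finite E] [Nonempty E] (hpos : ∀ α, 0 < (Z α).im)
    (hZ : ∀ α, Z (Γ.rev α) = Z α) {C' : ℝ}
    (hC' : ∀ p q, Γ.Linked Z p q → InStrip Z p → InStrip Z q → C' < p.2.re → C' < q.2.re →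
      ∃ n, Γ.RightSteps Z n p q ∨ Γ.RightSteps Z n q p) (α : E) : Nonempty (Cusp Γ Z α C') := by
  obtain ⟨ε, hε, hεZ⟩ := exists_pos_le_im hpos
  set L := Γ.faceTotal Z α with hLdef
  have hsum := mul_le_faceSum_im (Γ := Γ) hεZ α
  have hL : 0 < L.im := lt_of_lt_of_le
    (mul_pos (Nat.cast_pos.2 (Γ.facePeriod_pos α)) hε) (hsum (Γ.facePeriod α))
  have hL0 : L ≠ 0 := fun h => by simp [h] at hL
  have hpi := Real.pi_gt_three
  obtain ⟨A, B, hm⟩ := Γ.exists_isMonodromic (Z := Z) α hL0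
  -- the heights of `x + s`, for `x` in a strip and `s` the partial sum of the face, are between
  -- `-π` and `Im L`
  set H := L.im + 3 * Real.pi with hH
  obtain ⟨K, hK⟩ : ∃ K, CuspRange Γ Z α K H := by
    obtain ⟨K, hK⟩ := exists_nat_gt ((H + Real.pi + 1) / ε)
    refine ⟨K, fun k hk => ?_⟩
    have h1 := (hsum k).trans hk
    rw [← le_div_iff₀ hε] at h1
    exact_mod_cast (h1.trans_lt hK).le
  obtain ⟨C, hs⟩ := (eventually_cuspSmall Γ Z α A B K H).exists
  obtain ⟨D, hD⟩ := exists_faceSum_bound Γ Z α K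
  -- if the linear term is present, `L` is a multiple `2πim`
  obtain ⟨m, hm0, hAm⟩ : ∃ m : ℕ, m ≠ 0 ∧
      ∀ ξ, A * Complex.exp (-(2 * Real.pi * Complex.I) / L * ξ) ^ m = A * Complex.exp (-ξ) := by
    rcases eq_or_ne A 0 with rfl | hA
    · exact ⟨1, one_ne_zero, fun ξ => by simp⟩
    · have h1 : Complex.exp L = 1 := mul_left_cancel₀ hA (by rw [hm.1, mul_one])
      obtain ⟨n, hn⟩ := Complex.exp_eq_one_iff.1 h1
      have hn0 : 0 < n := by
        rw [hn] at hL
        simp at hL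
        have : (0 : ℝ) < n := by
          by_contra hc
          push Not at hc
          have : (n : ℝ) * (2 * Real.pi) ≤ 0 := mul_nonpos_of_nonpos_of_nonneg hc (by linarith)
          linarith
        exact_mod_cast this
      obtain ⟨m, rfl⟩ := Int.eq_ofNat_of_zero_le hn0.le
      have hm0 : m ≠ 0 := by rintro rfl; simp at hn0
      refine ⟨m, hm0, fun ξ => ?_⟩
      have hmC : (m : ℂ) ≠ 0 := Nat.cast_ne_zero.2 hm0
      have := Complex.two_pi_I_ne_zero
      rw [← Complex.exp_nat_mul, hn]
      congr 2
      push_cast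
      field_simp
  -- the real parts of the coordinate and of the parameter differ by a bounded amount
  have hre : ∀ {k : ℕ} {ξ : ℂ}, Γ.CuspValid Z α A B K H C k ξ →
      ξ.re - D - 1 < (Γ.cuspCoord Z α A B k ξ).re := by
    intro k ξ h
    have h1 := abs_le.1 ((Complex.abs_re_le_norm _).trans
      (hs.norm_coord_sub_le h.2.2.1 h.re_lt h.im_lt))
    simp only [Complex.sub_re] at h1
    linarith [(abs_le.1 (hD k h.2.2.1)).2]
  -- near the puncture, all points have valid parameters with large real part
  have hvalid : ∀ B' : ℝ, ∃ ρ > 0, ∀ ζ, ζ ≠ 0 → ‖ζ‖ < ρ → ∃ k ξ,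
      ζ = Complex.exp (-(2 * Real.pi * Complex.I) / L * ξ) ∧ Γ.CuspValid Z α A B K H C k ξ ∧
        B' < (Γ.cuspCoord Z α A B k ξ).re := by
    intro B'
    obtain ⟨ρ, hρ, h⟩ := exists_re_gt hL H (max (C + 1) (B' + D + 1))
    refine ⟨ρ, hρ, fun ζ hζ hlt => ?_⟩
    obtain ⟨ξ, h0, h1, h2⟩ := exists_exp_rate_eq hL hζ
    have h3 := h ξ (by rw [abs_of_nonneg h0]; linarith) (by rwa [h2])
    rw [max_lt_iff] at h3
    obtain ⟨k, hk⟩ := exists_cuspValid hs hK h0 (by linarith) h3.1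
    exact ⟨k, ξ, h2.symm, hk, by linarith [hre hk]⟩
  obtain ⟨ρ, hρ, hρv⟩ := hvalid C'
  have heq : ∀ {k : ℕ} {ξ : ℂ}, Γ.CuspValid Z α A B K H C k ξ → _ :=
    fun h => cuspMap_eq hs hK hpos hm hZ hL h
  refine ⟨{
    radius := ρ
    radius_pos := hρ
    toFun := cuspMap Γ Z α A B K H C
    q := fun z => 1 / (-(2 * Real.pi * Complex.I) / L) / (1 + A * z ^ m) - 1
    analyticAt_q := ?_
    map_zero := cuspMap_zero
    exists_lift := ?_
    inj := ?_
    far := ?_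
    surj := ?_ }⟩
  · refine (analyticAt_const.div ?_ ?_).sub analyticAt_const
    · exact analyticAt_const.add (analyticAt_const.mul (analyticAt_id.pow m))
    · simp [hm0]
  · intro ζ hζ hlt
    obtain ⟨k, ξ, he, hk, hkre⟩ := hρv ζ hζ hlt
    exact ⟨_, hk.2.2.2, hkre, face_faceEdge α k,
      cuspMap_exists_lift hs hK hpos hm hZ hL hk hAm he⟩
  · intro ζ hζ ζ' hζ' h
    rw [mem_ball_zero_iff] at hζ hζ'
    rcases eq_or_ne ζ 0 with rfl | h0 <;> rcases eq_or_ne ζ' 0 with rfl | h0'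
    · rfl
    · obtain ⟨k, ξ, he, hk, -⟩ := hρv ζ' h0' hζ'
      rw [cuspMap_zero, he, heq hk, stripMap_of_inStrip hk.2.2.2] at h
      cases h
    · obtain ⟨k, ξ, he, hk, -⟩ := hρv ζ h0 hζ
      rw [cuspMap_zero, he, heq hk, stripMap_of_inStrip hk.2.2.2] at h
      cases h
    · obtain ⟨k, ξ, he, hk, hr⟩ := hρv ζ h0 hζ
      obtain ⟨k', ξ', he', hk', hr'⟩ := hρv ζ' h0' hζ'
      rw [he, he', heq hk, heq hk'] at h
      rw [he, he']
      exact cuspMap_injective hs hK hm hZ hL hC' hk hk' hr hr' h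
  · intro B'
    obtain ⟨ρ', hρ', h⟩ := hvalid B'
    refine ⟨ρ', hρ', fun ζ hζ hlt => ?_⟩
    obtain ⟨k, ξ, he, hk, hr⟩ := h ζ hζ hlt
    exact ⟨_, hk.2.2.2, hr, by rw [he, heq hk]⟩
  · intro ρ' hρ'
    obtain ⟨C1, hC1⟩ := exists_norm_lt hL H hρ'
    refine ⟨max (C + 2) C1 + D + 1, fun p hp hface hpre => ?_⟩
    obtain ⟨k, hkper, hk⟩ := exists_faceEdge_eq hface
    obtain ⟨β, x⟩ := p
    simp only at hk hpre hface
    subst hk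
    have hsk1 : (Γ.faceSum Z α (k + 1)).im ≤ L.im := by
      obtain ⟨d, hd⟩ := Nat.exists_eq_add_of_le (Nat.succ_le_of_lt hkper)
      have hd' : Γ.facePeriod α = k + 1 + d := hd
      have e := Finset.sum_range_add (fun i => Z (Γ.faceEdge α i)) (k + 1) d
      rw [hLdef, faceTotal, hd', faceSum, faceSum, e, Complex.add_im]
      have : 0 ≤ (∑ x ∈ Finset.range d, Z (Γ.faceEdge α (k + 1 + x))).im := by
        rw [Complex.im_sum]
        exact Finset.sum_nonneg fun i _ => (hpos _).le
      linarith
    have hsk := (mul_nonneg (Nat.cast_nonneg k) hε.le).trans (hsum k)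
    rw [faceSum_succ, Complex.add_im] at hsk1
    have hposk := hpos (Γ.faceEdge α k)
    have hkK : k ≤ K := hK k (by linarith)
    obtain ⟨hx1, hx2⟩ := hp
    simp only at hx1 hx2
    have hDk := abs_le.1 (hD k hkK)
    have hmax1 := le_max_left (C + 2) C1
    have hmax2 := le_max_right (C + 2) C1
    obtain ⟨ξ, hξ, he⟩ := hs.exists_coord_eq (x := x) hkK
      (by rw [Complex.add_re]; linarith)
      (by rw [Complex.add_im, abs_lt]; constructor <;> linarith)
    have e1 := abs_le.1 ((Complex.abs_re_le_norm _).trans hξ)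
    have e2 := abs_le.1 ((Complex.abs_im_le_norm _).trans hξ)
    rw [Complex.sub_re, Complex.add_re] at e1
    rw [Complex.sub_im, Complex.add_im] at e2
    have him : |ξ.im| < H := by rw [abs_lt]; constructor <;> linarith
    have hv : Γ.CuspValid Z α A B K H C k ξ :=
      ⟨by linarith, him, hkK, by rw [he]; exact ⟨hx1, hx2⟩⟩
    refine ⟨_, Complex.exp_ne_zero _, hC1 ξ him (by linarith), ?_⟩
    rw [heq hv, he]

end FatGraph

end

noncomputable section

/-! ### Möbius related functions -/

section mobius
variable {X Y : Type*} [TopologicalSpace X] [TopologicalSpace Y]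

theorem MobiusAt.refl (z : X → ℂ) (p : X) : MobiusAt z z p :=
  ⟨1, 0, 0, 1, by simp, Eventually.of_forall fun q => by simp⟩

theorem MobiusAt.symm {z y : X → ℂ} {p : X} (h : MobiusAt z y p) : MobiusAt y z p := by
  obtain ⟨a, b, c, d, hD, h⟩ := h
  refine ⟨d, -b, -c, a, by convert! hD using 1; ring, ?_⟩
  filter_upwards [h] with q hq
  obtain ⟨h1, h2⟩ := hq
  have e : -c * y q + a = (a * d - b * c) / (c * z q + d) := by
    rw [h2]; field_simp; ring
  have e0 : -c * y q + a ≠ 0 := by rw [e]; exact div_ne_zero hD h1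
  have e2 : d * y q + -b = (a * d - b * c) * z q / (c * z q + d) := by
    have hy : y q * (c * z q + d) = a * z q + b := by rw [h2, div_mul_cancel₀ _ h1]
    rw [eq_div_iff h1]
    linear_combination d * hy
  refine ⟨e0, ?_⟩
  rw [e, e2, div_div_div_cancel_right₀ h1, mul_div_cancel_left₀ _ hD]

theorem MobiusAt.trans {z y w : X → ℂ} {p : X} (h : MobiusAt z y p) (h' : MobiusAt y w p) :
    MobiusAt z w p := by
  obtain ⟨a, b, c, d, hD, h⟩ := h
  obtain ⟨a', b', c', d', hD', h'⟩ := h'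
  refine ⟨a' * a + b' * c, a' * b + b' * d, c' * a + d' * c, c' * b + d' * d, ?_, ?_⟩
  · convert! mul_ne_zero hD hD' using 1
    ring
  · filter_upwards [h, h'] with q hq hq'
    obtain ⟨h1, h2⟩ := hq
    obtain ⟨h3, h4⟩ := hq'
    have e : (c' * a + d' * c) * z q + (c' * b + d' * d) = (c' * y q + d') * (c * z q + d) := by
      rw [h2]; field_simp; ring
    refine ⟨by rw [e]; exact mul_ne_zero h3 h1, ?_⟩
    have e2 : (a' * a + b' * c) * z q + (a' * b + b' * d) = (a' * y q + b') * (c * z q + d) := by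
      rw [h2]; field_simp; ring
    rw [e, e2, h4, mul_div_mul_right _ _ h1]

theorem MobiusAt.congr {z y z' y' : X → ℂ} {p : X} (h : MobiusAt z y p) (hz : z =ᶠ[𝓝 p] z')
    (hy : y =ᶠ[𝓝 p] y') : MobiusAt z' y' p := by
  obtain ⟨a, b, c, d, hD, h⟩ := h
  refine ⟨a, b, c, d, hD, ?_⟩
  filter_upwards [h, hz, hy] with q h1 h2 h3
  rwa [← h2, ← h3]

theorem MobiusAt.comp {z y : X → ℂ} {f : Y → X} {q : Y} (h : MobiusAt z y (f q))
    (hf : ContinuousAt f q) : MobiusAt (fun r => z (f r)) (fun r => y (f r)) q := by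
  obtain ⟨a, b, c, d, hD, h⟩ := h
  exact ⟨a, b, c, d, hD, hf.eventually h⟩

theorem MobiusAt.of_map {z y : X → ℂ} {f : Y → X} {q : Y}
    (h : MobiusAt (fun r => z (f r)) (fun r => y (f r)) q) (hf : Filter.map f (𝓝 q) = 𝓝 (f q)) :
    MobiusAt z y (f q) := by
  obtain ⟨a, b, c, d, hD, h⟩ := h
  refine ⟨a, b, c, d, hD, ?_⟩
  rw [← hf]
  exact h

end mobius

namespace FatGraph

variable {E : Type u} {Γ : FatGraph E} {Z : E → ℂ}

/-! ### Transition functions between strips -/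

variable (Γ Z) in
/-- Two points of strips are related by the germ of a biholomorphic map that is compatible with the
gluing and is a Möbius map in terms of the exponentials of the coordinates. -/
def StripRel (p q : E × ℂ) : Prop :=
  ∃ g : ℂ → ℂ, AnalyticAt ℂ g p.2 ∧ deriv g p.2 ≠ 0 ∧ g p.2 = q.2 ∧
    (∀ᶠ x in 𝓝 p.2, Γ.stripMap Z (q.1, g x) = Γ.stripMap Z (p.1, x)) ∧
    MobiusAt Complex.exp (fun x => Complex.exp (g x)) p.2

theorem StripRel.refl (p : E × ℂ) : Γ.StripRel Z p p :=
  ⟨id, analyticAt_id, by simp, rfl, by simp, MobiusAt.refl _ _⟩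

theorem StripRel.trans {p q r : E × ℂ} (h : Γ.StripRel Z p q) (h' : Γ.StripRel Z q r) :
    Γ.StripRel Z p r := by
  obtain ⟨g, hg, hd, hgx, hev, hm⟩ := h
  obtain ⟨k, hk, hkd, hkx, hev', hm'⟩ := h'
  rw [← hgx] at hk hkd hkx hev' hm'
  refine ⟨k ∘ g, hk.comp hg, ?_, hkx, ?_, hm.trans (hm'.comp hg.continuousAt)⟩
  · rw [deriv_comp _ hk.differentiableAt hg.differentiableAt]
    exact mul_ne_zero hkd hd
  · filter_upwards [hev, hg.continuousAt.tendsto.eventually hev'] with y hy h2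
    rw [Function.comp_apply, h2, hy]

theorem isOpen_strip (w : ℂ) : IsOpen (strip w) :=
  (isOpen_lt continuous_const Complex.continuous_im).inter
    (isOpen_lt Complex.continuous_im continuous_const)

theorem eventually_inStrip {α : E} {x : ℂ} (hx : InStrip Z (α, x)) :
    ∀ᶠ y in 𝓝 x, InStrip Z (α, y) := (isOpen_strip (Z α)).mem_nhds hx

theorem convex_strip (w : ℂ) : Convex ℝ (strip w) := by
  have e : strip w = Complex.imCLM ⁻¹' Set.Ioo (-Real.pi) w.im := rfl
  rw [e]
  exact (convex_Ioo _ _).is_linear_preimage Complex.imCLM.isLinear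

theorem isPreconnected_strip (w : ℂ) : IsPreconnected (strip w) := (convex_strip w).isPreconnected

section
variable (hZ : ∀ α, Z (Γ.rev α) = Z α)
include hZ

theorem linked_flip_self (p : E × ℂ) : Γ.Linked Z p (Γ.flip Z p) :=
  ⟨0, Or.inr (Or.inl (by rw [flip_flip hZ]; rfl))⟩

theorem stripRel_flip {p : E × ℂ} (hp : InStrip Z p) : Γ.StripRel Z p (Γ.flip Z p) := by
  refine ⟨fun x => Z p.1 - Real.pi * Complex.I - x, by fun_prop, ?_, rfl, ?_, ?_⟩
  · simp
  · filter_upwards [(isOpen_strip (Z p.1)).mem_nhds hp] with x hx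
    have hp' : InStrip Z (p.1, x) := hx
    exact ((stripMap_eq_iff hZ hp' (hp'.flip (Γ := Γ) hZ)).2 (linked_flip_self hZ _)).symm
  · refine ⟨0, Complex.exp (Z p.1 - Real.pi * Complex.I), 1, 0, by simp [Complex.exp_ne_zero], ?_⟩
    refine Eventually.of_forall fun x => ⟨by simp [Complex.exp_ne_zero], ?_⟩
    simp only [Complex.exp_sub]
    simp

variable (hpos : ∀ α, 0 < (Z α).im)
include hpos

/-- In the exponential coordinates `X` of `p` and `Y` of `q`, the passage is `Y = e ^ (-Z) X - 1` to
the right and `Y = X / (e ^ Z - X)` to the left. -/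
theorem stripRel_step {p q : E × ℂ} (h : Γ.Step Z p q) : Γ.StripRel Z p q := by
  obtain ⟨hp, hq, h1, h⟩ := h
  have h2 := hp.sub_im
  have hopen : ∀ᶠ x in 𝓝 p.2, InStrip Z (p.1, x) ∧ -Real.pi < (x - Z p.1).im := by
    refine (eventually_inStrip hp).and ?_
    have hc : Continuous fun x : ℂ => (x - Z p.1).im := by fun_prop
    exact (isOpen_lt continuous_const hc).mem_nhds h1
  have he : HasDerivAt (fun x => Complex.exp (x - Z p.1)) (Complex.exp (p.2 - Z p.1)) p.2 := by
    simpa using ((hasDerivAt_id p.2).sub_const (Z p.1)).cexp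
  have he' : HasDerivAt (fun x => Complex.exp (Z p.1 - x)) (-Complex.exp (Z p.1 - p.2)) p.2 := by
    simpa using ((hasDerivAt_id p.2).const_sub (Z p.1)).cexp
  rcases h with rfl | rfl
  · have hs : Complex.exp (p.2 - Z p.1) - 1 ∈ Complex.slitPlane := Or.inr (exp_sub_one_im h1 h2).ne
    refine ⟨turnR (Z p.1), ?_, ?_, rfl, ?_, ?_⟩
    · exact AnalyticAt.clog (by fun_prop) hs
    · have h3 : HasDerivAt (turnR (Z p.1)) _ p.2 := (he.sub_const 1).clog hs
      rw [h3.deriv]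
      exact div_ne_zero (Complex.exp_ne_zero _) (Complex.slitPlane_ne_zero hs)
    · filter_upwards [hopen] with x hx
      have hst := step_right (Γ := Γ) hpos hx.1 hx.2
      exact ((stripMap_eq_iff hZ hst.1 hst.2.1).2 ⟨1, Or.inl ⟨_, hst, rfl⟩⟩).symm
    · refine ⟨Complex.exp (-Z p.1), -1, 0, 1, by simp [Complex.exp_ne_zero], ?_⟩
      filter_upwards [hopen] with x hx
      refine ⟨by simp, ?_⟩
      rw [exp_turnR hx.2 hx.1.sub_im, Complex.exp_sub, Complex.exp_neg]
      ring
  · have hs : 1 - Complex.exp (Z p.1 - p.2) ∈ Complex.slitPlane := Or.inr (one_sub_exp_im h1 h2).ne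
    refine ⟨turnL (Z p.1), ?_, ?_, rfl, ?_, ?_⟩
    · exact analyticAt_const.sub (AnalyticAt.clog (by fun_prop) hs)
    · have h3 : HasDerivAt (turnL (Z p.1)) _ p.2 := ((he'.const_sub 1).clog hs).const_sub _
      rw [h3.deriv]
      refine neg_ne_zero.2 (div_ne_zero ?_ (Complex.slitPlane_ne_zero hs))
      simp [Complex.exp_ne_zero]
    · filter_upwards [hopen] with x hx
      have hst := step_left (Γ := Γ) hpos hx.1 hx.2
      exact ((stripMap_eq_iff hZ hst.1 hst.2.1).2 ⟨1, Or.inl ⟨_, hst, rfl⟩⟩).symm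
    · refine ⟨-Complex.exp (-Z p.1), 0, Complex.exp (-Z p.1), -1, by simp [Complex.exp_ne_zero], ?_⟩
      filter_upwards [hopen] with x hx
      have h0 := Complex.ne_zero_of_im_neg (exp_sub_one_im hx.2 hx.1.sub_im)
      have e : Complex.exp (x - Z p.1) = Complex.exp (-Z p.1) * Complex.exp x := by
        rw [sub_eq_neg_add, Complex.exp_add]
      rw [exp_turnL' hx.2 hx.1.sub_im]
      rw [e] at h0 ⊢
      exact ⟨by rwa [← sub_eq_add_neg], by ring⟩

theorem stripRel_steps {n : ℕ} {p q : E × ℂ} (h : Γ.Steps Z n p q) : Γ.StripRel Z p q := by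
  induction n generalizing p with
  | zero => rw [show p = q from h]; exact StripRel.refl q
  | succ n ih =>
    obtain ⟨s, hs, hsq⟩ := h
    exact (stripRel_step hZ hpos hs).trans (ih hsq)

theorem stripRel_of_linked {p q : E × ℂ} (hp : InStrip Z p) (hq : InStrip Z q)
    (h : Γ.Linked Z p q) : Γ.StripRel Z p q := by
  have hq' := stripRel_flip hZ (hq.flip (Γ := Γ) hZ)
  rw [flip_flip hZ] at hq'
  have hp' := stripRel_flip (Γ := Γ) hZ hp
  obtain ⟨n, h | h | h | h⟩ := h
  · exact stripRel_steps hZ hpos h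
  · exact (stripRel_steps hZ hpos h).trans hq'
  · exact hp'.trans (stripRel_steps hZ hpos h)
  · exact (hp'.trans (stripRel_steps hZ hpos h)).trans hq'

end

/-! ### The completed surface -/

/-- A choice of coordinate disks at all punctures, so small that points of these disks have
coordinates with large real part only on strips of the face of the puncture. -/
structure CuspSystem (Γ : FatGraph E) (Z : E → ℂ) where
  im_pos : ∀ α, 0 < (Z α).im
  rev_eq : ∀ α, Z (Γ.rev α) = Z α
  bound : ℝ
  right_of_linked : ∀ p q, Γ.Linked Z p q → InStrip Z p → InStrip Z q → bound < p.2.re →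
    bound < q.2.re → ∃ n, Γ.RightSteps Z n p q ∨ Γ.RightSteps Z n q p
  cusp : ∀ F : Γ.Face, Cusp Γ Z F.out bound

/-- For a large bound, points with real parts above the bound that are identified are related by
right passages, so that all faces have cusps. -/
theorem nonempty_cuspSystem [Finite E] [Nonempty E] (hpos : ∀ α, 0 < (Z α).im)
    (hZ : ∀ α, Z (Γ.rev α) = Z α) : Nonempty (CuspSystem Γ Z) := by
  obtain ⟨A, hA⟩ := (Set.finite_range fun α => |(Z α).re|).bddAbove
  obtain ⟨C, hC, hCA, hC1⟩ := ((eventually_linked_far (Γ := Γ) hpos hZ 0 one_pos).and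
    ((eventually_ge_atTop (A + 1)).and (eventually_ge_atTop 1))).exists
  have h : ∀ p q, Γ.Linked Z p q → InStrip Z p → InStrip Z q → C < p.2.re →
      C < q.2.re → ∃ n, Γ.RightSteps Z n p q ∨ Γ.RightSteps Z n q p := by
    intro p q hpq hp hq h1 h2
    rcases hC p q hpq hp h1 with h | h | h | h
    · exact h.2
    · linarith
    · have := abs_lt.1 ((Complex.abs_re_le_norm _).trans_lt h)
      simp at this; linarith
    · have h3 := abs_lt.1 ((Complex.abs_re_le_norm _).trans_lt h)
      have h4 := (le_abs_self _).trans (hA ⟨q.1, rfl⟩)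
      simp at h3; linarith
  exact ⟨⟨hpos, hZ, C, h, fun F => (exists_cusp hpos hZ h F.out).some⟩⟩

namespace CuspSystem

variable (K : CuspSystem Γ Z)

/-- The domains: the strips and the coordinate disks of the punctures. -/
def dom : E ⊕ Γ.Face → Set ℂ
  | Sum.inl α => strip (Z α)
  | Sum.inr F => Metric.ball 0 (K.cusp F).radius

/-- The parametrizations of the completed surface. -/
def map : E ⊕ Γ.Face → ℂ → Γ.Completed Z
  | Sum.inl α => fun x => Γ.stripMap Z (α, x)
  | Sum.inr F => (K.cusp F).toFun

theorem face_out (F : Γ.Face) : Γ.face F.out = F := Quot.out_eq F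

theorem map_zero (F : Γ.Face) : K.map (Sum.inr F) 0 = Sum.inr F := by
  rw [map, (K.cusp F).map_zero, face_out]

theorem map_eq_inr {i : E ⊕ Γ.Face} {x : ℂ} (hx : x ∈ K.dom i) {F : Γ.Face}
    (h : K.map i x = Sum.inr F) : i = Sum.inr F ∧ x = 0 := by
  rcases i with α | F'
  · have : Γ.stripMap Z (α, x) = Sum.inr F := h
    rw [stripMap_of_inStrip (p := (α, x)) hx] at this
    cases this
  · rcases eq_or_ne x 0 with rfl | h0
    · rw [map_zero] at h
      exact ⟨congrArg _ (Sum.inr_injective h), rfl⟩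
    · obtain ⟨p, hp, -, -, g, -, -, hg, hev, -⟩ :=
        (K.cusp F').exists_lift x h0 (mem_ball_zero_iff.1 hx)
      have h1 := hev.self_of_nhds
      have : (K.cusp F').toFun x = Sum.inr F := h
      rw [this, hg, stripMap_of_inStrip hp] at h1
      cases h1

/-- Every parametrization is, near a point that is not a puncture, related to that of a strip. -/
theorem exists_strip_rel {i : E ⊕ Γ.Face} {x : ℂ} (hx : x ∈ K.dom i)
    (h : ∀ F, K.map i x ≠ Sum.inr F) :
    ∃ p, InStrip Z p ∧ HoloRel K.map (i, x) (Sum.inl p.1, p.2) := by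
  rcases i with α | F'
  · exact ⟨(α, x), hx, HoloRel.refl _ _⟩
  · have h0 : x ≠ 0 := by
      rintro rfl
      exact h F' (K.map_zero F')
    obtain ⟨p, hp, -, -, g, hg, hd, hgx, hev, -⟩ :=
      (K.cusp F').exists_lift x h0 (mem_ball_zero_iff.1 hx)
    exact ⟨p, hp, g, hg, hd, hgx, hev.mono fun z hz => hz.symm⟩

theorem map_eq_of_rel {i j : E ⊕ Γ.Face} {x y : ℂ} (h : HoloRel K.map (i, x) (j, y)) :
    K.map i x = K.map j y := by
  obtain ⟨g, -, -, hg, hev⟩ := h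
  have := hev.self_of_nhds
  simp only at hg this
  rw [← this, hg]

variable [Finite E] [Nonempty E]

/-- The completed surface as a Riemann surface. -/
def gluing : HoloGluing (E ⊕ Γ.Face) (Γ.Completed Z) where
  dom := K.dom
  isOpen_dom
    | Sum.inl α => isOpen_strip _
    | Sum.inr F => Metric.isOpen_ball
  map := K.map
  surj := by
    rintro (m | F)
    · obtain ⟨⟨α, x⟩, rfl⟩ := Quot.exists_rep m
      exact ⟨Sum.inl α, x, x.2, stripMap_of_inStrip (p := (α, (x : ℂ))) x.2⟩
    · exact ⟨Sum.inr F, 0, Metric.mem_ball_self (K.cusp F).radius_pos, K.map_zero F⟩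
  rel := by
    intro i j x y hx hy h
    by_cases hF : ∃ F, K.map i x = Sum.inr F
    · obtain ⟨F, hF⟩ := hF
      obtain ⟨rfl, rfl⟩ := K.map_eq_inr hx hF
      obtain ⟨rfl, rfl⟩ := K.map_eq_inr hy (h ▸ hF)
      exact HoloRel.refl _ _
    · push Not at hF
      obtain ⟨p, hp, hpr⟩ := K.exists_strip_rel hx hF
      obtain ⟨q, hq, hqr⟩ := K.exists_strip_rel hy (h ▸ hF)
      have e : Γ.stripMap Z p = Γ.stripMap Z q :=
        (K.map_eq_of_rel hpr).symm.trans (h.trans (K.map_eq_of_rel hqr))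
      obtain ⟨g, hg, hd, hgx, hev, -⟩ := stripRel_of_linked K.rev_eq K.im_pos hp hq
        ((stripMap_eq_iff K.rev_eq hp hq).1 e)
      have hpq : HoloRel K.map (Sum.inl p.1, p.2) (Sum.inl q.1, q.2) := ⟨g, hg, hd, hgx, hev⟩
      exact (hpr.trans hpq).trans hqr.symm
  inj := by
    rintro (α | F) x hx
    · have h1 := eventually_eq_of_linked K.im_pos K.rev_eq (show InStrip Z (α, x) from hx)
      rw [nhds_prod_eq, eventually_prod_iff] at h1
      obtain ⟨pa, hpa, pb, hpb, h1⟩ := h1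
      refine ⟨_, inter_mem (inter_mem hpa hpb) ((isOpen_strip (Z α)).mem_nhds hx), ?_⟩
      rintro y ⟨⟨hy1, -⟩, hys⟩ z ⟨⟨-, hz2⟩, hzs⟩ h
      exact h1 hy1 hz2 hys ((stripMap_eq_iff (p := (α, y)) (q := (α, z)) K.rev_eq hys hzs).1 h)
    · exact ⟨_, Metric.isOpen_ball.mem_nhds hx, (K.cusp F).inj⟩

/-- The completed surface. -/
abbrev Surface : Type u := K.gluing.Space

/-- The parametrization of the completed surface by a strip. -/
abbrev strip (α : E) (x : ℂ) : K.Surface := K.gluing.par (Sum.inl α) x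

/-- The puncture of a face. -/
def puncture (F : Γ.Face) : K.Surface := (Sum.inr F : Γ.Completed Z)

/-- The set of punctures. -/
def punctures : Set K.Surface := Set.range K.puncture

theorem strip_eq_iff {α β : E} {x y : ℂ} (hx : InStrip Z (α, x)) (hy : InStrip Z (β, y)) :
    K.strip α x = K.strip β y ↔ Γ.Linked Z (α, x) (β, y) :=
  stripMap_eq_iff K.rev_eq hx hy

theorem strip_notMem_punctures {α : E} {x : ℂ} (hx : InStrip Z (α, x)) :
    K.strip α x ∉ K.punctures := by
  rintro ⟨F, hF⟩
  cases (K.map_eq_inr (i := Sum.inl α) hx hF.symm).1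

theorem exists_strip_eq {m : K.Surface} (hm : m ∉ K.punctures) :
    ∃ α x, InStrip Z (α, x) ∧ K.strip α x = m := by
  rcases m with m | F
  · obtain ⟨⟨α, x⟩, rfl⟩ := Quot.exists_rep m
    exact ⟨α, x, x.2, stripMap_of_inStrip (p := (α, (x : ℂ))) x.2⟩
  · exact absurd ⟨F, rfl⟩ hm

theorem par_zero (F : Γ.Face) : K.gluing.par (Sum.inr F) 0 = K.puncture F := K.map_zero F

theorem par_eq_puncture {i : E ⊕ Γ.Face} {x : ℂ} (hx : x ∈ K.gluing.dom i) {F : Γ.Face}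
    (h : K.gluing.par i x = K.puncture F) : i = Sum.inr F ∧ x = 0 := K.map_eq_inr hx h

theorem zero_mem_dom (F : Γ.Face) : (0 : ℂ) ∈ K.gluing.dom (Sum.inr F) :=
  Metric.mem_ball_self (K.cusp F).radius_pos

omit [Finite E] [Nonempty E] in
theorem face_eq_of_rightSteps {n : ℕ} {p q : E × ℂ} (h : Γ.RightSteps Z n p q) :
    Γ.face p.1 = Γ.face q.1 := by
  induction n generalizing p with
  | zero => rw [show p = q from h]
  | succ n ih =>
    obtain ⟨s, hs, hsq⟩ := h
    rw [← ih hsq]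
    exact Quot.sound (congrArg Prod.fst hs.2.2.2)

theorem disjoint_map {X Y Z : Type*} {f : X → Z} {g : Y → Z} {F : Filter X} {G : Filter Y}
    (h : ∀ᶠ q in F ×ˢ G, f q.1 ≠ g q.2) : Disjoint (Filter.map f F) (Filter.map g G) := by
  obtain ⟨pa, hpa, pb, hpb, h⟩ := eventually_prod_iff.1 h
  refine Filter.disjoint_iff.2 ⟨f '' {x | pa x}, image_mem_map hpa, g '' {y | pb y},
    image_mem_map hpb, ?_⟩
  rw [Set.disjoint_left]
  rintro _ ⟨x, hx, rfl⟩ ⟨y, hy, hxy⟩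
  exact h hx hy hxy.symm

/-- A puncture and a point of a strip have disjoint neighbourhoods: points far to the right on a
strip are identified only with points that are far away or close to the finite punctures on the
boundary. -/
theorem eventually_cusp_ne (F : Γ.Face) {α : E} {x : ℂ} (hx : InStrip Z (α, x)) :
    ∀ᶠ q : ℂ × ℂ in 𝓝 0 ×ˢ 𝓝 x, K.gluing.par (Sum.inr F) q.1 ≠ K.strip α q.2 := by
  -- near `x` the real part is bounded and the distances to `-πi` and to `Z α` are positive
  obtain ⟨η, hη, h1, h2⟩ : ∃ η > 0, 2 * η ≤ ‖x + Real.pi * Complex.I‖ ∧ 2 * η ≤ ‖x - Z α‖ := by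
    have h1 : 0 < ‖x + Real.pi * Complex.I‖ := by
      rw [norm_pos_iff]
      intro h
      have := congrArg Complex.im h
      have := hx.1
      simp at *; linarith
    have h2 : 0 < ‖x - Z α‖ := by
      rw [norm_pos_iff]
      intro h
      have := congrArg Complex.im h
      have := hx.2
      simp at *; linarith
    refine ⟨min ‖x + Real.pi * Complex.I‖ ‖x - Z α‖ / 2, by positivity, ?_, ?_⟩
    · rw [mul_div_cancel₀ _ two_ne_zero]; exact min_le_left _ _
    · rw [mul_div_cancel₀ _ two_ne_zero]; exact min_le_right _ _
  obtain ⟨C, hC⟩ := (eventually_linked_far (Γ := Γ) K.im_pos K.rev_eq (|x.re| + η) hη).exists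
  obtain ⟨ρ, hρ, hfar⟩ := (K.cusp F).far C
  refine eventually_prod_iff.2 ⟨fun ζ => ‖ζ‖ < ρ, ?_, fun y => ‖y - x‖ < η ∧ InStrip Z (α, y),
    ?_, ?_⟩
  · filter_upwards [Metric.ball_mem_nhds (0 : ℂ) hρ] with ζ hζ
    exact mem_ball_zero_iff.1 hζ
  · refine Eventually.and ?_ (eventually_inStrip hx)
    filter_upwards [Metric.ball_mem_nhds x hη] with y hy
    exact mem_ball_iff_norm.1 hy
  · intro ζ hζ y hy h
    simp only at h
    rcases eq_or_ne ζ 0 with rfl | h0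
    · rw [par_zero] at h
      exact K.strip_notMem_punctures hy.2 ⟨F, h⟩
    obtain ⟨p, hp, hpC, hpe⟩ := hfar ζ h0 hζ
    have hl : Γ.Linked Z p (α, y) := (stripMap_eq_iff K.rev_eq hp hy.2).1 (hpe.symm.trans h)
    have hre := abs_lt.1 ((Complex.abs_re_le_norm _).trans_lt hy.1)
    rw [Complex.sub_re] at hre
    rcases hC p _ hl hp hpC with h' | h' | h' | h'
    · have := le_abs_self x.re
      simp only at h'; linarith [h'.1]
    · have := neg_abs_le x.re
      simp only at h'; linarith
    · have := norm_sub_norm_le (x + Real.pi * Complex.I) (x - y)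
      rw [show x + Real.pi * Complex.I - (x - y) = y + Real.pi * Complex.I by ring,
        norm_sub_rev x y] at this
      simp only at h'; linarith [hy.1]
    · have := norm_sub_norm_le (x - Z α) (x - y)
      rw [show x - Z α - (x - y) = y - Z α by ring, norm_sub_rev x y] at this
      simp only at h'; linarith [hy.1]

theorem disks_disjoint {F F' : Γ.Face} {ζ ζ' : ℂ} (hζ : ‖ζ‖ < (K.cusp F).radius)
    (hζ' : ‖ζ'‖ < (K.cusp F').radius)
    (h : K.gluing.par (Sum.inr F) ζ = K.gluing.par (Sum.inr F') ζ') : F = F' := by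
  rcases eq_or_ne ζ 0 with rfl | h0
  · rw [par_zero] at h
    exact (Sum.inr_injective (K.par_eq_puncture (mem_ball_zero_iff.2 hζ') h.symm).1).symm
  rcases eq_or_ne ζ' 0 with rfl | h0'
  · rw [par_zero] at h
    exact Sum.inr_injective (K.par_eq_puncture (mem_ball_zero_iff.2 hζ) h).1
  obtain ⟨p, hp, hpC, hpf, g, -, -, hg, hev, -⟩ := (K.cusp F).exists_lift ζ h0 hζ
  obtain ⟨q, hq, hqC, hqf, k, -, -, hk, hev', -⟩ := (K.cusp F').exists_lift ζ' h0' hζ'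
  have e := hev.self_of_nhds
  have e' := hev'.self_of_nhds
  rw [hg] at e
  rw [hk] at e'
  have hl : Γ.Linked Z p q := (stripMap_eq_iff K.rev_eq hp hq).1 (e.symm.trans (h.trans e'))
  rw [← face_out F, ← face_out F', ← hpf, ← hqf]
  obtain ⟨n, h | h⟩ := K.right_of_linked p q hl hp hq hpC hqC
  · exact face_eq_of_rightSteps h
  · exact (face_eq_of_rightSteps h).symm

instance : T2Space K.Surface := by
  rw [t2Space_iff_disjoint_nhds]
  intro m m' hne
  have hcusp : ∀ (F : Γ.Face) (m : K.Surface), m ∉ K.punctures →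
      Disjoint (𝓝 (K.puncture F)) (𝓝 m) := by
    intro F m hm
    obtain ⟨α, x, hx, rfl⟩ := K.exists_strip_eq hm
    rw [← par_zero, ← K.gluing.map_nhds_par (K.zero_mem_dom F),
      ← K.gluing.map_nhds_par (i := Sum.inl α) hx]
    exact disjoint_map (K.eventually_cusp_ne F hx)
  by_cases hm : m ∈ K.punctures <;> by_cases hm' : m' ∈ K.punctures
  · obtain ⟨F, rfl⟩ := hm
    obtain ⟨F', rfl⟩ := hm'
    rw [← par_zero, ← par_zero, ← K.gluing.map_nhds_par (K.zero_mem_dom F),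
      ← K.gluing.map_nhds_par (K.zero_mem_dom F')]
    refine disjoint_map (eventually_prod_iff.2 ⟨_,
      Metric.isOpen_ball.mem_nhds (K.zero_mem_dom F), _,
      Metric.isOpen_ball.mem_nhds (K.zero_mem_dom F'), fun {ζ} hζ {ζ'} hζ' h => hne ?_⟩)
    rw [K.disks_disjoint (mem_ball_zero_iff.1 hζ) (mem_ball_zero_iff.1 hζ') h]
  · obtain ⟨F, rfl⟩ := hm
    exact hcusp F m' hm'
  · obtain ⟨F, rfl⟩ := hm'
    exact (hcusp F m hm).symm
  · obtain ⟨α, x, hx, rfl⟩ := K.exists_strip_eq hm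
    obtain ⟨β, y, hy, rfl⟩ := K.exists_strip_eq hm'
    rw [← K.gluing.map_nhds_par (i := Sum.inl α) hx, ← K.gluing.map_nhds_par (i := Sum.inl β) hy]
    apply disjoint_map
    rw [← nhds_prod_eq]
    have h1 := eventually_not_linked K.im_pos K.rev_eq hx hy
      fun h => hne ((K.strip_eq_iff hx hy).2 h)
    have h2 : ∀ᶠ q : ℂ × ℂ in 𝓝 (x, y), InStrip Z (α, q.1) :=
      continuous_fst.continuousAt.eventually (eventually_inStrip hx)
    have h3 : ∀ᶠ q : ℂ × ℂ in 𝓝 (x, y), InStrip Z (β, q.2) :=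
      continuous_snd.continuousAt.eventually (eventually_inStrip hy)
    filter_upwards [h1, h2, h3] with q hq1 hq2 hq3 h
    exact hq1 hq2 ((K.strip_eq_iff hq2 hq3).1 h)

end CuspSystem

end FatGraph

end

noncomputable section

namespace FatGraph

variable {E : Type u} {Γ : FatGraph E} {Z : E → ℂ} [Finite E] [Nonempty E]

/-! ### Compactness and connectedness -/

/-- Every class has a representative away from the boundary of its strip.  Otherwise there is a
representative `q` near the upper boundary, up to reversal, and the lowest one of these passes to
points near the lower boundary on both subsequent strips.  But the sum of the imaginary parts of
these two points is `Im (q - Z) - π > -4π / 3`. -/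
theorem exists_linked_inner (hpos : ∀ α, 0 < (Z α).im) (hZ : ∀ α, Z (Γ.rev α) = Z α) {p : E × ℂ}
    (hp : InStrip Z p) : ∃ q, InStrip Z q ∧ Γ.Linked Z p q ∧ -(2 * Real.pi / 3) ≤ q.2.im ∧
      q.2.im ≤ (Z q.1).im - Real.pi / 3 := by
  have hpi := Real.pi_pos
  by_contra hc
  push Not at hc
  set S : Set (E × ℂ) := {q | Γ.Linked Z p q ∧ InStrip Z q ∧ (Z q.1).im - Real.pi / 3 < q.2.im}
  have hfin : S.Finite := (finite_linked hZ (fun n c h => Finset.sum_pos (fun k _ => hpos _)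
    ⟨0, by simpa using h.1⟩) hp).subset fun q hq => hq.1
  have hself : Γ.Linked Z p p := ⟨0, Or.inl rfl⟩
  have hne : S.Nonempty := by
    by_cases h : -(2 * Real.pi / 3) ≤ p.2.im
    · exact ⟨p, hself, hp, hc p hp hself h⟩
    · refine ⟨Γ.flip Z p, hself.flip hZ, hp.flip hZ, ?_⟩
      simp [flip, hZ]
      linarith
  obtain ⟨q, ⟨hq1, hq2, hq3⟩, hmin⟩ := hfin.exists_minimalFor (fun q => q.2.im) S hne
  have hq4 : -Real.pi < (q.2 - Z q.1).im := by simp; linarith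
  have key : ∀ r, Γ.Step Z q r → r.2.im < -(2 * Real.pi / 3) := by
    intro r hr
    by_contra hlt
    push Not at hlt
    have hl := hq1.step hZ hr
    have h1 := hc r hr.2.1 hl hlt
    have h2 := hmin ⟨hl, hr.2.1, h1⟩
    have h3 := hr.im_lt
    have h4 := hpos q.1
    simp only at h2
    linarith [h2 (by linarith)]
  have h1 := key _ (step_right hpos hq2 hq4)
  have h2 := key _ (step_left hpos hq2 hq4)
  have h3 := congrArg Complex.im (turnR_add_turnL hq4 hq2.sub_im)
  simp at h1 h2 h3
  linarith

namespace CuspSystem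

variable (K : CuspSystem Γ Z)

omit [Nonempty E] in
theorem finite_face : Finite Γ.Face := Quot.finite _

theorem continuousOn_par (i : E ⊕ Γ.Face) {V : Set ℂ} (hV : V ⊆ K.gluing.dom i) :
    ContinuousOn (K.gluing.par i) V :=
  fun _ hx => (K.gluing.continuousAt_par (hV hx)).continuousWithinAt

instance : CompactSpace K.Surface := by
  have := finite_face (Γ := Γ)
  have hr : ∀ F, ∃ C' : ℝ, ∀ p, InStrip Z p → Γ.face p.1 = Γ.face F.out → C' < p.2.re →
      ∃ ζ, ζ ≠ 0 ∧ ‖ζ‖ < (K.cusp F).radius / 2 ∧ (K.cusp F).toFun ζ = Γ.stripMap Z p :=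
    fun F => (K.cusp F).surj _ (half_pos (K.cusp F).radius_pos)
  choose C hC using hr
  obtain ⟨C0, hC0⟩ := (Set.finite_range C).bddAbove
  obtain ⟨A, hA⟩ := (Set.finite_range fun α => |(Z α).re|).bddAbove
  set B := |C0| + A
  have hA0 : ∀ α, |(Z α).re| ≤ A := fun α => hA ⟨α, rfl⟩
  -- the compact pieces
  set R : E → Set ℂ := fun α =>
    Set.Icc (-B) B ×ℂ Set.Icc (-(2 * Real.pi / 3)) ((Z α).im - Real.pi / 3) with hR
  have hpi := Real.pi_pos
  have hRsub : ∀ α, R α ⊆ K.gluing.dom (Sum.inl α) := by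
    intro α x hx
    have h1 : -(2 * Real.pi / 3) ≤ x.im := hx.2.1
    have h2 : x.im ≤ (Z α).im - Real.pi / 3 := hx.2.2
    exact ⟨by linarith, by linarith⟩
  have hDsub : ∀ F, Metric.closedBall (0 : ℂ) ((K.cusp F).radius / 2) ⊆
      K.gluing.dom (Sum.inr F) := fun F =>
    Metric.closedBall_subset_ball (half_lt_self (K.cusp F).radius_pos)
  have hcov : (Set.univ : Set K.Surface) = (⋃ α, K.strip α '' R α) ∪
      ⋃ F, K.gluing.par (Sum.inr F) '' Metric.closedBall (0 : ℂ) ((K.cusp F).radius / 2) := by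
    refine (Set.eq_univ_of_forall fun m => ?_).symm
    have hfar : ∀ q, InStrip Z q → |C0| < q.2.re →
        K.strip q.1 q.2 ∈ ⋃ F, K.gluing.par (Sum.inr F) ''
          Metric.closedBall (0 : ℂ) ((K.cusp F).radius / 2) := by
      intro q hq hre
      have h2 := hC0 ⟨Γ.face q.1, rfl⟩
      have h3 := le_abs_self C0
      obtain ⟨ζ, -, hζ, he⟩ := hC (Γ.face q.1) q hq (face_out _).symm (by linarith)
      exact Set.mem_iUnion.2 ⟨_, ζ, mem_closedBall_zero_iff.2 hζ.le, he⟩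
    by_cases hm : m ∈ K.punctures
    · obtain ⟨F, rfl⟩ := hm
      exact Or.inr (Set.mem_iUnion.2 ⟨F, 0,
        Metric.mem_closedBall_self (half_pos (K.cusp F).radius_pos).le, K.par_zero F⟩)
    · obtain ⟨α, x, hx, rfl⟩ := K.exists_strip_eq hm
      obtain ⟨q, hq, hl, hq1, hq2⟩ := exists_linked_inner K.im_pos K.rev_eq hx
      rw [(K.strip_eq_iff hx hq).2 hl]
      rcases lt_or_ge B q.2.re with h1 | h1
      · exact Or.inr (hfar q hq (by linarith [(abs_nonneg _).trans (hA0 q.1)]))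
      rcases lt_or_ge q.2.re (-B) with h2 | h2
      · right
        rw [(K.strip_eq_iff hq (hq.flip (Γ := Γ) K.rev_eq)).2 (linked_flip_self K.rev_eq q)]
        refine hfar _ (hq.flip K.rev_eq) ?_
        have := (abs_le.1 (hA0 q.1)).1
        simp [flip]
        linarith
      · exact Or.inl (Set.mem_iUnion.2 ⟨q.1, q.2, ⟨⟨h2, h1⟩, hq1, hq2⟩, rfl⟩)
  refine ⟨?_⟩
  rw [hcov]
  refine (isCompact_iUnion fun α => ?_).union (isCompact_iUnion fun F => ?_)
  · exact (isCompact_Icc.reProdIm isCompact_Icc).image_of_continuousOn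
      (K.continuousOn_par _ (hRsub α))
  · exact (isCompact_closedBall _ _).image_of_continuousOn (K.continuousOn_par _ (hDsub F))

theorem exists_strip_eq_strip_rev (α : E) : ∃ x y, InStrip Z (α, x) ∧ InStrip Z (Γ.rev α, y) ∧
    K.strip α x = K.strip (Γ.rev α) y := by
  have hpi := Real.pi_pos
  have hp : InStrip Z (α, -(Real.pi / 2) * Complex.I) :=
    inStrip_of_im K.im_pos (by simp; linarith) (by simp; linarith)
  have hq := hp.flip (Γ := Γ) K.rev_eq
  exact ⟨_, _, hp, hq, (K.strip_eq_iff hp hq).2 (linked_flip_self K.rev_eq _)⟩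

theorem exists_strip_eq_strip_right (α : E) : ∃ x y, InStrip Z (α, x) ∧
    InStrip Z (Γ.next (Γ.rev α), y) ∧ K.strip α x = K.strip (Γ.next (Γ.rev α)) y := by
  have hpi := Real.pi_pos
  have hp : InStrip Z (α, Z α - Real.pi / 2 * Complex.I) :=
    ⟨by have := K.im_pos α; simp; linarith, by simp; linarith⟩
  have hs := step_right (Γ := Γ) K.im_pos hp (by simp; linarith)
  exact ⟨_, _, hp, hs.2.1, (K.strip_eq_iff hp hs.2.1).2 ⟨1, Or.inl ⟨_, hs, rfl⟩⟩⟩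

theorem isPreconnected_image_strip (α : E) : IsPreconnected (K.strip α '' FatGraph.strip (Z α)) :=
  (isPreconnected_strip _).image _ (K.continuousOn_par (Sum.inl α) le_rfl)

instance : ConnectedSpace K.Surface := by
  obtain ⟨α₀⟩ := ‹Nonempty E›
  obtain ⟨x₀, -, hx₀, -, -⟩ := K.exists_strip_eq_strip_rev α₀
  set m₀ := K.strip α₀ x₀
  have hstep : ∀ {α β : E} {x y : ℂ}, InStrip Z (α, x) → InStrip Z (β, y) →
      K.strip α x = K.strip β y →
      K.strip α '' FatGraph.strip (Z α) ⊆ connectedComponent m₀ →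
      K.strip β '' FatGraph.strip (Z β) ⊆ connectedComponent m₀ := by
    intro α β x y hx hy hxy h
    have h1 : K.strip β y ∈ connectedComponent m₀ := h ⟨x, hx, hxy⟩
    rw [connectedComponent_eq h1]
    exact (K.isPreconnected_image_strip β).subset_connectedComponent ⟨y, hy, rfl⟩
  have hall : ∀ β, K.strip β '' FatGraph.strip (Z β) ⊆ connectedComponent m₀ := by
    intro β
    induction Γ.connected α₀ β with
    | refl => exact (K.isPreconnected_image_strip α₀).subset_connectedComponent ⟨x₀, hx₀, rfl⟩
    | tail _ h ih =>
      rename_i β γ _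
      have hrev : K.strip (Γ.rev β) '' FatGraph.strip (Z (Γ.rev β)) ⊆ connectedComponent m₀ := by
        obtain ⟨x, y, hx, hy, hxy⟩ := K.exists_strip_eq_strip_rev β
        exact hstep hx hy hxy ih
      rcases h with rfl | rfl
      · exact hrev
      · obtain ⟨x, y, hx, hy, hxy⟩ := K.exists_strip_eq_strip_right (Γ.rev β)
        rw [Γ.rev_rev] at hy hxy
        exact hstep hx hy hxy hrev
  have huniv : ∀ m : K.Surface, m ∈ connectedComponent m₀ := by
    intro m
    by_cases hm : m ∈ K.punctures
    · obtain ⟨F, rfl⟩ := hm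
      have hr := (K.cusp F).radius_pos
      -- a disk contains points of the strips
      have hpre : IsPreconnected (K.gluing.par (Sum.inr F) '' Metric.ball 0 (K.cusp F).radius) :=
        (convex_ball _ _).isPreconnected.image _ (K.continuousOn_par (Sum.inr F) le_rfl)
      have hmem : (((K.cusp F).radius / 2 : ℝ) : ℂ) ∈ Metric.ball (0 : ℂ) (K.cusp F).radius := by
        rw [mem_ball_zero_iff, Complex.norm_real, Real.norm_eq_abs, abs_of_pos (half_pos hr)]
        exact half_lt_self hr
      have hnot : K.gluing.par (Sum.inr F) (((K.cusp F).radius / 2 : ℝ) : ℂ) ∉ K.punctures := by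
        rintro ⟨F', hF'⟩
        have := (K.par_eq_puncture hmem hF'.symm).2
        rw [Complex.ofReal_eq_zero] at this
        linarith
      obtain ⟨α, x, hx, he⟩ := K.exists_strip_eq hnot
      have h1 := hall α ⟨x, hx, rfl⟩
      rw [connectedComponent_eq h1, he]
      rw [← par_zero]
      exact hpre.subset_connectedComponent ⟨_, hmem, rfl⟩ ⟨0, K.zero_mem_dom F, rfl⟩
    · obtain ⟨α, x, hx, rfl⟩ := K.exists_strip_eq hm
      exact hall α ⟨x, hx, rfl⟩
  have : PreconnectedSpace K.Surface := ⟨by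
    rw [← (Set.eq_univ_of_forall huniv : connectedComponent m₀ = Set.univ)]
    exact isPreconnected_connectedComponent⟩
  exact ⟨⟨m₀⟩⟩

/-! ### The projective structure -/

/-- The projective coordinates: the holomorphic coordinates outside of the punctures which are
Möbius functions of the exponentials of the coordinates on all strips. -/
def projAtlas : Set (OpenPartialHomeomorph K.Surface ℂ) :=
  {φ | φ ∈ IsManifold.maximalAtlas 𝓘(ℂ) ω K.Surface ∧ φ.source ⊆ K.puncturesᶜ ∧
    ∀ α x, InStrip Z (α, x) → K.strip α x ∈ φ.source →
      MobiusAt Complex.exp (fun y => φ (K.strip α y)) x}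

theorem map_nhds_strip {α : E} {x : ℂ} (hx : InStrip Z (α, x)) :
    Filter.map (K.strip α) (𝓝 x) = 𝓝 (K.strip α x) := K.gluing.map_nhds_par (i := Sum.inl α) hx

theorem continuousAt_strip {α : E} {x : ℂ} (hx : InStrip Z (α, x)) :
    ContinuousAt (K.strip α) x := K.gluing.continuousAt_par (i := Sum.inl α) hx

/-- The exponential of the coordinate on a strip gives projective coordinates. -/
theorem exists_projChart {α : E} {x : ℂ} (hx : InStrip Z (α, x)) :
    ∃ φ ∈ K.projAtlas, K.strip α x ∈ φ.source ∧ ∀ᶠ y in 𝓝 x, φ (K.strip α y) = Complex.exp y := by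
  obtain ⟨V, hV, hxV, hVs, hVi⟩ := K.gluing.exists_injOn (i := Sum.inl α) hx
  set e := ((Complex.hasStrictDerivAt_exp x).hasStrictFDerivAt_equiv
    (Complex.exp_ne_zero x)).toOpenPartialHomeomorph Complex.exp with he
  have hecoe : ∀ y, e y = Complex.exp y := fun y => rfl
  have hxe : x ∈ e.source := HasStrictFDerivAt.mem_toOpenPartialHomeomorph_source _
  set c := (K.gluing.mapChart (Sum.inl α) V hV hVs hVi).symm with hc
  have hpar : ∀ y ∈ V, c (K.strip α y) = y := fun y hy => K.gluing.mapChart_symm_par hV hVs hVi hy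
  have hsrc : ∀ m ∈ (c ≫ₕ e).source, ∃ y ∈ V, K.strip α y = m := by
    intro m hm
    rw [OpenPartialHomeomorph.trans_source] at hm
    exact hm.1
  refine ⟨c ≫ₕ e, ⟨K.gluing.mem_maximalAtlas ?_, ?_, ?_⟩, ?_, ?_⟩
  · intro i y hy hys
    obtain ⟨z, hz, hzy⟩ := hsrc _ hys
    obtain ⟨h1, h2⟩ := K.gluing.analyticAt_transition (j := Sum.inl α) hy (hVs hz) hzy.symm hV hVs
      hVi hz
    refine ⟨h1.cexp, ?_⟩
    have h3 := (Complex.hasDerivAt_exp _).comp y h1.differentiableAt.hasDerivAt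
    have h4 : deriv (fun w => (c ≫ₕ e) (K.gluing.par i w)) y = _ := h3.deriv
    rw [h4]
    exact mul_ne_zero (Complex.exp_ne_zero _) h2
  · intro m hm
    obtain ⟨y, hy, rfl⟩ := hsrc m hm
    exact K.strip_notMem_punctures (hVs hy)
  · intro β y hy hys
    obtain ⟨z, hz, hzy⟩ := hsrc _ hys
    have hz' : InStrip Z (α, z) := hVs hz
    obtain ⟨g, hg, -, hgy, hev, hmob⟩ := stripRel_of_linked K.rev_eq K.im_pos hy hz'
      ((K.strip_eq_iff hy hz').1 hzy.symm)
    simp only at hg hgy hev hmob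
    refine hmob.congr EventuallyEq.rfl ?_
    have hgc := hg.continuousAt.tendsto
    rw [hgy] at hgc
    filter_upwards [hev, hgc.eventually (hV.mem_nhds hz)] with w hw hwV
    change _ = e (c (K.strip β w))
    rw [← show K.strip α (g w) = K.strip β w from hw, hpar _ hwV, hecoe]
  · rw [OpenPartialHomeomorph.trans_source]
    refine ⟨⟨x, hxV, rfl⟩, ?_⟩
    rw [Set.mem_preimage, hpar x hxV]
    exact hxe
  · filter_upwards [hV.mem_nhds hxV] with y hy
    change e (c (K.strip α y)) = _
    rw [hpar y hy, hecoe]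

/-- A function with the derivative `w`, where `w' = w r`, has the Schwarzian derivative
`r' - r² / 2`. -/
theorem schwarzian_eq {f w r : ℂ → ℂ} {r' z : ℂ}
    (h : ∀ᶠ y in 𝓝 z, HasDerivAt f (w y) y ∧ w y ≠ 0 ∧ HasDerivAt w (w y * r y) y)
    (hr : HasDerivAt r r' z) : schwarzian f z = r' - r z ^ 2 / 2 := by
  have h1 : deriv f =ᶠ[𝓝 z] w := h.mono fun y hy => hy.1.deriv
  have h2 : iteratedDeriv 2 f =ᶠ[𝓝 z] fun y => w y * r y := by
    rw [iteratedDeriv_succ, iteratedDeriv_one]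
    filter_upwards [h1.eventuallyEq_nhds, h] with y hy hy'
    rw [hy.deriv_eq, hy'.2.2.deriv]
  have h3 : iteratedDeriv 3 f z = w z * r z * r z + w z * r' := by
    rw [iteratedDeriv_succ, h2.deriv_eq]
    exact (h.self_of_nhds.2.2.mul hr).deriv
  obtain ⟨-, h0, -⟩ := h.self_of_nhds
  rw [schwarzian, h3, h1.self_of_nhds, h2.self_of_nhds]
  field_simp
  ring

/-- The Schwarzian derivative of a Möbius function of `f` is that of `f`. -/
theorem schwarzian_mobius {f w r F : ℂ → ℂ} {r' z a b c d : ℂ} (hD : a * d - b * c ≠ 0)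
    (h : ∀ᶠ y in 𝓝 z, HasDerivAt f (w y) y ∧ w y ≠ 0 ∧ HasDerivAt w (w y * r y) y)
    (hr : HasDerivAt r r' z)
    (hF : ∀ᶠ y in 𝓝 z, c * f y + d ≠ 0 ∧ F y = (a * f y + b) / (c * f y + d)) :
    schwarzian F z = r' - r z ^ 2 / 2 := by
  have key : ∀ᶠ y in 𝓝 z, HasDerivAt F ((a * d - b * c) * w y / (c * f y + d) ^ 2) y ∧
      (a * d - b * c) * w y / (c * f y + d) ^ 2 ≠ 0 ∧
      HasDerivAt (fun y => (a * d - b * c) * w y / (c * f y + d) ^ 2)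
        ((a * d - b * c) * w y / (c * f y + d) ^ 2 *
          (r y - 2 * c * (w y / (c * f y + d)))) y := by
    filter_upwards [h, hF.eventually_nhds] with y hy hy'
    obtain ⟨h1, h2, h3⟩ := hy
    have h0 := hy'.self_of_nhds.1
    have e1 := (h1.const_mul c).add_const d
    refine ⟨?_, div_ne_zero (mul_ne_zero hD h2) (pow_ne_zero 2 h0), ?_⟩
    · refine ((((h1.const_mul a).add_const b).div e1 h0).congr_of_eventuallyEq
        (hy'.mono fun x hx => hx.2)).congr_deriv ?_
      field_simp
      ring
    · refine ((h3.const_mul (a * d - b * c)).div (e1.pow 2) (pow_ne_zero 2 h0)).congr_deriv ?_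
      simp only [Pi.pow_apply]
      field_simp
      ring
  obtain ⟨h1, h2, h3⟩ := h.self_of_nhds
  have h0 := hF.self_of_nhds.1
  have hr2 : HasDerivAt (fun y => r y - 2 * c * (w y / (c * f y + d))) _ z :=
    hr.sub ((h3.div ((h1.const_mul c).add_const d) h0).const_mul (2 * c))
  rw [schwarzian_eq key hr2]
  field_simp
  ring

end CuspSystem
end FatGraph

end

noncomputable section

namespace FatGraph

variable {E : Type u} {Γ : FatGraph E} {Z : E → ℂ} [Finite E] [Nonempty E]

namespace CuspSystem

variable (K : CuspSystem Γ Z)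

theorem mobiusAt_projAtlas {φ ψ : OpenPartialHomeomorph K.Surface ℂ} (hφ : φ ∈ K.projAtlas)
    (hψ : ψ ∈ K.projAtlas) {m : K.Surface} (hm : m ∈ φ.source) (hm' : m ∈ ψ.source) :
    MobiusAt φ ψ m := by
  obtain ⟨α, x, hx, rfl⟩ := K.exists_strip_eq (hφ.2.1 hm)
  exact ((hφ.2.2 α x hx hm).symm.trans (hψ.2.2 α x hx hm')).of_map (K.map_nhds_strip hx)

/-- The Schwarzian derivative of the projective coordinates has at most a double pole at a puncture:
in the coordinate `ζ` of the disk it is `(q / ζ)' - (q / ζ)² / 2`, where `q / ζ` is the logarithmic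
derivative of the derivative of the exponential coordinate. -/
theorem regular_puncture (F : Γ.Face) : ∃ h : ℂ → ℂ,
    AnalyticAt ℂ h (chartAt ℂ (K.puncture F) (K.puncture F)) ∧
    ∀ᶠ q in 𝓝[≠] (K.puncture F), ∀ φ ∈ K.projAtlas, q ∈ φ.source →
      schwarzian (φ ∘ (chartAt ℂ (K.puncture F)).symm) (chartAt ℂ (K.puncture F) q) =
        h (chartAt ℂ (K.puncture F) q) /
          (chartAt ℂ (K.puncture F) q - chartAt ℂ (K.puncture F) (K.puncture F)) ^ 2 := by
  obtain ⟨i, x, V, hV, hs, hi, hxV, hx, hc⟩ := K.gluing.chartAt_eq (K.puncture F)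
  obtain ⟨rfl, rfl⟩ := K.par_eq_puncture (hs hxV) hx
  have hchart : ∀ ζ ∈ V, chartAt ℂ (K.puncture F) (K.gluing.par (Sum.inr F) ζ) = ζ := by
    intro ζ hζ
    rw [hc]
    exact K.gluing.mapChart_symm_par hV hs hi hζ
  have h0 : chartAt ℂ (K.puncture F) (K.puncture F) = 0 := by
    have := hchart 0 hxV
    rwa [par_zero] at this
  set q := (K.cusp F).q with hq
  have hqa := (K.cusp F).analyticAt_q
  rw [h0]
  refine ⟨fun ζ => ζ * deriv q ζ - q ζ - q ζ ^ 2 / 2, ?_, ?_⟩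
  · exact ((analyticAt_id.mul hqa.deriv).sub hqa).sub ((hqa.pow 2).div_const)
  have hqd : ∀ᶠ ζ in 𝓝 (0 : ℂ), DifferentiableAt ℂ q ζ := by
    filter_upwards [hqa.eventually_analyticAt] with ζ hζ using hζ.differentiableAt
  rw [eventually_nhdsWithin_iff, ← par_zero, ← K.gluing.map_nhds_par (K.zero_mem_dom F),
    eventually_map]
  filter_upwards [hV.mem_nhds hxV, hqd] with ζ hζV hζq hne φ hφ hsrc
  rw [par_zero] at hne ⊢
  have hζ0 : ζ ≠ 0 := by
    rintro rfl
    exact hne (K.par_zero F)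
  rw [hchart ζ hζV, sub_zero]
  obtain ⟨p, hp, -, -, g, hg, hd, hgx, hev, w, hw⟩ :=
    (K.cusp F).exists_lift ζ hζ0 (mem_ball_zero_iff.1 (hs hζV))
  have hr : HasDerivAt (fun z => q z / z) ((deriv q ζ * ζ - q ζ * 1) / ζ ^ 2) ζ :=
    hζq.hasDerivAt.div (hasDerivAt_id ζ) hζ0
  have hsrc' : K.strip p.1 p.2 ∈ φ.source := by
    have h1 := hev.self_of_nhds
    rw [hgx] at h1
    rwa [← show K.gluing.par (Sum.inr F) ζ = K.strip p.1 p.2 from h1]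
  have hm := hφ.2.2 p.1 p.2 hp hsrc'
  rw [← hgx] at hm
  obtain ⟨a, b, c, d, hD, hm⟩ := hm.comp hg.continuousAt
  rw [schwarzian_mobius hD hw hr]
  · field_simp
    ring
  · filter_upwards [hm, hev] with z h1 h2
    refine ⟨h1.1, ?_⟩
    rw [← h1.2, hc]
    exact congrArg φ h2

/-- The completed surface with its projective structure. -/
abbrev regularSurface : RegularProjectiveSurface.{u} where
  carrier := K.Surface
  punctures := K.punctures
  punctures_finite := by
    have := finite_face (Γ := Γ)
    exact Set.finite_range _
  projAtlas := K.projAtlas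
  projAtlas_holomorphic := fun φ hφ => hφ.1
  projAtlas_cover := by
    refine Set.Subset.antisymm (Set.iUnion₂_subset fun φ hφ => hφ.2.1) fun m hm => ?_
    obtain ⟨α, x, hx, rfl⟩ := K.exists_strip_eq hm
    obtain ⟨φ, hφ, hs, -⟩ := K.exists_projChart hx
    exact Set.mem_iUnion₂.2 ⟨φ, hφ, hs⟩
  projAtlas_mobius := fun φ hφ ψ hψ p hp => K.mobiusAt_projAtlas hφ hψ hp.1 hp.2
  regular := by
    rintro p ⟨F, rfl⟩
    exact K.regular_puncture F

/-- Maps that are given by a continuous function with projective exponential on a strip are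
projective. -/
theorem projectiveAt_of_lift {X : Type*} [TopologicalSpace X] {z : X → ℂ} {f : X → K.Surface}
    {g : X → ℂ} {p : X} {α : E} (hg : ContinuousAt g p) (hs : InStrip Z (α, g p))
    (hf : ∀ᶠ q in 𝓝 p, f q = K.strip α (g q)) (hm : MobiusAt z (fun q => Complex.exp (g q)) p) :
    K.regularSurface.ProjectiveAt z f p := by
  have hfp : f p = K.strip α (g p) := hf.self_of_nhds
  obtain ⟨φ, hφ, hsrc, he⟩ := K.exists_projChart hs
  refine ⟨?_, φ, hφ, ?_, ?_⟩
  · have h1 : ContinuousAt (fun q => K.strip α (g q)) p :=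
      ContinuousAt.comp (g := K.strip α) (K.continuousAt_strip hs) hg
    exact h1.congr (hf.mono fun q hq => hq.symm)
  · rwa [hfp]
  · refine hm.congr EventuallyEq.rfl ?_
    filter_upwards [hf, hg.eventually he] with q h1 h2
    rw [h1, h2]

/-- Projective maps lift to the strips. -/
theorem exists_lift_of_projectiveAt {X : Type*} [TopologicalSpace X] {z : X → ℂ}
    {f : X → K.Surface} {p : X} (h : K.regularSurface.ProjectiveAt z f p) {α : E} {x : ℂ}
    (hx : InStrip Z (α, x)) (hfp : f p = K.strip α x) :
    ∃ g : X → ℂ, ContinuousAt g p ∧ g p = x ∧ (∀ᶠ q in 𝓝 p, f q = K.strip α (g q)) ∧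
      MobiusAt z (fun q => Complex.exp (g q)) p := by
  obtain ⟨hc, φ, hφ, hsrc, hm⟩ := h
  obtain ⟨V, hV, hxV, hVs, hVi⟩ := K.gluing.exists_injOn (i := Sum.inl α) hx
  set c := (K.gluing.mapChart (Sum.inl α) V hV hVs hVi).symm with hc'
  have hpar : ∀ y ∈ V, c (K.strip α y) = y := fun y hy => K.gluing.mapChart_symm_par hV hVs hVi hy
  have hgp : c (f p) = x := by rw [hfp, hpar x hxV]
  have hcs : f p ∈ c.source := by rw [hfp]; exact ⟨x, hxV, rfl⟩
  have hgc : ContinuousAt (fun q => c (f q)) p :=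
    ContinuousAt.comp (g := c) (c.continuousAt hcs) hc
  have hev : ∀ᶠ q in 𝓝 p, f q = K.strip α (c (f q)) := by
    filter_upwards [hc.eventually (c.open_source.mem_nhds hcs)] with q hq
    obtain ⟨y, hy, hyq⟩ := hq
    have : K.strip α y = f q := hyq
    rw [← this, hpar y hy]
  refine ⟨fun q => c (f q), hgc, hgp, hev, hm.trans ?_⟩
  have h1 := hφ.2.2 α x hx (by rwa [hfp] at hsrc)
  have h2 : MobiusAt (fun q => Complex.exp (c (f q))) (fun q => φ (K.strip α (c (f q)))) p := by
    rw [← hgp] at h1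
    exact h1.comp (f := fun q => c (f q)) hgc
  exact h2.symm.congr (hev.mono fun q hq => congrArg φ hq.symm) EventuallyEq.rfl

/-- The inclusion of the glued surface into the completed surface. -/
def ofGlued (m : Γ.GluedSurface Z) : K.Surface := (Sum.inl m : Γ.Completed Z)

theorem continuous_ofGlued : Continuous K.ofGlued := by
  refine continuous_coinduced_dom.2 (continuous_sigma fun α => ?_)
  rw [continuous_iff_continuousAt]
  intro x
  have h := (K.continuousAt_strip (α := α) x.2).comp (x := x) continuous_subtype_val.continuousAt
  refine h.congr (Eventually.of_forall fun y => ?_)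
  exact stripMap_of_inStrip (p := (α, (y : ℂ))) y.2

theorem isOpenMap_ofGlued : IsOpenMap K.ofGlued := by
  intro W hW
  have e : K.ofGlued '' W =
      ⋃ α, K.strip α '' (Subtype.val '' {x : FatGraph.strip (Z α) | Γ.glued Z α x ∈ W}) := by
    ext m
    simp only [Set.mem_image, Set.mem_iUnion, Set.mem_ofPred_eq, Subtype.exists, exists_and_right,
      exists_eq_right]
    constructor
    · rintro ⟨m, hm, rfl⟩
      obtain ⟨⟨α, x⟩, rfl⟩ := Quot.exists_rep m
      exact ⟨α, x, ⟨x.2, hm⟩, stripMap_of_inStrip (p := (α, (x : ℂ))) x.2⟩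
    · rintro ⟨α, x, ⟨hx, hm⟩, rfl⟩
      exact ⟨_, hm, (stripMap_of_inStrip (p := (α, (x : ℂ))) hx).symm⟩
  rw [e]
  refine isOpen_iUnion fun α => K.gluing.isOpen_image_par ?_ ?_
  · have hc : Continuous fun x : FatGraph.strip (Z α) => Γ.glued Z α x :=
      continuous_coinduced_rng.comp continuous_sigmaMk
    exact (isOpen_strip (Z α)).isOpenMap_subtype_val _ (hW.preimage hc)
  · rintro _ ⟨x, -, rfl⟩
    exact x.2

theorem ofGlued_notMem (m : Γ.GluedSurface Z) : K.ofGlued m ∉ K.punctures := by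
  rintro ⟨F, hF⟩
  cases hF

theorem ofGlued_bijective : Function.Bijective
    fun m : Γ.GluedSurface Z =>
      (⟨K.ofGlued m, K.ofGlued_notMem m⟩ : K.regularSurface.Punctured) := by
  refine ⟨fun a b h => Sum.inl_injective (congrArg Subtype.val h), ?_⟩
  rintro ⟨m, hm⟩
  rcases m with m | F
  · exact ⟨m, rfl⟩
  · exact absurd ⟨F, rfl⟩ hm

/-- The glued surface is the complement of the punctures. -/
def homeo : Γ.GluedSurface Z ≃ₜ K.regularSurface.Punctured :=
  (Equiv.ofBijective _ K.ofGlued_bijective).toHomeomorphOfContinuousOpen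
    (K.continuous_ofGlued.subtype_mk _)
    (by
      intro W hW
      refine isOpen_induced_iff.2 ⟨_, K.isOpenMap_ofGlued W hW, ?_⟩
      ext ⟨m, hm⟩
      constructor
      · rintro ⟨w, hw, he⟩
        exact ⟨w, hw, Subtype.ext he⟩
      · rintro ⟨w, hw, he⟩
        exact ⟨w, hw, congrArg Subtype.val he⟩)

theorem homeo_glued (α : E) (x : FatGraph.strip (Z α)) :
    ((K.homeo (Γ.glued Z α x)).1 : K.Surface) = K.strip α x :=
  (stripMap_of_inStrip (p := (α, (x : ℂ))) x.2).symm

theorem projectiveAt_glued (α : E) (x : FatGraph.strip (Z α)) :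
    K.regularSurface.ProjectiveAt (fun y : FatGraph.strip (Z α) => Complex.exp (y : ℂ))
      (fun y => (K.homeo (Γ.glued Z α y) : K.regularSurface.carrier)) x :=
  K.projectiveAt_of_lift (g := Subtype.val) continuous_subtype_val.continuousAt x.2
    (Eventually.of_forall fun y => K.homeo_glued α y) (MobiusAt.refl _ _)

end CuspSystem
end FatGraph

end

noncomputable section

/-! ### Möbius maps of the unit disk -/

namespace Complex.UnitDisc

theorem map_coe_nhds (w : UnitDisc) :
    Filter.map (fun v : UnitDisc => (v : ℂ)) (𝓝 w) = 𝓝 (w : ℂ) := by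
  have hr : Set.range (fun v : UnitDisc => (v : ℂ)) = Metric.ball 0 1 := by
    ext z
    constructor
    · rintro ⟨v, rfl⟩
      exact mem_ball_zero_iff.2 v.norm_lt_one
    · intro hz
      exact ⟨mk z (mem_ball_zero_iff.1 hz), rfl⟩
  refine isEmbedding_coe.map_nhds_of_mem w ?_
  rw [hr]
  exact Metric.isOpen_ball.mem_nhds (mem_ball_zero_iff.2 w.norm_lt_one)

instance : ConnectedSpace UnitDisc :=
  Subtype.connectedSpace
    ⟨⟨0, Metric.mem_ball_self one_pos⟩, (convex_ball (0 : ℂ) 1).isPreconnected⟩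

theorem comap_coe_neBot {ξ : ℂ} (h : ‖ξ‖ = 1) :
    NeBot (comap (fun w : UnitDisc => (w : ℂ)) (𝓝 ξ)) := by
  rw [comap_neBot_iff]
  intro t ht
  have h1 : ξ ∈ closure (Metric.ball (0 : ℂ) 1) := by
    rw [closure_ball _ one_ne_zero, mem_closedBall_zero_iff, h]
  obtain ⟨z, hz, hz1⟩ := mem_closure_iff_nhds.1 h1 t ht
  exact ⟨mk z (mem_ball_zero_iff.1 hz1), hz⟩

end Complex.UnitDisc

open Complex.UnitDisc in
/-- A function on a disk that is locally a Möbius function is one Möbius function. -/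
theorem exists_mobius_of_locally {r : ℝ} (hr : 0 < r) {F : ℂ → ℂ}
    (h : ∀ w, ‖w‖ < r → MobiusAt id F w) : ∃ a b c d : ℂ, a * d - b * c ≠ 0 ∧
      ∀ w, ‖w‖ < r → c * w + d ≠ 0 ∧ F w = (a * w + b) / (c * w + d) := by
  have hF : AnalyticOnNhd ℂ F (Metric.ball 0 r) := by
    intro w hw
    obtain ⟨a, b, c, d, -, hm⟩ := h w (mem_ball_zero_iff.1 hw)
    refine AnalyticAt.congr (f := fun w => (a * w + b) / (c * w + d)) ?_
      (hm.mono fun q hq => hq.2.symm)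
    exact AnalyticAt.div (by fun_prop) (by fun_prop) hm.self_of_nhds.1
  obtain ⟨a, b, c, d, hD, hm⟩ := h 0 (by simpa using hr)
  refine ⟨a, b, c, d, hD, ?_⟩
  have hG : AnalyticOnNhd ℂ (fun w => F w * (c * w + d) - (a * w + b)) (Metric.ball 0 r) :=
    fun w hw => ((hF w hw).mul (by fun_prop)).sub (by fun_prop)
  have h0 := hG.eqOn_zero_of_preconnected_of_eventuallyEq_zero (convex_ball 0 r).isPreconnected
    (Metric.mem_ball_self hr) (hm.mono fun q hq => by
      obtain ⟨h1, h2⟩ := hq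
      simp only [id] at h1 h2
      simp only [Pi.zero_apply, h2, div_mul_cancel₀ _ h1, sub_self])
  intro w hw
  have h1 := h0 (mem_ball_zero_iff.2 hw)
  simp only [Pi.zero_apply, sub_eq_zero] at h1
  have h2 : c * w + d ≠ 0 := by
    intro h2
    rw [h2, mul_zero] at h1
    apply hD
    -- a common zero of numerator and denominator makes the determinant vanish
    by_cases hc : c = 0
    · rw [hc, zero_mul, zero_add] at h2
      rw [hc, h2]; ring
    · have e : c * (a * d - b * c) = 0 := by linear_combination a * c * h2 - c ^ 2 * (-h1)
      exact (mul_eq_zero.1 e).resolve_left hc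
  exact ⟨h2, by rw [eq_div_iff h2, h1]⟩

namespace RegularProjectiveSurface

open Complex (UnitDisc)

theorem isMobiusSelfMap_of_locally {f : UnitDisc → UnitDisc}
    (h : ∀ w, MobiusAt (fun v : UnitDisc => (v : ℂ)) (fun v => (f v : ℂ)) w) :
    IsMobiusSelfMap f := by
  set F : ℂ → ℂ := fun z => if hz : ‖z‖ < 1 then f (UnitDisc.mk z hz) else 0 with hF
  have hFf : ∀ w : UnitDisc, F w = f w := fun w => by
    simp only [hF, dif_pos w.norm_lt_one, UnitDisc.mk_coe]
  obtain ⟨a, b, c, d, hD, hm⟩ := exists_mobius_of_locally one_pos (F := F) (fun z hz => by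
    have h1 := h (UnitDisc.mk z hz)
    have h2 : MobiusAt (fun v : UnitDisc => id (v : ℂ)) (fun v => F (v : ℂ)) (UnitDisc.mk z hz) :=
      h1.congr EventuallyEq.rfl (Eventually.of_forall fun v => (hFf v).symm)
    exact h2.of_map (UnitDisc.map_coe_nhds _))
  refine ⟨a, b, c, d, hD, fun w => ?_⟩
  rw [← hFf]
  exact hm w w.norm_lt_one

theorem IsMobiusSelfMap.comp {f g : UnitDisc → UnitDisc} (hf : IsMobiusSelfMap f)
    (hg : IsMobiusSelfMap g) : IsMobiusSelfMap (f ∘ g) := by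
  have loc : ∀ {f : UnitDisc → UnitDisc}, IsMobiusSelfMap f → ∀ w,
      MobiusAt (fun v : UnitDisc => (v : ℂ)) (fun v => (f v : ℂ)) w := by
    rintro f ⟨a, b, c, d, hD, h⟩ w
    exact ⟨a, b, c, d, hD, Eventually.of_forall h⟩
  have cont : Continuous g := by
    obtain ⟨a, b, c, d, hD, h⟩ := hg
    refine UnitDisc.isEmbedding_coe.continuous_iff.2 ?_
    have e : (fun w : UnitDisc => (w : ℂ)) ∘ g =
        fun w : UnitDisc => (a * (w : ℂ) + b) / (c * (w : ℂ) + d) := funext fun w => (h w).2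
    rw [e]
    have := UnitDisc.continuous_coe
    exact Continuous.div (by fun_prop) (by fun_prop) fun w => (h w).1
  exact isMobiusSelfMap_of_locally fun w =>
    (loc hg w).trans ((loc hf (g w)).comp cont.continuousAt)

theorem IsMobiusSelfMap.id : IsMobiusSelfMap id :=
  ⟨1, 0, 0, 1, by simp, fun w => by simp⟩

theorem IsMobiusSelfMap.injective {f : UnitDisc → UnitDisc} (hf : IsMobiusSelfMap f) :
    Function.Injective f := by
  obtain ⟨a, b, c, d, hD, h⟩ := hf
  intro v w hvw
  have h1 := (h v).2
  rw [hvw, (h w).2, div_eq_div_iff (h w).1 (h v).1] at h1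
  have e : (a * d - b * c) * ((v : ℂ) - w) = 0 := by linear_combination -h1
  exact UnitDisc.coe_injective (sub_eq_zero.1 ((mul_eq_zero.1 e).resolve_left hD))

/-- A Möbius self map of the open disk extends to the closed disk. -/
theorem IsMobiusSelfMap.exists_ext {f : UnitDisc → UnitDisc} (hf : IsMobiusSelfMap f) :
    ∃ a b c d : ℂ, a * d - b * c ≠ 0 ∧
      (∀ ξ, ‖ξ‖ ≤ 1 → c * ξ + d ≠ 0 ∧ ‖(a * ξ + b) / (c * ξ + d)‖ ≤ 1) ∧
      ∀ w : UnitDisc, (f w : ℂ) = (a * (w : ℂ) + b) / (c * (w : ℂ) + d) := by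
  obtain ⟨a, b, c, d, hD, h⟩ := hf
  refine ⟨a, b, c, d, hD, ?_, fun w => (h w).2⟩
  have hle : ∀ ξ, ‖ξ‖ ≤ 1 → ‖a * ξ + b‖ ≤ ‖c * ξ + d‖ := by
    have hcl : closure (Metric.ball (0 : ℂ) 1) ⊆ {ξ | ‖a * ξ + b‖ ≤ ‖c * ξ + d‖} := by
      refine closure_minimal (fun z hz => ?_) (isClosed_le (by fun_prop) (by fun_prop))
      have h1 := h (UnitDisc.mk z (mem_ball_zero_iff.1 hz))
      have h2 := (f (UnitDisc.mk z (mem_ball_zero_iff.1 hz))).norm_lt_one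
      rw [h1.2, norm_div, div_lt_one (norm_pos_iff.2 h1.1)] at h2
      exact h2.le
    intro ξ hξ
    refine hcl ?_
    rw [closure_ball _ one_ne_zero]
    exact mem_closedBall_zero_iff.2 hξ
  intro ξ hξ
  have h1 := hle ξ hξ
  have h2 : c * ξ + d ≠ 0 := by
    intro h2
    rw [h2, norm_zero, norm_le_zero_iff] at h1
    apply hD
    by_cases hc : c = 0
    · rw [hc, zero_mul, zero_add] at h2
      rw [hc, h2]; ring
    · have e : c * (a * d - b * c) = 0 := by linear_combination a * c * h2 - c ^ 2 * h1
      exact (mul_eq_zero.1 e).resolve_left hc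
  exact ⟨h2, by rw [norm_div, div_le_one (norm_pos_iff.2 h2)]; exact h1⟩

end RegularProjectiveSurface

/-- The projective automorphisms of the unit disk, as functions on the plane.  The parameters are
the image `p` of `0` and a unit factor `τ`. -/
def discAutFun (p τ w : ℂ) : ℂ := (p + τ * w) / (1 + starRingEnd ℂ p * τ * w)

section discAutFun
variable {p τ w : ℂ}

theorem discAut_denom_ne (hp : ‖p‖ < 1) (hτ : ‖τ‖ = 1) (hw : ‖w‖ ≤ 1) :
    1 + starRingEnd ℂ p * τ * w ≠ 0 := by
  intro h
  have h1 : ‖starRingEnd ℂ p * τ * w‖ < 1 := by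
    rw [norm_mul, norm_mul, RCLike.norm_conj, hτ, mul_one]
    calc ‖p‖ * ‖w‖ ≤ ‖p‖ * 1 := by gcongr
      _ < 1 := by linarith
  rw [show starRingEnd ℂ p * τ * w = -1 by linear_combination h, norm_neg, norm_one] at h1
  exact lt_irrefl _ h1

theorem normSq_discAut (p w : ℂ) (hτ : ‖τ‖ = 1) :
    Complex.normSq (1 + starRingEnd ℂ p * τ * w) - Complex.normSq (p + τ * w) =
      (1 - Complex.normSq p) * (1 - Complex.normSq w) := by
  have h1 : Complex.normSq τ = 1 := by rw [Complex.normSq_eq_norm_sq, hτ, one_pow]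
  have h2 : Complex.normSq (τ * w) = Complex.normSq w := by rw [map_mul, h1, one_mul]
  rw [← h2, mul_assoc]
  generalize τ * w = v
  simp only [Complex.normSq_apply, Complex.add_re, Complex.add_im, Complex.mul_re, Complex.mul_im,
    Complex.one_re, Complex.one_im, Complex.conj_re, Complex.conj_im]
  ring

theorem norm_discAut_lt (hp : ‖p‖ < 1) (hτ : ‖τ‖ = 1) (hw : ‖w‖ < 1) :
    ‖discAutFun p τ w‖ < 1 := by
  have h0 := discAut_denom_ne hp hτ hw.le
  rw [discAutFun, norm_div, div_lt_one (norm_pos_iff.2 h0)]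
  have h1 := normSq_discAut p w hτ
  simp only [Complex.normSq_eq_norm_sq] at h1
  have h2 : 0 < (1 - ‖p‖ ^ 2) * (1 - ‖w‖ ^ 2) := by
    have := norm_nonneg p
    have := norm_nonneg w
    apply mul_pos <;> nlinarith
  exact lt_of_pow_lt_pow_left₀ 2 (norm_nonneg _) (by linarith)

theorem norm_discAut_eq (hp : ‖p‖ < 1) (hτ : ‖τ‖ = 1) (hw : ‖w‖ = 1) :
    ‖discAutFun p τ w‖ = 1 := by
  have h0 := discAut_denom_ne hp hτ hw.le
  rw [discAutFun, norm_div, div_eq_one_iff_eq (norm_pos_iff.2 h0).ne']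
  have h1 := normSq_discAut p w hτ
  simp only [Complex.normSq_eq_norm_sq, hw] at h1
  exact (sq_eq_sq₀ (norm_nonneg _) (norm_nonneg _)).1 (by linarith)

theorem discAut_inv (hp : ‖p‖ < 1) (hτ : ‖τ‖ = 1) (hw : ‖w‖ ≤ 1) :
    discAutFun (-(starRingEnd ℂ τ * p)) (starRingEnd ℂ τ) (discAutFun p τ w) = w := by
  have h0 := discAut_denom_ne hp hτ hw
  have h1 : starRingEnd ℂ τ * τ = 1 := by
    rw [mul_comm, Complex.mul_conj, Complex.normSq_eq_norm_sq, hτ]; simp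
  have h2 : 1 - starRingEnd ℂ p * p ≠ 0 := by
    rw [mul_comm, Complex.mul_conj, Complex.normSq_eq_norm_sq]
    norm_cast
    have := norm_nonneg p
    nlinarith
  have hq : discAutFun p τ w * (1 + starRingEnd ℂ p * τ * w) = p + τ * w :=
    div_mul_cancel₀ _ h0
  have e1 : -(starRingEnd ℂ τ * p) + starRingEnd ℂ τ * discAutFun p τ w =
      (1 - starRingEnd ℂ p * p) * w / (1 + starRingEnd ℂ p * τ * w) := by
    rw [eq_div_iff h0]
    linear_combination starRingEnd ℂ τ * hq + (w - starRingEnd ℂ p * p * w) * h1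
  have e2 : 1 + starRingEnd ℂ (-(starRingEnd ℂ τ * p)) * starRingEnd ℂ τ * discAutFun p τ w =
      (1 - starRingEnd ℂ p * p) / (1 + starRingEnd ℂ p * τ * w) := by
    rw [eq_div_iff h0, map_neg, map_mul, Complex.conj_conj]
    linear_combination -(τ * starRingEnd ℂ p * starRingEnd ℂ τ) * hq -
      (starRingEnd ℂ p * p + starRingEnd ℂ p * τ * w) * h1
  rw [discAutFun, e1, e2, div_div_div_cancel_right₀ h0, mul_div_cancel_left₀ _ h2]

theorem discAut_inv' (hp : ‖p‖ < 1) (hτ : ‖τ‖ = 1) (hw : ‖w‖ ≤ 1) :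
    discAutFun p τ (discAutFun (-(starRingEnd ℂ τ * p)) (starRingEnd ℂ τ) w) = w := by
  have h1 : τ * starRingEnd ℂ τ = 1 := by
    rw [Complex.mul_conj, Complex.normSq_eq_norm_sq, hτ]; simp
  have h := discAut_inv (p := -(starRingEnd ℂ τ * p)) (τ := starRingEnd ℂ τ) (w := w)
    (by rw [norm_neg, norm_mul, RCLike.norm_conj, hτ, one_mul]; exact hp)
    (by rw [RCLike.norm_conj, hτ]) hw
  rw [Complex.conj_conj] at h
  convert! h using 2
  linear_combination -p * h1

theorem discAut_inv_params (hp : ‖p‖ < 1) (hτ : ‖τ‖ = 1) :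
    ‖-(starRingEnd ℂ τ * p)‖ < 1 ∧ ‖starRingEnd ℂ τ‖ = 1 := by
  rw [norm_neg, norm_mul, RCLike.norm_conj, hτ, one_mul]
  exact ⟨hp, rfl⟩

/-- A non-negative trigonometric polynomial of degree one that vanishes at two points of the unit
circle is zero. -/
theorem eq_zero_of_trigonometric {A : ℝ} {B ξ η : ℂ}
    (h : ∀ ζ : ℂ, ‖ζ‖ = 1 → 0 ≤ A + 2 * (B * ζ).re) (hξ : ‖ξ‖ = 1) (hη : ‖η‖ = 1) (hne : ξ ≠ η)
    (h1 : A + 2 * (B * ξ).re = 0) (h2 : A + 2 * (B * η).re = 0) : A = 0 ∧ B = 0 := by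
  have hB : B = 0 := by
    by_contra hB
    have hB' : (‖B‖ : ℂ) ≠ 0 := by exact_mod_cast (norm_pos_iff.2 hB).ne'
    have hA := h (-(starRingEnd ℂ B / ‖B‖)) (by
      rw [norm_neg, norm_div, RCLike.norm_conj, Complex.norm_real, norm_norm,
        div_self (norm_pos_iff.2 hB).ne'])
    have e : B * -(starRingEnd ℂ B / ‖B‖) = ((-‖B‖ : ℝ) : ℂ) := by
      rw [mul_neg, ← mul_div_assoc, Complex.mul_conj, Complex.normSq_eq_norm_sq]
      push_cast
      field_simp
    rw [e, Complex.ofReal_re] at hA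
    have key : ∀ ζ : ℂ, ‖ζ‖ = 1 → A + 2 * (B * ζ).re = 0 → B * ζ = ((-‖B‖ : ℝ) : ℂ) := by
      intro ζ hζ h0
      have hn : ‖B * ζ‖ = ‖B‖ := by rw [norm_mul, hζ, mul_one]
      have h3 := Complex.abs_re_le_norm (B * ζ)
      rw [hn, abs_le] at h3
      have hre : (B * ζ).re = -‖B‖ := by linarith
      refine Complex.ext (by rw [hre, Complex.ofReal_re]) ?_
      have h4 := Complex.normSq_apply (B * ζ)
      rw [Complex.normSq_eq_norm_sq, hn, hre] at h4
      rw [Complex.ofReal_im]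
      exact mul_self_eq_zero.1 (by linarith)
    exact hne (mul_left_cancel₀ hB ((key ξ hξ h1).trans (key η hη h2).symm))
  refine ⟨?_, hB⟩
  rw [hB] at h1
  simpa using h1

end discAutFun

namespace RegularProjectiveSurface

open Complex (UnitDisc)

/-- The projective automorphisms of the unit disk. -/
def discAut (p : UnitDisc) (τ : Circle) (w : UnitDisc) : UnitDisc :=
  UnitDisc.mk (discAutFun p τ w) (norm_discAut_lt p.norm_lt_one τ.norm_coe w.norm_lt_one)

theorem coe_discAut (p : UnitDisc) (τ : Circle) (w : UnitDisc) :
    (discAut p τ w : ℂ) = discAutFun p τ w := rfl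

theorem isMobiusSelfMap_discAut (p : UnitDisc) (τ : Circle) : IsMobiusSelfMap (discAut p τ) := by
  refine ⟨τ, p, starRingEnd ℂ p * τ, 1, ?_, fun w => ⟨?_, ?_⟩⟩
  · have h2 : 1 - (p : ℂ) * starRingEnd ℂ p ≠ 0 := by
      rw [Complex.mul_conj, Complex.normSq_eq_norm_sq]
      norm_cast
      have := norm_nonneg (p : ℂ)
      have := p.norm_lt_one
      nlinarith
    have e : (τ : ℂ) * 1 - p * (starRingEnd ℂ p * τ) = τ * (1 - p * starRingEnd ℂ p) := by ring
    rw [e]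
    exact mul_ne_zero τ.coe_ne_zero h2
  · rw [add_comm]
    exact discAut_denom_ne p.norm_lt_one τ.norm_coe w.norm_lt_one.le
  · rw [coe_discAut, discAutFun, add_comm, add_comm (1 : ℂ)]

theorem exists_discAut_inv (p : UnitDisc) (τ : Circle) : ∃ (p' : UnitDisc) (τ' : Circle),
    ∀ w, discAut p' τ' (discAut p τ w) = w := by
  refine ⟨UnitDisc.mk (-(starRingEnd ℂ τ * p)) ?_, τ⁻¹, fun w => ?_⟩
  · rw [norm_neg, norm_mul, RCLike.norm_conj, τ.norm_coe, one_mul]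
    exact p.norm_lt_one
  · apply UnitDisc.coe_injective
    rw [coe_discAut, coe_discAut, UnitDisc.coe_mk, Circle.coe_inv_eq_conj]
    exact discAut_inv p.norm_lt_one τ.norm_coe w.norm_lt_one.le

theorem bijective_discAut (p : UnitDisc) (τ : Circle) : Function.Bijective (discAut p τ) := by
  obtain ⟨p', τ', h⟩ := exists_discAut_inv p τ
  obtain ⟨p'', τ'', h'⟩ := exists_discAut_inv p' τ'
  refine ⟨(isMobiusSelfMap_discAut p τ).injective, fun v => ⟨discAut p' τ' v, ?_⟩⟩
  exact (isMobiusSelfMap_discAut p' τ').injective (h _)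

theorem continuous_discAut (p : UnitDisc) (τ : Circle) : Continuous (discAut p τ) := by
  refine UnitDisc.isEmbedding_coe.continuous_iff.2 ?_
  have := UnitDisc.continuous_coe
  exact Continuous.div (by fun_prop) (by fun_prop)
    fun w => discAut_denom_ne p.norm_lt_one τ.norm_coe w.norm_lt_one.le

/-- A Möbius function that takes the closed disk to itself and two boundary points to boundary
points is an automorphism of the disk: the function `‖c w + d‖² - ‖a w + b‖²` on the unit
circle is a trigonometric polynomial of degree one that is non-negative and vanishes twice. -/
theorem exists_eq_discAut {a b c d : ℂ} (hD : a * d - b * c ≠ 0)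
    (h : ∀ ξ, ‖ξ‖ ≤ 1 → c * ξ + d ≠ 0 ∧ ‖(a * ξ + b) / (c * ξ + d)‖ ≤ 1)
    {ξ₁ ξ₂ : ℂ} (hξ₁ : ‖ξ₁‖ = 1) (hξ₂ : ‖ξ₂‖ = 1) (hne : ξ₁ ≠ ξ₂)
    (h1 : ‖(a * ξ₁ + b) / (c * ξ₁ + d)‖ = 1) (h2 : ‖(a * ξ₂ + b) / (c * ξ₂ + d)‖ = 1) :
    ∃ (p : UnitDisc) (τ : Circle), ∀ w, (a * w + b) / (c * w + d) = discAutFun p τ w := by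
  have hsq : ∀ ξ, ‖ξ‖ ≤ 1 → Complex.normSq (a * ξ + b) ≤ Complex.normSq (c * ξ + d) := by
    intro ξ hξ
    obtain ⟨e1, e2⟩ := h ξ hξ
    rw [norm_div, div_le_one (norm_pos_iff.2 e1)] at e2
    rw [Complex.normSq_eq_norm_sq, Complex.normSq_eq_norm_sq]
    gcongr
  have heq : ∀ ξ, ‖ξ‖ ≤ 1 → ‖(a * ξ + b) / (c * ξ + d)‖ = 1 →
      Complex.normSq (a * ξ + b) = Complex.normSq (c * ξ + d) := by
    intro ξ hξ he
    obtain ⟨e1, -⟩ := h ξ hξ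
    rw [norm_div, div_eq_one_iff_eq (norm_pos_iff.2 e1).ne'] at he
    rw [Complex.normSq_eq_norm_sq, Complex.normSq_eq_norm_sq, he]
  -- the trigonometric polynomial
  have htr : ∀ ξ : ℂ, ‖ξ‖ = 1 → Complex.normSq (c * ξ + d) - Complex.normSq (a * ξ + b) =
      (Complex.normSq c + Complex.normSq d - (Complex.normSq a + Complex.normSq b)) +
        2 * ((c * starRingEnd ℂ d - a * starRingEnd ℂ b) * ξ).re := by
    intro ξ hξ
    have e : Complex.normSq ξ = 1 := by rw [Complex.normSq_eq_norm_sq, hξ, one_pow]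
    have e1 : ∀ x y : ℂ, Complex.normSq (x * ξ + y) =
        Complex.normSq x + Complex.normSq y + 2 * (x * starRingEnd ℂ y * ξ).re := by
      intro x y
      rw [Complex.normSq_add, map_mul, e, mul_one, mul_right_comm]
    rw [e1, e1, sub_mul, Complex.sub_re]
    ring
  obtain ⟨k1, k2⟩ := eq_zero_of_trigonometric
    (fun ζ hζ => by rw [← htr ζ hζ]; exact sub_nonneg.2 (hsq ζ hζ.le)) hξ₁ hξ₂ hne
    (by rw [← htr ξ₁ hξ₁, heq ξ₁ hξ₁.le h1, sub_self])
    (by rw [← htr ξ₂ hξ₂, heq ξ₂ hξ₂.le h2, sub_self])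
  have hd : d ≠ 0 := by simpa using (h 0 (by simp)).1
  have eA : Complex.normSq c + Complex.normSq d = Complex.normSq a + Complex.normSq b :=
    sub_eq_zero.1 k1
  have eB : c * starRingEnd ℂ d = a * starRingEnd ℂ b := sub_eq_zero.1 k2
  have hdd : starRingEnd ℂ d ≠ 0 := (map_ne_zero _).2 hd
  set p := b / d with hp
  have hb : b = p * d := by rw [hp, div_mul_cancel₀ _ hd]
  have hc : c = a * starRingEnd ℂ p := by
    rw [hp, map_div₀, ← mul_div_assoc, eq_div_iff hdd, eB]
  have hD' : a * d * (1 - p * starRingEnd ℂ p) ≠ 0 := by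
    convert! hD using 1
    rw [hc, hb]; ring
  have hp2 : 1 - Complex.normSq p ≠ 0 := by
    intro h0
    apply hD'
    rw [Complex.mul_conj]
    have : (1 - (Complex.normSq p : ℂ)) = ((1 - Complex.normSq p : ℝ) : ℂ) := by push_cast; rfl
    rw [this, h0]; simp
  have hp1 : ‖p‖ < 1 := by
    have h3 := (h 0 (by simp)).2
    rw [mul_zero, mul_zero, zero_add, zero_add] at h3
    refine lt_of_le_of_ne h3 fun h4 => hp2 ?_
    rw [Complex.normSq_eq_norm_sq, hp, h4]; norm_num
  have had : Complex.normSq a = Complex.normSq d := by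
    rw [hc, hb, map_mul, map_mul, Complex.normSq_conj] at eA
    have : (Complex.normSq a - Complex.normSq d) * (1 - Complex.normSq p) = 0 := by
      linear_combination -eA
    linarith [(mul_eq_zero.1 this).resolve_right hp2]
  have hτ : ‖a / d‖ = 1 := by
    rw [norm_div, div_eq_one_iff_eq (norm_pos_iff.2 hd).ne']
    rw [Complex.normSq_eq_norm_sq, Complex.normSq_eq_norm_sq] at had
    exact (sq_eq_sq₀ (norm_nonneg _) (norm_nonneg _)).1 had
  refine ⟨UnitDisc.mk p hp1, ⟨a / d, mem_sphere_zero_iff_norm.2 hτ⟩, fun w => ?_⟩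
  rw [UnitDisc.coe_mk, discAutFun, hc]
  change _ = (p + a / d * w) / (1 + starRingEnd ℂ p * (a / d) * w)
  rw [← mul_div_mul_right (p + a / d * w) _ hd]
  congr 1
  · rw [hp]; field_simp; ring
  · field_simp; ring

/-- A surjective Möbius self map of the disk is an automorphism. -/
theorem IsMobiusSelfMap.eq_discAut {f : UnitDisc → UnitDisc} (hf : IsMobiusSelfMap f)
    (hb : Function.Surjective f) : ∃ (p : UnitDisc) (τ : Circle), f = discAut p τ := by
  obtain ⟨a, b, c, d, hD, h, hf'⟩ := hf.exists_ext
  have hbd : ∀ ξ : ℂ, ‖ξ‖ = 1 → ‖(a * ξ + b) / (c * ξ + d)‖ = 1 := by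
    intro ξ hξ
    obtain ⟨h1, h2⟩ := h ξ hξ.le
    refine le_antisymm h2 (not_lt.1 fun hlt => ?_)
    obtain ⟨w, hw⟩ := hb (UnitDisc.mk _ hlt)
    have h3 := congrArg (fun v : UnitDisc => (v : ℂ)) hw
    simp only [hf', UnitDisc.coe_mk] at h3
    rw [div_eq_div_iff (h w w.norm_lt_one.le).1 h1] at h3
    have e : (a * d - b * c) * ((w : ℂ) - ξ) = 0 := by linear_combination h3
    have h4 := sub_eq_zero.1 ((mul_eq_zero.1 e).resolve_left hD)
    have := w.norm_lt_one
    rw [h4, hξ] at this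
    exact lt_irrefl _ this
  obtain ⟨p, τ, h⟩ := exists_eq_discAut hD h (ξ₁ := 1) (ξ₂ := -1) (by simp) (by simp)
    (by norm_num) (hbd 1 (by simp)) (hbd (-1) (by simp))
  exact ⟨p, τ, funext fun w => UnitDisc.coe_injective (by rw [hf', h]; rfl)⟩

end RegularProjectiveSurface

end

noncomputable section

/-! ### Half planes in logarithmic coordinates -/

open Complex (UnitDisc)

/-- The coordinate `x` on the half plane `θ - π < Im x < θ`, parametrized by the unit disk.  It is
`halfPlaneLog θ` on the open disk and, unlike that function, continuous at the points of the unit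
circle other than `1` and `-1`. -/
def halfLog (θ : ℝ) (w : ℂ) : ℂ := Complex.log ((1 + w) / (1 - w)) + (θ - Real.pi / 2) * Complex.I

section halfLog
variable {θ : ℝ} {w : ℂ}

theorem cayley_re (w : ℂ) : ((1 + w) / (1 - w)).re = (1 - ‖w‖ ^ 2) / Complex.normSq (1 - w) := by
  rw [Complex.div_re, ← add_div, ← Complex.normSq_eq_norm_sq, Complex.normSq_apply w]
  congr 1
  simp
  ring

theorem one_sub_ne (hw : ‖w‖ < 1) : 1 - w ≠ 0 := by
  intro h
  rw [← sub_eq_zero.1 h, norm_one] at hw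
  exact lt_irrefl _ hw

theorem cayley_re_pos (hw : ‖w‖ < 1) : 0 < ((1 + w) / (1 - w)).re := by
  rw [cayley_re]
  refine div_pos ?_ (Complex.normSq_pos.2 (one_sub_ne hw))
  have := norm_nonneg w
  nlinarith

theorem cayley_mem_slitPlane (hw : ‖w‖ ≤ 1) (h1 : w ≠ 1) (h2 : w ≠ -1) :
    (1 + w) / (1 - w) ∈ Complex.slitPlane := by
  have h0 : (1 + w) / (1 - w) ≠ 0 := by
    exact div_ne_zero (fun h => h2 (by linear_combination h))
      fun h => h1 (by linear_combination -h)
  rw [Complex.mem_slitPlane_iff]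
  by_contra hc
  push Not at hc
  have h3 : 0 ≤ ((1 + w) / (1 - w)).re := by
    rw [cayley_re]
    refine div_nonneg ?_ (Complex.normSq_nonneg _)
    have := norm_nonneg w
    nlinarith
  exact h0 (Complex.ext (le_antisymm hc.1 h3) hc.2)

theorem halfLog_im_bounds (hw : ‖w‖ < 1) :
    θ - Real.pi < (halfLog θ w).im ∧ (halfLog θ w).im < θ := by
  have h := Complex.abs_arg_lt_pi_div_two_iff.2 (Or.inl (cayley_re_pos hw))
  rw [abs_lt] at h
  rw [halfLog, Complex.add_im, Complex.log_im]
  have e : (((θ : ℂ) - Real.pi / 2) * Complex.I).im = θ - Real.pi / 2 := by simp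
  rw [e]
  constructor <;> linarith

theorem halfLog_im_eq (hw : ‖w‖ = 1) (h1 : w ≠ 1) (h2 : w ≠ -1) :
    (halfLog θ w).im = θ ∨ (halfLog θ w).im = θ - Real.pi := by
  have h0 : ((1 + w) / (1 - w)).re = 0 := by rw [cayley_re, hw]; simp
  have h3 := (Complex.mem_slitPlane_iff.1 (cayley_mem_slitPlane hw.le h1 h2)).resolve_left
    (by rw [h0]; exact lt_irrefl _)
  have e : (((θ : ℂ) - Real.pi / 2) * Complex.I).im = θ - Real.pi / 2 := by simp
  rw [halfLog, Complex.add_im, Complex.log_im, e]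
  rcases lt_or_gt_of_ne h3 with h | h
  · right
    rw [Complex.arg_eq_neg_pi_div_two_iff.2 ⟨h0, h⟩]; ring
  · left
    rw [Complex.arg_eq_pi_div_two_iff.2 ⟨h0, h⟩]; ring

theorem exp_halfLog (hw : (1 + w) / (1 - w) ≠ 0) : Complex.exp (halfLog θ w) =
    Complex.exp ((θ - Real.pi / 2) * Complex.I) * ((1 + w) / (1 - w)) := by
  rw [halfLog, Complex.exp_add, Complex.exp_log hw, mul_comm]

theorem cayley_ne_zero (hw : ‖w‖ < 1) : (1 + w) / (1 - w) ≠ 0 := fun h => by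
  have := cayley_re_pos hw
  rw [h] at this
  exact lt_irrefl _ this

theorem halfPlaneLog_eq_halfLog (hw : ‖w‖ < 1) :
    RegularProjectiveSurface.halfPlaneLog θ w = halfLog θ w := by
  have h0 := cayley_ne_zero hw
  have h := Complex.abs_arg_lt_pi_div_two_iff.2 (Or.inl (cayley_re_pos hw))
  rw [abs_lt] at h
  rw [RegularProjectiveSurface.halfPlaneLog, RegularProjectiveSurface.toLowerHalfPlane, halfLog]
  have e : Complex.log (-Complex.I * (1 + w) / (1 - w)) =
      Complex.log ((1 + w) / (1 - w)) - Real.pi / 2 * Complex.I := by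
    have hpi := Real.pi_pos
    have h1 := Complex.arg_le_pi (-Complex.I * (1 + w) / (1 - w))
    have h2 := Complex.neg_pi_lt_arg (-Complex.I * (1 + w) / (1 - w))
    have e1 : (Complex.log ((1 + w) / (1 - w)) - Real.pi / 2 * Complex.I).im =
        Complex.arg ((1 + w) / (1 - w)) - Real.pi / 2 := by
      rw [Complex.sub_im, Complex.log_im]; simp
    have e2 : -Complex.I * (1 + w) / (1 - w) = -Complex.I * ((1 + w) / (1 - w)) :=
      mul_div_assoc _ _ _
    apply Complex.eq_of_exp_eq
    · rw [e2, Complex.exp_sub, Complex.exp_log h0, Complex.exp_pi_div_two_mul_I,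
        Complex.exp_log (mul_ne_zero (neg_ne_zero.2 Complex.I_ne_zero) h0), Complex.div_I]
      ring
    · rw [e1, Complex.log_im]; linarith
    · rw [e1, Complex.log_im]; linarith
  rw [e]
  ring

theorem cayley_injective {v w : ℂ} (hv : v ≠ 1) (hw : w ≠ 1)
    (h : (1 + v) / (1 - v) = (1 + w) / (1 - w)) : v = w := by
  have e1 : 1 - v ≠ 0 := fun h => hv (by linear_combination -h)
  have e2 : 1 - w ≠ 0 := fun h => hw (by linear_combination -h)
  rw [div_eq_div_iff e1 e2] at h
  linear_combination h / 2

theorem continuousAt_halfLog (hw : ‖w‖ ≤ 1) (h1 : w ≠ 1) (h2 : w ≠ -1) :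
    ContinuousAt (fun q : ℝ × ℂ => halfLog q.1 q.2) (θ, w) := by
  have h3 : 1 - w ≠ 0 := fun h => h1 (by linear_combination -h)
  have hc : ContinuousAt (fun q : ℝ × ℂ => (1 + q.2) / (1 - q.2)) (θ, w) :=
    ContinuousAt.div (by fun_prop) (by fun_prop) h3
  exact (hc.clog (cayley_mem_slitPlane hw h1 h2)).add (by fun_prop)

theorem halfLog_re : (halfLog θ w).re = Real.log ‖(1 + w) / (1 - w)‖ := by
  rw [halfLog, Complex.add_re, Complex.log_re]
  simp

theorem tendsto_halfLog_re_one (θ : ℝ) : Tendsto (fun q : ℝ × UnitDisc => (halfLog q.1 q.2).re)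
    (𝓝 θ ×ˢ comap (fun w : UnitDisc => (w : ℂ)) (𝓝 1)) atTop := by
  have h1 : Tendsto (fun w : ℂ => ‖(1 + w) / (1 - w)‖) (𝓝[≠] 1) atTop := by
    have h2 : Tendsto (fun w : ℂ => ‖1 + w‖) (𝓝[≠] 1) (𝓝 2) := by
      have : ContinuousAt (fun w : ℂ => ‖1 + w‖) 1 := by fun_prop
      have h3 := this.tendsto.mono_left (nhdsWithin_le_nhds (s := {1}ᶜ))
      convert! h3 using 2
      norm_num
    have h4 : Tendsto (fun w : ℂ => ‖1 - w‖⁻¹) (𝓝[≠] 1) atTop := by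
      refine tendsto_inv_nhdsGT_zero.comp (tendsto_nhdsWithin_iff.2 ⟨?_, ?_⟩)
      · have : ContinuousAt (fun w : ℂ => ‖1 - w‖) 1 := by fun_prop
        have h3 := this.tendsto.mono_left (nhdsWithin_le_nhds (s := {1}ᶜ))
        simpa using h3
      · filter_upwards [self_mem_nhdsWithin] with w hw
        exact norm_pos_iff.2 (sub_ne_zero.2 (Ne.symm hw))
    refine (h2.pos_mul_atTop two_pos h4).congr fun w => ?_
    rw [norm_div, div_eq_mul_inv]
  have h5 : Tendsto (fun w : UnitDisc => (w : ℂ)) (comap (fun w : UnitDisc => (w : ℂ)) (𝓝 1))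
      (𝓝[≠] 1) :=
    tendsto_nhdsWithin_iff.2 ⟨tendsto_comap, Eventually.of_forall fun w => w.coe_ne_one⟩
  refine ((Real.tendsto_log_atTop.comp (h1.comp h5)).comp tendsto_snd).congr fun q => ?_
  rw [halfLog_re]; rfl

theorem halfLog_neg_re : (halfLog θ (-w)).re = -(halfLog θ w).re := by
  rw [halfLog_re, halfLog_re, ← Real.log_inv, ← norm_inv, inv_div]
  congr 2
  ring

theorem tendsto_halfLog_re_neg_one (θ : ℝ) :
    Tendsto (fun q : ℝ × UnitDisc => (halfLog q.1 q.2).re)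
      (𝓝 θ ×ˢ comap (fun w : UnitDisc => (w : ℂ)) (𝓝 (-1))) atBot := by
  have h1 : Tendsto (fun w : UnitDisc => -w) (comap (fun w : UnitDisc => (w : ℂ)) (𝓝 (-1)))
      (comap (fun w : UnitDisc => (w : ℂ)) (𝓝 1)) := by
    refine tendsto_comap_iff.2 ?_
    have := (tendsto_comap (f := fun w : UnitDisc => (w : ℂ)) (x := 𝓝 (-1))).neg
    rw [neg_neg] at this
    exact this
  have h2 := (tendsto_halfLog_re_one θ).comp ((tendsto_id (x := 𝓝 θ)).prodMap h1)
  refine (tendsto_neg_atTop_atBot.comp h2).congr fun q => ?_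
  simp only [Function.comp_apply, Prod.map_snd, Prod.map_fst, id, UnitDisc.coe_neg, halfLog_neg_re,
    neg_neg]

theorem mobiusAt_exp_halfLog (θ : ℝ) (w : UnitDisc) :
    MobiusAt (fun v : UnitDisc => (v : ℂ)) (fun v => Complex.exp (halfLog θ v)) w := by
  set e := Complex.exp ((θ - Real.pi / 2) * Complex.I) with he
  refine ⟨e, e, -1, 1, ?_, Eventually.of_forall fun v => ?_⟩
  · rw [show e * 1 - e * -1 = 2 * e by ring]
    exact mul_ne_zero two_ne_zero (Complex.exp_ne_zero _)
  · have h := one_sub_ne v.norm_lt_one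
    refine ⟨by rwa [neg_one_mul, neg_add_eq_sub], ?_⟩
    change Complex.exp (halfLog θ v) = (e * (v : ℂ) + e) / (-1 * (v : ℂ) + 1)
    rw [exp_halfLog (cayley_ne_zero v.norm_lt_one), ← he, neg_one_mul, neg_add_eq_sub]
    ring

theorem Continuous.halfLog {X : Type*} [TopologicalSpace X] {θ : X → ℝ} {w : X → UnitDisc}
    (hθ : Continuous θ) (hw : Continuous w) : Continuous fun x => halfLog (θ x) (w x) := by
  have hc : Continuous fun x => (w x : ℂ) := UnitDisc.continuous_coe.comp hw
  have hθ' : Continuous fun x => (θ x : ℂ) := Complex.continuous_ofReal.comp hθ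
  refine Continuous.add (Continuous.clog ((continuous_const.add hc).div (continuous_const.sub hc)
    fun x => one_sub_ne (w x).norm_lt_one) fun x => ?_) ((hθ'.sub continuous_const).mul
      continuous_const)
  exact cayley_mem_slitPlane (w x).norm_lt_one.le (w x).coe_ne_one (w x).coe_ne_neg_one

attribute [irreducible] halfLog

end halfLog

/-! ### Boundary behaviour of the parametrizations by strips -/

namespace FatGraph

variable {E : Type u} {Γ : FatGraph E} {Z : E → ℂ} [Finite E] [Nonempty E]

namespace CuspSystem

variable (K : CuspSystem Γ Z)

/-- The right end of a strip is the puncture of the face of its edge. -/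
theorem tendsto_strip_atTop (α : E) : Tendsto (K.strip α)
    (comap Complex.re atTop ⊓ 𝓟 (FatGraph.strip (Z α))) (𝓝 (K.puncture (Γ.face α))) := by
  intro W hW
  rw [← par_zero] at hW
  have h1 := K.gluing.continuousAt_par (K.zero_mem_dom (Γ.face α)) hW
  obtain ⟨ρ, hρ, hball⟩ := Metric.mem_nhds_iff.1 (Filter.mem_map.1 h1)
  obtain ⟨C, hC⟩ := (K.cusp (Γ.face α)).surj ρ hρ
  refine Filter.mem_map.2 (mem_inf_iff_superset.2 ⟨_, preimage_mem_comap (Ioi_mem_atTop C), _,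
    mem_principal_self _, ?_⟩)
  rintro x ⟨hx1, hx2⟩
  obtain ⟨ζ, -, hζ, he⟩ := hC (α, x) hx2 (face_out _).symm hx1
  have h2 := hball (mem_ball_zero_iff.2 hζ)
  rwa [Set.mem_preimage, show K.gluing.par (Sum.inr (Γ.face α)) ζ = K.strip α x from he] at h2

theorem strip_flip {α : E} {x : ℂ} (hx : InStrip Z (α, x)) :
    K.strip (Γ.rev α) (Z α - Real.pi * Complex.I - x) = K.strip α x :=
  ((K.strip_eq_iff hx (hx.flip (Γ := Γ) K.rev_eq)).2 (linked_flip_self K.rev_eq _)).symm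

theorem strip_eq_of_tendsto {α β : E} {F : Filter ℂ} {g : ℂ → ℂ} {L : K.Surface} {G : Filter ℂ}
    (h : Tendsto (K.strip β) G (𝓝 L)) (hg : Tendsto g F G)
    (he : ∀ᶠ x in F, K.strip β (g x) = K.strip α x) : Tendsto (K.strip α) F (𝓝 L) :=
  (h.comp hg).congr' he

theorem tendsto_strip_atBot (α : E) : Tendsto (K.strip α)
    (comap Complex.re atBot ⊓ 𝓟 (FatGraph.strip (Z α))) (𝓝 (K.puncture (Γ.face (Γ.rev α)))) := by
  refine K.strip_eq_of_tendsto (K.tendsto_strip_atTop (Γ.rev α))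
    (g := fun x => Z α - Real.pi * Complex.I - x) (tendsto_inf.2 ⟨tendsto_comap_iff.2 ?_, ?_⟩) ?_
  · have h1 : Tendsto Complex.re (comap Complex.re atBot ⊓ 𝓟 (FatGraph.strip (Z α))) atBot :=
      tendsto_comap.mono_left inf_le_left
    refine (tendsto_atTop_add_const_left _ (Z α).re (tendsto_neg_atBot_atTop.comp h1)).congr
      fun x => ?_
    simp; ring
  · refine tendsto_principal.2 (mem_inf_of_right fun x hx => ?_)
    exact (show InStrip Z (α, x) from hx).flip (Γ := Γ) K.rev_eq
  · exact mem_inf_of_right fun x hx => K.strip_flip hx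

theorem strip_turnR {α : E} {x : ℂ} (hx : InStrip Z (α, x)) (h : -Real.pi < (x - Z α).im) :
    K.strip (Γ.right α) (turnR (Z α) x) = K.strip α x := by
  have hs := step_right (Γ := Γ) K.im_pos hx h
  exact ((K.strip_eq_iff hx hs.2.1).2 ⟨1, Or.inl ⟨_, hs, rfl⟩⟩).symm

theorem strip_turnL {α : E} {x : ℂ} (hx : InStrip Z (α, x)) (h : -Real.pi < (x - Z α).im) :
    K.strip (Γ.next (Γ.right α)) (turnL (Z α) x) = K.strip α x := by
  have hs := step_left (Γ := Γ) K.im_pos hx h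
  exact ((K.strip_eq_iff hx hs.2.1).2 ⟨1, Or.inl ⟨_, hs, rfl⟩⟩).symm

omit [Finite E] [Nonempty E] in
theorem eventually_sub_im {α : E} {x₀ : ℂ} (h : x₀.im = (Z α).im) (s : Set ℂ) :
    ∀ᶠ x in 𝓝[s] x₀, -Real.pi < (x - Z α).im := by
  refine nhdsWithin_le_nhds ?_
  have hc : Continuous fun x : ℂ => (x - Z α).im := by fun_prop
  refine (isOpen_lt continuous_const hc).mem_nhds ?_
  simp [h, Real.pi_pos]

omit [Finite E] [Nonempty E] in
theorem inStrip_ofReal (hpos : ∀ α, 0 < (Z α).im) (α : E) (t : ℝ) : InStrip Z (α, (t : ℂ)) :=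
  ⟨by simp [Real.pi_pos], by simpa using hpos α⟩

/-- A point of the upper boundary other than `Z α` corresponds to a point of the real line in one of
the two subsequent strips: the left one if it lies to the left of `Z α`, and the right one
otherwise. -/
theorem exists_tendsto_strip_upper {α : E} {x₀ : ℂ} (h : x₀.im = (Z α).im) (hne : x₀ ≠ Z α) :
    ∃ L ∉ K.punctures, Tendsto (K.strip α) (𝓝[FatGraph.strip (Z α)] x₀) (𝓝 L) := by
  set δ := x₀.re - (Z α).re with hδ
  have hx : x₀ - Z α = (δ : ℂ) := Complex.ext (by simp [hδ]) (by simp [h])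
  have hδ0 : δ ≠ 0 := by
    intro h0
    apply hne
    rw [← sub_eq_zero, hx, h0, Complex.ofReal_zero]
  have he : Complex.exp (x₀ - Z α) = ((Real.exp δ : ℝ) : ℂ) := by rw [hx, Complex.ofReal_exp]
  have hev := eventually_sub_im h (FatGraph.strip (Z α))
  have hst : ∀ᶠ x in 𝓝[FatGraph.strip (Z α)] x₀, InStrip Z (α, x) := self_mem_nhdsWithin
  rcases lt_or_gt_of_ne hδ0 with hneg | hpos
  · -- the left subsequent strip
    have hlt : Real.exp δ < 1 := Real.exp_lt_one_iff.2 hneg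
    have hy : ContinuousAt (fun x => x - Z α - Complex.log (1 - Complex.exp (x - Z α))) x₀ := by
      refine ContinuousAt.sub (by fun_prop) (ContinuousAt.clog (by fun_prop) ?_)
      rw [he, ← Complex.ofReal_one, ← Complex.ofReal_sub]
      exact Complex.ofReal_mem_slitPlane.2 (by linarith)
    have hval : x₀ - Z α - Complex.log (1 - Complex.exp (x₀ - Z α)) =
        ((δ - Real.log (1 - Real.exp δ) : ℝ) : ℂ) := by
      rw [he, hx, ← Complex.ofReal_one, ← Complex.ofReal_sub,
        ← Complex.ofReal_log (by linarith), ← Complex.ofReal_sub]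
    have hin := inStrip_ofReal K.im_pos (Γ.next (Γ.right α)) (δ - Real.log (1 - Real.exp δ))
    rw [← hval] at hin
    refine ⟨_, K.strip_notMem_punctures hin, K.strip_eq_of_tendsto (K.continuousAt_strip hin)
      (hy.tendsto.mono_left nhdsWithin_le_nhds) ?_⟩
    filter_upwards [hev, hst] with x h1 h2
    have h3 := h2.sub_im
    rw [← K.strip_turnL h2 h1]
    congr 1
    have e1 := turnR_add_turnL h1 h3
    rw [turnR_eq_log_one_sub h1 h3] at e1
    linear_combination -e1
  · -- the right subsequent strip
    have hlt : 1 < Real.exp δ := Real.one_lt_exp_iff.2 hpos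
    have hy : ContinuousAt (fun x => turnR (Z α) x) x₀ := by
      refine ContinuousAt.clog (by fun_prop) ?_
      rw [he, ← Complex.ofReal_one, ← Complex.ofReal_sub]
      exact Complex.ofReal_mem_slitPlane.2 (by linarith)
    have hval : turnR (Z α) x₀ = ((Real.log (Real.exp δ - 1) : ℝ) : ℂ) := by
      rw [turnR, he, ← Complex.ofReal_one, ← Complex.ofReal_sub,
        ← Complex.ofReal_log (by linarith)]
    have hin := inStrip_ofReal K.im_pos (Γ.right α) (Real.log (Real.exp δ - 1))
    rw [← hval] at hin
    refine ⟨_, K.strip_notMem_punctures hin, K.strip_eq_of_tendsto (K.continuousAt_strip hin)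
      (hy.tendsto.mono_left nhdsWithin_le_nhds) ?_⟩
    filter_upwards [hev, hst] with x h1 h2
    exact K.strip_turnR h2 h1

/-- The boundary point `Z α` corresponds to the puncture at the left end of the right subsequent
strip. -/
theorem tendsto_strip_number (α : E) : Tendsto (K.strip α) (𝓝[FatGraph.strip (Z α)] (Z α))
    (𝓝 (K.puncture (Γ.face (Γ.rev (Γ.right α))))) := by
  have hev := eventually_sub_im (Z := Z) (α := α) rfl (FatGraph.strip (Z α))
  have hst : ∀ᶠ x in 𝓝[FatGraph.strip (Z α)] (Z α), InStrip Z (α, x) := self_mem_nhdsWithin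
  refine K.strip_eq_of_tendsto (K.tendsto_strip_atBot (Γ.right α)) (g := turnR (Z α))
    (tendsto_inf.2 ⟨tendsto_comap_iff.2 ?_, tendsto_principal.2 ?_⟩) ?_
  · have h1 : Tendsto (fun x => ‖Complex.exp (x - Z α) - 1‖) (𝓝[FatGraph.strip (Z α)] (Z α))
        (𝓝[>] 0) := by
      refine tendsto_nhdsWithin_iff.2 ⟨?_, ?_⟩
      · have : ContinuousAt (fun x => ‖Complex.exp (x - Z α) - 1‖) (Z α) := by fun_prop
        simpa using this.tendsto.mono_left (nhdsWithin_le_nhds (s := FatGraph.strip (Z α)))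
      · filter_upwards [hev, hst] with x h1 h2
        exact norm_pos_iff.2 (Complex.ne_zero_of_im_neg (exp_sub_one_im h1 h2.sub_im))
    refine (Real.tendsto_log_nhdsGT_zero.comp h1).congr fun x => ?_
    rw [Function.comp_apply, Function.comp_apply, turnR, Complex.log_re]
  · filter_upwards [hev, hst] with x h1 h2
    exact (step_right (Γ := Γ) K.im_pos h2 h1).2.1
  · filter_upwards [hev, hst] with x h1 h2
    exact K.strip_turnR h2 h1

/-- The parametrization by a strip extends continuously to the boundary of the strip; exactly two
boundary points correspond to punctures. -/
theorem exists_tendsto_strip {α : E} {x₀ : ℂ} (h1 : -Real.pi ≤ x₀.im) (h2 : x₀.im ≤ (Z α).im) :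
    ∃ L, Tendsto (K.strip α) (𝓝[FatGraph.strip (Z α)] x₀) (𝓝 L) ∧
      (L ∈ K.punctures ↔ x₀ = -(Real.pi * Complex.I) ∨ x₀ = Z α) := by
  have hpi := Real.pi_pos
  have upper : ∀ {α : E} {x₀ : ℂ}, x₀.im = (Z α).im →
      ∃ L, Tendsto (K.strip α) (𝓝[FatGraph.strip (Z α)] x₀) (𝓝 L) ∧
      (L ∈ K.punctures ↔ x₀ = Z α) := by
    intro α x₀ h
    by_cases hne : x₀ = Z α
    · rw [hne]
      exact ⟨_, K.tendsto_strip_number α, by simp [punctures]⟩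
    · obtain ⟨L, hL, hT⟩ := K.exists_tendsto_strip_upper h hne
      exact ⟨L, hT, by simp [hL, hne]⟩
  rcases h1.eq_or_lt with h1 | h1
  · -- the lower boundary is the upper boundary of the strip of the reversed edge
    obtain ⟨L, hT, hL⟩ := upper (α := Γ.rev α) (x₀ := Z α - Real.pi * Complex.I - x₀)
      (by simp [K.rev_eq, ← h1])
    refine ⟨L, K.strip_eq_of_tendsto hT (g := fun x => Z α - Real.pi * Complex.I - x)
      (tendsto_nhdsWithin_iff.2 ⟨?_, ?_⟩) ?_, ?_⟩
    · have hc : Continuous fun x => Z α - Real.pi * Complex.I - x := by fun_prop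
      exact (hc.tendsto x₀).mono_left nhdsWithin_le_nhds
    · filter_upwards [self_mem_nhdsWithin] with x hx
      exact (show InStrip Z (α, x) from hx).flip (Γ := Γ) K.rev_eq
    · filter_upwards [self_mem_nhdsWithin] with x hx
      exact K.strip_flip hx
    · rw [hL, K.rev_eq]
      constructor
      · intro h; left; linear_combination -h
      · rintro (h | h)
        · rw [h]; ring
        · have := K.im_pos α
          rw [h] at h1
          linarith
  · rcases h2.eq_or_lt with h2 | h2
    · obtain ⟨L, hT, hL⟩ := upper h2
      refine ⟨L, hT, hL.trans ⟨Or.inr, ?_⟩⟩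
      rintro (h | h)
      · rw [h] at h1; simp at h1
      · exact h
    · have hin : InStrip Z (α, x₀) := ⟨h1, h2⟩
      refine ⟨_, (K.continuousAt_strip hin).tendsto.mono_left nhdsWithin_le_nhds, ?_⟩
      simp only [K.strip_notMem_punctures hin, false_iff, not_or]
      constructor
      · rintro rfl; simp at h1
      · rintro rfl; exact lt_irrefl _ h2

end CuspSystem
end FatGraph

end

noncomputable section

open Complex (UnitDisc)

/-! ### The disks along an edge -/

/-- `halfLog θ` is onto the closed half plane: the preimage is given by the inverse Cayley
transform. -/
theorem exists_halfLog_eq_of_le {θ : ℝ} {x : ℂ} (h1 : θ - Real.pi ≤ x.im) (h2 : x.im ≤ θ) :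
    ∃ w, ‖w‖ ≤ 1 ∧ w ≠ 1 ∧ w ≠ -1 ∧ halfLog θ w = x := by
  set y := x - (θ - Real.pi / 2) * Complex.I with hy
  have e : (((θ : ℂ) - Real.pi / 2) * Complex.I).im = θ - Real.pi / 2 := by simp
  have hyi : y.im = x.im - (θ - Real.pi / 2) := by rw [hy, Complex.sub_im, e]
  have hpi := Real.pi_pos
  set ζ := Complex.exp y with hζ
  have hre : 0 ≤ ζ.re := by
    rw [hζ, Complex.exp_re]
    exact mul_nonneg (Real.exp_pos _).le (Real.cos_nonneg_of_mem_Icc ⟨by linarith, by linarith⟩)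
  have hζ0 : ζ ≠ 0 := Complex.exp_ne_zero _
  have h0 : ζ + 1 ≠ 0 := fun h => by
    have := congrArg Complex.re h
    simp at this; linarith
  refine ⟨(ζ - 1) / (ζ + 1), ?_, ?_, ?_, ?_⟩
  · rw [norm_div, div_le_one (norm_pos_iff.2 h0)]
    refine le_of_sq_le_sq ?_ (norm_nonneg _)
    rw [← Complex.normSq_eq_norm_sq, ← Complex.normSq_eq_norm_sq, Complex.normSq_apply,
      Complex.normSq_apply]
    simp
    nlinarith
  · rw [Ne, div_eq_iff h0]
    intro h
    have : (2 : ℂ) = 0 := by linear_combination -h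
    norm_num at this
  · rw [Ne, div_eq_iff h0]
    intro h
    exact hζ0 (by linear_combination h / 2)
  · have e1 : (1 + (ζ - 1) / (ζ + 1)) / (1 - (ζ - 1) / (ζ + 1)) = ζ := by
      have e2 : 1 + (ζ - 1) / (ζ + 1) = 2 * ζ / (ζ + 1) := by field_simp; ring
      have e3 : 1 - (ζ - 1) / (ζ + 1) = 2 / (ζ + 1) := by field_simp; ring
      rw [e2, e3, div_div_div_cancel_right₀ h0]
      ring
    rw [halfLog, e1, hζ, Complex.log_exp (by linarith) (by linarith), hy]
    ring

theorem exists_halfLog_eq {θ : ℝ} {x : ℂ} (h1 : θ - Real.pi < x.im) (h2 : x.im < θ) :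
    ∃ w, ‖w‖ < 1 ∧ halfLog θ w = x := by
  obtain ⟨w, hw, e1, e2, rfl⟩ := exists_halfLog_eq_of_le h1.le h2.le
  refine ⟨w, lt_of_le_of_ne hw fun h => ?_, rfl⟩
  rcases halfLog_im_eq (θ := θ) h e1 e2 with h | h
  · exact h2.ne h
  · exact h1.ne' h

theorem halfLog_injective {θ : ℝ} {v w : ℂ} (hv : ‖v‖ ≤ 1) (hv1 : v ≠ 1) (hv2 : v ≠ -1)
    (hw : ‖w‖ ≤ 1) (hw1 : w ≠ 1) (hw2 : w ≠ -1) (h : halfLog θ v = halfLog θ w) : v = w := by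
  have h1 := congrArg Complex.exp h
  rw [exp_halfLog (Complex.slitPlane_ne_zero (cayley_mem_slitPlane hv hv1 hv2)),
    exp_halfLog (Complex.slitPlane_ne_zero (cayley_mem_slitPlane hw hw1 hw2))] at h1
  exact cayley_injective hv1 hw1 (mul_left_cancel₀ (Complex.exp_ne_zero _) h1)

theorem halfLog_zero_neg_I : halfLog 0 (-Complex.I) = -(Real.pi * Complex.I) := by
  have e : (1 + -Complex.I) / (1 - -Complex.I) = -Complex.I := by
    have h0 : (1 - -Complex.I) ≠ 0 := fun h => by simpa using congrArg Complex.re h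
    rw [div_eq_iff h0]
    linear_combination Complex.I_sq
  rw [halfLog, e, Complex.log_neg_I]
  push_cast
  ring

/-- On the unit circle, where `halfPlaneLog` takes the logarithm of real numbers, of either sign, it
agrees with `halfLog` on the arc where `Im x = θ`. -/
theorem halfPlaneLog_eq_halfLog_of_im_eq {θ : ℝ} {w : ℂ} (h0 : ‖w‖ = 1) (hw1 : w ≠ 1)
    (hw2 : w ≠ -1) (h : (halfLog θ w).im = θ) :
    RegularProjectiveSurface.halfPlaneLog θ w = halfLog θ w := by
  have hs := cayley_mem_slitPlane h0.le hw1 hw2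
  set c := (1 + w) / (1 - w) with hc
  have e : (((θ : ℂ) - Real.pi / 2) * Complex.I).im = θ - Real.pi / 2 := by simp
  have harg : c.arg = Real.pi / 2 := by
    rw [halfLog, Complex.add_im, Complex.log_im, e, ← hc] at h
    linarith
  have e2 : RegularProjectiveSurface.toLowerHalfPlane w = -Complex.I * c := mul_div_assoc _ _ _
  rw [RegularProjectiveSurface.halfPlaneLog, halfLog, ← hc, e2]
  have e3 : Complex.log (-Complex.I * c) = Complex.log c - Real.pi / 2 * Complex.I := by
    have hpi := Real.pi_pos
    have h1 := Complex.arg_le_pi (-Complex.I * c)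
    have h2 := Complex.neg_pi_lt_arg (-Complex.I * c)
    have e1 : (Complex.log c - Real.pi / 2 * Complex.I).im = 0 := by
      rw [Complex.sub_im, Complex.log_im, harg]; simp
    have hc0 := Complex.slitPlane_ne_zero hs
    apply Complex.eq_of_exp_eq
    · rw [Complex.exp_sub, Complex.exp_log hc0, Complex.exp_pi_div_two_mul_I,
        Complex.exp_log (mul_ne_zero (neg_ne_zero.2 Complex.I_ne_zero) hc0), Complex.div_I]
      ring
    · rw [e1, Complex.log_im]; linarith
    · rw [e1, Complex.log_im]; linarith
  rw [e3]
  ring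

/-- A Möbius function with values in a half plane `θ - π < arg z < θ` is the composition of a Möbius
self map of the unit disk with the standard parametrization of the half plane. -/
theorem exists_isMobiusSelfMap_halfLog {θ : ℝ} {x : UnitDisc → ℂ}
    (h1 : ∀ w, θ - Real.pi < (x w).im) (h2 : ∀ w, (x w).im < θ)
    (hm : ∃ a b c d : ℂ, a * d - b * c ≠ 0 ∧ ∀ w : UnitDisc, c * (w : ℂ) + d ≠ 0 ∧
      Complex.exp (x w) = (a * (w : ℂ) + b) / (c * (w : ℂ) + d)) :
    ∃ f, RegularProjectiveSurface.IsMobiusSelfMap f ∧ ∀ w, halfLog θ (f w) = x w := by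
  choose g hg hgx using fun w => exists_halfLog_eq (h1 w) (h2 w)
  obtain ⟨a, b, c, d, hD, h⟩ := hm
  set e := Complex.exp ((θ - Real.pi / 2) * Complex.I) with he
  have he0 : e ≠ 0 := Complex.exp_ne_zero _
  refine ⟨fun w => UnitDisc.mk (g w) (hg w), ⟨a - e * c, b - e * d, a + e * c, b + e * d, ?_,
    fun w => ?_⟩, hgx⟩
  · rw [show (a - e * c) * (b + e * d) - (b - e * d) * (a + e * c) =
      2 * e * (a * d - b * c) by ring]
    exact mul_ne_zero (mul_ne_zero two_ne_zero he0) hD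
  · obtain ⟨hden, hval⟩ := h w
    have h3 := one_sub_ne (hg w)
    rw [← hgx, exp_halfLog (cayley_ne_zero (hg w)), ← he, eq_div_iff hden, mul_assoc,
      div_mul_eq_mul_div, ← mul_div_assoc, div_eq_iff h3] at hval
    have h4 : (a + e * c) * (w : ℂ) + (b + e * d) = 2 * e * (c * w + d) / (1 - g w) := by
      rw [eq_div_iff h3]
      linear_combination -hval
    have h5 : (a + e * c) * (w : ℂ) + (b + e * d) ≠ 0 := by
      rw [h4]
      exact div_ne_zero (mul_ne_zero (mul_ne_zero two_ne_zero he0) hden) h3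
    refine ⟨h5, ?_⟩
    rw [UnitDisc.coe_mk, eq_div_iff h5]
    linear_combination hval

namespace FatGraph

variable {E : Type u} {Γ : FatGraph E} {Z : E → ℂ} [Finite E] [Nonempty E]

/-- The angle of the half plane in the strip of `α` that corresponds to the parameter `t`. -/
def angle (Z : E → ℂ) (α : E) (t : unitInterval) : ℝ := t * (Z α).im

omit [Finite E] [Nonempty E] in
theorem inStrip_halfLog {α : E} {θ : ℝ} (h0 : 0 ≤ θ) (h1 : θ ≤ (Z α).im) (w : UnitDisc) :
    InStrip Z (α, halfLog θ w) := by
  have := halfLog_im_bounds (θ := θ) w.norm_lt_one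
  constructor <;> simp only <;> linarith

namespace CuspSystem

variable (K : CuspSystem Γ Z)

omit [Finite E] [Nonempty E] in
include K in
theorem angle_nonneg (α : E) (t : unitInterval) : 0 ≤ angle Z α t :=
  mul_nonneg t.2.1 (K.im_pos α).le

omit [Finite E] [Nonempty E] in
include K in
theorem angle_le (α : E) (t : unitInterval) : angle Z α t ≤ (Z α).im :=
  mul_le_of_le_one_left (K.im_pos α).le t.2.2

omit [Finite E] [Nonempty E] in
theorem angle_zero (α : E) : angle Z α 0 = 0 := by simp [angle]

omit [Finite E] [Nonempty E] in
theorem angle_one (α : E) : angle Z α 1 = (Z α).im := by simp [angle]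

omit [Finite E] [Nonempty E] in
theorem continuous_angle (α : E) : Continuous (angle Z α) :=
  continuous_subtype_val.mul continuous_const

omit [Finite E] [Nonempty E] in
include K in
theorem inStrip_angle (α : E) (t : unitInterval) (w : UnitDisc) :
    InStrip Z (α, halfLog (angle Z α t) w) :=
  inStrip_halfLog (K.angle_nonneg α t) (K.angle_le α t) w

theorem continuous_strip_halfLog (α : E) {X : Type*} [TopologicalSpace X] {t : X → unitInterval}
    {w : X → UnitDisc} (ht : Continuous t) (hw : Continuous w) :
    Continuous fun x => K.strip α (halfLog (angle Z α (t x)) (w x)) := by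
  have h : Continuous fun x => halfLog (angle Z α (t x)) (w x) :=
    ((continuous_angle α).comp ht).halfLog hw
  rw [continuous_iff_continuousAt]
  intro x
  exact ContinuousAt.comp (g := K.strip α) (K.continuousAt_strip (K.inStrip_angle α (t x) (w x)))
    h.continuousAt

/-- The projective disk with parameter `t` along the oriented edge `α`: the half plane
`θ - π < Im x < θ` of the strip of `α`, where `θ = t · Im Z α`. -/
def disk (α : E) (t : unitInterval) : C(UnitDisc, K.Surface) where
  toFun w := K.strip α (halfLog (angle Z α t) w)
  continuous_toFun := K.continuous_strip_halfLog α continuous_const continuous_id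

theorem disk_apply (α : E) (t : unitInterval) (w : UnitDisc) :
    K.disk α t w = K.strip α (halfLog (angle Z α t) w) := rfl

theorem continuous_disk (α : E) :
    Continuous fun q : unitInterval × UnitDisc => K.disk α q.1 q.2 :=
  K.continuous_strip_halfLog α continuous_fst continuous_snd

theorem disk_notMem (α : E) (t : unitInterval) (w : UnitDisc) : K.disk α t w ∉ K.punctures :=
  K.strip_notMem_punctures (K.inStrip_angle α t w)

theorem isProjectiveDisk_disk (α : E) (t : unitInterval) :
    K.regularSurface.IsProjectiveDisk (K.disk α t) := by
  intro w
  have h : Continuous fun w : UnitDisc => halfLog (angle Z α t) w :=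
    continuous_const.halfLog continuous_id
  exact K.projectiveAt_of_lift (g := fun w : UnitDisc => halfLog (angle Z α t) w) h.continuousAt
    (K.inStrip_angle α t w) (Eventually.of_forall fun v => rfl) (mobiusAt_exp_halfLog _ w)

theorem puncture_mem (F : Γ.Face) : K.puncture F ∈ K.punctures := by simp [punctures]

/-- The boundary points at which a disk along an edge takes a puncture as its value. -/
def IsLean (Z : E → ℂ) (α : E) (θ : ℝ) (ξ : ℂ) : Prop :=
  ξ = 1 ∨ ξ = -1 ∨ halfLog θ ξ = -(Real.pi * Complex.I) ∨ halfLog θ ξ = Z α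

/-- The disks along an edge extend continuously, also in the parameter of the edge, to the closed
disk. -/
theorem exists_tendsto_disk (α : E) (t : unitInterval) {ξ : ℂ} (hξ : ‖ξ‖ = 1) :
    ∃ L, Tendsto (fun q : unitInterval × UnitDisc => K.disk α q.1 q.2)
      (𝓝 t ×ˢ comap (fun w : UnitDisc => (w : ℂ)) (𝓝 ξ)) (𝓝 L) ∧
      (L ∈ K.punctures ↔ IsLean Z α (angle Z α t) ξ) := by
  have hang : Tendsto (fun q : unitInterval × UnitDisc => (angle Z α q.1, q.2))
      (𝓝 t ×ˢ comap (fun w : UnitDisc => (w : ℂ)) (𝓝 ξ))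
      (𝓝 (angle Z α t) ×ˢ comap (fun w : UnitDisc => (w : ℂ)) (𝓝 ξ)) :=
    ((continuous_angle α).tendsto t).prodMap tendsto_id
  have hstrip : ∀ q : unitInterval × UnitDisc,
      halfLog (angle Z α q.1) q.2 ∈ FatGraph.strip (Z α) := fun q => K.inStrip_angle α q.1 q.2
  by_cases h1 : ξ = 1
  · subst h1
    refine ⟨_, (K.tendsto_strip_atTop α).comp (tendsto_inf.2 ⟨tendsto_comap_iff.2 ?_,
      tendsto_principal.2 (Eventually.of_forall hstrip)⟩),
      iff_of_true (K.puncture_mem _) (Or.inl rfl)⟩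
    exact (tendsto_halfLog_re_one _).comp hang
  by_cases h2 : ξ = -1
  · subst h2
    refine ⟨_, (K.tendsto_strip_atBot α).comp (tendsto_inf.2 ⟨tendsto_comap_iff.2 ?_,
      tendsto_principal.2 (Eventually.of_forall hstrip)⟩),
      iff_of_true (K.puncture_mem _) (Or.inr (Or.inl rfl))⟩
    exact (tendsto_halfLog_re_neg_one _).comp hang
  have him := halfLog_im_eq (θ := angle Z α t) hξ h1 h2
  have h3 := K.angle_nonneg α t
  have h4 := K.angle_le α t
  have hpi := Real.pi_pos
  obtain ⟨L, hL, hmem⟩ := K.exists_tendsto_strip (α := α) (x₀ := halfLog (angle Z α t) ξ)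
    (by rcases him with h | h <;> linarith) (by rcases him with h | h <;> linarith)
  refine ⟨L, hL.comp (tendsto_nhdsWithin_iff.2 ⟨?_, Eventually.of_forall hstrip⟩), ?_⟩
  · have hc := (continuousAt_halfLog (θ := angle Z α t) hξ.le h1 h2).tendsto
    rw [nhds_prod_eq] at hc
    exact Tendsto.comp (g := fun q : ℝ × ℂ => halfLog q.1 q.2)
      (f := fun q : unitInterval × UnitDisc => (angle Z α q.1, (q.2 : ℂ))) hc
      (((continuous_angle α).tendsto t).prodMap tendsto_comap)
  · rw [hmem, IsLean]
    simp only [h1, h2, false_or]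

theorem tendsto_disk_of_tendsto (α : E) {t : unitInterval} {ξ : ℂ} {L : K.Surface}
    (h : Tendsto (fun q : unitInterval × UnitDisc => K.disk α q.1 q.2)
      (𝓝 t ×ˢ comap (fun w : UnitDisc => (w : ℂ)) (𝓝 ξ)) (𝓝 L)) :
    Tendsto (K.disk α t) (comap (fun w : UnitDisc => (w : ℂ)) (𝓝 ξ)) (𝓝 L) :=
  h.comp ((tendsto_const_nhds (x := t)).prodMk tendsto_id)

theorem mem_leanPoints_disk (α : E) (t : unitInterval) (ξ : ℂ) :
    ξ ∈ K.regularSurface.leanPoints (K.disk α t) ↔ ‖ξ‖ = 1 ∧ IsLean Z α (angle Z α t) ξ := by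
  refine and_congr_right fun hξ => ?_
  obtain ⟨L, hL, hmem⟩ := K.exists_tendsto_disk α t hξ
  have hL := K.tendsto_disk_of_tendsto α hL
  rw [← hmem]
  constructor
  · rintro ⟨p, hp, hT⟩
    have := UnitDisc.comap_coe_neBot hξ
    rwa [tendsto_nhds_unique hL hT]
  · exact fun h => ⟨L, h, hL⟩

omit [Finite E] [Nonempty E] in
include K in
theorem isLean_iff_of_pos {α : E} {t : unitInterval} (h0 : t ≠ 0) {ξ : ℂ} (hξ : ‖ξ‖ = 1) :
    IsLean Z α (angle Z α t) ξ ↔ ξ = 1 ∨ ξ = -1 ∨ halfLog (angle Z α t) ξ = Z α := by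
  have hpos : 0 < angle Z α t := mul_pos (unitInterval.pos_iff_ne_zero.2 h0) (K.im_pos α)
  refine or_congr_right' fun h1 => or_congr_right' fun h2 => or_iff_right fun h => ?_
  have hpi := Real.pi_pos
  rcases halfLog_im_eq (θ := angle Z α t) hξ h1 h2 with h3 | h3 <;> rw [h] at h3 <;>
    simp at h3 <;> linarith

omit [Finite E] [Nonempty E] in
include K in
theorem isLean_iff_of_lt {α : E} {t : unitInterval} (h0 : t ≠ 1) {ξ : ℂ} (hξ : ‖ξ‖ = 1) :
    IsLean Z α (angle Z α t) ξ ↔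
      ξ = 1 ∨ ξ = -1 ∨ halfLog (angle Z α t) ξ = -(Real.pi * Complex.I) := by
  have hpos : angle Z α t < (Z α).im :=
    mul_lt_of_lt_one_left (K.im_pos α) (unitInterval.lt_one_iff_ne_one.2 h0)
  refine or_congr_right' fun h1 => or_congr_right' fun h2 => or_iff_left fun h => ?_
  have hpi := Real.pi_pos
  rcases halfLog_im_eq (θ := angle Z α t) hξ h1 h2 with h3 | h3 <;> rw [h] at h3 <;> linarith

theorem leanPoints_disk_zero (α : E) :
    K.regularSurface.leanPoints (K.disk α 0) = {1, -1, -Complex.I} := by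
  ext ξ
  have hI1 : -Complex.I ≠ 1 := fun h => by simpa using congrArg Complex.re h
  have hI2 : -Complex.I ≠ -1 := fun h => by simpa using congrArg Complex.re h
  rw [mem_leanPoints_disk]
  simp only [Set.mem_insert_iff, Set.mem_singleton_iff]
  constructor
  · rintro ⟨hξ, h⟩
    rw [K.isLean_iff_of_lt zero_ne_one hξ, angle_zero, ← halfLog_zero_neg_I] at h
    by_cases h1 : ξ = 1
    · exact Or.inl h1
    by_cases h2 : ξ = -1
    · exact Or.inr (Or.inl h2)
    · exact Or.inr (Or.inr (halfLog_injective hξ.le h1 h2 (by simp) hI1 hI2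
        ((h.resolve_left h1).resolve_left h2)))
  · intro h
    have hξ : ‖ξ‖ = 1 := by rcases h with rfl | rfl | rfl <;> simp
    refine ⟨hξ, (K.isLean_iff_of_lt zero_ne_one hξ).2 ?_⟩
    rw [angle_zero, ← halfLog_zero_neg_I]
    exact h.imp_right (Or.imp_right (congrArg _))

/-- The disk at the end of `α` has three lean points; `Z α` is the coordinate of the one that does
not stay on along the edge. -/
theorem leanPoints_disk_one (α : E) : ∃ w, K.regularSurface.leanPoints (K.disk α 1) = {1, -1, w} ∧
    w ≠ 1 ∧ w ≠ -1 ∧ RegularProjectiveSurface.halfPlaneLog (Z α).im w = Z α := by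
  have hpi := Real.pi_pos
  obtain ⟨w, hw, hw1, hw2, hwZ⟩ := exists_halfLog_eq_of_le (θ := (Z α).im) (x := Z α)
    (by linarith) le_rfl
  have hw' : ‖w‖ = 1 := by
    refine le_antisymm hw (not_lt.1 fun h => ?_)
    have h := (halfLog_im_bounds (θ := (Z α).im) h).2
    rw [hwZ] at h
    exact lt_irrefl _ h
  refine ⟨w, ?_, hw1, hw2, ?_⟩
  · ext ξ
    rw [mem_leanPoints_disk]
    simp only [Set.mem_insert_iff, Set.mem_singleton_iff]
    constructor
    · rintro ⟨hξ, h⟩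
      rw [K.isLean_iff_of_pos one_ne_zero hξ, angle_one] at h
      by_cases h1 : ξ = 1
      · exact Or.inl h1
      by_cases h2 : ξ = -1
      · exact Or.inr (Or.inl h2)
      · exact Or.inr (Or.inr (halfLog_injective hξ.le h1 h2 hw hw1 hw2
          (((h.resolve_left h1).resolve_left h2).trans hwZ.symm)))
    · intro h
      have hξ : ‖ξ‖ = 1 := by rcases h with rfl | rfl | rfl <;> simp [hw']
      refine ⟨hξ, (K.isLean_iff_of_pos one_ne_zero hξ).2 ?_⟩
      rw [angle_one]
      exact h.imp_right (Or.imp_right fun h => by rw [h, hwZ])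
  · rw [halfPlaneLog_eq_halfLog_of_im_eq hw' hw1 hw2 (by rw [hwZ]), hwZ]

theorem leanPoints_disk_of_ne (α : E) {t : unitInterval} (h0 : t ≠ 0) (h1 : t ≠ 1) :
    K.regularSurface.leanPoints (K.disk α t) ⊆ {1, -1} := by
  intro ξ hξ
  rw [mem_leanPoints_disk] at hξ
  obtain ⟨hξ, h⟩ := hξ
  have h' := (K.isLean_iff_of_pos h0 hξ).1 h
  have h'' := (K.isLean_iff_of_lt h1 hξ).1 h
  simp only [Set.mem_insert_iff, Set.mem_singleton_iff]
  by_cases e1 : ξ = 1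
  · exact Or.inl e1
  by_cases e2 : ξ = -1
  · exact Or.inr e2
  have e := ((h'.resolve_left e1).resolve_left e2).symm.trans
    ((h''.resolve_left e1).resolve_left e2)
  have h3 := K.im_pos α
  rw [e] at h3
  simp at h3
  linarith [Real.pi_pos]

theorem one_mem_leanPoints (α : E) (t : unitInterval) :
    1 ∈ K.regularSurface.leanPoints (K.disk α t) :=
  (K.mem_leanPoints_disk α t 1).2 ⟨by simp, Or.inl rfl⟩

theorem neg_one_mem_leanPoints (α : E) (t : unitInterval) :
    -1 ∈ K.regularSurface.leanPoints (K.disk α t) :=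
  (K.mem_leanPoints_disk α t (-1)).2 ⟨by simp, Or.inr (Or.inl rfl)⟩

theorem projectiveAt_exp_strip (α : E) {x : ℂ} (hx : InStrip Z (α, x)) :
    K.regularSurface.ProjectiveAt Complex.exp (K.strip α) x :=
  K.projectiveAt_of_lift (g := id) continuousAt_id hx (Eventually.of_forall fun _ => rfl)
    (MobiusAt.refl _ _)

end CuspSystem
end FatGraph

end

noncomputable section

open Complex (UnitDisc)

/-! ### Logarithms of Möbius functions -/

/-- Two continuous logarithms of the same function with the same limit agree. -/
theorem eventually_eq_of_exp_eq {X : Type*} {l : Filter X} {x y : X → ℂ} {a : ℂ}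
    (hx : Tendsto x l (𝓝 a)) (hy : Tendsto y l (𝓝 a))
    (h : ∀ᶠ q in l, Complex.exp (x q) = Complex.exp (y q)) : ∀ᶠ q in l, x q = y q := by
  have h1 : Tendsto (fun q => (x q).im - (y q).im) l (𝓝 0) := by
    have := ((Complex.continuous_im.tendsto a).comp hx).sub
      ((Complex.continuous_im.tendsto a).comp hy)
    rwa [sub_self] at this
  have hpi := Real.pi_pos
  filter_upwards [h, h1.eventually (Ioo_mem_nhds (show -(2 * Real.pi) < 0 by linarith)
    (show 0 < 2 * Real.pi by linarith))] with q hq h2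
  exact Complex.eq_of_exp_eq hq h2.2 (by linarith [h2.1])

/-- A logarithm of a Möbius function that is continuous at a point is continuous nearby. -/
theorem eventually_continuousAt_of_exp {x : ℂ → ℂ} {z : ℂ} (hx : ContinuousAt x z)
    (hm : MobiusAt id (fun v => Complex.exp (x v)) z) : ∀ᶠ v in 𝓝 z, ContinuousAt x v := by
  obtain ⟨a, b, c, d, -, h⟩ := hm
  obtain ⟨m, hmdef⟩ : ∃ m : ℂ → ℂ, ∀ v, m v = (a * v + b) / (c * v + d) / Complex.exp (x z) :=
    ⟨_, fun _ => rfl⟩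
  have hz := h.self_of_nhds
  simp only [id] at h hz
  have hmc : ∀ v, c * v + d ≠ 0 → ContinuousAt m v := fun v hv => by
    rw [funext hmdef]
    have h1 : ContinuousAt (fun v => (a * v + b) / (c * v + d)) v :=
      ContinuousAt.div (by fun_prop) (by fun_prop) hv
    exact h1.div_const _
  have hm1 : m z = 1 := by
    rw [hmdef, ← hz.2, div_self (Complex.exp_ne_zero _)]
  have hslit : m z ∈ Complex.slitPlane := by rw [hm1]; exact Complex.one_mem_slitPlane
  have hyc : ∀ v, c * v + d ≠ 0 → m v ∈ Complex.slitPlane →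
      ContinuousAt (fun v => x z + Complex.log (m v)) v := fun v h1 h2 =>
    continuousAt_const.add ((hmc v h1).clog h2)
  have heq : x =ᶠ[𝓝 z] fun v => x z + Complex.log (m v) := by
    have hy := (hyc z hz.1 hslit).tendsto
    rw [hm1, Complex.log_one, add_zero] at hy
    refine eventually_eq_of_exp_eq hx hy ?_
    filter_upwards [h,
      (hmc z hz.1).eventually (Complex.isOpen_slitPlane.mem_nhds hslit)] with v h1 h2
    rw [Complex.exp_add, Complex.exp_log (Complex.slitPlane_ne_zero h2), hmdef,
      mul_div_cancel₀ _ (Complex.exp_ne_zero _), h1.2]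
  filter_upwards [heq.eventuallyEq_nhds, h,
    (hmc z hz.1).eventually (Complex.isOpen_slitPlane.mem_nhds hslit)] with v h1 h2 h3
  exact (hyc v h2.1 h3).congr h1.symm

/-- Two Möbius functions that agree near a point on an open set having the point in its closure
agree near the point. -/
theorem MobiusAt.eventually_eq {f g : ℂ → ℂ} {z : ℂ} (hf : MobiusAt id f z) (hg : MobiusAt id g z)
    {s : Set ℂ} (hs : IsOpen s) (hz : z ∈ closure s) (h : ∀ᶠ v in 𝓝[s] z, f v = g v) :
    ∀ᶠ v in 𝓝 z, f v = g v := by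
  have an : ∀ {f : ℂ → ℂ}, MobiusAt id f z → AnalyticAt ℂ f z := by
    rintro f ⟨a, b, c, d, -, hm⟩
    refine AnalyticAt.congr (f := fun w => (a * w + b) / (c * w + d)) ?_
      (hm.mono fun q hq => hq.2.symm)
    exact AnalyticAt.div (by fun_prop) (by fun_prop) hm.self_of_nhds.1
  refine ((an hf).frequently_eq_iff_eventually_eq (an hg)).1 ?_
  rw [frequently_nhdsWithin_iff, Filter.Frequently]
  intro hc
  obtain ⟨U, hU, hUo, hzU⟩ := eventually_nhds_iff.1 ((eventually_nhdsWithin_iff.1 h).and hc)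
  obtain ⟨v, hvU, hvs⟩ := mem_closure_iff.1 hz U hUo hzU
  -- a neighbourhood of `v` contains a point other than `z`
  have hne : (U ∩ s ∩ {z}ᶜ).Nonempty := by
    have h1 : (𝓝[≠] z).NeBot := inferInstance
    by_cases hvz : v = z
    · have h2 : U ∩ s ∈ 𝓝[≠] z :=
        mem_nhdsWithin_of_mem_nhds ((hUo.inter hs).mem_nhds (hvz ▸ ⟨hvU, hvs⟩))
      obtain ⟨w, hw⟩ := h1.nonempty_of_mem (inter_mem h2 self_mem_nhdsWithin)
      exact ⟨w, hw⟩
    · exact ⟨v, ⟨hvU, hvs⟩, hvz⟩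
  obtain ⟨w, ⟨hwU, hws⟩, hwz⟩ := hne
  exact (hU w hwU).2 ⟨(hU w hwU).1 hws, hwz⟩

/-- A Möbius function without zeros and poles on a disk takes its values in a half plane, as `0` and
`∞` are not in the image of the disk.  If `z = (a w + b) / (c w + d)`, the inequality `‖w‖ < r` for
`w` as a Möbius function of `z` has the form `N ‖z‖² + M < 2 Re (e z)` with `N, M ≥ 0`. -/
theorem exists_re_mul_pos {a b c d : ℂ} {r : ℝ} (hr : 0 < r) (hD : a * d - b * c ≠ 0)
    (h : ∀ w, ‖w‖ < r → c * w + d ≠ 0 ∧ a * w + b ≠ 0) :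
    ∃ e : ℂ, ∀ w, ‖w‖ < r → 0 < (e * ((a * w + b) / (c * w + d))).re := by
  -- the zero `-b / a` lies outside the disk
  have aux : ∀ a b : ℂ, (∀ w, ‖w‖ < r → a * w + b ≠ 0) →
      r ^ 2 * Complex.normSq a ≤ Complex.normSq b := by
    intro a b h
    by_contra hc
    push Not at hc
    have ha : a ≠ 0 := by
      rintro rfl
      simp at hc
      exact absurd (Complex.normSq_nonneg b) (not_le.2 hc)
    refine h (-b / a) ?_ (by field_simp; ring)
    rw [norm_div, norm_neg, div_lt_iff₀ (norm_pos_iff.2 ha)]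
    refine lt_of_pow_lt_pow_left₀ 2 (by positivity) ?_
    rw [mul_pow, ← Complex.normSq_eq_norm_sq, ← Complex.normSq_eq_norm_sq]
    exact hc
  have hM := aux a b fun w hw => (h w hw).2
  have hN := aux c d fun w hw => (h w hw).1
  refine ⟨d * starRingEnd ℂ b - r ^ 2 * (c * starRingEnd ℂ a), fun w hw => ?_⟩
  have hden := (h w hw).1
  set z := (a * w + b) / (c * w + d) with hz
  have hz' : z * (c * w + d) = a * w + b := div_mul_cancel₀ _ hden
  have e1 : w * (a - c * z) = d * z - b := by linear_combination -hz'
  have h0 : a - c * z ≠ 0 := by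
    intro h0
    rw [h0, mul_zero] at e1
    refine hD ?_
    have hdz : d * z = b := by linear_combination -e1
    linear_combination d * h0 + c * hdz
  have h1 : Complex.normSq (d * z - b) < r ^ 2 * Complex.normSq (a - c * z) := by
    rw [← e1, map_mul]
    refine mul_lt_mul_of_pos_right ?_ (Complex.normSq_pos.2 h0)
    rw [Complex.normSq_eq_norm_sq]
    exact pow_lt_pow_left₀ hw (norm_nonneg _) two_ne_zero
  have h2 : Complex.normSq (d * z - b) = Complex.normSq d * Complex.normSq z + Complex.normSq b -
      2 * (d * starRingEnd ℂ b * z).re := by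
    rw [Complex.normSq_sub, map_mul, mul_right_comm]
  have h3 : Complex.normSq (a - c * z) = Complex.normSq a + Complex.normSq c * Complex.normSq z -
      2 * (c * starRingEnd ℂ a * z).re := by
    rw [Complex.normSq_sub, map_mul, ← Complex.conj_re, map_mul, Complex.conj_conj,
      mul_comm (starRingEnd ℂ a), mul_right_comm]
  have h4 : ((d * starRingEnd ℂ b - r ^ 2 * (c * starRingEnd ℂ a)) * z).re =
      (d * starRingEnd ℂ b * z).re - r ^ 2 * (c * starRingEnd ℂ a * z).re := by
    rw [sub_mul, Complex.sub_re, mul_assoc ((r : ℂ) ^ 2), ← Complex.ofReal_pow,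
      Complex.re_ofReal_mul]
  rw [h4]
  rw [h2, h3] at h1
  have h5 := Complex.normSq_nonneg z
  have h6 := mul_le_mul_of_nonneg_right hN h5
  nlinarith

/-- A continuous logarithm of a Möbius function on a disk oscillates by less than `π`. -/
theorem exists_im_bounds_of_mobius {a b c d : ℂ} {r : ℝ} (hr : 0 < r) (hD : a * d - b * c ≠ 0)
    {x : ℂ → ℂ} (hx : ∀ w, ‖w‖ < r → ContinuousAt x w)
    (h : ∀ w, ‖w‖ < r → c * w + d ≠ 0 ∧ Complex.exp (x w) = (a * w + b) / (c * w + d)) :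
    ∃ θ : ℝ, ∀ w, ‖w‖ < r → θ - Real.pi < (x w).im ∧ (x w).im < θ := by
  obtain ⟨e, he⟩ := exists_re_mul_pos hr hD fun w hw => ⟨(h w hw).1, fun h0 => by
    have := (h w hw).2
    rw [h0, zero_div] at this
    exact Complex.exp_ne_zero _ this⟩
  have he' : ∀ w, ‖w‖ < r → 0 < (e * Complex.exp (x w)).re := fun w hw => by
    rw [(h w hw).2]; exact he w hw
  -- `g` compares `x` with the principal branch, which is continuous on the half plane
  set g : ℂ → ℂ := fun w => x w - Complex.log (e * Complex.exp (x w)) with hg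
  have hgc : ∀ w, ‖w‖ < r → ContinuousAt g w := fun w hw =>
    (hx w hw).sub (ContinuousAt.clog ((continuousAt_const).mul (hx w hw).cexp)
      (Complex.mem_slitPlane_iff.2 (Or.inl (he' w hw))))
  have h0 : ‖(0 : ℂ)‖ < r := by simpa using hr
  have hge : ∀ w, ‖w‖ < r → Complex.exp (g w) = Complex.exp (g 0) := by
    have he0 : e ≠ 0 := by
      rintro rfl
      simpa using he 0 h0
    have : ∀ w, ‖w‖ < r → Complex.exp (g w) = e⁻¹ := fun w hw => by
      rw [hg, Complex.exp_sub, Complex.exp_log (mul_ne_zero he0 (Complex.exp_ne_zero _))]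
      field_simp
    intro w hw
    rw [this w hw, this 0 h0]
  -- a continuous function with constant exponential is constant
  have hconst : ∀ w, ‖w‖ < r → g w = g 0 := by
    have hsub : Metric.ball (0 : ℂ) r ⊆ {w | ∀ᶠ v in 𝓝 w, g v = g 0} := by
      refine (convex_ball (0 : ℂ) r).isPreconnected.subset_of_closure_inter_subset
        isOpen_setOfPred_eventually_nhds ⟨0, Metric.mem_ball_self hr, ?_⟩ ?_
      · have hb := Metric.isOpen_ball.mem_nhds (Metric.mem_ball_self (x := (0 : ℂ)) hr)
        exact eventually_eq_of_exp_eq (hgc 0 h0) tendsto_const_nhds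
          (by filter_upwards [hb] with v hv using hge v (mem_ball_zero_iff.1 hv))
      · rintro w ⟨hw, hwr⟩
        have hwr' := mem_ball_zero_iff.1 hwr
        have hfr : ∃ᶠ v in 𝓝 w, g v = g 0 :=
          (mem_closure_iff_frequently.1 hw).mono fun v hv => hv.self_of_nhds
        have hgw : g w = g 0 :=
          tendsto_nhds_unique_of_frequently_eq (hgc w hwr') tendsto_const_nhds hfr
        have hgt := (hgc w hwr').tendsto
        rw [hgw] at hgt
        exact eventually_eq_of_exp_eq hgt tendsto_const_nhds (by
          filter_upwards [Metric.isOpen_ball.mem_nhds hwr] with v hv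
            using hge v (mem_ball_zero_iff.1 hv))
    exact fun w hw => (hsub (mem_ball_zero_iff.2 hw)).self_of_nhds
  refine ⟨(g 0).im + Real.pi / 2, fun w hw => ?_⟩
  have h1 := Complex.abs_arg_lt_pi_div_two_iff.2 (Or.inl (he' w hw))
  rw [abs_lt, ← Complex.log_im] at h1
  have h2 := congrArg Complex.im (hconst w hw)
  simp only [hg, Complex.sub_im] at h2 ⊢
  constructor <;> linarith

namespace FatGraph

variable {E : Type u} {Γ : FatGraph E} {Z : E → ℂ} [Finite E] [Nonempty E]

namespace CuspSystem

variable (K : CuspSystem Γ Z)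

/-! ### Lifting projective disks to the strips -/

/-- Two maps to a strip with the same limit inside the strip and the same values in the surface
agree. -/
theorem eventually_eq_of_strip_eq {X : Type*} {l : Filter X} {x y : X → ℂ} {α : E} {a : ℂ}
    (ha : InStrip Z (α, a)) (hx : Tendsto x l (𝓝 a)) (hy : Tendsto y l (𝓝 a))
    (h : ∀ᶠ q in l, K.strip α (x q) = K.strip α (y q)) : ∀ᶠ q in l, x q = y q := by
  have h1 := (hx.prodMk_nhds hy).eventually
    (eventually_eq_of_linked (Γ := Γ) K.im_pos K.rev_eq ha)
  filter_upwards [h, h1, hx.eventually (eventually_inStrip ha),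
    hy.eventually (eventually_inStrip ha)] with q h2 h3 h4 h5
  exact h3 h4 ((K.strip_eq_iff h4 h5).1 h2)

/-- `x` is a continuous lift of `U` to the strip of `α` over the disk of radius `r`. -/
def IsLift (U : ℂ → K.Surface) (r : ℝ) (α : E) (x : ℂ → ℂ) : Prop :=
  ∀ z, ‖z‖ < r → ContinuousAt x z ∧ InStrip Z (α, x z) ∧ U z = K.strip α (x z)

section lift
variable {K} {U : ℂ → K.Surface} {r : ℝ} {α : E} {x : ℂ → ℂ}

theorem IsLift.mono (h : K.IsLift U r α x) {r' : ℝ} (hr : r' ≤ r) : K.IsLift U r' α x :=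
  fun z hz => h z (hz.trans_le hr)

theorem IsLift.eventually (h : K.IsLift U r α x) {z : ℂ} (hz : ‖z‖ < r) :
    ∀ᶠ v in 𝓝 z, U v = K.strip α (x v) := by
  filter_upwards [Metric.isOpen_ball.mem_nhds (mem_ball_zero_iff.2 hz)] with v hv
  exact (h v (mem_ball_zero_iff.1 hv)).2.2

/-- A lift of a projective map has a Möbius function as its exponential, as it agrees locally with
the lift that the projective charts provide. -/
theorem IsLift.mobiusAt (h : K.IsLift U r α x) {z : ℂ} (hz : ‖z‖ < r)
    (hU : K.regularSurface.ProjectiveAt id U z) : MobiusAt id (fun v => Complex.exp (x v)) z := by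
  obtain ⟨hx, hs, he⟩ := h z hz
  obtain ⟨g, hg, hgz, hge, hgm⟩ := K.exists_lift_of_projectiveAt hU hs he
  have hg' := hg.tendsto
  rw [hgz] at hg'
  have h1 := K.eventually_eq_of_strip_eq hs hg' hx (by
    filter_upwards [hge, h.eventually hz] with v h1 h2
    rw [← h1, h2])
  exact hgm.congr EventuallyEq.rfl (h1.mono fun v hv => by simp only [hv])

theorem IsLift.unique (h : K.IsLift U r α x) {y : ℂ → ℂ} (h' : K.IsLift U r α y) (hr : 0 < r)
    (h0 : x 0 = y 0) {z : ℂ} (hz : ‖z‖ < r) : x z = y z := by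
  have key : ∀ w, ‖w‖ < r → x w = y w → ∀ᶠ v in 𝓝 w, x v = y v := by
    intro w hw hxy
    have hy := (h' w hw).1.tendsto
    rw [← hxy] at hy
    refine K.eventually_eq_of_strip_eq (h w hw).2.1 (h w hw).1 hy ?_
    filter_upwards [h.eventually hw, h'.eventually hw] with v h1 h2
    rw [← h1, h2]
  have hsub : Metric.ball (0 : ℂ) r ⊆ {w | ∀ᶠ v in 𝓝 w, x v = y v} := by
    refine (convex_ball (0 : ℂ) r).isPreconnected.subset_of_closure_inter_subset
      isOpen_setOfPred_eventually_nhds ⟨0, Metric.mem_ball_self hr, key 0 (by simpa using hr) h0⟩ ?_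
    rintro w ⟨hw, hwr⟩
    have hwr' := mem_ball_zero_iff.1 hwr
    have hfr : ∃ᶠ v in 𝓝 w, x v = y v :=
      (mem_closure_iff_frequently.1 hw).mono fun v hv => hv.self_of_nhds
    exact key w hwr' (tendsto_nhds_unique_of_frequently_eq (h w hwr').1 (h' w hwr').1 hfr)
  exact (hsub (mem_ball_zero_iff.2 hz)).self_of_nhds

theorem exists_isLift (hU : K.regularSurface.ProjectiveAt id U 0) (h0 : U 0 ∉ K.punctures) :
    ∃ r > 0, ∃ α x, K.IsLift U r α x := by
  obtain ⟨α, a, ha, hae⟩ := K.exists_strip_eq h0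
  obtain ⟨g, hg, hgz, hge, hgm⟩ := K.exists_lift_of_projectiveAt hU ha hae.symm
  rw [← hgz] at ha
  obtain ⟨r, hr, hb⟩ := Metric.eventually_nhds_iff_ball.1
    ((eventually_continuousAt_of_exp hg hgm).and
      ((hg.eventually (eventually_inStrip ha)).and hge))
  exact ⟨r, hr, α, g, fun z hz => hb z (mem_ball_zero_iff.2 hz)⟩

theorem IsLift.flip (h : K.IsLift U r α x) :
    K.IsLift U r (Γ.rev α) (fun z => Z α - Real.pi * Complex.I - x z) := fun z hz =>
  ⟨continuousAt_const.sub (h z hz).1, (h z hz).2.1.flip (Γ := Γ) K.rev_eq,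
    by rw [K.strip_flip (h z hz).2.1]; exact (h z hz).2.2⟩

/-- A lift over a disk that extends to the closed disk extends to a larger disk. -/
theorem exists_isLift_of_closedBall (hr : 0 < r)
    (hU : ∀ z, ‖z‖ ≤ r → K.regularSurface.ProjectiveAt id U z)
    (hx : ∀ z, ‖z‖ ≤ r → ContinuousAt x z ∧ InStrip Z (α, x z) ∧
      MobiusAt id (fun v => Complex.exp (x v)) z)
    (hUx : ∀ z, ‖z‖ < r → U z = K.strip α (x z)) : ∃ r' > r, K.IsLift U r' α x := by
  -- near a boundary point, a local lift agrees with `x` on the part inside the disk, hence on both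
  -- sides
  have hloc : ∀ z, ‖z‖ ≤ r → ∀ᶠ v in 𝓝 z, ContinuousAt x v ∧ InStrip Z (α, x v) ∧
      U v = K.strip α (x v) := by
    intro z hz
    obtain ⟨hc, hs, hm⟩ := hx z hz
    have hcl : z ∈ closure (Metric.ball (0 : ℂ) r) := by
      rw [closure_ball _ hr.ne']; exact mem_closedBall_zero_iff.2 hz
    have hne : (𝓝[Metric.ball (0 : ℂ) r] z).NeBot := mem_closure_iff_nhdsWithin_neBot.1 hcl
    have hUx' : ∀ᶠ v in 𝓝[Metric.ball (0 : ℂ) r] z, U v = K.strip α (x v) := by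
      filter_upwards [self_mem_nhdsWithin] with v hv
      exact hUx v (mem_ball_zero_iff.1 hv)
    have hsc : ContinuousAt (fun v => K.strip α (x v)) z :=
      ContinuousAt.comp (g := K.strip α) (K.continuousAt_strip hs) hc
    have hUz : U z = K.strip α (x z) := by
      refine tendsto_nhds_unique_of_eventuallyEq (l := 𝓝[Metric.ball (0 : ℂ) r] z) ?_ ?_ hUx'
      · exact (hU z hz).1.tendsto.mono_left nhdsWithin_le_nhds
      · exact hsc.tendsto.mono_left nhdsWithin_le_nhds
    obtain ⟨g, hg, hgz, hge, hgm⟩ := K.exists_lift_of_projectiveAt (hU z hz) hs hUz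
    have hg' := hg.tendsto
    rw [hgz] at hg'
    have h1 : ∀ᶠ v in 𝓝[Metric.ball (0 : ℂ) r] z, g v = x v := by
      refine K.eventually_eq_of_strip_eq hs (hg'.mono_left nhdsWithin_le_nhds)
        (hc.tendsto.mono_left nhdsWithin_le_nhds) ?_
      filter_upwards [hUx', nhdsWithin_le_nhds hge] with v h1 h2
      rw [← h2, h1]
    have h2 := hgm.eventually_eq hm Metric.isOpen_ball hcl (h1.mono fun v hv => by simp only [hv])
    have h3 := eventually_eq_of_exp_eq hg' hc.tendsto h2
    filter_upwards [eventually_continuousAt_of_exp hc hm, hc.eventually (eventually_inStrip hs),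
      h3, hge] with v h4 h5 h6 h7
    exact ⟨h4, h5, by rw [h7, h6]⟩
  obtain ⟨δ, hδ, hsub⟩ := (isCompact_closedBall (0 : ℂ) r).exists_thickening_subset_open
    isOpen_setOfPred_eventually_nhds (fun z hz => hloc z (mem_closedBall_zero_iff.1 hz))
  rw [thickening_closedBall hδ hr.le] at hsub
  refine ⟨δ + r, by linarith, fun z hz => (hsub (mem_ball_zero_iff.2 hz)).self_of_nhds⟩

/-- A lift over a disk takes its values in one of the half planes of the strip. -/
theorem IsLift.exists_angle (h : K.IsLift U r α x) (hr : 0 < r)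
    (hU : ∀ z, ‖z‖ < r → K.regularSurface.ProjectiveAt id U z) :
    ∃ t : unitInterval, ∀ z, ‖z‖ < r →
      angle Z α t - Real.pi < (x z).im ∧ (x z).im < angle Z α t := by
  obtain ⟨a, b, c, d, hD, hm⟩ := exists_mobius_of_locally hr fun z hz => h.mobiusAt hz (hU z hz)
  obtain ⟨θ, hθ⟩ := exists_im_bounds_of_mobius hr hD (fun w hw => (h w hw).1) hm
  have hpos := K.im_pos α
  -- the half plane may stick out of the strip; it is moved to the nearest one inside
  refine ⟨Set.projIcc 0 1 zero_le_one (θ / (Z α).im), fun z hz => ?_⟩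
  have e : angle Z α (Set.projIcc 0 1 zero_le_one (θ / (Z α).im)) = max 0 (min (Z α).im θ) := by
    rw [angle, Set.coe_projIcc, max_mul_of_nonneg _ _ hpos.le, min_mul_of_nonneg _ _ hpos.le,
      zero_mul, one_mul, div_mul_cancel₀ _ hpos.ne']
  obtain ⟨h1, h2⟩ := hθ z hz
  obtain ⟨h3, h4⟩ := (h z hz).2.1
  simp only at h3 h4
  rw [e]
  constructor
  · rw [sub_lt_iff_lt_add]
    refine max_lt (by linarith) (min_lt_of_right_lt (by linarith))
  · exact lt_max_of_lt_right (lt_min h4 h2)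

end lift

end CuspSystem
end FatGraph

end

noncomputable section

open Complex (UnitDisc)

theorem MobiusAt.exp_halfLog {X : Type*} [TopologicalSpace X] {z F : X → ℂ} {p : X} (θ : ℝ)
    (hF : MobiusAt z F p) (hc : ContinuousAt F p) (h1 : F p ≠ 1) (h2 : F p ≠ -1) :
    MobiusAt z (fun q => Complex.exp (halfLog θ (F q))) p := by
  refine hF.trans ?_
  set e := Complex.exp ((θ - Real.pi / 2) * Complex.I) with he
  refine ⟨e, e, -1, 1, ?_, ?_⟩
  · rw [show e * 1 - e * -1 = 2 * e by ring]
    exact mul_ne_zero two_ne_zero (Complex.exp_ne_zero _)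
  · filter_upwards [hc.eventually_ne h1, hc.eventually_ne h2] with q h3 h4
    have h5 : 1 - F q ≠ 0 := fun h => h3 (by linear_combination -h)
    refine ⟨by rwa [neg_one_mul, neg_add_eq_sub], ?_⟩
    rw [_root_.exp_halfLog (div_ne_zero (fun h => h4 (by linear_combination h)) h5), ← he,
      neg_one_mul, neg_add_eq_sub]
    ring

theorem RegularProjectiveSurface.ProjectiveAt.notMem {S : RegularProjectiveSurface.{u}} {X : Type*}
    [TopologicalSpace X] {z : X → ℂ} {f : X → S.carrier} {p : X} (h : S.ProjectiveAt z f p) :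
    f p ∉ S.punctures := by
  obtain ⟨-, φ, hφ, hs, -⟩ := h
  have h1 : f p ∈ ⋃ φ ∈ S.projAtlas, φ.source := Set.mem_iUnion₂.2 ⟨φ, hφ, hs⟩
  rwa [S.projAtlas_cover] at h1

namespace FatGraph

variable {E : Type u} {Γ : FatGraph E} {Z : E → ℂ} [Finite E] [Nonempty E]

namespace CuspSystem

variable (K : CuspSystem Γ Z)

/-! ### Change of edge at a vertex -/

/-- The lower half plane, which is the disk at the beginning of `α`, in terms of the next edge:
`z` becomes `-(1 + z) / z`. -/
theorem strip_next {α : E} {y : ℂ} (h1 : -Real.pi < y.im) (h2 : y.im < 0) :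
    ((-1 * Complex.exp y + -1) / (1 * Complex.exp y + 0)).im < 0 ∧
      K.strip (Γ.next α) (Complex.log ((-1 * Complex.exp y + -1) / (1 * Complex.exp y + 0))) =
        K.strip α y := by
  have hy : InStrip Z (α, y) := ⟨h1, h2.trans (K.im_pos α)⟩
  have hy' := hy.flip (Γ := Γ) K.rev_eq
  have h3 : -Real.pi < (Z α - Real.pi * Complex.I - y - Z (Γ.rev α)).im := by
    rw [K.rev_eq]; simp; linarith
  have h4 := hy'.sub_im
  have e : (-1 * Complex.exp y + -1) / (1 * Complex.exp y + 0) =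
      Complex.exp (Z α - Real.pi * Complex.I - y - Z (Γ.rev α)) - 1 := by
    rw [K.rev_eq, show Z α - Real.pi * Complex.I - y - Z α = -(Real.pi * Complex.I) - y by ring,
      Complex.exp_sub, Complex.exp_neg, Complex.exp_pi_mul_I]
    have := Complex.exp_ne_zero y
    field_simp
    ring
  rw [e]
  refine ⟨exp_sub_one_im h3 h4, ?_⟩
  have h5 := K.strip_turnR hy' h3
  rw [← K.strip_flip hy]
  refine Eq.trans ?_ h5
  rw [turnR, FatGraph.right]
  simp only [Γ.rev_rev]

/-- The lower half plane, which is the disk at the beginning of `α`, in terms of the edge before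
`α`: `z` becomes `-1 / (z + 1)`. -/
theorem strip_next_next {α : E} {y : ℂ} (h1 : -Real.pi < y.im) (h2 : y.im < 0) :
    ((0 * Complex.exp y + -1) / (1 * Complex.exp y + 1)).im < 0 ∧
      K.strip (Γ.next (Γ.next α))
        (Complex.log ((0 * Complex.exp y + -1) / (1 * Complex.exp y + 1))) = K.strip α y := by
  obtain ⟨h3, h4⟩ := K.strip_next (α := α) h1 h2
  set m := (-1 * Complex.exp y + -1) / (1 * Complex.exp y + 0) with hm
  obtain ⟨h5, h6⟩ := Complex.log_im_of_im_neg h3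
  have h7 := K.strip_next (α := Γ.next α) h5 h6
  rw [h4, Complex.exp_log (Complex.ne_zero_of_im_neg h3)] at h7
  have e : (-1 * m + -1) / (1 * m + 0) = (0 * Complex.exp y + -1) / (1 * Complex.exp y + 1) := by
    have hy0 := Complex.exp_ne_zero y
    have hy1 : Complex.exp y + 1 ≠ 0 :=
      Complex.ne_zero_of_im_neg (by simpa using Complex.exp_im_neg h1 h2)
    have hm' : m = -(Complex.exp y + 1) / Complex.exp y := by rw [hm]; congr 1 <;> ring
    have e2 : -1 * m + -1 = 1 / Complex.exp y := by rw [hm']; field_simp; ring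
    have e3 : 1 * m + 0 = -(Complex.exp y + 1) / Complex.exp y := by rw [hm']; ring
    rw [e2, e3, div_div_div_cancel_right₀ hy0, zero_mul, zero_add, one_mul, div_neg, neg_div]
  rwa [e] at h7

/-! ### Extension of lifts -/

section lift
variable {K} {U : ℂ → K.Surface} {r : ℝ} {α : E} {x : ℂ → ℂ}

/-- Extension of a lift with values in the lower half plane that touches the boundary in one point,
by passing to an edge `β` with the same beginning.  The change of coordinates
`z ↦ (a z + b) / (c z + d)` takes the point of contact to a positive number, which is inside the
strip of `β`. -/
theorem exists_isLift_of_touch (hr : 0 < r)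
    (hU : ∀ z, ‖z‖ ≤ r → K.regularSurface.ProjectiveAt id U z)
    (hx : ∀ z, ‖z‖ ≤ r → ContinuousAt x z ∧ MobiusAt id (fun v => Complex.exp (x v)) z)
    (hUx : ∀ z, ‖z‖ < r → U z = K.strip α (x z)) {z₀ : ℂ}
    (hz₀ : ‖z₀‖ = r) (him : ∀ z, ‖z‖ ≤ r → z ≠ z₀ → -Real.pi < (x z).im ∧ (x z).im < 0)
    {β : E} {a b c d : ℂ} (hD : a * d - b * c ≠ 0)
    (hM : ∀ y : ℂ, -Real.pi < y.im → y.im < 0 →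
      ((a * Complex.exp y + b) / (c * Complex.exp y + d)).im < 0 ∧
      K.strip β (Complex.log ((a * Complex.exp y + b) / (c * Complex.exp y + d))) = K.strip α y)
    {ρ : ℝ} (hρ : 0 < ρ) (hM₀ : (a * Complex.exp (x z₀) + b) / (c * Complex.exp (x z₀) + d) = ρ) :
    ∃ r' > r, ∃ β y, K.IsLift U r' β y := by
  set m : ℂ → ℂ := fun z => (a * Complex.exp (x z) + b) / (c * Complex.exp (x z) + d) with hm
  have hslit : ∀ z, ‖z‖ ≤ r → m z ∈ Complex.slitPlane := by
    intro z hz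
    by_cases h : z = z₀
    · rw [h, hm]
      simp only [hM₀]
      exact Complex.ofReal_mem_slitPlane.2 hρ
    · obtain ⟨h1, h2⟩ := him z hz h
      exact Complex.mem_slitPlane_iff.2 (Or.inr (hM _ h1 h2).1.ne)
  have hden : ∀ z, ‖z‖ ≤ r → c * Complex.exp (x z) + d ≠ 0 := by
    intro z hz h0
    have := Complex.slitPlane_ne_zero (hslit z hz)
    simp only [hm, h0, div_zero] at this
    exact this rfl
  have hdenc : ∀ z, ‖z‖ ≤ r → ContinuousAt (fun v => c * Complex.exp (x v) + d) z := fun z hz =>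
    ((hx z hz).1.cexp.const_mul c).add_const d
  have hmc : ∀ z, ‖z‖ ≤ r → ContinuousAt m z := fun z hz =>
    (((hx z hz).1.cexp.const_mul a).add_const b).div (hdenc z hz) (hden z hz)
  suffices hs : ∃ r' > r, K.IsLift U r' β fun z => Complex.log (m z) by
    obtain ⟨r', hr', hl⟩ := hs
    exact ⟨r', hr', β, _, hl⟩
  refine exists_isLift_of_closedBall hr hU (fun z hz => ⟨(hmc z hz).clog (hslit z hz), ?_, ?_⟩)
    (fun z hz => ?_)
  · by_cases h : z = z₀
    · subst h
      simp only [hm, hM₀, ← Complex.ofReal_log hρ.le]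
      exact inStrip_ofReal K.im_pos β _
    · obtain ⟨h1, h2⟩ := him z hz h
      obtain ⟨h3, h4⟩ := Complex.log_im_of_im_neg (hM _ h1 h2).1
      exact ⟨h3, h4.trans (K.im_pos β)⟩
  · refine (hx z hz).2.trans ⟨a, b, c, d, hD, ?_⟩
    filter_upwards [(hdenc z hz).eventually_ne (hden z hz),
      (hmc z hz).eventually (Complex.isOpen_slitPlane.mem_nhds (hslit z hz))] with v h1 h2
    exact ⟨h1, Complex.exp_log (Complex.slitPlane_ne_zero h2)⟩
  · have h : z ≠ z₀ := by rintro rfl; exact hz.ne hz₀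
    obtain ⟨h1, h2⟩ := him z hz.le h
    rw [hUx z hz]
    exact (hM _ h1 h2).2.symm

/-- The continuous extension of a lift to the closed disk, in terms of a half plane: `F` is a Möbius
map from the closed disk to itself.  It avoids the boundary points at which the disk of `U` would
have a puncture inside, and touches the boundary at most once, as otherwise it is onto. -/
theorem IsLift.exists_closed (h : K.IsLift U r α x) (hr : 0 < r) (hr1 : r < 1)
    (hU : ∀ z, ‖z‖ < 1 → K.regularSurface.ProjectiveAt id U z) {t : unitInterval}
    (ht : ∀ z, ‖z‖ < r → angle Z α t - Real.pi < (x z).im ∧ (x z).im < angle Z α t) :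
    ∃ F : ℂ → ℂ, (∀ z, ‖z‖ ≤ r → ContinuousAt F z ∧ MobiusAt id F z ∧ ‖F z‖ ≤ 1 ∧ F z ≠ 1 ∧
        F z ≠ -1 ∧ (‖F z‖ = 1 → ¬ IsLean Z α (angle Z α t) (F z))) ∧
      (∀ z, ‖z‖ < r → ‖F z‖ < 1 ∧ halfLog (angle Z α t) (F z) = x z) ∧
      ∀ z z', ‖z‖ ≤ r → ‖z'‖ ≤ r → ‖F z‖ = 1 → ‖F z'‖ = 1 → z = z' := by
  have hrC : (r : ℂ) ≠ 0 := by exact_mod_cast hr.ne'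
  have hnr : ∀ w : ℂ, ‖(r : ℂ) * w‖ = r * ‖w‖ := fun w => by
    rw [norm_mul, Complex.norm_real, Real.norm_of_nonneg hr.le]
  have hnd : ∀ z : ℂ, ‖z / r‖ = ‖z‖ / r := fun z => by
    rw [norm_div, Complex.norm_real, Real.norm_of_nonneg hr.le]
  have hrw : ∀ w : UnitDisc, ‖(r : ℂ) * w‖ < r := fun w => by
    rw [hnr]; exact mul_lt_of_lt_one_right hr w.norm_lt_one
  obtain ⟨a, b, c, d, hD, hm⟩ := exists_mobius_of_locally hr fun z hz =>
    h.mobiusAt hz (hU z (hz.trans hr1))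
  obtain ⟨k, hk, hkx⟩ := exists_isMobiusSelfMap_halfLog (θ := angle Z α t)
    (x := fun w : UnitDisc => x (r * w)) (fun w => (ht _ (hrw w)).1) (fun w => (ht _ (hrw w)).2)
    ⟨a * r, b, c * r, d, by
      rw [show a * r * d - b * (c * r) = r * (a * d - b * c) by ring]
      exact mul_ne_zero hrC hD, fun w => by
      obtain ⟨h1, h2⟩ := hm _ (hrw w)
      rw [mul_assoc, mul_assoc]
      exact ⟨h1, h2⟩⟩
  clear hm hD a b c d
  -- `F₀` extends to the closed unit disk the map by which `U` factors through the half plane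
  obtain ⟨a, b, c, d, hD, hcl, hkF⟩ := hk.exists_ext
  set F₀ : ℂ → ℂ := fun ξ => (a * ξ + b) / (c * ξ + d) with hF₀
  have hF₀c : ∀ ξ, ‖ξ‖ ≤ 1 → ContinuousAt F₀ ξ := fun ξ hξ =>
    ContinuousAt.div (by fun_prop) (by fun_prop) (hcl ξ hξ).1
  have hle : ∀ {z : ℂ}, ‖z‖ ≤ r → ‖z / r‖ ≤ 1 := fun hz => by rwa [hnd, div_le_one hr]
  have hlt : ∀ z : ℂ, ‖z‖ < r → ‖F₀ (z / r)‖ < 1 ∧ halfLog (angle Z α t) (F₀ (z / r)) = x z := by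
    intro z hz
    have hz' : ‖z / r‖ < 1 := by rwa [hnd, div_lt_one hr]
    have h1 := hkF (UnitDisc.mk _ hz')
    have h2 := hkx (UnitDisc.mk _ hz')
    rw [h1] at h2
    have h3 := (k (UnitDisc.mk _ hz')).norm_lt_one
    rw [h1] at h3
    refine ⟨h3, h2.trans ?_⟩
    simp only [UnitDisc.coe_mk, mul_div_cancel₀ _ hrC]
  have hone : ∀ {z : ℂ}, ‖z‖ ≤ r → ‖F₀ (z / r)‖ = 1 → ‖z / r‖ = 1 := by
    intro z hz h1
    rw [hnd, div_eq_one_iff_eq hr.ne']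
    refine le_antisymm hz (not_lt.1 fun h2 => ?_)
    exact (hlt z h2).1.ne h1
  -- at a lean point, `U` would take a puncture as its value, as both sides of `heq` have limits
  have hlean : ∀ ξ, ‖ξ‖ = 1 → ‖F₀ ξ‖ = 1 → ¬ IsLean Z α (angle Z α t) (F₀ ξ) := by
    intro ξ hξ hFξ
    have := UnitDisc.comap_coe_neBot hξ
    obtain ⟨L, hL, hmem⟩ := K.exists_tendsto_disk α t hFξ
    have hL := K.tendsto_disk_of_tendsto α hL
    have hkT : Tendsto k (comap (fun w : UnitDisc => (w : ℂ)) (𝓝 ξ))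
        (comap (fun w : UnitDisc => (w : ℂ)) (𝓝 (F₀ ξ))) := by
      refine tendsto_comap_iff.2 ?_
      have : (fun w : UnitDisc => (w : ℂ)) ∘ k = F₀ ∘ fun w : UnitDisc => (w : ℂ) := funext hkF
      rw [this]
      exact (hF₀c ξ hξ.le).tendsto.comp tendsto_comap
    have hrξ : ‖(r : ℂ) * ξ‖ < 1 := by rw [hnr, hξ, mul_one]; exact hr1
    have hUξ := hU _ hrξ
    have hUT : Tendsto (fun w : UnitDisc => U (r * w)) (comap (fun w : UnitDisc => (w : ℂ)) (𝓝 ξ))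
        (𝓝 (U (r * ξ))) :=
      hUξ.1.tendsto.comp ((tendsto_comap (f := fun w : UnitDisc => (w : ℂ)) (x := 𝓝 ξ)).const_mul _)
    have heq : (fun w => K.disk α t (k w)) = fun w : UnitDisc => U (r * w) := funext fun w => by
      rw [disk_apply, hkx]
      exact ((h _ (hrw w)).2.2).symm
    have hLT : Tendsto (fun w => K.disk α t (k w)) (comap (fun w : UnitDisc => (w : ℂ)) (𝓝 ξ))
        (𝓝 L) := hL.comp hkT
    rw [heq] at hLT
    rw [← hmem, tendsto_nhds_unique hLT hUT]
    exact hUξ.notMem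
  refine ⟨fun z => F₀ (z / r), fun z hz => ?_, hlt, fun z z' hz hz' h1 h2 => ?_⟩
  · have hcz : ContinuousAt (fun v : ℂ => F₀ (v / r)) z :=
      ContinuousAt.comp (g := F₀) (f := fun v : ℂ => v / r) (hF₀c _ (hle hz)) (by fun_prop)
    have hl : ‖F₀ (z / r)‖ = 1 → ¬ IsLean Z α (angle Z α t) (F₀ (z / r)) :=
      fun h1 => hlean _ (hone hz h1) h1
    refine ⟨hcz, ⟨a, b * r, c, d * r, ?_, ?_⟩, (hcl _ (hle hz)).2, fun h1 => ?_, fun h1 => ?_, hl⟩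
    · rw [show a * (d * r) - b * r * c = r * (a * d - b * c) by ring]
      exact mul_ne_zero hrC hD
    · have hd : ContinuousAt (fun v : ℂ => c * (v / r) + d) z := by fun_prop
      filter_upwards [hd.eventually_ne (hcl _ (hle hz)).1] with v hv
      have e : c * v + d * r = (c * (v / r) + d) * r := by field_simp
      have e' : a * v + b * r = (a * (v / r) + b) * r := by field_simp
      simp only [id]
      rw [e, e', mul_div_mul_right _ _ hrC]
      exact ⟨mul_ne_zero hv hrC, rfl⟩
    · exact hl ((congrArg norm h1).trans (by simp)) (Or.inl h1)
    · exact hl ((congrArg norm h1).trans (by simp)) (Or.inr (Or.inl h1))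
  · -- with two points of contact `F₀` is an automorphism, so that it takes the lean point `1` as a
    -- value
    by_contra hne
    have hne' : z / r ≠ z' / r := fun h => hne ((div_left_inj' hrC).1 h)
    obtain ⟨p, τ, hpt⟩ := RegularProjectiveSurface.exists_eq_discAut hD hcl (hone hz h1)
      (hone hz' h2) hne' h1 h2
    obtain ⟨hp', hτ'⟩ := discAut_inv_params p.norm_lt_one τ.norm_coe
    have h3 := discAut_inv' (p := p) (τ := τ) (w := 1) p.norm_lt_one τ.norm_coe (by simp)
    have h4 := norm_discAut_eq (w := 1) hp' hτ' (by simp)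
    have h5 := (hpt _).trans h3
    refine hlean _ h4 ?_ (Or.inl h5)
    rw [hF₀]
    simp only [h5, norm_one]

/-- A lift with values in the lower half plane extends to a larger disk.  The extension to the
closed disk may touch the line `Im x = -π` at one point, on either side of the puncture `-π i`; then
one of the other edges with the same beginning takes over.  Otherwise it stays in the strip. -/
theorem IsLift.exists_gt_of_lower (h : K.IsLift U r α x) (hr : 0 < r) (hr1 : r < 1)
    (hU : ∀ z, ‖z‖ < 1 → K.regularSurface.ProjectiveAt id U z)
    (ht : ∀ z, ‖z‖ < r → (x z).im < 0) : ∃ r' > r, ∃ β y, K.IsLift U r' β y := by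
  obtain ⟨F, hF, hFx, hinj⟩ := h.exists_closed hr hr1 hU (t := 0) (fun z hz => by
    rw [angle_zero, zero_sub]
    exact ⟨(h z hz).2.1.1, ht z hz⟩)
  rw [angle_zero] at hF hFx
  have hU' : ∀ z, ‖z‖ ≤ r → K.regularSurface.ProjectiveAt id U z := fun z hz =>
    hU z (hz.trans_lt hr1)
  have hX : ∀ z, ‖z‖ ≤ r → ContinuousAt (fun v => halfLog 0 (F v)) z ∧
      MobiusAt id (fun v => Complex.exp (halfLog 0 (F v))) z := by
    intro z hz
    obtain ⟨hc, hm, h1, h2, h3, -⟩ := hF z hz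
    refine ⟨?_, hm.exp_halfLog 0 hc h2 h3⟩
    exact ContinuousAt.comp (g := fun q : ℝ × ℂ => halfLog q.1 q.2) (f := fun v => (0, F v))
      (continuousAt_halfLog h1 h2 h3) (continuousAt_const.prodMk hc)
  have hUX : ∀ z, ‖z‖ < r → U z = K.strip α (halfLog 0 (F z)) := fun z hz => by
    rw [(hFx z hz).2]; exact (h z hz).2.2
  by_cases hz₀ : ∃ z₀, ‖z₀‖ ≤ r ∧ ‖F z₀‖ = 1 ∧ (halfLog 0 (F z₀)).im = -Real.pi
  · obtain ⟨z₀, hz₀, hF1, him₀⟩ := hz₀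
    obtain ⟨-, -, -, h2, h3, hl⟩ := hF z₀ hz₀
    have hz₀' : ‖z₀‖ = r := le_antisymm hz₀ (not_lt.1 fun h4 => (hFx z₀ h4).1.ne hF1)
    have him : ∀ z, ‖z‖ ≤ r → z ≠ z₀ →
        -Real.pi < (halfLog 0 (F z)).im ∧ (halfLog 0 (F z)).im < 0 := by
      intro z hz hne
      have h4 := halfLog_im_bounds (θ := 0) (lt_of_le_of_ne (hF z hz).2.2.1 fun h5 =>
        hne (hinj z z₀ hz hz₀ h5 hF1))
      rwa [zero_sub] at h4
    set ρ := (halfLog 0 (F z₀)).re with hρ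
    have hx₀ : halfLog 0 (F z₀) = ρ - Real.pi * Complex.I :=
      Complex.ext (by simp [hρ]) (by simp [him₀])
    have hρ0 : ρ ≠ 0 := fun h0 => hl hF1 (Or.inr (Or.inr (Or.inl (by rw [hx₀, h0]; simp))))
    have hexp : Complex.exp (halfLog 0 (F z₀)) = ((-Real.exp ρ : ℝ) : ℂ) := by
      rw [hx₀, Complex.exp_sub, Complex.exp_pi_mul_I, Complex.ofReal_neg, Complex.ofReal_exp]
      ring
    have hρe := Real.exp_pos ρ
    rcases lt_or_gt_of_ne hρ0 with hneg | hpos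
    · -- `-1 < z < 0` at the point of contact: the next edge
      have h5 := Real.exp_lt_one_iff.2 hneg
      refine exists_isLift_of_touch hr hU' hX hUX hz₀' him (β := Γ.next α) (a := -1) (b := -1)
        (c := 1) (d := 0) (by norm_num) (fun y h1 h2 => K.strip_next h1 h2)
        (ρ := (1 - Real.exp ρ) / Real.exp ρ) (div_pos (by linarith) hρe) ?_
      rw [hexp]
      push_cast
      have h6 : Complex.exp ρ ≠ 0 := Complex.exp_ne_zero _
      field_simp
      ring
    · -- `z < -1` at the point of contact: the edge before
      have h5 := Real.one_lt_exp_iff.2 hpos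
      refine exists_isLift_of_touch hr hU' hX hUX hz₀' him (β := Γ.next (Γ.next α)) (a := 0)
        (b := -1) (c := 1) (d := 1) (by norm_num) (fun y h1 h2 => K.strip_next_next h1 h2)
        (ρ := 1 / (Real.exp ρ - 1)) (div_pos one_pos (by linarith)) ?_
      rw [hexp]
      push_cast
      rw [zero_mul, zero_add, one_mul, neg_add_eq_sub, ← neg_sub, neg_div_neg_eq]
  · push Not at hz₀
    suffices hs : ∃ r' > r, K.IsLift U r' α fun z => halfLog 0 (F z) by
      obtain ⟨r', hr', hl⟩ := hs
      exact ⟨r', hr', α, _, hl⟩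
    refine exists_isLift_of_closedBall hr hU' (fun z hz => ⟨(hX z hz).1, ?_, (hX z hz).2⟩) hUX
    obtain ⟨hc, hm, h1, h2, h3, hl⟩ := hF z hz
    have hpos := K.im_pos α
    rcases h1.eq_or_lt with h4 | h4
    · rcases halfLog_im_eq (θ := 0) h4 h2 h3 with h5 | h5
      · constructor <;> simp only [h5] <;> linarith [Real.pi_pos]
      · exact absurd (by rw [h5, zero_sub]) (hz₀ z hz h4)
    · obtain ⟨h5, h6⟩ := halfLog_im_bounds (θ := 0) h4
      constructor <;> simp only <;> linarith

/-- A lift over a smaller disk extends, possibly after a change of the edge.  Only the disks at the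
ends of the edge require a change: the closures of the other half planes lie in the strip. -/
theorem IsLift.exists_gt (h : K.IsLift U r α x) (hr : 0 < r) (hr1 : r < 1)
    (hU : ∀ z, ‖z‖ < 1 → K.regularSurface.ProjectiveAt id U z) :
    ∃ r' > r, ∃ β y, K.IsLift U r' β y := by
  obtain ⟨t, ht⟩ := h.exists_angle hr fun z hz => hU z (hz.trans hr1)
  by_cases h0 : t = 0
  · subst h0
    rw [angle_zero] at ht
    exact h.exists_gt_of_lower hr hr1 hU fun z hz => (ht z hz).2
  by_cases h1 : t = 1
  · subst h1
    rw [angle_one] at ht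
    refine h.flip.exists_gt_of_lower hr hr1 hU fun z hz => ?_
    have := (ht z hz).1
    simp
    linarith
  obtain ⟨F, hF, hFx, -⟩ := h.exists_closed hr hr1 hU ht
  have hpos : 0 < angle Z α t := mul_pos (unitInterval.pos_iff_ne_zero.2 h0) (K.im_pos α)
  have hlt : angle Z α t < (Z α).im :=
    mul_lt_of_lt_one_left (K.im_pos α) (unitInterval.lt_one_iff_ne_one.2 h1)
  suffices hs : ∃ r' > r, K.IsLift U r' α fun v => halfLog (angle Z α t) (F v) by
    obtain ⟨r', hr', hl⟩ := hs
    exact ⟨r', hr', α, _, hl⟩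
  refine exists_isLift_of_closedBall hr (fun z hz => hU z (hz.trans_lt hr1)) (fun z hz => ?_)
    (fun z hz => by rw [(hFx z hz).2]; exact (h z hz).2.2)
  obtain ⟨hc, hm, h1, h2, h3, -⟩ := hF z hz
  refine ⟨?_, ?_, hm.exp_halfLog _ hc h2 h3⟩
  · exact ContinuousAt.comp (g := fun q : ℝ × ℂ => halfLog q.1 q.2)
      (f := fun v => (angle Z α t, F v)) (continuousAt_halfLog h1 h2 h3)
      (continuousAt_const.prodMk hc)
  · have hpi := Real.pi_pos
    rcases h1.eq_or_lt with h4 | h4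
    · rcases halfLog_im_eq (θ := angle Z α t) h4 h2 h3 with h5 | h5 <;>
        constructor <;> simp only [h5] <;> linarith
    · obtain ⟨h5, h6⟩ := halfLog_im_bounds (θ := angle Z α t) h4
      constructor <;> simp only <;> linarith

end lift

end CuspSystem
end FatGraph

end

noncomputable section

open Complex (UnitDisc)

namespace FatGraph

variable {E : Type u} {Γ : FatGraph E} {Z : E → ℂ} [Finite E] [Nonempty E]

namespace CuspSystem

variable (K : CuspSystem Γ Z)

/-! ### Classification of projective disks -/

/-- Only finitely many points of the strips represent a point of the surface. -/
theorem finite_fiber (m : K.Surface) :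
    {p : E × ℂ | InStrip Z p ∧ K.strip p.1 p.2 = m}.Finite := by
  by_cases h : ∃ p : E × ℂ, InStrip Z p ∧ K.strip p.1 p.2 = m
  · obtain ⟨p, hp, rfl⟩ := h
    refine (finite_linked (Γ := Γ) K.rev_eq (fun n c hc => Finset.sum_pos (fun k _ => K.im_pos _)
      ⟨0, by simpa using hc.1⟩) hp).subset ?_
    rintro q ⟨hq, he⟩
    exact (K.strip_eq_iff hp hq).1 he.symm
  · convert Set.finite_empty
    exact Set.eq_empty_of_forall_notMem fun p hp => h ⟨p, hp⟩

section lift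
variable {K} {U : ℂ → K.Surface}

/-- A projective disk lifts to one strip: as there are finitely many points over `U 0`, the lifts
over smaller disks that start at one of them exist up to the supremum `s` of the possible radii, and
they fit together to a lift over the disk of radius `s`, which would extend if `s < 1`. -/
theorem exists_isLift_one (hU : ∀ z, ‖z‖ < 1 → K.regularSurface.ProjectiveAt id U z) :
    ∃ α x, K.IsLift U 1 α x := by
  have hU0 := hU 0 (by simp)
  set R : Set ℝ := {r | 0 < r ∧ r ≤ 1 ∧ ∃ α x, K.IsLift U r α x} with hR
  have hbdd : BddAbove R := ⟨1, fun r hr => hr.2.1⟩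
  obtain ⟨r₀, hr₀, α₀, x₀, h₀⟩ := exists_isLift hU0 hU0.notMem
  have hmem₀ : min r₀ 1 ∈ R :=
    ⟨lt_min hr₀ one_pos, min_le_right _ _, α₀, x₀, h₀.mono (min_le_left _ _)⟩
  set s := sSup R with hs
  have hs0 : 0 < s := hmem₀.1.trans_le (le_csSup hbdd hmem₀)
  have hs1 : s ≤ 1 := csSup_le ⟨_, hmem₀⟩ fun r hr => hr.2.1
  have hlt : ∀ r < s, ∃ α x, K.IsLift U r α x := by
    intro r hr
    obtain ⟨r', hr', hlt⟩ := exists_lt_of_lt_csSup ⟨_, hmem₀⟩ hr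
    obtain ⟨-, -, α, x, h⟩ := hr'
    exact ⟨α, x, h.mono hlt.le⟩
  -- one point over `U 0` serves for all radii
  obtain ⟨p, hp⟩ : ∃ p : E × ℂ, ∀ r, 0 < r → r < s → ∃ x, K.IsLift U r p.1 x ∧ x 0 = p.2 := by
    by_contra hc
    push Not at hc
    have h1 : ∀ᶠ r in 𝓝[<] s, ∀ p ∈ {p : E × ℂ | InStrip Z p ∧ K.strip p.1 p.2 = U 0},
        ¬ ∃ x, K.IsLift U r p.1 x ∧ x 0 = p.2 := by
      rw [Filter.eventually_all_finite (K.finite_fiber (U 0))]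
      intro p _
      obtain ⟨r, -, hrs, hno⟩ := hc p
      filter_upwards [Ioo_mem_nhdsLT hrs] with r' hr'
      rintro ⟨x, hx, hx0⟩
      exact hno x (hx.mono hr'.1.le) hx0
    obtain ⟨r, hr, hr0, hrs⟩ := (h1.and (Ioo_mem_nhdsLT hs0)).exists
    obtain ⟨α, x, hx⟩ := hlt r hrs
    have hx0 := hx 0 (by simpa using hr0)
    exact hr (α, x 0) ⟨hx0.2.1, hx0.2.2.symm⟩ ⟨x, hx, rfl⟩
  choose! f hf hf0 using hp
  have hmid : ∀ z : ℂ, ‖z‖ < s → ‖z‖ < (‖z‖ + s) / 2 ∧ 0 < (‖z‖ + s) / 2 ∧ (‖z‖ + s) / 2 < s :=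
    fun z hz => ⟨by linarith, by linarith [norm_nonneg z], by linarith⟩
  have heq : ∀ r, 0 < r → r < s → ∀ z, ‖z‖ < r → f ((‖z‖ + s) / 2) z = f r z := by
    intro r hr hrs z hz
    obtain ⟨h1, h2, h3⟩ := hmid z (hz.trans hrs)
    refine IsLift.unique ((hf _ h2 h3).mono (min_le_left _ r))
      ((hf r hr hrs).mono (min_le_right _ _)) (lt_min h2 hr)
      ((hf0 _ h2 h3).trans (hf0 r hr hrs).symm) (lt_min h1 hz)
  have hlift : K.IsLift U s p.1 fun z => f ((‖z‖ + s) / 2) z := by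
    intro z hz
    obtain ⟨h1, h2, h3⟩ := hmid z hz
    obtain ⟨h4, h5, h6⟩ := hf _ h2 h3 z h1
    refine ⟨h4.congr ?_, h5, h6⟩
    filter_upwards [Metric.isOpen_ball.mem_nhds (mem_ball_zero_iff.2 h1)] with v hv
    exact (heq _ h2 h3 v (mem_ball_zero_iff.1 hv)).symm
  rcases hs1.eq_or_lt with h1 | h1
  · rw [h1] at hlift
    exact ⟨_, _, hlift⟩
  · obtain ⟨r', hr', β, y, hy⟩ := hlift.exists_gt hs0 h1 hU
    have h2 : min r' 1 ∈ R :=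
      ⟨lt_min (hs0.trans hr') one_pos, min_le_right _ _, β, y, hy.mono (min_le_left _ _)⟩
    exact absurd (le_csSup hbdd h2) (not_le.2 (lt_min hr' h1))

end lift

/-- Every projective disk factors through a disk along an edge: it lifts to a strip, and the lift
takes its values in a half plane. -/
theorem exists_eq_disk_comp {u : C(UnitDisc, K.Surface)}
    (hu : K.regularSurface.IsProjectiveDisk u) :
    ∃ α t k, RegularProjectiveSurface.IsMobiusSelfMap k ∧ ∀ w, u w = K.disk α t (k w) := by
  -- the value `u 0` outside the disk is not used
  set U : ℂ → K.Surface := fun z => if hz : ‖z‖ < 1 then u (UnitDisc.mk z hz) else u 0 with hUdef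
  have hUu : ∀ w : UnitDisc, U w = u w := fun w => by
    simp only [hUdef, dif_pos w.norm_lt_one, UnitDisc.mk_coe]
  have hU : ∀ z, ‖z‖ < 1 → K.regularSurface.ProjectiveAt id U z := by
    intro z hz
    obtain ⟨w, rfl⟩ : ∃ w : UnitDisc, (w : ℂ) = z := ⟨UnitDisc.mk z hz, rfl⟩
    obtain ⟨hc, φ, hφ, hsrc, hm⟩ := hu w
    have hmap := UnitDisc.map_coe_nhds w
    rw [← hUu] at hsrc
    refine ⟨?_, φ, hφ, hsrc, ?_⟩
    · have h1 : Tendsto (fun w : UnitDisc => U w) (𝓝 w) (𝓝 (U w)) := by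
        rw [funext hUu, hUu]
        exact hc.tendsto
      rw [ContinuousAt, ← hmap]
      exact h1
    · have h2 : MobiusAt (fun v : UnitDisc => id (v : ℂ)) (fun v : UnitDisc => φ (U (v : ℂ))) w :=
        hm.congr EventuallyEq.rfl (Eventually.of_forall fun v => by simp only [hUu])
      exact MobiusAt.of_map (f := fun v : UnitDisc => (v : ℂ)) (q := w) h2 hmap
  obtain ⟨α, x, hx⟩ := exists_isLift_one hU
  obtain ⟨t, ht⟩ := hx.exists_angle one_pos hU
  obtain ⟨a, b, c, d, hD, hm⟩ := exists_mobius_of_locally one_pos fun z hz =>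
    hx.mobiusAt hz (hU z hz)
  obtain ⟨k, hk, hkx⟩ := exists_isMobiusSelfMap_halfLog (θ := angle Z α t)
    (x := fun w : UnitDisc => x w) (fun w => (ht _ w.norm_lt_one).1)
    (fun w => (ht _ w.norm_lt_one).2) ⟨a, b, c, d, hD, fun w => hm w w.norm_lt_one⟩
  refine ⟨α, t, k, hk, fun w => ?_⟩
  rw [disk_apply, hkx, ← hUu]
  exact (hx w w.norm_lt_one).2.2

/-! ### Maximal disks -/

open RegularProjectiveSurface in
/-- A Möbius map between disks along edges is an automorphism, as it takes the boundary points `1`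
and `-1`, where the disk leans on punctures, to boundary points. -/
theorem exists_discAut_of_disk_comp {α β : E} {t t' : unitInterval} {f : UnitDisc → UnitDisc}
    (hf : IsMobiusSelfMap f) (h : ∀ w, K.disk α t w = K.disk β t' (f w)) :
    ∃ p τ, f = discAut p τ := by
  obtain ⟨a, b, c, d, hD, hcl, hfF⟩ := hf.exists_ext
  have key : ∀ ξ : ℂ, ‖ξ‖ = 1 → ξ ∈ K.regularSurface.leanPoints (K.disk α t) →
      ‖(a * ξ + b) / (c * ξ + d)‖ = 1 := by
    rintro ξ hξ ⟨-, p, hp, hT⟩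
    obtain ⟨hden, hle⟩ := hcl ξ hξ.le
    refine le_antisymm hle (not_lt.1 fun hlt => ?_)
    have := UnitDisc.comap_coe_neBot hξ
    have hfT : Tendsto f (comap (fun w : UnitDisc => (w : ℂ)) (𝓝 ξ)) (𝓝 (UnitDisc.mk _ hlt)) := by
      rw [UnitDisc.isEmbedding_coe.tendsto_nhds_iff]
      have e : (fun w : UnitDisc => (w : ℂ)) ∘ f =
          (fun z => (a * z + b) / (c * z + d)) ∘ fun w : UnitDisc => (w : ℂ) := funext hfF
      rw [e]
      have hc : ContinuousAt (fun z => (a * z + b) / (c * z + d)) ξ :=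
        ContinuousAt.div (by fun_prop) (by fun_prop) hden
      exact hc.tendsto.comp tendsto_comap
    have hT' := ((K.disk β t').continuous.tendsto (UnitDisc.mk _ hlt)).comp hfT
    have e : (K.disk β t') ∘ f = K.disk α t := funext fun w => (h w).symm
    rw [e] at hT'
    rw [tendsto_nhds_unique hT hT'] at hp
    exact K.disk_notMem _ _ _ hp
  obtain ⟨p, τ, h1⟩ := exists_eq_discAut hD hcl (ξ₁ := 1) (ξ₂ := -1) (by simp) (by simp)
    (by norm_num) (key 1 (by simp) (K.one_mem_leanPoints α t))
    (key (-1) (by simp) (K.neg_one_mem_leanPoints α t))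
  exact ⟨p, τ, funext fun w => UnitDisc.coe_injective (by rw [hfF, h1]; rfl)⟩

open RegularProjectiveSurface in
theorem isMaximalDisk_disk (α : E) (t : unitInterval) :
    K.regularSurface.IsMaximalDisk (K.disk α t) := by
  refine ⟨K.isProjectiveDisk_disk α t, ?_⟩
  rintro v hv ⟨f, hf, hvf⟩
  obtain ⟨β, t', k, hk, hvk⟩ := K.exists_eq_disk_comp hv
  obtain ⟨p, τ, hp⟩ := K.exists_discAut_of_disk_comp (β := β) (t' := t') (hk.comp hf) fun w => by
    rw [hvf, hvk]; rfl
  refine ⟨f, hf, ⟨hf.injective, fun w => ?_⟩, hvf⟩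
  obtain ⟨w', hw'⟩ := (bijective_discAut p τ).2 (k w)
  rw [← hp] at hw'
  exact ⟨w', hk.injective hw'⟩

open RegularProjectiveSurface in
/-- The maximal disks are the disks along edges. -/
theorem exists_eq_disk_discAut {u : C(UnitDisc, K.Surface)}
    (hu : K.regularSurface.IsMaximalDisk u) :
    ∃ α t p τ, ∀ w, u w = K.disk α t (discAut p τ w) := by
  obtain ⟨α, t, k, hk, hku⟩ := K.exists_eq_disk_comp hu.1
  obtain ⟨f, hf, hfb, hfu⟩ := hu.2 _ (K.isProjectiveDisk_disk α t) ⟨k, hk, hku⟩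
  obtain ⟨p, τ, rfl⟩ := hf.eq_discAut hfb.2
  exact ⟨α, t, p, τ, hfu⟩

/-- The disk along an edge as a parametrized maximal disk. -/
def maxDisk (α : E) (t : unitInterval) : K.regularSurface.ParamMaximalDisk :=
  ⟨K.disk α t, K.isMaximalDisk_disk α t⟩

open RegularProjectiveSurface in
theorem isProjectiveDisk_comp {u v : C(UnitDisc, K.Surface)}
    (hu : K.regularSurface.IsProjectiveDisk u) {f : UnitDisc → UnitDisc} (hf : IsMobiusSelfMap f)
    (hfc : Continuous f) (h : ∀ w, v w = u (f w)) : K.regularSurface.IsProjectiveDisk v := by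
  intro w
  obtain ⟨hc, φ, hφ, hsrc, hm⟩ := hu (f w)
  obtain ⟨a, b, c, d, hD, hf'⟩ := hf
  refine ⟨v.continuous.continuousAt, φ, hφ, by rwa [h], ?_⟩
  have h1 : MobiusAt (fun q : UnitDisc => (q : ℂ)) (fun q => (f q : ℂ)) w :=
    ⟨a, b, c, d, hD, Eventually.of_forall hf'⟩
  refine h1.trans ((hm.comp (f := f) hfc.continuousAt).congr EventuallyEq.rfl
    (Eventually.of_forall fun q => ?_))
  simp only [h]

open RegularProjectiveSurface in
/-- The disk along an edge in another parametrization. -/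
def rotatedDisk (α : E) (p : UnitDisc) (τ : Circle) (t : unitInterval) :
    C(UnitDisc, K.Surface) where
  toFun w := K.disk α t (discAut p τ w)
  continuous_toFun := (K.disk α t).continuous.comp (continuous_discAut p τ)

open RegularProjectiveSurface in
theorem isMaximalDisk_rotatedDisk (α : E) (p : UnitDisc) (τ : Circle) (t : unitInterval) :
    K.regularSurface.IsMaximalDisk (K.rotatedDisk α p τ t) := by
  refine ⟨K.isProjectiveDisk_comp (K.isProjectiveDisk_disk α t) (isMobiusSelfMap_discAut p τ)
    (continuous_discAut p τ) fun w => rfl, ?_⟩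
  rintro v hv ⟨f, hf, hvf⟩
  obtain ⟨p', τ', hinv⟩ := exists_discAut_inv p τ
  have hinv' : ∀ w, discAut p τ (discAut p' τ' w) = w := by
    intro w
    obtain ⟨w', rfl⟩ := (bijective_discAut p τ).2 w
    rw [hinv]
  have hle : K.regularSurface.DiskLE (K.disk α t) v :=
    ⟨f ∘ discAut p' τ', hf.comp (isMobiusSelfMap_discAut p' τ'), fun w => by
      rw [Function.comp_apply, ← hvf]
      exact congrArg (K.disk α t) (hinv' w).symm⟩
  obtain ⟨g, hg, hgb, hgv⟩ := (K.isMaximalDisk_disk α t).2 v hv hle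
  exact ⟨g ∘ discAut p τ, hg.comp (isMobiusSelfMap_discAut p τ), hgb.comp (bijective_discAut p τ),
    fun w => hgv _⟩

/-- The disk along an edge in another parametrization, as a parametrized maximal disk. -/
def rotatedMaxDisk (α : E) (p : UnitDisc) (τ : Circle) (t : unitInterval) :
    K.regularSurface.ParamMaximalDisk :=
  ⟨K.rotatedDisk α p τ t, K.isMaximalDisk_rotatedDisk α p τ t⟩

open RegularProjectiveSurface in
theorem diskClass_rotatedMaxDisk (α : E) (p : UnitDisc) (τ : Circle) (t : unitInterval) :
    K.regularSurface.diskClass (K.rotatedMaxDisk α p τ t) =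
      K.regularSurface.diskClass (K.maxDisk α t) :=
  Quot.sound ⟨discAut p τ, isMobiusSelfMap_discAut p τ, bijective_discAut p τ, fun _ => rfl⟩

open RegularProjectiveSurface in
theorem continuous_rotatedMaxDisk (α : E) (p : UnitDisc) (τ : Circle) :
    Continuous (K.rotatedMaxDisk α p τ) := by
  refine Continuous.subtype_mk (ContinuousMap.continuous_of_continuous_uncurry _ ?_) _
  exact K.continuous_strip_halfLog α continuous_fst ((continuous_discAut p τ).comp continuous_snd)

theorem continuous_maxDisk (α : E) : Continuous (K.maxDisk α) :=
  Continuous.subtype_mk (ContinuousMap.continuous_of_continuous_uncurry _ (K.continuous_disk α)) _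

open RegularProjectiveSurface in
theorem exists_eq_rotatedMaxDisk (u : K.regularSurface.ParamMaximalDisk) :
    ∃ α t p τ, u = K.rotatedMaxDisk α p τ t := by
  obtain ⟨α, t, p, τ, h⟩ := K.exists_eq_disk_discAut u.2
  exact ⟨α, t, p, τ, Subtype.ext (ContinuousMap.ext h)⟩

open RegularProjectiveSurface in
/-- Equivalent parametrized maximal disks differ by an automorphism: the relation defining the
quotient is an equivalence relation. -/
theorem diskEquiv_of_diskClass_eq {S : RegularProjectiveSurface.{u}} {u v : S.ParamMaximalDisk}
    (h : S.diskClass u = S.diskClass v) : S.DiskEquiv u.1 v.1 := by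
  have hinv : ∀ {f}, IsMobiusSelfMap f → Function.Bijective f → ∃ g, IsMobiusSelfMap g ∧
      Function.Bijective g ∧ ∀ w, f (g w) = w := by
    intro f hf hfb
    obtain ⟨p, τ, rfl⟩ := hf.eq_discAut hfb.2
    obtain ⟨p', τ', h⟩ := exists_discAut_inv p τ
    refine ⟨_, isMobiusSelfMap_discAut p' τ', bijective_discAut p' τ', fun w => ?_⟩
    obtain ⟨w', rfl⟩ := hfb.2 w
    rw [h]
  have heq : Equivalence fun u v : S.ParamMaximalDisk => S.DiskEquiv u.1 v.1 := by
    refine ⟨fun u => ⟨id, IsMobiusSelfMap.id, Function.bijective_id, fun w => rfl⟩, ?_, ?_⟩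
    · rintro u v ⟨f, hf, hfb, h⟩
      obtain ⟨g, hg, hgb, hfg⟩ := hinv hf hfb
      exact ⟨g, hg, hgb, fun w => by rw [h, hfg]⟩
    · rintro u v w ⟨f, hf, hfb, h⟩ ⟨g, hg, hgb, h'⟩
      exact ⟨g ∘ f, hg.comp hf, hgb.comp hfb, fun x => by rw [h, h']; rfl⟩
  exact heq.eqvGen_iff.1 (Quot.eqvGen_exact h)

theorem diskClass_eq_of_diskLE {α β : E} {t t' : unitInterval}
    (h : K.regularSurface.DiskLE (K.disk α t) (K.disk β t')) :
    K.regularSurface.diskClass (K.maxDisk α t) = K.regularSurface.diskClass (K.maxDisk β t') :=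
  Quot.sound ((K.isMaximalDisk_disk α t).2 _ (K.isProjectiveDisk_disk β t') h)

end CuspSystem
end FatGraph

end

noncomputable section

open Complex (UnitDisc)

namespace FatGraph

variable {E : Type u} {Γ : FatGraph E} {Z : E → ℂ}

/-! ### Distinct points of the graph have distinct disks -/

/-- Chains of passages are locally given by continuous functions. -/
theorem Steps.exists_germ (hpos : ∀ α, 0 < (Z α).im) {n : ℕ} {α β : E} {x₀ y₀ : ℂ}
    (h : Γ.Steps Z n (α, x₀) (β, y₀)) :
    ∃ g : ℂ → ℂ, ContinuousAt g x₀ ∧ g x₀ = y₀ ∧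
      ∀ᶠ x in 𝓝 x₀, InStrip Z (α, x) → Γ.Steps Z n (α, x) (β, g x) := by
  induction n generalizing α x₀ with
  | zero =>
    have h' : (α, x₀) = (β, y₀) := h
    obtain ⟨rfl, rfl⟩ := Prod.ext_iff.1 h'
    exact ⟨id, continuousAt_id, rfl, Eventually.of_forall fun x _ => rfl⟩
  | succ n ih =>
    obtain ⟨⟨γ, r⟩, hs, hr⟩ := h
    obtain ⟨g, hg, hg0, hge⟩ := ih hr
    have h1 : -Real.pi < (x₀ - Z α).im := hs.2.2.1
    have h2 : (x₀ - Z α).im < 0 := hs.1.sub_im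
    have hc : Continuous fun x : ℂ => (x - Z α).im := by fun_prop
    have h3 : ∀ᶠ x in 𝓝 x₀, -Real.pi < (x - Z α).im :=
      (isOpen_lt continuous_const hc).mem_nhds h1
    have key : ∀ {T : ℂ → ℂ}, T x₀ = r → ContinuousAt T x₀ → (∀ x, InStrip Z (α, x) →
        -Real.pi < (x - Z α).im → Γ.Step Z (α, x) (γ, T x)) →
        ∃ g : ℂ → ℂ, ContinuousAt g x₀ ∧ g x₀ = y₀ ∧
          ∀ᶠ x in 𝓝 x₀, InStrip Z (α, x) → Γ.Steps Z (n + 1) (α, x) (β, g x) := by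
      intro T hT hTc hTs
      refine ⟨g ∘ T, ContinuousAt.comp (by rwa [hT]) hTc, by rw [Function.comp_apply, hT, hg0], ?_⟩
      have hTt := hTc.tendsto
      rw [hT] at hTt
      filter_upwards [h3, hTt.eventually hge] with x h4 h5 h6
      have h7 := hTs x h6 h4
      exact ⟨_, h7, h5 h7.2.1⟩
    rcases hs.2.2.2 with he | he <;> obtain ⟨rfl, rfl⟩ := Prod.ext_iff.1 he
    · exact key rfl (continuousAt_turnR h1 h2) fun x h4 h5 => step_right (Γ := Γ) hpos h4 h5
    · exact key rfl (continuousAt_turnL h1 h2) fun x h4 h5 => step_left (Γ := Γ) hpos h4 h5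

theorem point_rev (α : E) (t : unitInterval) :
    Γ.point (Γ.rev α) (unitInterval.symm t) = Γ.point α t :=
  (Quot.sound (RealizationRel.rev α t)).symm

theorem point_next (α : E) : Γ.point (Γ.next α) 0 = Γ.point α 0 :=
  (Quot.sound (RealizationRel.next α)).symm

theorem point_right (α : E) : Γ.point (Γ.right α) 0 = Γ.point α 1 := by
  rw [right, point_next, ← point_rev α 1, unitInterval.symm_one]

/-- The image of the function `x` is the half plane of the disk with parameter `t` along `α`. -/
def Sweeps (Z : E → ℂ) (α : E) (t : unitInterval) (x : UnitDisc → ℂ) : Prop :=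
  ∀ y : ℂ, (∃ w, x w = y) ↔ angle Z α t - Real.pi < y.im ∧ y.im < angle Z α t

theorem Sweeps.exists_im {α : E} {t : unitInterval} {x : UnitDisc → ℂ} (h : Sweeps Z α t x) {s : ℝ}
    (h1 : angle Z α t - Real.pi < s) (h2 : s < angle Z α t) : ∃ w, (x w).im = s := by
  obtain ⟨w, hw⟩ := (h (s * Complex.I)).2 (by simpa using ⟨h1, h2⟩)
  exact ⟨w, by rw [hw]; simp⟩

theorem Sweeps.angle_le {α β : E} {t t' : unitInterval} {x : UnitDisc → ℂ} (h : Sweeps Z α t x)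
    (h' : Sweeps Z β t' x) : angle Z α t ≤ angle Z β t' := by
  by_contra hc
  push Not at hc
  have hpi := Real.pi_pos
  obtain ⟨w, hw⟩ := h.exists_im (s := max (angle Z β t') (angle Z α t - Real.pi / 2))
    (lt_max_of_lt_right (by linarith)) (max_lt hc (by linarith))
  have h1 := ((h' (x w)).1 ⟨w, rfl⟩).2
  rw [hw] at h1
  exact absurd (le_max_left _ _) (not_le.2 h1)

theorem Sweeps.flip {α : E} {t : unitInterval} {x : UnitDisc → ℂ} (h : Sweeps Z α t x)
    (hZ : ∀ α, Z (Γ.rev α) = Z α) :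
    Sweeps Z (Γ.rev α) (unitInterval.symm t) fun w => Z α - Real.pi * Complex.I - x w := by
  intro y
  have e : angle Z (Γ.rev α) (unitInterval.symm t) = (Z α).im - angle Z α t := by
    rw [angle, angle, hZ, unitInterval.coe_symm_eq]; ring
  have h1 : (∃ w, Z α - Real.pi * Complex.I - x w = y) ↔
      ∃ w, x w = Z α - Real.pi * Complex.I - y :=
    exists_congr fun w => ⟨fun h => by rw [← h]; ring, fun h => by rw [h]; ring⟩
  rw [h1, h, e]
  simp only [Complex.sub_im, Complex.mul_im, Complex.ofReal_re, Complex.ofReal_im, Complex.I_re,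
    Complex.I_im]
  constructor <;> rintro ⟨h2, h3⟩ <;> constructor <;> linarith

theorem Steps.im_neg {n : ℕ} {p q : E × ℂ} (h : Γ.Steps Z (n + 1) p q) : q.2.im < 0 := by
  obtain ⟨r, -, hr⟩ := h.exists_last
  exact hr.im_neg

/-- If the same chain of passages takes a half plane on the strip of `α` to one on the strip of `β`,
then the two half planes are the disk of the same point of the graph.  If there is a passage, the
half planes are at the end of `α` and at the beginning of `β`; a chain of two passages is
impossible, because a point of the half plane with imaginary part near the lower bound goes too far
down in the first one. -/
theorem point_eq_of_steps (hpos : ∀ α, 0 < (Z α).im) {n : ℕ} {α β : E} {t t' : unitInterval}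
    {x y : UnitDisc → ℂ} (hx : Sweeps Z α t x) (hy : Sweeps Z β t' y)
    (h : ∀ w, Γ.Steps Z n (α, x w) (β, y w)) : Γ.point α t = Γ.point β t' := by
  have hpi := Real.pi_pos
  cases n with
  | zero =>
    have h0 : ∀ w, (α, x w) = (β, y w) := h
    have hαβ : α = β := congrArg Prod.fst (h0 0)
    have hxy : x = y := funext fun w => congrArg Prod.snd (h0 w)
    subst hαβ hxy
    have h1 : angle Z α t = angle Z α t' := le_antisymm (hx.angle_le hy) (hy.angle_le hx)
    rw [Subtype.ext (mul_right_cancel₀ (hpos α).ne' h1)]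
  | succ n =>
    -- a passage requires `Im x > Im Z α - π`
    have ht : t = 1 := by
      by_contra ht
      have hlt : angle Z α t < (Z α).im :=
        mul_lt_of_lt_one_left (hpos α) (unitInterval.lt_one_iff_ne_one.2 ht)
      obtain ⟨w, hw⟩ := hx.exists_im
        (s := min (angle Z α t - Real.pi / 2) ((Z α).im - Real.pi))
        (lt_min (by linarith) (by linarith)) (min_lt_of_left_lt (by linarith))
      obtain ⟨r, hs, -⟩ := h w
      have h1 := hs.2.2.1
      rw [Complex.sub_im, hw] at h1
      have h2 := min_le_right (angle Z α t - Real.pi / 2) ((Z α).im - Real.pi)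
      simp only at h1
      linarith
    -- a passage arrives in the lower half plane
    have ht' : t' = 0 := by
      by_contra ht'
      have hlt : 0 < angle Z β t' := mul_pos (unitInterval.pos_iff_ne_zero.2 ht') (hpos β)
      obtain ⟨w, hw⟩ := hy.exists_im (s := max 0 (angle Z β t' - Real.pi / 2))
        (lt_max_of_lt_right (by linarith)) (max_lt hlt (by linarith))
      have h1 := (h w).im_neg
      simp only [hw] at h1
      exact absurd (le_max_left _ _) (not_le.2 h1)
    subst ht ht'
    cases n with
    | zero =>
      obtain ⟨r, hs, hr⟩ := h 0
      have hr' : r = (β, y 0) := hr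
      subst hr'
      rcases hs.2.2.2 with he | he
      · have hβ : β = Γ.right α := congrArg Prod.fst he
        rw [hβ, point_right]
      · have hβ : β = Γ.next (Γ.right α) := congrArg Prod.fst he
        rw [hβ, point_next, point_right]
    | succ n =>
      set ε := min (Real.pi / 2) (min (Z (Γ.right α)).im (Z (Γ.next (Γ.right α))).im) with hε
      have hε0 : 0 < ε := lt_min (by linarith) (lt_min (hpos _) (hpos _))
      have hε1 : ε ≤ Real.pi / 2 := min_le_left _ _
      have e : angle Z α 1 = (Z α).im := by simp [angle]
      obtain ⟨w, hw⟩ := hx.exists_im (s := (Z α).im - Real.pi + ε) (by rw [e]; linarith)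
        (by rw [e]; linarith)
      obtain ⟨r, hs, s, hs', -⟩ := h w
      have h1 := hs.im_lt
      have h2 := hs'.2.2.1
      have h3 : ε ≤ (Z r.1).im := by
        rcases hs.2.2.2 with he | he
        · rw [he]
          exact (min_le_right _ _).trans (min_le_left _ _)
        · rw [he]
          exact (min_le_right _ _).trans (min_le_right _ _)
      simp only [Complex.sub_im] at h1 h2
      rw [hw] at h1
      linarith

variable [Finite E] [Nonempty E]

namespace CuspSystem

variable (K : CuspSystem Γ Z)

theorem strip_eq_of_steps {n : ℕ} {α β : E} {x y : ℂ} (hx : InStrip Z (α, x))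
    (h : Γ.Steps Z n (α, x) (β, y)) : K.strip α x = K.strip β y :=
  (K.strip_eq_iff hx (h.inStrip.1 hx)).2 ⟨n, Or.inl h⟩

/-- Continuous coordinates of the same map to the surface are related by the same chain of passages
everywhere. -/
theorem steps_of_strip_eq {α β : E} {x y : UnitDisc → ℂ} (hxc : Continuous x) (hyc : Continuous y)
    (hx : ∀ w, InStrip Z (α, x w)) (hy : ∀ w, InStrip Z (β, y w))
    (h : ∀ w, K.strip α (x w) = K.strip β (y w)) {n : ℕ} {w₀ : UnitDisc}
    (h₀ : Γ.Steps Z n (α, x w₀) (β, y w₀)) (w : UnitDisc) : Γ.Steps Z n (α, x w) (β, y w) := by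
  have hcl : IsClopen {w | Γ.Steps Z n (α, x w) (β, y w)} := by
    constructor
    · refine isOpen_compl_iff.1 (isOpen_iff_eventually.2 fun w hw => ?_)
      exact ((hxc.tendsto w).prodMk_nhds (hyc.tendsto w)).eventually
        (eventually_not_steps K.im_pos n (hx w) (hy w) hw)
    · refine isOpen_iff_eventually.2 fun w hw => ?_
      obtain ⟨g, hg, hg0, hge⟩ := Steps.exists_germ K.im_pos (show Γ.Steps Z n _ _ from hw)
      have h1 : Tendsto (fun v => g (x v)) (𝓝 w) (𝓝 (y w)) := by
        have h2 := hg.tendsto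
        rw [hg0] at h2
        exact h2.comp (hxc.tendsto w)
      have h3 := (hxc.tendsto w).eventually hge
      have h4 := K.eventually_eq_of_strip_eq (hy w) h1 (hyc.tendsto w) (by
        filter_upwards [h3] with v hv
        rw [← h v, K.strip_eq_of_steps (hx v) (hv (hx v))])
      filter_upwards [h3, h4] with v h5 h6
      have h7 := h5 (hx v)
      rwa [h6] at h7
  have := hcl.eq_univ ⟨w₀, h₀⟩
  exact (Set.ext_iff.1 this w).2 trivial

omit [Finite E] [Nonempty E] in
theorem sweeps_halfLog (α : E) (t : unitInterval) {f : UnitDisc → UnitDisc}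
    (hf : Function.Bijective f) : Sweeps Z α t fun w => halfLog (angle Z α t) (f w) := by
  intro y
  constructor
  · rintro ⟨w, rfl⟩
    exact halfLog_im_bounds (f w).norm_lt_one
  · rintro ⟨h1, h2⟩
    obtain ⟨v, hv, rfl⟩ := exists_halfLog_eq h1 h2
    obtain ⟨w, hw⟩ := hf.2 (UnitDisc.mk v hv)
    exact ⟨w, by simp only [hw]; rfl⟩

open RegularProjectiveSurface in
/-- Distinct points of the graph have distinct disks: coordinates of the same disk along two edges
are related by one chain of passages, after a reversal of the edges if necessary. -/
theorem point_eq_of_diskClass_eq {α β : E} {t t' : unitInterval}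
    (h : K.regularSurface.diskClass (K.maxDisk α t) = K.regularSurface.diskClass (K.maxDisk β t')) :
    Γ.point α t = Γ.point β t' := by
  obtain ⟨f, hf, hfb, hfe⟩ := diskEquiv_of_diskClass_eq h
  obtain ⟨p, τ, rfl⟩ := hf.eq_discAut hfb.2
  set x : UnitDisc → ℂ := fun w => halfLog (angle Z α t) w with hx
  set y : UnitDisc → ℂ := fun w => halfLog (angle Z β t') (discAut p τ w) with hy
  have hxs : Sweeps Z α t x := sweeps_halfLog α t Function.bijective_id
  have hys : Sweeps Z β t' y := sweeps_halfLog β t' hfb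
  have hxc : Continuous x := continuous_const.halfLog continuous_id
  have hyc : Continuous y := continuous_const.halfLog (continuous_discAut p τ)
  have hxi : ∀ w, InStrip Z (α, x w) := K.inStrip_angle α t
  have hyi : ∀ w, InStrip Z (β, y w) := fun w => K.inStrip_angle β t' _
  have hxy : ∀ w, K.strip α (x w) = K.strip β (y w) := hfe
  have hxs' := hxs.flip (Γ := Γ) K.rev_eq
  have hys' := hys.flip (Γ := Γ) K.rev_eq
  have hxc' : Continuous fun w => Z α - Real.pi * Complex.I - x w := continuous_const.sub hxc
  have hyc' : Continuous fun w => Z β - Real.pi * Complex.I - y w := continuous_const.sub hyc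
  have hxi' := fun w => (hxi w).flip (Γ := Γ) K.rev_eq
  have hyi' := fun w => (hyi w).flip (Γ := Γ) K.rev_eq
  have hxe : ∀ w, K.strip (Γ.rev α) (Z α - Real.pi * Complex.I - x w) = K.strip α (x w) :=
    fun w => K.strip_flip (hxi w)
  have hye : ∀ w, K.strip (Γ.rev β) (Z β - Real.pi * Complex.I - y w) = K.strip β (y w) :=
    fun w => K.strip_flip (hyi w)
  obtain ⟨n, h1 | h1 | h1 | h1⟩ := (K.strip_eq_iff (hxi 0) (hyi 0)).1 (hxy 0)
  · exact point_eq_of_steps K.im_pos hxs hys (K.steps_of_strip_eq hxc hyc hxi hyi hxy h1)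
  · rw [← point_rev β]
    exact point_eq_of_steps K.im_pos hxs hys' (K.steps_of_strip_eq hxc hyc' hxi hyi'
      (fun w => by rw [hye, hxy]) h1)
  · rw [← point_rev α]
    exact point_eq_of_steps K.im_pos hxs' hys (K.steps_of_strip_eq hxc' hyc hxi' hyi
      (fun w => by rw [hxe, hxy]) h1)
  · rw [← point_rev α, ← point_rev β]
    exact point_eq_of_steps K.im_pos hxs' hys' (K.steps_of_strip_eq hxc' hyc' hxi' hyi'
      (fun w => by rw [hxe, hye, hxy]) h1)

/-! ### The graph of maximal disks -/

omit [Finite E] [Nonempty E] in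
theorem exp_halfLog_unitDisc (θ : ℝ) (w : UnitDisc) : Complex.exp (halfLog θ w) =
    Complex.exp ((θ - Real.pi / 2) * Complex.I) * (1 + w) / (1 - w) := by
  rw [exp_halfLog (cayley_ne_zero w.norm_lt_one), mul_div_assoc]

/-- The disk with parameter `t` along `α` is the one with parameter `1 - t` along the reversed edge;
the function `z` is replaced by `-e^Z / z`. -/
theorem diskLE_rev (α : E) (t : unitInterval) : K.regularSurface.DiskLE (K.disk α t)
    (K.disk (Γ.rev α) (unitInterval.symm t)) := by
  have e : angle Z (Γ.rev α) (unitInterval.symm t) = (Z α).im - angle Z α t := by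
    rw [angle, angle, K.rev_eq, unitInterval.coe_symm_eq]; ring
  set ε := Complex.exp ((angle Z α t - Real.pi / 2) * Complex.I) with hε
  set η := Complex.exp (Z α - Real.pi * Complex.I) with hη
  have hb := fun w : UnitDisc => halfLog_im_bounds (θ := angle Z α t) w.norm_lt_one
  obtain ⟨f, hf, hfe⟩ := exists_isMobiusSelfMap_halfLog
    (θ := angle Z (Γ.rev α) (unitInterval.symm t))
    (x := fun w => Z α - Real.pi * Complex.I - halfLog (angle Z α t) w)
    (fun w => by
      have := (hb w).2
      rw [e]; simp; linarith)
    (fun w => by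
      have := (hb w).1
      rw [e]; simp; linarith)
    ⟨-η, η, ε, ε, by
      rw [show -η * ε - η * ε = -(2 * (η * ε)) by ring]
      exact neg_ne_zero.2 (mul_ne_zero two_ne_zero
        (mul_ne_zero (Complex.exp_ne_zero _) (Complex.exp_ne_zero _))), fun w => by
      have h1 : (1 : ℂ) + w ≠ 0 := by
        intro h
        exact w.coe_ne_neg_one (by linear_combination h)
      have h0 : ε ≠ 0 := Complex.exp_ne_zero _
      refine ⟨by rw [show ε * (w : ℂ) + ε = ε * (1 + w) by ring]; exact mul_ne_zero h0 h1, ?_⟩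
      rw [Complex.exp_sub, exp_halfLog_unitDisc, ← hε, ← hη, div_div_eq_mul_div]
      congr 1 <;> ring⟩
  refine ⟨f, hf, fun w => ?_⟩
  rw [disk_apply, disk_apply, hfe]
  exact (K.strip_flip (K.inStrip_angle α t w)).symm

end CuspSystem

/-- The parameters of the rotation of the disk at a vertex that takes the lean points `1, -1, -i` to
`-i, 1, -1`. -/
def vertexParam : UnitDisc := UnitDisc.mk ((1 - 2 * Complex.I) / 5) (by
  refine lt_of_pow_lt_pow_left₀ 2 zero_le_one ?_
  rw [← Complex.normSq_eq_norm_sq, Complex.normSq_apply]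
  norm_num)

/-- The unimodular factor of the rotation of the disk at a vertex. -/
def vertexFactor : Circle := ⟨-(3 + 4 * Complex.I) / 5, mem_sphere_zero_iff_norm.2 (by
  refine (sq_eq_sq₀ (norm_nonneg _) zero_le_one).1 ?_
  rw [← Complex.normSq_eq_norm_sq, Complex.normSq_apply]
  norm_num)⟩

theorem discAutFun_vertex (w : ℂ) : discAutFun vertexParam vertexFactor w =
    ((1 - 2 * Complex.I) - (3 + 4 * Complex.I) * w) / (5 + (1 - 2 * Complex.I) * w) := by
  have e1 : (vertexParam : ℂ) = (1 - 2 * Complex.I) / 5 := rfl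
  have e2 : (vertexFactor : ℂ) = -(3 + 4 * Complex.I) / 5 := rfl
  have e3 : starRingEnd ℂ ((1 - 2 * Complex.I) / 5) = (1 + 2 * Complex.I) / 5 := by
    rw [map_div₀, map_sub, map_mul, Complex.conj_I, map_one, map_ofNat, map_ofNat]
    ring
  rw [discAutFun, e1, e2, e3, ← mul_div_mul_left _ _ (show (5 : ℂ) ≠ 0 by norm_num)]
  congr 1
  · ring
  · linear_combination (-8 / 5 * w) * Complex.I_sq

namespace CuspSystem

variable (K : CuspSystem Γ Z)

open RegularProjectiveSurface in
/-- The three edges at a vertex start at the same disk.  The parametrizations by two consecutive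
edges differ by a rotation, as `discAutFun_vertex` and `strip_next` are the same map of order three.
-/
theorem disk_zero_eq (α : E) (w : UnitDisc) :
    K.disk α 0 w = K.disk (Γ.next α) 0 (discAut vertexParam vertexFactor w) := by
  have hpi := Real.pi_pos
  set R := discAut vertexParam vertexFactor w with hR
  have hRw : (R : ℂ) = _ := discAutFun_vertex w
  rw [disk_apply, disk_apply, angle_zero, angle_zero]
  obtain ⟨h1, h2⟩ := halfLog_im_bounds (θ := 0) w.norm_lt_one
  obtain ⟨h3, h4⟩ := halfLog_im_bounds (θ := 0) R.norm_lt_one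
  rw [zero_sub] at h1 h3
  obtain ⟨h5, h6⟩ := K.strip_next (α := α) h1 h2
  rw [← h6]
  congr 1
  obtain ⟨h7, h8⟩ := Complex.log_im_of_im_neg h5
  refine Complex.eq_of_exp_eq ?_ (by linarith) (by linarith)
  have e : Complex.exp (((0 : ℝ) - Real.pi / 2) * Complex.I) = -Complex.I := by
    rw [Complex.ofReal_zero, zero_sub, neg_mul, Complex.exp_neg, Complex.exp_pi_div_two_mul_I,
      Complex.inv_I]
  have hw1 := one_sub_ne w.norm_lt_one
  have hw2 : (1 : ℂ) + w ≠ 0 := fun h => w.coe_ne_neg_one (by linear_combination h)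
  have hR1 := one_sub_ne R.norm_lt_one
  have hI := Complex.I_ne_zero
  have hden : 5 + (1 - 2 * Complex.I) * (w : ℂ) ≠ 0 := by
    intro h
    have h9 := congrArg Complex.normSq (show (1 - 2 * Complex.I) * (w : ℂ) = -5 by
      linear_combination h)
    rw [map_mul, Complex.normSq_eq_norm_sq (w : ℂ)] at h9
    have h10 : Complex.normSq (1 - 2 * Complex.I) = 5 := by
      rw [Complex.normSq_apply]; norm_num
    rw [h10, Complex.normSq_neg] at h9
    have h11 : Complex.normSq (5 : ℂ) = 25 := by rw [Complex.normSq_apply]; norm_num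
    rw [h11] at h9
    have := w.norm_lt_one
    have := norm_nonneg (w : ℂ)
    nlinarith
  rw [Complex.exp_log (Complex.ne_zero_of_im_neg h5)]
  have hE0 := Complex.exp_ne_zero (halfLog 0 w)
  have hE : Complex.exp (halfLog 0 w) * (1 - w) = -Complex.I * (1 + w) := by
    rw [exp_halfLog_unitDisc, e, div_mul_cancel₀ _ hw1]
  have hm : (-1 * Complex.exp (halfLog 0 w) + -1) / (1 * Complex.exp (halfLog 0 w) + 0) =
      -((1 + w) + Complex.I * (1 - w)) / (1 + w) := by
    rw [div_eq_div_iff (by simp) hw2]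
    linear_combination Complex.I * hE - (1 + (w : ℂ)) * Complex.I_sq
  rw [hm, exp_halfLog_unitDisc, e, div_eq_div_iff hw2 hR1, hRw, sub_div' hden, add_div' _ _ _ hden,
    mul_div_assoc', mul_div_assoc', div_mul_eq_mul_div]
  congr 1
  linear_combination -(4 + 8 * (w : ℂ) + 4 * w ^ 2) * Complex.I_sq

/-- The map from the graph to the set of maximal disks. -/
def toMaximalDisk : Γ.Realization → K.regularSurface.MaximalDisk :=
  Quot.lift (fun p => K.regularSurface.diskClass (K.maxDisk p.1 p.2)) (by
    rintro _ _ (⟨α, t⟩ | α)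
    · exact K.diskClass_eq_of_diskLE (K.diskLE_rev α t)
    · exact K.diskClass_eq_of_diskLE ⟨_,
        RegularProjectiveSurface.isMobiusSelfMap_discAut _ _, K.disk_zero_eq α⟩)

theorem continuous_diskClass : Continuous K.regularSurface.diskClass := continuous_quot_mk

theorem continuous_toMaximalDisk : Continuous K.toMaximalDisk :=
  (isQuotientMap_quot_mk).continuous_iff.2
    (continuous_sigma fun α => K.continuous_diskClass.comp (K.continuous_maxDisk α))

theorem bijective_toMaximalDisk : Function.Bijective K.toMaximalDisk := by
  constructor
  · intro x y h
    obtain ⟨⟨α, t⟩, rfl⟩ := Quot.exists_rep x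
    obtain ⟨⟨β, t'⟩, rfl⟩ := Quot.exists_rep y
    exact K.point_eq_of_diskClass_eq h
  · intro m
    obtain ⟨u, rfl⟩ := Quot.exists_rep m
    obtain ⟨α, t, p, τ, rfl⟩ := K.exists_eq_rotatedMaxDisk u
    exact ⟨Γ.point α t, (K.diskClass_rotatedMaxDisk α p τ t).symm⟩

end CuspSystem
end FatGraph

end

noncomputable section

open Complex (UnitDisc)

/-! ### Cyclic order on the unit circle -/

/-- The orientation of a triple of points of the unit circle: it is positive if `κ` lies on the
counterclockwise arc from `ξ` to `η`. -/
def orientation (ξ η κ : ℂ) : ℝ := ((ξ - η) * (η - κ) * (κ - ξ) / (ξ * η * κ)).im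

theorem orientation_rotate (ξ η κ : ℂ) : orientation η κ ξ = orientation ξ η κ := by
  rw [orientation, orientation]
  congr 2 <;> ring

theorem exp_mul_I_sub_exp_mul_I (a b : ℂ) :
    Complex.exp (a * Complex.I) - Complex.exp (b * Complex.I) =
    2 * Complex.I * Complex.sin ((a - b) / 2) * Complex.exp ((a + b) / 2 * Complex.I) := by
  have e1 : Complex.exp (a * Complex.I) =
      Complex.exp ((a - b) / 2 * Complex.I) * Complex.exp ((a + b) / 2 * Complex.I) := by
    rw [← Complex.exp_add]; congr 1; ring
  have e2 : Complex.exp (b * Complex.I) =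
      Complex.exp (-((a - b) / 2) * Complex.I) * Complex.exp ((a + b) / 2 * Complex.I) := by
    rw [← Complex.exp_add]; congr 1; ring
  rw [e1, e2, Complex.sin]
  linear_combination (Complex.exp ((a + b) / 2 * Complex.I) *
    (Complex.exp ((a - b) / 2 * Complex.I) - Complex.exp (-((a - b) / 2) * Complex.I))) *
      Complex.I_sq

/-- For `η = ξ e^(it)` and `κ = ξ e^(is)` the orientation is `8 sin (t/2) sin ((t-s)/2) sin (s/2)`.
-/
theorem orientation_pos_of_inArc {ξ η κ : ℂ} (hξ : ‖ξ‖ = 1)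
    (h : RegularProjectiveSurface.InArc ξ η κ) : 0 < orientation ξ η κ := by
  obtain ⟨s, t, hs, hst, ht, rfl, rfl⟩ := h
  have hξ0 : ξ ≠ 0 := norm_pos_iff.1 (by rw [hξ]; exact one_pos)
  have e1 := exp_mul_I_sub_exp_mul_I 0 t
  have e2 := exp_mul_I_sub_exp_mul_I t s
  have e3 := exp_mul_I_sub_exp_mul_I s 0
  rw [zero_mul, Complex.exp_zero, zero_sub, neg_div, Complex.sin_neg, zero_add] at e1
  rw [zero_mul, Complex.exp_zero, sub_zero, add_zero] at e3
  have e4 : Complex.exp ((t : ℂ) / 2 * Complex.I) * Complex.exp ((t + s : ℂ) / 2 * Complex.I) *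
      Complex.exp ((s : ℂ) / 2 * Complex.I) =
        Complex.exp (t * Complex.I) * Complex.exp (s * Complex.I) := by
    rw [← Complex.exp_add, ← Complex.exp_add, ← Complex.exp_add]; congr 1; ring
  have e5 : (ξ - ξ * Complex.exp (t * Complex.I)) *
      (ξ * Complex.exp (t * Complex.I) - ξ * Complex.exp (s * Complex.I)) *
      (ξ * Complex.exp (s * Complex.I) - ξ) =
      (8 * Complex.sin (t / 2) * Complex.sin ((t - s) / 2) * Complex.sin (s / 2) * Complex.I) *
        (ξ * (ξ * Complex.exp (t * Complex.I)) * (ξ * Complex.exp (s * Complex.I))) := by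
    have : (ξ - ξ * Complex.exp (t * Complex.I)) *
        (ξ * Complex.exp (t * Complex.I) - ξ * Complex.exp (s * Complex.I)) *
        (ξ * Complex.exp (s * Complex.I) - ξ) = ξ ^ 3 * ((1 - Complex.exp (t * Complex.I)) *
        (Complex.exp (t * Complex.I) - Complex.exp (s * Complex.I)) *
        (Complex.exp (s * Complex.I) - 1)) := by ring
    rw [this, e1, e2, e3]
    linear_combination (8 * Complex.I * ξ ^ 3 * Complex.sin (t / 2) * Complex.sin ((t - s) / 2) *
      Complex.sin (s / 2)) * e4 - (8 * Complex.I * ξ ^ 3 * Complex.sin (t / 2) *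
      Complex.sin ((t - s) / 2) * Complex.sin (s / 2) * (Complex.exp ((t : ℂ) / 2 * Complex.I) *
      Complex.exp ((t + s : ℂ) / 2 * Complex.I) * Complex.exp ((s : ℂ) / 2 * Complex.I))) *
      Complex.I_sq
  have h0 : ξ * (ξ * Complex.exp (t * Complex.I)) * (ξ * Complex.exp (s * Complex.I)) ≠ 0 := by
    have := Complex.exp_ne_zero (t * Complex.I)
    have := Complex.exp_ne_zero (s * Complex.I)
    positivity
  have e6 : 8 * Complex.sin (t / 2) * Complex.sin ((t - s) / 2) * Complex.sin (s / 2) =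
      ((8 * Real.sin (t / 2) * Real.sin ((t - s) / 2) * Real.sin (s / 2) : ℝ) : ℂ) := by
    push_cast; rfl
  rw [orientation, e5, mul_div_cancel_right₀ _ h0, e6, Complex.im_ofReal_mul, Complex.I_im, mul_one]
  have h1 := Real.sin_pos_of_pos_of_lt_pi (x := t / 2) (by linarith) (by linarith)
  have h2 := Real.sin_pos_of_pos_of_lt_pi (x := (t - s) / 2) (by linarith) (by linarith)
  have h3 := Real.sin_pos_of_pos_of_lt_pi (x := s / 2) (by linarith) (by linarith)
  positivity

theorem not_inArc_left {ξ η : ℂ} (hξ : ‖ξ‖ = 1) :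
    ¬ RegularProjectiveSurface.InArc ξ η ξ := fun h => by
  have := orientation_pos_of_inArc hξ h
  simp [orientation] at this

theorem not_inArc_right {ξ η : ℂ} (hξ : ‖ξ‖ = 1) :
    ¬ RegularProjectiveSurface.InArc ξ η η := fun h => by
  have := orientation_pos_of_inArc hξ h
  simp [orientation] at this

/-- Automorphisms of the disk preserve the cyclic order.  On the unit circle
`F z = τ z (conj D z) / D z`, where `D` is the denominator, which gives the factor
`(1 - ‖p‖²)³ / (‖D ξ‖² ‖D η‖² ‖D κ‖²)`. -/
theorem exists_orientation_discAut {p τ ξ η κ : ℂ} (hp : ‖p‖ < 1) (hτ : ‖τ‖ = 1) (hξ : ‖ξ‖ = 1)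
    (hη : ‖η‖ = 1) (hκ : ‖κ‖ = 1) : ∃ c > 0,
      orientation (discAutFun p τ ξ) (discAutFun p τ η) (discAutFun p τ κ) =
        c * orientation ξ η κ := by
  have unit : ∀ {z : ℂ}, ‖z‖ = 1 → z * starRingEnd ℂ z = 1 := fun hz => by
    rw [Complex.mul_conj, Complex.normSq_eq_norm_sq, hz]; simp
  obtain ⟨D, hD⟩ : ∃ D : ℂ → ℂ, ∀ z, D z = 1 + starRingEnd ℂ p * τ * z := ⟨_, fun _ => rfl⟩
  have hD0 : ∀ {z : ℂ}, ‖z‖ = 1 → D z ≠ 0 := fun hz => by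
    rw [hD]; exact discAut_denom_ne hp hτ hz.le
  have hF : ∀ {z : ℂ}, ‖z‖ = 1 → discAutFun p τ z = τ * z * starRingEnd ℂ (D z) / D z := by
    intro z hz
    rw [discAutFun, ← hD]
    congr 1
    rw [hD, map_add, map_mul, map_mul, Complex.conj_conj, map_one]
    linear_combination -p * z * starRingEnd ℂ z * unit hτ - p * unit hz
  have hdiff : ∀ {z w : ℂ}, ‖z‖ = 1 → ‖w‖ = 1 → discAutFun p τ z - discAutFun p τ w =
      τ * (1 - p * starRingEnd ℂ p) * (z - w) / (D z * D w) := by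
    intro z w hz hw
    rw [discAutFun, discAutFun, ← hD, ← hD, div_sub_div _ _ (hD0 hz) (hD0 hw), hD, hD]
    congr 1
    ring
  have hτ0 : τ ≠ 0 := norm_pos_iff.1 (by rw [hτ]; exact one_pos)
  have h0 : ∀ {z : ℂ}, ‖z‖ = 1 → z ≠ 0 := fun hz => norm_pos_iff.1 (by rw [hz]; exact one_pos)
  refine ⟨(1 - Complex.normSq p) ^ 3 /
    (Complex.normSq (D ξ) * Complex.normSq (D η) * Complex.normSq (D κ)), ?_, ?_⟩
  · have h1 : Complex.normSq p < 1 := by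
      rw [Complex.normSq_eq_norm_sq]
      have := norm_nonneg p
      nlinarith
    have h2 := Complex.normSq_pos.2 (hD0 hξ)
    have h3 := Complex.normSq_pos.2 (hD0 hη)
    have h4 := Complex.normSq_pos.2 (hD0 hκ)
    have h5 : 0 < 1 - Complex.normSq p := by linarith
    positivity
  · rw [orientation, orientation, ← Complex.im_ofReal_mul]
    congr 1
    push_cast
    rw [← Complex.mul_conj p, ← Complex.mul_conj (D ξ), ← Complex.mul_conj (D η),
      ← Complex.mul_conj (D κ), hdiff hξ hη, hdiff hη hκ, hdiff hκ hξ, hF hξ, hF hη, hF hκ]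
    have h1 := hD0 hξ
    have h2 := hD0 hη
    have h3 := hD0 hκ
    have h1' := (map_ne_zero (starRingEnd ℂ)).2 h1
    have h2' := (map_ne_zero (starRingEnd ℂ)).2 h2
    have h3' := (map_ne_zero (starRingEnd ℂ)).2 h3
    have h4 := h0 hξ
    have h5 := h0 hη
    have h6 := h0 hκ
    field_simp

theorem orientation_one_neg_one_neg_I : orientation 1 (-1) (-Complex.I) = -4 := by
  have e : (1 - -1) * (-1 - -Complex.I) * (-Complex.I - 1) / (1 * -1 * -Complex.I) =
      -4 * Complex.I := by
    rw [div_eq_iff (by simp)]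
    linear_combination 2 * Complex.I_sq
  rw [orientation, e]
  simp

/-! ### The homeomorphism from the graph to the set of maximal disks -/

namespace FatGraph

variable {E : Type u} {Γ : FatGraph E} {Z : E → ℂ} [Finite E] [Nonempty E]

namespace CuspSystem

variable (K : CuspSystem Γ Z)

open RegularProjectiveSurface

omit [Finite E] [Nonempty E] in
theorem continuous_point (α : E) : Continuous (Γ.point α) :=
  continuous_quot_mk.comp continuous_sigmaMk

theorem tendsto_disk_apply {ι : Type*} {l : Filter ι} (α : E) {T : ι → unitInterval}
    {W : ι → UnitDisc} {t : unitInterval} {w : UnitDisc} (hT : Tendsto T l (𝓝 t))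
    (hW : Tendsto W l (𝓝 w)) : Tendsto (fun v => K.disk α (T v) (W v)) l (𝓝 (K.disk α t w)) := by
  have h1 := (K.continuous_disk α).tendsto (t, w)
  have h2 : Tendsto (fun v => (T v, W v)) l (𝓝 (t, w)) := hT.prodMk_nhds hW
  exact Tendsto.comp (f := fun v => (T v, W v)) h1 h2

/-- Along an ultrafilter of maximal disks that converges to `u`, the parameters of the disks
converge to parameters of `u`: they have limits in the compact closures, and if the limit of `p`
were on the unit circle, the automorphisms of the disk would converge to a constant there, so that
`u` would be constant. -/
theorem exists_tendsto_parameters {𝒰 : Ultrafilter K.regularSurface.ParamMaximalDisk}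
    {u : K.regularSurface.ParamMaximalDisk} (h𝒰 : (𝒰 : Filter _) ≤ 𝓝 u) :
    ∃ α T t p τ, u = K.rotatedMaxDisk α p τ t ∧ Tendsto T 𝒰 (𝓝 t) ∧
      ∀ᶠ v in 𝒰, ∃ P Θ, v = K.rotatedMaxDisk α P Θ (T v) := by
  choose A T P Θ h using K.exists_eq_rotatedMaxDisk
  obtain ⟨α, hα⟩ : ∃ α, ∀ᶠ v in 𝒰, A v = α := by
    have h1 : (⋃ α ∈ (Set.univ : Set E), A ⁻¹' {α}) ∈ 𝒰 :=
      Filter.univ_mem' fun v => by simp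
    obtain ⟨α, -, hα⟩ := (Ultrafilter.finite_biUnion_mem_iff Set.finite_univ).1 h1
    exact ⟨α, hα⟩
  obtain ⟨t, -, ht⟩ := (isCompact_univ (X := unitInterval)).ultrafilter_le_nhds (𝒰.map T) (by simp)
  obtain ⟨τ, -, hτ⟩ := (isCompact_univ (X := Circle)).ultrafilter_le_nhds (𝒰.map Θ) (by simp)
  obtain ⟨p, hp, hpT⟩ := (isCompact_closedBall (0 : ℂ) 1).ultrafilter_le_nhds
    (𝒰.map fun v : K.regularSurface.ParamMaximalDisk => (P v : ℂ))
    (le_principal_iff.2 (Ultrafilter.mem_map.2 (Filter.univ_mem'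
      fun v => mem_closedBall_zero_iff.2 (P v).norm_lt_one.le)))
  have ht : Tendsto T 𝒰 (𝓝 t) := ht
  have hτ : Tendsto (fun v => (Θ v : ℂ)) 𝒰 (𝓝 τ) := (continuous_subtype_val.tendsto τ).comp hτ
  have hpT : Tendsto (fun v => (P v : ℂ)) 𝒰 (𝓝 p) := hpT
  have hp := mem_closedBall_zero_iff.1 hp
  have hev : ∀ w, Tendsto (fun v : K.regularSurface.ParamMaximalDisk => v.1 w) 𝒰 (𝓝 (u.1 w)) :=
    fun w => (((continuous_eval_const w).comp continuous_subtype_val).tendsto u).mono_left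
      h𝒰
  have hval : ∀ w, ∀ᶠ v in 𝒰, v.1 w = K.disk α (T v) (discAut (P v) (Θ v) w) := fun w => by
    filter_upwards [hα] with v hv
    rw [← hv]
    exact DFunLike.congr_fun (congrArg Subtype.val (h v)) w
  -- the limit of the automorphisms
  have hden : ∀ w : UnitDisc, 1 + starRingEnd ℂ p * τ * w ≠ 0 := by
    intro w h0
    have h1 : ‖starRingEnd ℂ p * τ * (w : ℂ)‖ < 1 := by
      rw [norm_mul, norm_mul, RCLike.norm_conj, τ.norm_coe, mul_one]
      calc ‖p‖ * ‖(w : ℂ)‖ ≤ 1 * ‖(w : ℂ)‖ := by gcongr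
        _ < 1 := by rw [one_mul]; exact w.norm_lt_one
    rw [show starRingEnd ℂ p * τ * (w : ℂ) = -1 by linear_combination h0, norm_neg, norm_one] at h1
    exact lt_irrefl _ h1
  have hlim : ∀ w : UnitDisc, Tendsto (fun v => (discAut (P v) (Θ v) w : ℂ)) 𝒰
      (𝓝 (discAutFun p τ w)) := fun w =>
    Tendsto.div (hpT.add (hτ.mul_const _)) (tendsto_const_nhds.add
      ((((Complex.continuous_conj.tendsto p).comp hpT).mul hτ).mul_const _)) (hden w)
  rcases hp.lt_or_eq with hp1 | hp1
  · refine ⟨α, T, t, UnitDisc.mk p hp1, τ, ?_, ht, ?_⟩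
    · refine Subtype.ext (ContinuousMap.ext fun w => ?_)
      refine tendsto_nhds_unique_of_eventuallyEq (hev w) ?_ (hval w)
      have h1 : Tendsto (fun v => discAut (P v) (Θ v) w) 𝒰
          (𝓝 (discAut (UnitDisc.mk p hp1) τ w)) :=
        UnitDisc.isEmbedding_coe.tendsto_nhds_iff.2 (hlim w)
      exact K.tendsto_disk_apply α ht h1
    · filter_upwards [hα] with v hv
      exact ⟨P v, Θ v, hv ▸ h v⟩
  · -- `p` is on the unit circle: `u` is constant, which its lean point `1` excludes
    exfalso
    have hpp : p * starRingEnd ℂ p = 1 := by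
      rw [Complex.mul_conj, Complex.normSq_eq_norm_sq, hp1]; simp
    have hconst : ∀ w : UnitDisc, discAutFun p τ w = p := fun w => by
      rw [discAutFun, div_eq_iff (hden w)]
      linear_combination -(τ * (w : ℂ)) * hpp
    obtain ⟨L, hL, -⟩ := K.exists_tendsto_disk α t hp1
    have huL : ∀ w, u.1 w = L := by
      intro w
      refine tendsto_nhds_unique_of_eventuallyEq (hev w) ?_ (hval w)
      have h1 := hlim w
      rw [hconst w] at h1
      have h2 : Tendsto (fun v => discAut (P v) (Θ v) w) 𝒰
          (comap (fun w : UnitDisc => (w : ℂ)) (𝓝 p)) := tendsto_comap_iff.2 h1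
      exact Tendsto.comp (f := fun v => (T v, discAut (P v) (Θ v) w)) hL (ht.prodMk h2)
    obtain ⟨β, t', p', τ', rfl⟩ := K.exists_eq_rotatedMaxDisk u
    have hdL : ∀ w, K.disk β t' w = L := by
      intro w
      obtain ⟨w', rfl⟩ := (bijective_discAut p' τ').2 w
      exact huL w'
    obtain ⟨-, q, hq, hT⟩ := K.one_mem_leanPoints β t'
    have := UnitDisc.comap_coe_neBot (ξ := 1) (by simp)
    have hT' : Tendsto (K.disk β t') (comap (fun w : UnitDisc => (w : ℂ)) (𝓝 1)) (𝓝 L) :=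
      tendsto_const_nhds.congr fun w => (hdL w).symm
    rw [tendsto_nhds_unique hT hT', ← hdL 0] at hq
    exact K.disk_notMem β t' 0 hq

/-- A function of the parametrized maximal disks is continuous if it is a function of the point of
the graph. -/
theorem continuous_of_rotatedMaxDisk {g : K.regularSurface.ParamMaximalDisk → Γ.Realization}
    (hg : ∀ α p τ t, g (K.rotatedMaxDisk α p τ t) = Γ.point α t) : Continuous g := by
  rw [continuous_iff_continuousAt]
  intro u
  refine (tendsto_iff_ultrafilter _ _ _).2 fun 𝒰 h𝒰 => ?_
  obtain ⟨α, T, t, p, τ, hu, hT, hv⟩ := K.exists_tendsto_parameters h𝒰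
  have hgu : g u = Γ.point α t := hu ▸ hg α p τ t
  rw [hgu]
  refine Tendsto.congr' ?_ (((continuous_point α).tendsto t).comp hT)
  filter_upwards [hv] with v hv
  obtain ⟨P, Θ, hv⟩ := hv
  exact (hg α P Θ (T v)).symm.trans (congrArg g hv.symm)

/-- The homeomorphism from the graph to the set of maximal disks. -/
def graphHomeo : Γ.Realization ≃ₜ K.regularSurface.MaximalDisk where
  toEquiv := Equiv.ofBijective K.toMaximalDisk K.bijective_toMaximalDisk
  continuous_toFun := K.continuous_toMaximalDisk
  continuous_invFun := by
    refine isQuotientMap_quot_mk.continuous_iff.2 (K.continuous_of_rotatedMaxDisk fun α p τ t => ?_)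
    change (Equiv.ofBijective K.toMaximalDisk K.bijective_toMaximalDisk).symm
      (K.regularSurface.diskClass (K.rotatedMaxDisk α p τ t)) = _
    refine (Equiv.symm_apply_eq _).2 ?_
    exact K.diskClass_rotatedMaxDisk α p τ t

theorem graphHomeo_point (α : E) (t : unitInterval) :
    K.graphHomeo (Γ.point α t) = K.regularSurface.diskClass (K.maxDisk α t) := rfl

/-! ### Vertices and the cyclic order of edges -/

theorem tendsto_discAut (p : UnitDisc) (τ : Circle) {ξ : ℂ} (hξ : ‖ξ‖ = 1) :
    Tendsto (discAut p τ) (comap (fun w : UnitDisc => (w : ℂ)) (𝓝 ξ))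
      (comap (fun w : UnitDisc => (w : ℂ)) (𝓝 (discAutFun p τ ξ))) := by
  refine tendsto_comap_iff.2 ?_
  have hc : ContinuousAt (discAutFun p τ) ξ :=
    ContinuousAt.div (by fun_prop) (by fun_prop) (discAut_denom_ne p.norm_lt_one τ.norm_coe hξ.le)
  exact hc.tendsto.comp tendsto_comap

theorem mem_leanPoints_rotatedDisk (α : E) (p : UnitDisc) (τ : Circle) (t : unitInterval) {ξ : ℂ} :
    ξ ∈ K.regularSurface.leanPoints (K.rotatedDisk α p τ t) ↔
      ‖ξ‖ = 1 ∧ discAutFun p τ ξ ∈ K.regularSurface.leanPoints (K.disk α t) := by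
  refine and_congr_right fun hξ => ?_
  have hF := norm_discAut_eq p.norm_lt_one τ.norm_coe hξ
  obtain ⟨L, hL, -⟩ := K.exists_tendsto_disk α t hF
  have hL := K.tendsto_disk_of_tendsto α hL
  have hR : Tendsto (K.rotatedDisk α p τ t) (comap (fun w : UnitDisc => (w : ℂ)) (𝓝 ξ)) (𝓝 L) :=
    hL.comp (tendsto_discAut p τ hξ)
  constructor
  · rintro ⟨q, hq, hT⟩
    have := UnitDisc.comap_coe_neBot hξ
    rw [tendsto_nhds_unique hT hR] at hq
    exact ⟨hF, L, hq, hL⟩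
  · rintro ⟨-, q, hq, hT⟩
    exact ⟨q, hq, hT.comp (tendsto_discAut p τ hξ)⟩

theorem injOn_discAutFun (p : UnitDisc) (τ : Circle) :
    Set.InjOn (discAutFun p τ) {ξ | ‖ξ‖ = 1} := by
  intro ξ hξ η hη h
  have h1 := discAut_inv (w := ξ) p.norm_lt_one τ.norm_coe (le_of_eq hξ)
  rw [h, discAut_inv p.norm_lt_one τ.norm_coe (le_of_eq hη)] at h1
  exact h1.symm

/-- The disks at vertices lean at three points, the other ones at `1` and `-1` only. -/
theorem isVertex_iff (x : Γ.Realization) :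
    K.regularSurface.IsVertex (K.graphHomeo x) ↔ ∃ α, x = Γ.point α 0 := by
  constructor
  · rintro ⟨u, hu, h3⟩
    obtain ⟨α, t, p, τ, rfl⟩ := K.exists_eq_rotatedMaxDisk u
    rw [diskClass_rotatedMaxDisk, ← graphHomeo_point] at hu
    have hx := K.graphHomeo.injective hu
    by_cases h0 : t = 0
    · exact ⟨α, by rw [← hx, h0]⟩
    by_cases h1 : t = 1
    · exact ⟨Γ.rev α, by rw [← hx, h1, ← point_rev, unitInterval.symm_one]⟩
    exfalso
    have himg :
        discAutFun p τ '' K.regularSurface.leanPoints (K.rotatedDisk α p τ t) ⊆ {1, -1} := by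
      rintro _ ⟨ξ, hξ, rfl⟩
      exact K.leanPoints_disk_of_ne α h0 h1 ((K.mem_leanPoints_rotatedDisk α p τ t).1 hξ).2
    have h4 := Set.encard_le_encard himg
    rw [((injOn_discAutFun p τ).mono fun ξ hξ => hξ.1).encard_image] at h4
    have h5 := (h3.trans h4).trans (Set.encard_insert_le _ _)
    rw [Set.encard_singleton] at h5
    norm_num at h5
  · rintro ⟨α, rfl⟩
    refine ⟨K.maxDisk α 0, rfl, ?_⟩
    change 3 ≤ (K.regularSurface.leanPoints (K.disk α 0)).encard
    have hI1 : (1 : ℂ) ≠ -Complex.I := fun h => by simpa using congrArg Complex.re h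
    have hI2 : (-1 : ℂ) ≠ -Complex.I := fun h => by simpa using congrArg Complex.re h
    rw [leanPoints_disk_zero, Set.encard_insert_of_notMem (by simp [hI1]; norm_num),
      Set.encard_pair hI2]
    norm_num

theorem discAutFun_vertex_neg_one : discAutFun vertexParam vertexFactor (-1) = 1 := by
  rw [discAutFun_vertex, div_eq_one_iff_eq]
  · ring
  · intro h
    simpa using congrArg Complex.im h

theorem discAutFun_vertex_neg_I : discAutFun vertexParam vertexFactor (-Complex.I) = -1 := by
  rw [discAutFun_vertex, div_eq_iff]
  · linear_combination 6 * Complex.I_sq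
  · intro h
    have := congrArg Complex.im h
    simp at this

/-- An automorphism followed by the rotation at a vertex is an automorphism, also on the unit
circle. -/
theorem discAutFun_vertex_comp (p : UnitDisc) (τ : Circle) : ∃ (p' : UnitDisc) (τ' : Circle),
    (∀ w, discAut vertexParam vertexFactor (discAut p τ w) = discAut p' τ' w) ∧
    ∀ ξ, ‖ξ‖ = 1 →
      discAutFun p' τ' ξ = discAutFun vertexParam vertexFactor (discAutFun p τ ξ) := by
  obtain ⟨p', τ', h⟩ := ((isMobiusSelfMap_discAut vertexParam vertexFactor).comp
    (isMobiusSelfMap_discAut p τ)).eq_discAut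
    ((bijective_discAut vertexParam vertexFactor).comp (bijective_discAut p τ)).2
  have h := fun w => congrFun h w
  refine ⟨p', τ', h, fun ξ hξ => ?_⟩
  have := UnitDisc.comap_coe_neBot hξ
  have t1 : Tendsto (fun w => (discAut p' τ' w : ℂ)) (comap (fun w : UnitDisc => (w : ℂ)) (𝓝 ξ))
      (𝓝 (discAutFun p' τ' ξ)) := tendsto_comap.comp (tendsto_discAut p' τ' hξ)
  have t2 : Tendsto (fun w => (discAut vertexParam vertexFactor (discAut p τ w) : ℂ))
      (comap (fun w : UnitDisc => (w : ℂ)) (𝓝 ξ))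
      (𝓝 (discAutFun vertexParam vertexFactor (discAutFun p τ ξ))) :=
    tendsto_comap.comp ((tendsto_discAut vertexParam vertexFactor
      (norm_discAut_eq p.norm_lt_one τ.norm_coe hξ)).comp (tendsto_discAut p τ hξ))
  exact tendsto_nhds_unique t1 (t2.congr fun w => congrArg _ (h w))

/-- The edges at a vertex leave through the arcs between the lean points, in counterclockwise
order. -/
theorem leavesThrough (α : E) (u : K.regularSurface.ParamMaximalDisk)
    (hu : K.regularSurface.diskClass u = K.graphHomeo (Γ.point α 0)) : ∃ ξ η κ : ℂ,
      K.regularSurface.LeavesThrough u (fun s => K.graphHomeo (Γ.point α s)) ξ η ∧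
      K.regularSurface.LeavesThrough u (fun s => K.graphHomeo (Γ.point (Γ.next α) s)) η κ := by
  obtain ⟨f, hf, hfb, hfu⟩ := diskEquiv_of_diskClass_eq (v := K.maxDisk α 0) hu
  obtain ⟨p, τ, rfl⟩ := hf.eq_discAut hfb.2
  obtain rfl : u = K.rotatedMaxDisk α p τ 0 := Subtype.ext (ContinuousMap.ext hfu)
  have hI1 : -Complex.I ≠ 1 := fun h => by simpa using congrArg Complex.re h
  have hI2 : -Complex.I ≠ -1 := fun h => by simpa using congrArg Complex.re h
  -- the lean points are the preimages of `1, -1, -i`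
  obtain ⟨hp', hτ'⟩ := discAut_inv_params p.norm_lt_one τ.norm_coe
  have hpre : ∀ ζ : ℂ, ‖ζ‖ = 1 → ∃ ξ, ‖ξ‖ = 1 ∧ discAutFun p τ ξ = ζ := fun ζ hζ =>
    ⟨_, norm_discAut_eq hp' hτ' hζ, discAut_inv' p.norm_lt_one τ.norm_coe hζ.le⟩
  obtain ⟨ξ, hξ, hFξ⟩ := hpre 1 (by simp)
  obtain ⟨η, hη, hFη⟩ := hpre (-1) (by simp)
  obtain ⟨κ, hκ, hFκ⟩ := hpre (-Complex.I) (by simp)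
  have hlean : ∀ ζ ∈ K.regularSurface.leanPoints (K.rotatedMaxDisk α p τ 0).1,
      ζ = ξ ∨ ζ = η ∨ ζ = κ := by
    intro ζ hζ
    obtain ⟨h1, h2⟩ := (K.mem_leanPoints_rotatedDisk α p τ 0).1 hζ
    rw [leanPoints_disk_zero] at h2
    have hinj := injOn_discAutFun p τ
    rcases h2 with h2 | h2 | h2
    · exact Or.inl (hinj h1 hξ (h2.trans hFξ.symm))
    · exact Or.inr (Or.inl (hinj h1 hη (h2.trans hFη.symm)))
    · exact Or.inr (Or.inr (hinj h1 hκ (h2.trans hFκ.symm)))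
  obtain ⟨c, hc, hor⟩ := exists_orientation_discAut p.norm_lt_one τ.norm_coe hξ hη hκ
  rw [hFξ, hFη, hFκ, orientation_one_neg_one_neg_I] at hor
  have hneg : ¬ 0 < orientation ξ η κ := fun h => by
    have := mul_pos hc h
    linarith
  have hξη : ξ ≠ η := by
    rintro rfl
    rw [hFξ] at hFη
    norm_num at hFη
  have hηκ : η ≠ κ := by
    rintro rfl
    rw [hFη] at hFκ
    exact hI2 hFκ.symm
  -- the disks along `next α` in the parametrization that extends `u`
  obtain ⟨p', τ', hcomp, hcompF⟩ := discAutFun_vertex_comp p τ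
  refine ⟨ξ, η, κ, ⟨⟨K.rotatedMaxDisk α p τ, K.continuous_rotatedMaxDisk α p τ, rfl, fun s =>
    ⟨K.diskClass_rotatedMaxDisk α p τ s, ?_, ?_⟩⟩, hξη, ?_⟩,
    ⟨⟨K.rotatedMaxDisk (Γ.next α) p' τ', K.continuous_rotatedMaxDisk _ p' τ', ?_, fun s =>
    ⟨K.diskClass_rotatedMaxDisk (Γ.next α) p' τ' s, ?_, ?_⟩⟩, hηκ, ?_⟩⟩
  · exact (K.mem_leanPoints_rotatedDisk α p τ s).2 ⟨hξ, by rw [hFξ]; exact K.one_mem_leanPoints α s⟩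
  · exact (K.mem_leanPoints_rotatedDisk α p τ s).2
      ⟨hη, by rw [hFη]; exact K.neg_one_mem_leanPoints α s⟩
  · intro ζ hζ harc
    rcases hlean ζ hζ with rfl | rfl | rfl
    · exact not_inArc_left hξ harc
    · exact not_inArc_right hξ harc
    · exact hneg (orientation_pos_of_inArc hξ harc)
  · refine Subtype.ext (ContinuousMap.ext fun w => ?_)
    change K.disk (Γ.next α) 0 (discAut p' τ' w) = K.disk α 0 (discAut p τ w)
    rw [K.disk_zero_eq α (discAut p τ w), hcomp]
  · exact (K.mem_leanPoints_rotatedDisk (Γ.next α) p' τ' s).2 ⟨hη, by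
      rw [hcompF η hη, hFη, discAutFun_vertex_neg_one]; exact K.one_mem_leanPoints _ s⟩
  · exact (K.mem_leanPoints_rotatedDisk (Γ.next α) p' τ' s).2 ⟨hκ, by
      rw [hcompF κ hκ, hFκ, discAutFun_vertex_neg_I]; exact K.neg_one_mem_leanPoints _ s⟩
  · intro ζ hζ harc
    rcases hlean ζ hζ with rfl | rfl | rfl
    · have := orientation_pos_of_inArc hη harc
      rw [orientation_rotate] at this
      exact hneg this
    · exact not_inArc_left hη harc
    · exact not_inArc_right hη harc

/-! ### The numbers on edges -/

theorem isEdgeNumber (α : E) :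
    K.regularSurface.IsEdgeNumber (fun s => K.graphHomeo (Γ.point α s)) (Z α) := by
  obtain ⟨w, hw, hw1, hw2, hwZ⟩ := K.leanPoints_disk_one α
  refine ⟨K.strip α, fun x hx => K.projectiveAt_exp_strip α hx, angle Z α, K.maxDisk α,
    continuous_angle α, angle_zero α, angle_one α,
    fun s => ⟨K.angle_nonneg α s, K.angle_le α s⟩, fun s => ⟨rfl, fun v => ?_⟩,
    K.leanPoints_disk_zero α, w, hw, hw1, hw2, hwZ⟩
  rw [halfPlaneLog_eq_halfLog v.norm_lt_one]
  rfl

theorem reproduces : K.regularSurface.Reproduces Γ Z :=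
  ⟨K.graphHomeo, K.isVertex_iff, K.leavesThrough, K.isEdgeNumber⟩

end CuspSystem
end FatGraph

end

theorem mainTheorem2 {E : Type u} [Finite E] [Nonempty E] (Γ : FatGraph E) (Z : E → ℂ)
    (hZ : ∀ α, Z (Γ.rev α) = Z α) :
    -- the inequality for the coordinates of one point on two subsequent edges
    (∀ p q p' q' : FatGraph.StripPoint Z, Γ.Subsequent p.1 q.1 →
      (Γ.Turn Z q p ∨ Γ.Flip Z p p' ∧ Γ.Flip Z q q' ∧ Γ.Turn Z p' q') →
      (Z p.1).im + (q.2 : ℂ).im < (p.2 : ℂ).im) ∧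
    -- finiteness of the equivalence classes
    ((∀ n c, Γ.IsClosedPathWithoutReturns n c → 0 < ∑ k ∈ Finset.range n, (Z (c k)).im) →
      ∀ p : Γ.GluedSurface Z, {a : FatGraph.StripPoint Z | Γ.glued Z a.1 a.2 = p}.Finite) ∧
    -- the glued surface and the recovery of the graph
    ((∀ α, 0 < (Z α).im) →
      ∃ (S : RegularProjectiveSurface.{u}) (h : Γ.GluedSurface Z ≃ₜ S.Punctured),
        (∀ (α : E) (x : FatGraph.strip (Z α)),
          S.ProjectiveAt (fun y : FatGraph.strip (Z α) => Complex.exp (y : ℂ))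
            (fun y => (h (Γ.glued Z α y) : S.carrier)) x) ∧
        S.Reproduces Γ Z) := by
  refine ⟨fun p q p' q' _ h => FatGraph.im_lt_of_turn hZ p q p' q' h,
    fun hpos m => FatGraph.finite_class hZ hpos m, fun hpos => ?_⟩
  obtain ⟨K⟩ := FatGraph.nonempty_cuspSystem (Γ := Γ) hpos hZ
  exact ⟨K.regularSurface, K.homeo, K.projectiveAt_glued, K.reproduces⟩
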